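/- **Setting.** Let $r_+>0$ and $|\kappa|<1$, and consider the Kerr metric $\tilde g$ with mass $M=\tfrac{r_+}{2}(1+\kappa^2)$ and rotation parameter $a=\kappa r_+$ in Boyer–Lindquist coordinates $(t,r,\theta,\phi)$, with $\tilde\Delta=r^2-2Mr+a^2$, $\tilde\Sigma=r^2+a^2\cos^2\theta$, signature $(-,+,+,+)$ and Kinnersley tetrad $\tilde\ell=\big(\tfrac{r^2+a^2}{\tilde\Delta},1,0,\tfrac{a}{\tilde\Delta}\big)$, $\tilde k=\tfrac1{2\tilde\Sigma}(r^2+a^2,-\tilde\Delta,0,a)$, $\tilde m=\tfrac{1}{\sqrt2(r+ia\cos\theta)}\big(ia\sin\theta,0,1,\tfrac{i}{\sin\theta}\big)$. Introduce coordinates $(T,\varsigma,\theta,\varphi)$ by $$r=\frac{r_+}{\varsigma(1-T)},\qquad \phi=\varphi+\phi_*(r),\quad \phi_*'(r)=\frac{a}{\tilde\Delta},$$ $$t=r_+\Big(\tfrac{T}{\varsigma(1-T)}-(1+\kappa^2)\ln(1-T)+\tfrac{1+\kappa^2}{1-\kappa^2}\Big[\kappa^2\ln\tfrac{1-\kappa^2\varsigma}{1-\kappa^2\varsigma(1-T)}-\ln\tfrac{1-\varsigma}{1-\varsigma(1-T)}\Big]\Big),$$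 on $U=\{0<\varsigma<1,\ \varsigma(1-T)<1,\ 0<\theta<\pi\}$ (the transformation is used for $T<1$; $T=1$ is $\mathscr I^+$, and the conformal metric extends smoothly through it to all of $U$). Let $\Xi=1/r=\varsigma(1-T)/r_+$, $g=\Xi^2\tilde g$, and let $\ell=\Xi^{-2}\tfrac{\varsigma}{r_+}\tilde\ell$, $k=\tfrac{r_+}{\varsigma}\tilde k$, $m=\Xi^{-1}\tilde m$. Put $$F(\varsigma)=\frac{\varsigma^2(1-\varsigma)(1-\kappa^2\varsigma)}{1+\kappa^2\varsigma^2},\quad \Sigma=\Xi^2\tilde\Sigma,\quad \Sigma_0=\Xi^2(r^2+a^2),\quad \Delta=\Xi^2\tilde\Delta,\quad \zeta=1-i\kappa\varsigma(1-T)\cos\theta .$$ The conformal Einstein field equations (CEFEs) are the equations $\nabla_a\nabla_b\Xi+\Xi L_{ab}-s g_{ab}=0$, $\nabla_a s+L_{ac}\nabla^c\Xi=0$, $\nabla_aL_{bc}-\nabla_bL_{ac}-d^{d}{}_{cab}\nabla_d\Xi=0$, $\nabla_e d^{e}{}_{abc}=0$ for a null tetrad and its Levi-Civita connection, a conformal factor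 $\Xi$, a scalar $s$, the Schouten tensor $L_{ab}$ and the rescaled Weyl tensor $d_{abcd}$, where the curvature of the connection is the one with Weyl tensor $\Xi d_{abcd}$ and Schouten tensor $L_{ab}$. Let $\phi_0,\dots,\phi_4$ be the Newman–Penrose components of $d_{abcd}$. A linear perturbation of a solution on an open set is the $\varepsilon$-derivative at $\varepsilon=0$ (denoted by $\check{\ }$) of a smooth one-parameter family of such fields that is the given solution at $\varepsilon=0$ and satisfies the CEFEs to first order in $\varepsilon$. Finally, on functions of spin weight $\mathfrak s$, $\eth f=-(\partial_\theta+\tfrac{i}{\sin\theta}\partial_\varphi-\mathfrak s\cot\theta)f$ and $\bar\eth f=-(\partial_\theta-\tfrac{i}{\sin\theta}\partial_\varphi+\mathfrak s\cot\theta)f$. For an integer $\mathfrak s$ let $q=2-\tfrac14\mathfrak s^2$, $u=1-T$, and define the master operator $$P_{\mathfrak s}=\mathcal A_{TT}\partial_T^2+\mathcal A_{T\varsigma}\partial_T\partial_\varsigma+\mathcal A_{T\varphi}\partial_T\partial_\varphi+\mathcal A_{\varsigma\varsigma}\partial_\varsigma^2+\mathcal A_{\varsigma\varphi}\partial_\varsigma\partial_\varphi+\mathcal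 A\,\eth\bar\eth+\mathcal B_\varsigma\partial_\varsigma+\mathcal B_\varphi\partial_\varphi+\mathcal B_T\partial_T+\mathcal C,$$ where - $\mathcal A_{TT}=q\,u\,\big(2F(1+\kappa^2\varsigma^2u^2)-F^2\kappa^2\sin^2\theta\,u-\varsigma^2(1-\varsigma u)(1-\kappa^2\varsigma u)u\big)$, - $\mathcal A_{T\varsigma}=2q\,\varsigma F\big(1+\kappa^2(-F\sin^2\theta+\varsigma^2u)u\big)$, $\quad\mathcal A_{T\varphi}=2q\,\kappa\varsigma(-F+\varsigma^2u)u$, - $\mathcal A_{\varsigma\varsigma}=-q\,F^2\kappa^2\sin^2\theta\,\varsigma^2$, $\quad\mathcal A_{\varsigma\varphi}=-2q\,F\kappa\varsigma^2$, $\quad\mathcal A=-q\,\varsigma^2$, - $\mathcal B_\varsigma=F\kappa\varsigma\big(2i\mathfrak s\cos\theta\,\varsigma+(-4-4\mathfrak s+\tfrac12\mathfrak s^2)\kappa\varsigma^2u+\kappa\sin^2\theta(2F\mathfrak s-q\,\varsigma F')\big)$, - $\mathcal B_\varphi=2\kappa\varsigma\big(F\mathfrak s+(-2-2\mathfrak s+\tfrac14\mathfrak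 s^2)\varsigma^2u\big)$, - $\mathcal B_T=F^2(4+2\mathfrak s-\tfrac12\mathfrak s^2)\kappa^2\sin^2\theta\,u+(2+\mathfrak s-\tfrac14\mathfrak s^2)\varsigma^2\big(2+\varsigma(-3+\kappa^2(-3+4\varsigma u))u\big)u+F\big(-4-2\mathfrak s+\tfrac12\mathfrak s^2+4\kappa\varsigma(\tfrac i2\mathfrak s\cos\theta+(-2-\tfrac32\mathfrak s+\tfrac14\mathfrak s^2)\kappa\varsigma u)u+(-2+\tfrac14\mathfrak s^2)\kappa^2\sin^2\theta\,\varsigma uF'\big)$, - $\mathcal C=-F^2\mathfrak s(1+\mathfrak s)\kappa^2\sin^2\theta+2F\kappa\varsigma\big(-i\mathfrak s^2\cos\theta+\mathfrak s(1+2\mathfrak s)\kappa\varsigma u+\tfrac12\mathfrak s\kappa\sin^2\theta F'\big)+\varsigma^2\big(-2\mathfrak s+(2+3\mathfrak s+\tfrac74\mathfrak s^2)\varsigma(1+\kappa^2(1-2\varsigma u))u\big)$. **Theorem.** 1. (Background.) For $T<1$, in the coordinates $(T,\varsigma,\theta,\varphi)$ the $g$-normalised tetrad is $\ell=(1,0,0,0)$,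 $k=\big(\tfrac{1-T}{2\Sigma}\big[\tfrac{2\Sigma_0F}{\varsigma^2}-(1-T)\Delta\big],\tfrac F\varsigma\tfrac{\Sigma_0}{\Sigma},0,\tfrac{\kappa\varsigma(1-T)^2}{\Sigma}\big)$, $m=\tfrac1{\sqrt2\,\zeta^*}\big(\tfrac{F(1-T)}{\varsigma}i\kappa\sin\theta,\,F\,i\kappa\sin\theta,\,1,\,\tfrac{i}{\sin\theta}\big)$. With these components and $\Xi=\varsigma(1-T)/r_+$ it extends to a smooth solution of the CEFEs on all of $U$, with $\phi_0=\phi_1=\phi_3=\phi_4=0$, $\phi_2=-M/\zeta^3$, and vanishing spin coefficients $\kappa,\sigma,\nu,\lambda$. 2. (Master equation.) For every linear perturbation of this background on an open subset of $U$, $\check\phi_0$ and $\check\phi_4$ satisfy the CEFE-Teukolsky equations $$\mathcal T_0\check\phi_0:=\big[(D-3\epsilon+\epsilon^*-4\rho-\rho^*)(\Delta-4\gamma+\mu)-(\delta+\pi^*-\alpha^*-3\beta-4\tau)(\delta^*+\pi-4\alpha)-3\Xi\phi_2\big]\check\phi_0=0,$$ $$\mathcal T_4\check\phi_4:=\big[(\Delta+3\gamma-\gamma^*+4\mu+\mu^*)(D+4\epsilon-\rho)-(\delta^*-\tau^*+\beta^*+3\alpha+4\pi)(\delta-\tau+4\beta)-3\Xi\phi_2\big]\check\phi_4=0$$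 (here $D,\Delta,\delta,\delta^*$ are the derivatives along $\ell,k,m,m^*$, and all coefficients are those of the background), and the master functions ${}_{2}\check\phi=\check\phi_0$ and ${}_{-2}\check\phi=\zeta^4\check\phi_4$ satisfy $P_{\mathfrak s}\,{}_{\mathfrak s}\check\phi=0$ for $\mathfrak s=\pm2$. Moreover $P_2u=2\varsigma^2\Sigma\,\mathcal T_0u$ and $P_{-2}(\zeta^4u)=2\varsigma^2\Sigma\,\zeta^4\,\mathcal T_4u$ for every $C^2$ function $u$. 3. (Total characteristic.) For $\mathfrak s\in\{2,0,-2\}$ and every function $u$ that is $C^2$ near a point $p$ with $\varsigma=0$, $0<\theta<\pi$, as $p$ is approached from $\varsigma>0$ one has $$\varsigma^{-2}P_{\mathfrak s}u\;\longrightarrow\;\big(2-\tfrac14\mathfrak s^2\big)\big((1-T)(1+T)\partial_T^2-2(1+\mathfrak s)T\partial_T-\eth\bar\eth-2\mathfrak s\big)u\big|_p,$$ an operator without $\varsigma$-derivatives. In particular, if $P_{\mathfrak s}u=0$ for $\varsigma>0$ near $p$, then $u$ satisfies the transport equation $\big((1-T)(1+T)\partial_T^2-2(1+\mathfrak s)T\partial_T-\eth\bar\eth-2\mathfrak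 s\big)u=0$ at $p$. 4. (Scalar field.) For $\mathfrak s=0$ the equation is the conformally invariant scalar wave equation on the background: $P_0u=-2\varsigma^2\Sigma\,\big(\nabla^a\nabla_au-\tfrac16R\,u\big)$ for every $C^2$ function $u$, where $\nabla$ and $R$ are the Levi-Civita connection and the Ricci scalar of $g$. -/

import Mathlib

open Set Filter Topology
open scoped ContDiff

noncomputable section

namespace CylTeukolsky

/-- Coordinates: either cylinder coordinates `(T, ς, θ, φ)` or Boyer–Lindquist coordinates
`(t, r, θ, φ)`, in this order. -/
abbrev Pt := Fin 4 → ℝ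

/-- Coordinate partial derivative `∂_μ f`. -/
def pd (μ : Fin 4) (f : Pt → ℂ) (x : Pt) : ℂ := fderiv ℝ f x (Pi.single μ 1)

/-! ### Null tetrads and the conformal Einstein field equations in a null frame

Frame indices `0, 1, 2, 3` stand for `ℓ, k, m, m*`; the signature is `(-,+,+,+)`, with
`g(ℓ,k) = -1` and `g(m,m*) = 1`. -/

/-- The frame components `g(e_a, e_b)` of the metric; this matrix is its own inverse. -/
def eta : Matrix (Fin 4) (Fin 4) ℂ := !![0, -1, 0, 0; -1, 0, 0, 0; 0, 0, 0, 1; 0, 0, 1, 0]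

/-- Complex conjugation on frame indices: it exchanges `m` and `m*`. -/
def bar (a : Fin 4) : Fin 4 := Equiv.swap 2 3 a

/-- The unknowns of the conformal Einstein field equations in a null frame. -/
structure CEFEFields where
  /-- `e a μ` is the coordinate component `e_a^μ`. -/
  e : Fin 4 → Fin 4 → Pt → ℂ
  /-- `conn a b c = g(∇_{e_a} e_b, e_c)`. -/
  conn : Fin 4 → Fin 4 → Fin 4 → Pt → ℂ
  /-- The conformal factor. -/
  Xi : Pt → ℝ
  /-- The Friedrich scalar. -/
  s : Pt → ℝ
  /-- The Schouten tensor `L_{ab}`. -/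
  L : Fin 4 → Fin 4 → Pt → ℂ
  /-- The rescaled Weyl tensor `d_{abcd}`. -/
  d : Fin 4 → Fin 4 → Fin 4 → Fin 4 → Pt → ℂ

namespace CEFEFields

variable (X : CEFEFields)

/-- Directional derivative `e_a(f)`. -/
def dir (a : Fin 4) (f : Pt → ℂ) (x : Pt) : ℂ := ∑ μ, X.e a μ x * pd μ f x

/-- `∇_{e_a} e_b = ∑ c, connUp a b c • e_c`. -/
def connUp (a b c : Fin 4) (x : Pt) : ℂ := ∑ f, eta c f * X.conn a b f x

/-- The conformal factor as a complex-valued function. -/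
def XiC (x : Pt) : ℂ := (X.Xi x : ℂ)

/-- The Friedrich scalar as a complex-valued function. -/
def sC (x : Pt) : ℂ := (X.s x : ℂ)

/-- Torsion: `[e_a, e_b]^μ - (∇_{e_a} e_b - ∇_{e_b} e_a)^μ`. -/
def torsion (a b μ : Fin 4) (x : Pt) : ℂ :=
  X.dir a (X.e b μ) x - X.dir b (X.e a μ) x
    - ∑ c, (X.connUp a b c x - X.connUp b a c x) * X.e c μ x

/-- The curvature of the connection, `R_{abcd} = g(R(e_c, e_d) e_b, e_a)`. -/
def riem (a b c d : Fin 4) (x : Pt) : ℂ :=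
  X.dir c (X.conn d b a) x - X.dir d (X.conn c b a) x
    + ∑ f, (X.connUp d b f x * X.conn c f a x - X.connUp c b f x * X.conn d f a x)
    - ∑ f, (X.connUp c d f x - X.connUp d c f x) * X.conn f b a x

/-- The Ricci scalar of the connection. -/
def ricciScalar (x : Pt) : ℂ := ∑ a, ∑ b, ∑ c, ∑ d, eta a c * eta b d * X.riem a b c d x

/-- Second structure equation: the curvature minus its decomposition into the Weyl tensor
`Ξ d_{abcd}` and the Schouten tensor. -/
def zeroCurv (a b c d : Fin 4) (x : Pt) : ℂ :=
  X.riem a b c d x - (X.XiC x * X.d a b c d x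
    + (eta a c * X.L b d x - eta b c * X.L a d x + eta b d * X.L a c x - eta a d * X.L b c x))

/-- `∇_a ∇_b f`. -/
def hess (f : Pt → ℂ) (a b : Fin 4) (x : Pt) : ℂ :=
  X.dir a (X.dir b f) x - ∑ c, X.connUp a b c x * X.dir c f x

/-- `∇^a ∇_a f`. -/
def box (f : Pt → ℂ) (x : Pt) : ℂ := ∑ a, ∑ b, eta a b * X.hess f a b x

/-- `∇_a L_{bc}`. -/
def covL (a b c : Fin 4) (x : Pt) : ℂ :=
  X.dir a (X.L b c) x - ∑ f, (X.connUp a b f x * X.L f c x + X.connUp a c f x * X.L b f x)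

/-- `∇_h d_{abcf}`. -/
def covD (h a b c f : Fin 4) (x : Pt) : ℂ :=
  X.dir h (X.d a b c f) x
    - ∑ g, (X.connUp h a g x * X.d g b c f x + X.connUp h b g x * X.d a g c f x
      + X.connUp h c g x * X.d a b g f x + X.connUp h f g x * X.d a b c g x)

/-- `∇_a ∇_b Ξ + Ξ L_{ab} - s g_{ab}`. -/
def zeroXi (a b : Fin 4) (x : Pt) : ℂ :=
  X.hess X.XiC a b x + X.XiC x * X.L a b x - X.sC x * eta a b

/-- `∇_a s + L_{ac} ∇^c Ξ`. -/
def zeroS (a : Fin 4) (x : Pt) : ℂ :=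
  X.dir a X.sC x + ∑ c, ∑ f, X.L a c x * eta c f * X.dir f X.XiC x

/-- `∇_a L_{bc} - ∇_b L_{ac} - d^f_{cab} ∇_f Ξ`. -/
def zeroL (a b c : Fin 4) (x : Pt) : ℂ :=
  X.covL a b c x - X.covL b a c x - ∑ f, ∑ g, eta f g * X.d g c a b x * X.dir f X.XiC x

/-- `∇_f d^f_{abc}`. -/
def zeroD (a b c : Fin 4) (x : Pt) : ℂ := ∑ f, ∑ g, eta f g * X.covD f g a b c x

/-- The algebraic properties of the unknowns at a point: `e` is a frame, all objects are frame
components of real tensors, the connection is metric, `L` is symmetric and `d` has the symmetries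
of a Weyl tensor. -/
structure Admissible (x : Pt) : Prop where
  frame : (Matrix.of fun a μ => X.e a μ x).det ≠ 0
  real_e : ∀ a μ, star (X.e a μ x) = X.e (bar a) μ x
  real_conn : ∀ a b c, star (X.conn a b c x) = X.conn (bar a) (bar b) (bar c) x
  real_L : ∀ a b, star (X.L a b x) = X.L (bar a) (bar b) x
  real_d : ∀ a b c f, star (X.d a b c f x) = X.d (bar a) (bar b) (bar c) (bar f) x
  conn_metric : ∀ a b c, X.conn a b c x = -X.conn a c b x
  L_symm : ∀ a b, X.L a b x = X.L b a x
  d_anti : ∀ a b c f, X.d a b c f x = -X.d b a c f x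
  d_pair : ∀ a b c f, X.d a b c f x = X.d c f a b x
  d_cyclic : ∀ a b c f, X.d a b c f x + X.d a c f b x + X.d a f b c x = 0
  d_trace : ∀ b f, ∑ a, ∑ c, eta a c * X.d a b c f x = 0

/-- `X` is a smooth solution on `V` of the conformal Einstein field equations: the two Cartan
structure equations and the equations for `Ξ`, `s`, `L_{ab}` and `d_{abcd}`. -/
structure IsSolution (V : Set Pt) : Prop where
  smooth_e : ∀ a μ, ContDiffOn ℝ ∞ (X.e a μ) V
  smooth_conn : ∀ a b c, ContDiffOn ℝ ∞ (X.conn a b c) V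
  smooth_Xi : ContDiffOn ℝ ∞ X.Xi V
  smooth_s : ContDiffOn ℝ ∞ X.s V
  smooth_L : ∀ a b, ContDiffOn ℝ ∞ (X.L a b) V
  smooth_d : ∀ a b c f, ContDiffOn ℝ ∞ (X.d a b c f) V
  admissible : ∀ x ∈ V, X.Admissible x
  eq_torsion : ∀ x ∈ V, ∀ a b μ, X.torsion a b μ x = 0
  eq_curv : ∀ x ∈ V, ∀ a b c f, X.zeroCurv a b c f x = 0
  eq_Xi : ∀ x ∈ V, ∀ a b, X.zeroXi a b x = 0
  eq_s : ∀ x ∈ V, ∀ a, X.zeroS a x = 0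
  eq_L : ∀ x ∈ V, ∀ a b c, X.zeroL a b c x = 0
  eq_d : ∀ x ∈ V, ∀ a b c, X.zeroD a b c x = 0

/-! Newman–Penrose scalars -/

def phi0 (x : Pt) : ℂ := X.d 0 2 0 2 x
def phi1 (x : Pt) : ℂ := X.d 0 1 0 2 x
def phi2 (x : Pt) : ℂ := X.d 0 2 3 1 x
def phi3 (x : Pt) : ℂ := X.d 0 1 3 1 x
def phi4 (x : Pt) : ℂ := X.d 1 3 1 3 x

def npKappa (x : Pt) : ℂ := -X.conn 0 0 2 x
def npTau (x : Pt) : ℂ := -X.conn 1 0 2 x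
def npSigma (x : Pt) : ℂ := -X.conn 2 0 2 x
def npRho (x : Pt) : ℂ := -X.conn 3 0 2 x
def npPi (x : Pt) : ℂ := X.conn 0 1 3 x
def npNu (x : Pt) : ℂ := X.conn 1 1 3 x
def npMu (x : Pt) : ℂ := X.conn 2 1 3 x
def npLambda (x : Pt) : ℂ := X.conn 3 1 3 x
def npEps (x : Pt) : ℂ := (X.conn 0 2 3 x - X.conn 0 0 1 x) / 2
def npGamma (x : Pt) : ℂ := (X.conn 1 2 3 x - X.conn 1 0 1 x) / 2
def npBeta (x : Pt) : ℂ := (X.conn 2 2 3 x - X.conn 2 0 1 x) / 2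
def npAlpha (x : Pt) : ℂ := (X.conn 3 2 3 x - X.conn 3 0 1 x) / 2

/-- The conformal Teukolsky operator acting on the perturbation of `φ₀`:
`(D - 3ε + ε* - 4ρ - ρ*)(Δ - 4γ + μ) - (δ + π* - α* - 3β - 4τ)(δ* + π - 4α) - 3Ξφ₂`. -/
def teuk0 (u : Pt → ℂ) (x : Pt) : ℂ :=
  let p : Pt → ℂ := fun y => X.dir 1 u y + (-4 * X.npGamma y + X.npMu y) * u y
  let q : Pt → ℂ := fun y => X.dir 3 u y + (X.npPi y - 4 * X.npAlpha y) * u y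
  X.dir 0 p x
      + (-3 * X.npEps x + star (X.npEps x) - 4 * X.npRho x - star (X.npRho x)) * p x
    - (X.dir 2 q x
      + (star (X.npPi x) - star (X.npAlpha x) - 3 * X.npBeta x - 4 * X.npTau x) * q x)
    - 3 * X.XiC x * X.phi2 x * u x

/-- The conformal Teukolsky operator acting on the perturbation of `φ₄`:
`(Δ + 3γ - γ* + 4μ + μ*)(D + 4ε - ρ) - (δ* - τ* + β* + 3α + 4π)(δ - τ + 4β) - 3Ξφ₂`. -/
def teuk4 (u : Pt → ℂ) (x : Pt) : ℂ :=
  let p : Pt → ℂ := fun y => X.dir 0 u y + (4 * X.npEps y - X.npRho y) * u y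
  let q : Pt → ℂ := fun y => X.dir 2 u y + (-X.npTau y + 4 * X.npBeta y) * u y
  X.dir 1 p x
      + (3 * X.npGamma x - star (X.npGamma x) + 4 * X.npMu x + star (X.npMu x)) * p x
    - (X.dir 3 q x
      + (-star (X.npTau x) + star (X.npBeta x) + 3 * X.npAlpha x + 4 * X.npPi x) * q x)
    - 3 * X.XiC x * X.phi2 x * u x

end CEFEFields

/-- `𝓕` is a smooth one-parameter family of field configurations on `V` which for `ε = 0` solves
the conformal Einstein field equations and for which these equations hold to first order in `ε`:
the first-order perturbation `∂_ε 𝓕 |_{ε = 0}` solves the equations linearised around `𝓕 0`. -/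
structure IsLinearisedSolution (V : Set Pt) (𝓕 : ℝ → CEFEFields) : Prop where
  background : (𝓕 0).IsSolution V
  family : ∃ δ > (0 : ℝ),
    (∀ a μ, ContDiffOn ℝ ∞ (fun p : ℝ × Pt => (𝓕 p.1).e a μ p.2) (Ioo (-δ) δ ×ˢ V)) ∧
    (∀ a b c, ContDiffOn ℝ ∞ (fun p : ℝ × Pt => (𝓕 p.1).conn a b c p.2) (Ioo (-δ) δ ×ˢ V)) ∧
    ContDiffOn ℝ ∞ (fun p : ℝ × Pt => (𝓕 p.1).Xi p.2) (Ioo (-δ) δ ×ˢ V) ∧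
    ContDiffOn ℝ ∞ (fun p : ℝ × Pt => (𝓕 p.1).s p.2) (Ioo (-δ) δ ×ˢ V) ∧
    (∀ a b, ContDiffOn ℝ ∞ (fun p : ℝ × Pt => (𝓕 p.1).L a b p.2) (Ioo (-δ) δ ×ˢ V)) ∧
    (∀ a b c f, ContDiffOn ℝ ∞ (fun p : ℝ × Pt => (𝓕 p.1).d a b c f p.2) (Ioo (-δ) δ ×ˢ V)) ∧
    (∀ ε ∈ Ioo (-δ) δ, ∀ x ∈ V, (𝓕 ε).Admissible x)
  lin_torsion : ∀ x ∈ V, ∀ a b μ, deriv (fun ε => (𝓕 ε).torsion a b μ x) 0 = 0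
  lin_curv : ∀ x ∈ V, ∀ a b c f, deriv (fun ε => (𝓕 ε).zeroCurv a b c f x) 0 = 0
  lin_Xi : ∀ x ∈ V, ∀ a b, deriv (fun ε => (𝓕 ε).zeroXi a b x) 0 = 0
  lin_s : ∀ x ∈ V, ∀ a, deriv (fun ε => (𝓕 ε).zeroS a x) 0 = 0
  lin_L : ∀ x ∈ V, ∀ a b c, deriv (fun ε => (𝓕 ε).zeroL a b c x) 0 = 0
  lin_d : ∀ x ∈ V, ∀ a b c, deriv (fun ε => (𝓕 ε).zeroD a b c x) 0 = 0

/-- The first-order perturbation of `φ₀`. -/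
def phi0Pert (𝓕 : ℝ → CEFEFields) (x : Pt) : ℂ := deriv (fun ε => (𝓕 ε).phi0 x) 0

/-- The first-order perturbation of `φ₄`. -/
def phi4Pert (𝓕 : ℝ → CEFEFields) (x : Pt) : ℂ := deriv (fun ε => (𝓕 ε).phi4 x) 0

/-! ### The Kerr spacetime in Boyer–Lindquist coordinates `(t, r, θ, φ)` -/

def kerrDelta (M a r : ℝ) : ℝ := r ^ 2 - 2 * M * r + a ^ 2

def kerrSigma (a r θ : ℝ) : ℝ := r ^ 2 + a ^ 2 * Real.cos θ ^ 2

def kerrMetric (M a : ℝ) (y : Pt) : Matrix (Fin 4) (Fin 4) ℝ :=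
  let r := y 1
  let S := kerrSigma a r (y 2)
  let sn := Real.sin (y 2)
  !![-(1 - 2 * M * r / S), 0, 0, -(2 * M * a * r / S * sn ^ 2);
     0, S / kerrDelta M a r, 0, 0;
     0, 0, S, 0;
     -(2 * M * a * r / S * sn ^ 2), 0, 0,
       sn ^ 2 * (r ^ 2 + a ^ 2 + 2 * M * a ^ 2 * r / S * sn ^ 2)]

/-- The vector `m` of the Kinnersley tetrad. -/
def kinnersleyM (a : ℝ) (y : Pt) : Fin 4 → ℂ :=
  let c : ℂ := 1 / ((Real.sqrt 2 : ℝ) * ((y 1 : ℂ) + Complex.I * a * (Real.cos (y 2) : ℝ)))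
  ![c * (Complex.I * a * (Real.sin (y 2) : ℝ)), 0, c, c * (Complex.I / (Real.sin (y 2) : ℝ))]

/-- The Kinnersley tetrad `ℓ, k, m, m*`. -/
def kinnersley (M a : ℝ) (y : Pt) : Fin 4 → Fin 4 → ℂ :=
  let r := y 1
  let D := kerrDelta M a r
  let S := kerrSigma a r (y 2)
  ![![((r ^ 2 + a ^ 2) / D : ℝ), 1, 0, (a / D : ℝ)],
    ![((r ^ 2 + a ^ 2) / (2 * S) : ℝ), (-D / (2 * S) : ℝ), 0, (a / (2 * S) : ℝ)],
    kinnersleyM a y,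
    fun μ => star (kinnersleyM a y μ)]

/-! ### The cylinder at spatial infinity

`rp` is the horizon radius `r₊` and `κ = a / r₊` the rotation parameter. -/

def kerrMass (rp κ : ℝ) : ℝ := rp * (1 + κ ^ 2) / 2

def kerrSpin (rp κ : ℝ) : ℝ := κ * rp

/-- The range of the coordinates `(T, ς, θ, φ)`. The part `T < 1` lies in the exterior of the black
hole, `T = 1` is future null infinity, and `T > 1` is a smooth extension through it. -/
def cylRegion : Set Pt :=
  {x | 0 < x 1 ∧ x 1 < 1 ∧ x 1 * (1 - x 0) < 1 ∧ 0 < x 2 ∧ x 2 < Real.pi}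

/-- The transformation from `(T, ς, θ, φ)` to Boyer–Lindquist coordinates; `φs` is a function
with `dφs/dr = a / Δ(r)`. -/
def cylToBL (rp κ : ℝ) (φs : ℝ → ℝ) (x : Pt) : Pt :=
  let T := x 0
  let ς := x 1
  let r := rp / (ς * (1 - T))
  ![rp * (T / (ς * (1 - T)) - (1 + κ ^ 2) * Real.log (1 - T)
      + (1 + κ ^ 2) / (1 - κ ^ 2) *
        (κ ^ 2 * Real.log ((1 - κ ^ 2 * ς) / (1 - κ ^ 2 * ς * (1 - T)))
          - Real.log ((1 - ς) / (1 - ς * (1 - T))))),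
    r, x 2, x 3 + φs r]

/-- The entry `∂Φ^μ/∂x^ν` of the Jacobian matrix of a map `Φ`. -/
def jac (Φ : Pt → Pt) (x : Pt) (μ ν : Fin 4) : ℝ := fderiv ℝ Φ x (Pi.single ν 1) μ

/-- The conformal factor `Ξ = ς (1 - T) / r₊`. -/
def cylXi (rp : ℝ) (x : Pt) : ℝ := x 1 * (1 - x 0) / rp

def cylF (κ ς : ℝ) : ℝ := ς ^ 2 * (1 - ς) * (1 - κ ^ 2 * ς) / (1 + κ ^ 2 * ς ^ 2)

/-- The conformal metric function `Δ = Ξ² Δ̃`. -/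
def cylDelta (κ : ℝ) (x : Pt) : ℝ := (1 - x 1 * (1 - x 0)) * (1 - κ ^ 2 * (x 1 * (1 - x 0)))

/-- The conformal metric function `Σ = Ξ² Σ̃`. -/
def cylSigma (κ : ℝ) (x : Pt) : ℝ := 1 + κ ^ 2 * (x 1 * (1 - x 0)) ^ 2 * Real.cos (x 2) ^ 2

/-- The conformal metric function `Σ₀ = Ξ² (r² + a²)`. -/
def cylSigma0 (κ : ℝ) (x : Pt) : ℝ := 1 + κ ^ 2 * (x 1 * (1 - x 0)) ^ 2

/-- The Killing–Yano coefficient `ζ = Ξ (r - i a cos θ)` of the conformal background. -/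
def cylZeta (κ : ℝ) (x : Pt) : ℂ :=
  1 - Complex.I * κ * (x 1 * (1 - x 0) : ℝ) * (Real.cos (x 2) : ℝ)

def cylM (κ : ℝ) (x : Pt) : Fin 4 → ℂ :=
  let F := cylF κ (x 1)
  let c : ℂ := 1 / ((Real.sqrt 2 : ℝ)
    * (1 + Complex.I * κ * (x 1 * (1 - x 0) : ℝ) * (Real.cos (x 2) : ℝ)))
  ![c * ((F * (1 - x 0) / x 1 : ℝ) * (Complex.I * κ * (Real.sin (x 2) : ℝ))),
    c * ((F : ℝ) * (Complex.I * κ * (Real.sin (x 2) : ℝ))),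
    c,
    c * (Complex.I / (Real.sin (x 2) : ℝ))]

/-- The coordinate components of the conformal null tetrad `ℓ, k, m, m*` adapted to the
cylinder. -/
def cylTetrad (κ : ℝ) (x : Pt) : Fin 4 → Fin 4 → ℂ :=
  let T := x 0
  let ς := x 1
  let F := cylF κ ς
  let S := cylSigma κ x
  let S0 := cylSigma0 κ x
  ![![1, 0, 0, 0],
    ![((1 - T) / (2 * S) * (2 * S0 * F / ς ^ 2 - (1 - T) * cylDelta κ x) : ℝ),
      (F / ς * (S0 / S) : ℝ), 0, (κ * ς * (1 - T) ^ 2 / S : ℝ)],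
    cylM κ x,
    fun μ => star (cylM κ x μ)]

/-- The factors relating the conformal tetrad to the Kinnersley tetrad:
`ℓ = Ξ⁻² (ς/r₊) ℓ̃`, `k = (r₊/ς) k̃`, `m = Ξ⁻¹ m̃`. -/
def tetradScale (rp : ℝ) (x : Pt) : Fin 4 → ℝ :=
  ![(cylXi rp x ^ 2)⁻¹ * (x 1 / rp), rp / x 1, (cylXi rp x)⁻¹, (cylXi rp x)⁻¹]

/-- `B` is the conformal Kerr background on `V`: a solution of the conformal Einstein field
equations whose tetrad and conformal factor are the ones above. -/
structure IsCylBackground (rp κ : ℝ) (V : Set Pt) (B : CEFEFields) : Prop where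
  solution : B.IsSolution V
  tetrad : ∀ x ∈ V, ∀ a μ, B.e a μ x = cylTetrad κ x a μ
  conformalFactor : ∀ x ∈ V, B.Xi x = cylXi rp x

/-! ### The master equation -/

/-- `ð` on functions of spin weight `s`. -/
def eth (s : ℤ) (f : Pt → ℂ) (x : Pt) : ℂ :=
  -(pd 2 f x + Complex.I / (Real.sin (x 2) : ℝ) * pd 3 f x
    - s * ((Real.cos (x 2) / Real.sin (x 2) : ℝ) : ℂ) * f x)

/-- `ð̄` on functions of spin weight `s`. -/
def ethbar (s : ℤ) (f : Pt → ℂ) (x : Pt) : ℂ :=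
  -(pd 2 f x - Complex.I / (Real.sin (x 2) : ℝ) * pd 3 f x
    + s * ((Real.cos (x 2) / Real.sin (x 2) : ℝ) : ℂ) * f x)

/-- `ð ð̄` on functions of spin weight `s` (`ð̄` lowers the spin weight by one). -/
def ethEthbar (s : ℤ) (f : Pt → ℂ) : Pt → ℂ := eth (s - 1) (ethbar s f)

section Coefficients

variable (κ : ℝ) (s : ℤ) (x : Pt)

def coefATT : ℂ :=
  let u : ℂ := 1 - (x 0 : ℂ); let ς : ℂ := (x 1 : ℂ); let k : ℂ := (κ : ℂ)
  let sn : ℂ := (Real.sin (x 2) : ℝ); let F : ℂ := (cylF κ (x 1) : ℝ)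
  (2 - (s : ℂ) ^ 2 / 4) *
    (2 * F * (1 + k ^ 2 * ς ^ 2 * u ^ 2) - F ^ 2 * k ^ 2 * sn ^ 2 * u
      - ς ^ 2 * (-1 + ς * u) * (-1 + k ^ 2 * ς * u) * u) * u

def coefATς : ℂ :=
  let u : ℂ := 1 - (x 0 : ℂ); let ς : ℂ := (x 1 : ℂ); let k : ℂ := (κ : ℂ)
  let sn : ℂ := (Real.sin (x 2) : ℝ); let F : ℂ := (cylF κ (x 1) : ℝ)
  2 * (2 - (s : ℂ) ^ 2 / 4) * ς * F * (1 + k ^ 2 * (-F * sn ^ 2 + ς ^ 2 * u) * u)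

def coefATφ : ℂ :=
  let u : ℂ := 1 - (x 0 : ℂ); let ς : ℂ := (x 1 : ℂ); let k : ℂ := (κ : ℂ)
  let F : ℂ := (cylF κ (x 1) : ℝ)
  2 * (2 - (s : ℂ) ^ 2 / 4) * k * ς * (-F + ς ^ 2 * u) * u

def coefAςς : ℂ :=
  let ς : ℂ := (x 1 : ℂ); let k : ℂ := (κ : ℂ)
  let sn : ℂ := (Real.sin (x 2) : ℝ); let F : ℂ := (cylF κ (x 1) : ℝ)
  (-F ^ 2) * (2 - (s : ℂ) ^ 2 / 4) * k ^ 2 * sn ^ 2 * ς ^ 2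

def coefAςφ : ℂ :=
  let ς : ℂ := (x 1 : ℂ); let k : ℂ := (κ : ℂ); let F : ℂ := (cylF κ (x 1) : ℝ)
  (-2) * F * (2 - (s : ℂ) ^ 2 / 4) * k * ς ^ 2

def coefA : ℂ :=
  let ς : ℂ := (x 1 : ℂ)
  (-(2 - (s : ℂ) ^ 2 / 4)) * ς ^ 2

def coefBς : ℂ :=
  let u : ℂ := 1 - (x 0 : ℂ); let ς : ℂ := (x 1 : ℂ); let k : ℂ := (κ : ℂ)
  let sn : ℂ := (Real.sin (x 2) : ℝ); let cs : ℂ := (Real.cos (x 2) : ℝ)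
  let F : ℂ := (cylF κ (x 1) : ℝ); let F' : ℂ := (deriv (cylF κ) (x 1) : ℝ)
  let s : ℂ := (s : ℂ)
  F * k * ς * (2 * Complex.I * s * cs * ς + (-4 - 4 * s + s ^ 2 / 2) * k * ς ^ 2 * u
    + k * sn ^ 2 * (2 * F * s - (2 - s ^ 2 / 4) * ς * F'))

def coefBφ : ℂ :=
  let u : ℂ := 1 - (x 0 : ℂ); let ς : ℂ := (x 1 : ℂ); let k : ℂ := (κ : ℂ)
  let F : ℂ := (cylF κ (x 1) : ℝ); let s : ℂ := (s : ℂ)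
  2 * k * ς * (F * s + (-2 - 2 * s + s ^ 2 / 4) * ς ^ 2 * u)

def coefBT : ℂ :=
  let u : ℂ := 1 - (x 0 : ℂ); let ς : ℂ := (x 1 : ℂ); let k : ℂ := (κ : ℂ)
  let sn : ℂ := (Real.sin (x 2) : ℝ); let cs : ℂ := (Real.cos (x 2) : ℝ)
  let F : ℂ := (cylF κ (x 1) : ℝ); let F' : ℂ := (deriv (cylF κ) (x 1) : ℝ)
  let s : ℂ := (s : ℂ)
  F ^ 2 * (4 + 2 * s - s ^ 2 / 2) * k ^ 2 * sn ^ 2 * u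
    + (2 + s - s ^ 2 / 4) * ς ^ 2 * (2 + ς * (-3 + k ^ 2 * (-3 + 4 * ς * u)) * u) * u
    + F * (-4 - 2 * s + s ^ 2 / 2
      + 4 * k * ς * (Complex.I * s * cs / 2 + (-2 - 3 * s / 2 + s ^ 2 / 4) * k * ς * u) * u
      + (-2 + s ^ 2 / 4) * k ^ 2 * sn ^ 2 * ς * u * F')

def coefC : ℂ :=
  let u : ℂ := 1 - (x 0 : ℂ); let ς : ℂ := (x 1 : ℂ); let k : ℂ := (κ : ℂ)
  let sn : ℂ := (Real.sin (x 2) : ℝ); let cs : ℂ := (Real.cos (x 2) : ℝ)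
  let F : ℂ := (cylF κ (x 1) : ℝ); let F' : ℂ := (deriv (cylF κ) (x 1) : ℝ)
  let s : ℂ := (s : ℂ)
  (-F ^ 2) * s * (1 + s) * k ^ 2 * sn ^ 2
    + 2 * F * k * ς * (-Complex.I * s ^ 2 * cs + s * (1 + 2 * s) * k * ς * u
      + s * k * sn ^ 2 * F' / 2)
    + ς ^ 2 * (-2 * s + (2 + 3 * s + 7 * s ^ 2 / 4) * ς * (1 + k ^ 2 * (1 - 2 * ς * u)) * u)

end Coefficients

/-- The master operator for spin weight `s` in the coordinates `(T, ς, θ, φ)`. -/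
def masterOp (κ : ℝ) (s : ℤ) (u : Pt → ℂ) (x : Pt) : ℂ :=
  coefATT κ s x * pd 0 (pd 0 u) x + coefATς κ s x * pd 0 (pd 1 u) x
    + coefATφ κ s x * pd 0 (pd 3 u) x + coefAςς κ s x * pd 1 (pd 1 u) x
    + coefAςφ κ s x * pd 1 (pd 3 u) x + coefA s x * ethEthbar s u x
    + coefBς κ s x * pd 1 u x + coefBφ κ s x * pd 3 u x + coefBT κ s x * pd 0 u x
    + coefC κ s x * u x

/-- The transport operator `(1 - T)(1 + T) ∂_T² - 2 (1 + s) T ∂_T - ð ð̄ - 2 s`. -/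
def transportOp (s : ℤ) (u : Pt → ℂ) (x : Pt) : ℂ :=
  (1 - (x 0 : ℂ)) * (1 + (x 0 : ℂ)) * pd 0 (pd 0 u) x
    - 2 * (1 + (s : ℂ)) * (x 0 : ℂ) * pd 0 u x - ethEthbar s u x - 2 * (s : ℂ) * u x

end CylTeukolsky

end

open CylTeukolsky

/-! Every background quantity is a rational function of a few symbols: `ς`, `w = ς(1 - T) = r₊ Ξ`,
`sin θ`, `cos θ`, `F`, `F'`, `K = iκ` and `h = 1/√2`. Apart from constants, the denominators are
products of `ς`, `sin θ`, `ζ = 1 - K w cos θ` and `ζ* = 1 + K w cos θ`, which do not vanish on the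
region. Derivatives of the symbols along the tetrad are again rational in them (`HasFr` records
these rules). Hence the torsion, curvature, `Ξ`, `s`, `L` and `d` equations, as well as the
comparison with the master operator, become rational identities modulo `h² = 1/2`, `sin² θ + cos² θ
= 1` and `i² = -1`. The explicit form of `F` plays no role in them: `F` and `F'` are free symbols.
It matters only for the non-degeneracy of the frame, for the relation to Boyer–Lindquist time, and
for `F/ς² → 1` at `ς = 0`.

A background in the sense of the theorem is prescribed only through its tetrad and `Ξ`, so
uniqueness is needed besides existence (`isCylBackground_bgFields`). The torsion-free metric
connection is determined by the frame (`conn_unique`). The Schouten tensor is then determined by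
tracing the curvature (`schouten_unique`). The rescaled Weyl tensor follows by dividing by `Ξ`, and
at null infinity by first differentiating in `T`, since `Ξ` has a simple zero there
(`IsCylBackground.d_eq`).

The Teukolsky equations come from three equations of the full system: two Bianchi equations relating
`φ₀`, `φ₁`, `κ`, `σ`, and the structure equation for `Dσ - δκ`. Each of their terms contains a
factor that vanishes on the background, so perturbations of the tetrad and of the coefficients drop
out at first order. Applying suitable first-order operators to the two Bianchi equations and
subtracting eliminates the perturbation of `φ₁`, by the commutator of `D` and `δ` and one identity
between spin coefficients. Because `φ₂` is a constant multiple of `ζ⁻³`, with `Dφ₂ = 3ρφ₂` and `δφ₂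
= 3τφ₂`, the perturbations of `κ` and `σ` combine into the structure equation, which produces the
potential `-3Ξφ₂` (`frOp_decoupled`). The case of `φ₄` is the same with `ℓ ↔ k` and `m ↔ m*`.

The master operator is compared with these operators coefficient by coefficient in coordinates. For
spin weight `-2` one first conjugates with `ζ⁴`; the logarithmic derivatives of `ζ` along the tetrad
are `-ρ, μ, -τ, π`, so conjugation only shifts the lower-order coefficients. For spin weight zero
the same principal part gives the wave operator, and the trace of `L` gives the curvature term.

The link to Kerr is a Jacobian computation resting on two facts: `∂_T` is proportional to the
principal null vector of the Kinnersley tetrad, and `F((1 - T)/ς ∂_T + ∂_ς)` is `r₊` times the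
stationary Killing vector. At `ς = 0`, writing `F = ς² G` with `G(0) = 1` shows that every
`ς`-derivative in `ς⁻² P` carries a positive power of `ς`, so only the transport operator survives.
-/

noncomputable section

namespace CylTeukolsky

set_option linter.unusedVariables false
set_option linter.unusedSimpArgs false
set_option linter.unusedTactic false
set_option linter.unreachableTactic false

/-! ### Partial derivatives -/

lemma pd_add {f g : Pt → ℂ} {x : Pt} (hf : DifferentiableAt ℝ f x) (hg : DifferentiableAt ℝ g x)
    (μ : Fin 4) : pd μ (fun y => f y + g y) x = pd μ f x + pd μ g x := by
  simp only [pd]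
  rw [fderiv_fun_add hf hg]
  rfl

lemma pd_mul {f g : Pt → ℂ} {x : Pt} (hf : DifferentiableAt ℝ f x) (hg : DifferentiableAt ℝ g x)
    (μ : Fin 4) : pd μ (fun y => f y * g y) x = pd μ f x * g x + f x * pd μ g x := by
  simp only [pd]
  rw [fderiv_fun_mul hf hg]
  simp only [add_apply, smul_apply, smul_eq_mul]
  ring

@[simp] lemma pd_const (μ : Fin 4) (c : ℂ) (x : Pt) : pd μ (fun _ => c) x = 0 := by
  simp [pd]

@[simp] lemma pd_zero (μ : Fin 4) (x : Pt) : pd μ 0 x = 0 := pd_const μ 0 x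

lemma pd_neg (μ : Fin 4) (f : Pt → ℂ) (x : Pt) : pd μ (fun y => -f y) x = -pd μ f x := by
  simp only [pd]
  rw [fderiv_fun_neg]
  rfl

lemma pd_congr {f g : Pt → ℂ} {x : Pt} (h : f =ᶠ[𝓝 x] g) (μ : Fin 4) : pd μ f x = pd μ g x := by
  simp only [pd]
  rw [h.fderiv_eq]

lemma pd_inv {f : Pt → ℂ} {x : Pt} (hf : DifferentiableAt ℝ f x) (h0 : f x ≠ 0)
    (μ : Fin 4) : pd μ (fun y => (f y)⁻¹) x = -pd μ f x / f x ^ 2 := by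
  have h := (hasFDerivAt_inv' (𝕜 := ℝ) h0).comp x hf.hasFDerivAt
  simp only [pd]
  have h2 : (fun y => (f y)⁻¹) = Inv.inv ∘ f := rfl
  rw [h2, h.fderiv]
  simp
  field_simp

lemma pd_coord {g : ℝ → ℝ} {g' : ℝ} {i : Fin 4} {x : Pt} (h : HasDerivAt g g' (x i))
    (μ : Fin 4) : pd μ (fun y => (g (y i) : ℂ)) x = if μ = i then (g' : ℂ) else 0 := by
  have h1 : HasFDerivAt (fun y : Pt => y i) (ContinuousLinearMap.proj (R := ℝ) i) x :=
    (ContinuousLinearMap.proj (R := ℝ) (φ := fun _ : Fin 4 => ℝ) i).hasFDerivAt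
  have h2 := Complex.ofRealCLM.hasFDerivAt.comp x (h.hasFDerivAt.comp x h1)
  have h3 : pd μ (Complex.ofRealCLM ∘ g ∘ fun y : Pt => y i) x
      = if μ = i then (g' : ℂ) else 0 := by
    simp only [pd]
    rw [h2.fderiv]
    by_cases hi : μ = i
    · subst hi; simp
    · simp [hi]
  exact h3

lemma contDiffAt_pd {n : ℕ∞} {f : Pt → ℂ} {x : Pt} (hf : ContDiffAt ℝ (n + 1) f x) (μ : Fin 4) :
    ContDiffAt ℝ n (pd μ f) x :=
  (hf.fderiv_right (m := n) le_rfl).clm_apply contDiffAt_const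

lemma pd_comm {f : Pt → ℂ} {x : Pt} (hf : ContDiffAt ℝ 2 f x) (μ ν : Fin 4) :
    pd μ (pd ν f) x = pd ν (pd μ f) x := by
  have hs := hf.isSymmSndFDerivAt (by simp)
  have hd : DifferentiableAt ℝ (fderiv ℝ f) x :=
    (hf.fderiv_right (m := 1) (by norm_num)).differentiableAt (by norm_num)
  have key : ∀ v w : Pt, fderiv ℝ (fun y => fderiv ℝ f y v) x w = fderiv ℝ (fderiv ℝ f) x w v := by
    intro v w
    rw [fderiv_clm_apply hd (differentiableAt_const _)]
    simp
  show fderiv ℝ (fun y => fderiv ℝ f y _) x _ = fderiv ℝ (fun y => fderiv ℝ f y _) x _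
  rw [key, key]
  exact hs _ _

/-! ### Elementary functions on the cylinder -/

/-- `i κ`. -/
def imk (κ : ℝ) : ℂ := Complex.I * κ

/-- `1 / √2`. -/
def hsq : ℂ := ((Real.sqrt 2 : ℝ) : ℂ)⁻¹

/-- `ς (1 - T)`. -/
def cylW (x : Pt) : ℂ := (x 1 * (1 - x 0) : ℝ)

def cosC (x : Pt) : ℂ := (Real.cos (x 2) : ℝ)

def sinC (x : Pt) : ℂ := (Real.sin (x 2) : ℝ)

def sigC (x : Pt) : ℂ := (x 1 : ℝ)

def cylFC (κ : ℝ) (x : Pt) : ℂ := (cylF κ (x 1) : ℝ)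

def cylFC' (κ : ℝ) (x : Pt) : ℂ := (deriv (cylF κ) (x 1) : ℝ)

lemma imk_sq (κ : ℝ) : imk κ ^ 2 = -(κ : ℂ) ^ 2 := by
  simp [imk, mul_pow]

@[simp] lemma star_imk (κ : ℝ) : star (imk κ) = -imk κ := by
  simp [imk]

lemma hsq_sq : hsq ^ 2 = 1 / 2 := by
  rw [hsq, inv_pow, ← Complex.ofReal_pow, Real.sq_sqrt (by norm_num)]
  norm_num

lemma hsq_pow_three : hsq ^ 3 = hsq / 2 := by
  linear_combination hsq * hsq_sq

@[simp] lemma star_hsq : star hsq = hsq := by simp [hsq]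
@[simp] lemma star_cylW (x : Pt) : star (cylW x) = cylW x := Complex.conj_ofReal _
@[simp] lemma star_cosC (x : Pt) : star (cosC x) = cosC x := Complex.conj_ofReal _
@[simp] lemma star_sinC (x : Pt) : star (sinC x) = sinC x := Complex.conj_ofReal _
@[simp] lemma star_sigC (x : Pt) : star (sigC x) = sigC x := Complex.conj_ofReal _
@[simp] lemma star_cylFC (κ : ℝ) (x : Pt) : star (cylFC κ x) = cylFC κ x := Complex.conj_ofReal _

lemma sinC_sq (x : Pt) : sinC x ^ 2 = 1 - cosC x ^ 2 := by
  have := Real.sin_sq_add_cos_sq (x 2)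
  simp only [sinC, cosC]
  rw [eq_sub_iff_add_eq]
  exact_mod_cast this

lemma sinC_pow_three (x : Pt) : sinC x ^ 3 = sinC x * (1 - cosC x ^ 2) := by
  linear_combination sinC x * sinC_sq x

lemma sinC_pow_four (x : Pt) : sinC x ^ 4 = (1 - cosC x ^ 2) ^ 2 := by
  linear_combination (sinC x ^ 2 + 1 - cosC x ^ 2) * sinC_sq x

lemma cylW_eq (x : Pt) : cylW x = sigC x * (1 - (x 0 : ℂ)) := by
  simp [cylW, sigC]

lemma sigC_ne {x : Pt} (hx : x ∈ cylRegion) : sigC x ≠ 0 :=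
  Complex.ofReal_ne_zero.mpr hx.1.ne'

lemma sinC_ne {x : Pt} (hx : x ∈ cylRegion) : sinC x ≠ 0 :=
  Complex.ofReal_ne_zero.mpr (Real.sin_pos_of_pos_of_lt_pi hx.2.2.2.1 hx.2.2.2.2).ne'

lemma zeta_eq (κ : ℝ) (x : Pt) : cylZeta κ x = 1 - imk κ * cylW x * cosC x := by
  simp [cylZeta, imk, cylW, cosC]

/-- The subtracted product is purely imaginary, so the real part is 1 at every point, without any
restriction to the region. -/
lemma zeta_ne (κ : ℝ) (x : Pt) : 1 - imk κ * cylW x * cosC x ≠ 0 := by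
  intro h
  have := congrArg Complex.re h
  simp [imk, cylW, cosC] at this

lemma zetaBar_ne (κ : ℝ) (x : Pt) : 1 + imk κ * cylW x * cosC x ≠ 0 := by
  intro h
  have := congrArg Complex.re h
  simp [imk, cylW, cosC] at this

lemma sigma_eq (κ : ℝ) (x : Pt) : (cylSigma κ x : ℂ)
    = (1 - imk κ * cylW x * cosC x) * (1 + imk κ * cylW x * cosC x) := by
  have := imk_sq κ
  simp only [cylSigma, cylW, cosC]
  push_cast
  linear_combination (((x 1 : ℂ) * (1 - x 0)) ^ 2 * (Complex.cos (x 2)) ^ 2) * this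

lemma sigma0_eq (κ : ℝ) (x : Pt) : (cylSigma0 κ x : ℂ) = 1 - imk κ ^ 2 * cylW x ^ 2 := by
  rw [imk_sq]
  simp only [cylSigma0, cylW]
  push_cast
  ring

lemma delta_eq (κ : ℝ) (x : Pt) :
    (cylDelta κ x : ℂ) = (1 - cylW x) * (1 + imk κ ^ 2 * cylW x) := by
  rw [imk_sq]
  simp only [cylDelta, cylW]
  push_cast
  ring

lemma contDiff_cylF (κ : ℝ) : ContDiff ℝ ∞ (cylF κ) := by
  unfold cylF
  refine ContDiff.div (by fun_prop) (by fun_prop) (fun x => ?_)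
  positivity

/-! ### The tetrad in complex form -/

lemma cylTetrad_zero (κ : ℝ) (x : Pt) : cylTetrad κ x 0 = ![1, 0, 0, 0] := rfl

lemma cylTetrad_one (κ : ℝ) (x : Pt) : cylTetrad κ x 1 =
    ![(1 - (x 0 : ℂ)) / (2 * ((1 - imk κ * cylW x * cosC x) * (1 + imk κ * cylW x * cosC x)))
        * (2 * (1 - imk κ ^ 2 * cylW x ^ 2) * cylFC κ x / sigC x ^ 2
          - (1 - (x 0 : ℂ)) * ((1 - cylW x) * (1 + imk κ ^ 2 * cylW x))),
      cylFC κ x / sigC x * ((1 - imk κ ^ 2 * cylW x ^ 2)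
        / ((1 - imk κ * cylW x * cosC x) * (1 + imk κ * cylW x * cosC x))), 0,
      κ * sigC x * (1 - (x 0 : ℂ)) ^ 2
        / ((1 - imk κ * cylW x * cosC x) * (1 + imk κ * cylW x * cosC x))] := by
  rw [← sigma_eq, ← sigma0_eq, ← delta_eq]
  funext μ
  fin_cases μ <;> simp [cylTetrad, sigC, cylFC]

lemma cylTetrad_two (κ : ℝ) (x : Pt) : cylTetrad κ x 2 =
    ![hsq / (1 + imk κ * cylW x * cosC x)
        * (cylFC κ x * (1 - (x 0 : ℂ)) / sigC x * imk κ * sinC x),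
      hsq / (1 + imk κ * cylW x * cosC x) * (cylFC κ x * imk κ * sinC x),
      hsq / (1 + imk κ * cylW x * cosC x),
      hsq / (1 + imk κ * cylW x * cosC x) * (Complex.I / sinC x)] := by
  funext μ
  fin_cases μ <;>
    simp only [Fin.zero_eta, Fin.mk_one, Fin.reduceFinMk, cylTetrad, cylM, Matrix.cons_val, sigC,
      cylFC, imk, hsq, cylW, cosC, sinC, div_eq_mul_inv, mul_inv, one_mul, Complex.ofReal_mul,
      Complex.ofReal_inv, Complex.ofReal_sub, Complex.ofReal_one] <;> ring

lemma cylTetrad_three (κ : ℝ) (x : Pt) : cylTetrad κ x 3 =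
    ![-(hsq / (1 - imk κ * cylW x * cosC x)
        * (cylFC κ x * (1 - (x 0 : ℂ)) / sigC x * imk κ * sinC x)),
      -(hsq / (1 - imk κ * cylW x * cosC x) * (cylFC κ x * imk κ * sinC x)),
      hsq / (1 - imk κ * cylW x * cosC x),
      -(hsq / (1 - imk κ * cylW x * cosC x) * (Complex.I / sinC x))] := by
  have h : cylTetrad κ x 3 = fun μ => star (cylTetrad κ x 2 μ) := rfl
  rw [h, cylTetrad_two]
  have hI : star (Complex.I) = -Complex.I := Complex.conj_I
  have h0 : star (x 0 : ℂ) = (x 0 : ℂ) := Complex.conj_ofReal _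
  funext μ
  fin_cases μ <;>
    simp only [Fin.zero_eta, Fin.mk_one, Fin.reduceFinMk, Matrix.cons_val, star_mul', star_div₀,
      star_add, star_sub, star_one, star_imk, star_hsq, star_cylW, star_cosC, star_sinC, star_sigC,
      star_cylFC, hI, h0] <;> ring

lemma star_cylTetrad (κ : ℝ) (x : Pt) (a μ : Fin 4) :
    star (cylTetrad κ x a μ) = cylTetrad κ x (bar a) μ := by
  have b0 : bar 0 = 0 := by decide
  have b1 : bar 1 = 1 := by decide
  have b2 : bar 2 = 3 := by decide
  have b3 : bar 3 = 2 := by decide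
  fin_cases a
  · simp only [Fin.zero_eta, b0]
    fin_cases μ <;> simp [cylTetrad]
  · simp only [Fin.mk_one, b1]
    fin_cases μ <;> simp [cylTetrad]
  · simp only [Fin.reduceFinMk, b2]
    rfl
  · simp only [Fin.reduceFinMk, b3]
    exact star_star (cylM κ x μ)

/-! ### Derivatives along the background tetrad -/

/-- Derivative along the `a`-th vector of the background tetrad. -/
def frD (κ : ℝ) (a : Fin 4) (f : Pt → ℂ) (x : Pt) : ℂ := ∑ μ, cylTetrad κ x a μ * pd μ f x

/-- `f` is smooth at `x` and `v` lists its derivatives along the background tetrad. -/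
structure HasFr (κ : ℝ) (f : Pt → ℂ) (x : Pt) (v : Fin 4 → ℂ) : Prop where
  smooth : ContDiffAt ℝ ∞ f x
  frD_eq : ∀ a, frD κ a f x = v a

namespace HasFr

variable {κ : ℝ} {f g : Pt → ℂ} {x : Pt} {v w : Fin 4 → ℂ}

lemma diff (h : HasFr κ f x v) : DifferentiableAt ℝ f x := h.smooth.differentiableAt (by simp)

lemma congr (h : HasFr κ f x v) (hg : g =ᶠ[𝓝 x] f) (hv : ∀ a, v a = w a) : HasFr κ g x w := by
  refine ⟨h.smooth.congr_of_eventuallyEq hg, fun a => ?_⟩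
  rw [← hv, ← h.frD_eq]
  simp only [frD, pd_congr hg]

lemma congr_val (h : HasFr κ f x v) (hv : ∀ a, v a = w a) : HasFr κ f x w :=
  h.congr (EventuallyEq.refl _ _) hv

lemma add (hf : HasFr κ f x v) (hg : HasFr κ g x w) :
    HasFr κ (fun y => f y + g y) x (fun a => v a + w a) := by
  refine ⟨hf.smooth.add hg.smooth, fun a => ?_⟩
  rw [← hf.frD_eq, ← hg.frD_eq]
  simp only [frD, pd_add hf.diff hg.diff, mul_add, Finset.sum_add_distrib]

lemma mul (hf : HasFr κ f x v) (hg : HasFr κ g x w) :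
    HasFr κ (fun y => f y * g y) x (fun a => v a * g x + f x * w a) := by
  refine ⟨hf.smooth.mul hg.smooth, fun a => ?_⟩
  rw [← hf.frD_eq, ← hg.frD_eq]
  simp only [frD, pd_mul hf.diff hg.diff, Fin.sum_univ_four]
  ring

lemma neg (hf : HasFr κ f x v) : HasFr κ (fun y => -f y) x (fun a => -v a) := by
  refine ⟨hf.smooth.neg, fun a => ?_⟩
  rw [← hf.frD_eq]
  simp only [frD, pd_neg, Fin.sum_univ_four]
  ring

lemma sub (hf : HasFr κ f x v) (hg : HasFr κ g x w) :
    HasFr κ (fun y => f y - g y) x (fun a => v a - w a) := by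
  simpa only [sub_eq_add_neg] using hf.add hg.neg

lemma const (κ : ℝ) (x : Pt) (c : ℂ) : HasFr κ (fun _ => c) x (fun _ => 0) :=
  ⟨contDiffAt_const, fun a => by simp [frD]⟩

lemma pow (hf : HasFr κ f x v) (n : ℕ) :
    HasFr κ (fun y => f y ^ n) x (fun a => n * f x ^ (n - 1) * v a) := by
  induction n with
  | zero => simpa using const κ x 1
  | succ n ih =>
    refine (ih.mul hf).congr (Eventually.of_forall fun y => pow_succ _ _) fun a => ?_
    rcases n with _ | n
    · simp
    · simp only [Nat.add_sub_cancel]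
      push_cast
      ring

lemma inv (hf : HasFr κ f x v) (h0 : f x ≠ 0) :
    HasFr κ (fun y => (f y)⁻¹) x (fun a => -v a / f x ^ 2) := by
  refine ⟨hf.smooth.inv h0, fun a => ?_⟩
  rw [← hf.frD_eq]
  simp only [frD, pd_inv hf.diff h0, Fin.sum_univ_four]
  ring

lemma div (hf : HasFr κ f x v) (hg : HasFr κ g x w) (h0 : g x ≠ 0) :
    HasFr κ (fun y => f y / g y) x (fun a => v a / g x - f x * w a / g x ^ 2) := by
  simp only [div_eq_mul_inv]
  exact (hf.mul (hg.inv h0)).congr_val fun a => by ring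

/-- Derivatives of a function of a single coordinate. -/
lemma coord {φ : ℝ → ℝ} {φ' : ℝ} (i : Fin 4) (hφ : ContDiffAt ℝ ∞ φ (x i))
    (h : HasDerivAt φ φ' (x i)) :
    HasFr κ (fun y => (φ (y i) : ℂ)) x (fun a => cylTetrad κ x a i * φ') := by
  refine ⟨?_, fun a => ?_⟩
  · have h1 : ContDiffAt ℝ ∞ (fun y : Pt => y i) x := contDiffAt_apply ℝ _ i x
    exact Complex.ofRealCLM.contDiff.contDiffAt.comp x (ContDiffAt.comp x hφ h1)
  · simp only [frD, pd_coord h]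
    simp

end HasFr

lemma hasFr_coord (κ : ℝ) (x : Pt) (i : Fin 4) :
    HasFr κ (fun y => (y i : ℂ)) x (fun a => cylTetrad κ x a i) :=
  (HasFr.coord (φ := id) i contDiffAt_id (hasDerivAt_id _)).congr_val fun a => by simp

/-- Derivatives of `ς` along the tetrad. -/
def frSig (κ : ℝ) (x : Pt) : Fin 4 → ℂ :=
  ![0, cylFC κ x * (1 - imk κ ^ 2 * cylW x ^ 2) / (sigC x * (1 - imk κ * cylW x * cosC x)
      * (1 + imk κ * cylW x * cosC x)),
    hsq * cylFC κ x * imk κ * sinC x / (1 + imk κ * cylW x * cosC x),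
    -(hsq * cylFC κ x * imk κ * sinC x / (1 - imk κ * cylW x * cosC x))]

lemma hasFr_sig {κ : ℝ} {x : Pt} : HasFr κ sigC x (frSig κ x) := by
  refine (hasFr_coord κ x 1).congr_val fun a => ?_
  fin_cases a
  · rfl
  · simp only [Fin.mk_one, cylTetrad_one, frSig, Matrix.cons_val, mul_assoc, mul_div_assoc]
    rw [div_mul_div_comm, mul_div_assoc]
  · simp only [Fin.reduceFinMk, cylTetrad_two, frSig, Matrix.cons_val]
    ring
  · simp only [Fin.reduceFinMk, cylTetrad_three, frSig, Matrix.cons_val]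
    ring

/-- Derivatives of `ς (1 - T)` along the tetrad. -/
def frW (κ : ℝ) (x : Pt) : Fin 4 → ℂ :=
  ![-sigC x, cylW x ^ 2 * (1 - cylW x) * (1 + imk κ ^ 2 * cylW x)
      / (2 * sigC x * (1 - imk κ * cylW x * cosC x) * (1 + imk κ * cylW x * cosC x)), 0, 0]

/-- In the Kerr exterior `w = r₊/r`, and the Kinnersley vector `m` has no radial component; this is
why the last two entries of `frW` are zero. -/
lemma hasFr_W {κ : ℝ} {x : Pt} (hS : sigC x ≠ 0) : HasFr κ cylW x (frW κ x) := by
  have h := (hasFr_coord κ x 1).mul ((HasFr.const κ x 1).sub (hasFr_coord κ x 0))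
  refine h.congr (Eventually.of_forall fun y => ?_) fun a => ?_
  · rw [cylW_eq]; rfl
  · have hz := zeta_ne κ x
    have hzb := zetaBar_ne κ x
    have hw := cylW_eq x
    have hs : (x 1 : ℂ) = sigC x := rfl
    have hu : 1 - (x 0 : ℂ) = cylW x / sigC x := by rw [hw]; field_simp
    fin_cases a
    · simp [cylTetrad_zero, frW, hs]
    · simp only [Fin.mk_one, cylTetrad_one, frW, Matrix.cons_val, hs, hu]
      field_simp
      ring
    · simp only [Fin.reduceFinMk, cylTetrad_two, frW, Matrix.cons_val, hs, hu]
      field_simp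
      ring
    · simp only [Fin.reduceFinMk, cylTetrad_three, frW, Matrix.cons_val, hs, hu]
      field_simp
      ring

/-- Derivatives of `θ` along the tetrad. -/
def frTh (κ : ℝ) (x : Pt) : Fin 4 → ℂ :=
  ![0, 0, hsq / (1 + imk κ * cylW x * cosC x), hsq / (1 - imk κ * cylW x * cosC x)]

lemma frTh_eq (κ : ℝ) (x : Pt) (a : Fin 4) : cylTetrad κ x a 2 = frTh κ x a := by
  fin_cases a
  · rfl
  · simp [cylTetrad_one, frTh]
  · simp [cylTetrad_two, frTh]
  · simp [cylTetrad_three, frTh]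

lemma hasFr_cos {κ : ℝ} {x : Pt} : HasFr κ cosC x (fun a => -sinC x * frTh κ x a) := by
  refine (HasFr.coord 2 Real.contDiff_cos.contDiffAt (Real.hasDerivAt_cos (x 2))).congr_val
    fun a => ?_
  rw [frTh_eq, mul_comm, sinC, Complex.ofReal_neg]

lemma hasFr_sin {κ : ℝ} {x : Pt} : HasFr κ sinC x (fun a => cosC x * frTh κ x a) := by
  refine (HasFr.coord 2 Real.contDiff_sin.contDiffAt (Real.hasDerivAt_sin (x 2))).congr_val
    fun a => ?_
  rw [frTh_eq, mul_comm, cosC]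

lemma hasFr_of_sig {κ : ℝ} {x : Pt} {φ : ℝ → ℝ} (hφ : ContDiff ℝ ∞ φ) :
    HasFr κ (fun y => (φ (y 1) : ℂ)) x
      (fun a => ((deriv φ (x 1) : ℝ) : ℂ) * frSig κ x a) := by
  refine (HasFr.coord 1 hφ.contDiffAt
    (hφ.differentiable (by simp) (x 1)).hasDerivAt).congr_val fun a => ?_
  rw [← hasFr_sig.frD_eq a, ← (hasFr_coord κ x 1).frD_eq a, mul_comm]
  rfl

lemma hasFr_F {κ : ℝ} {x : Pt} : HasFr κ (cylFC κ) x (fun a => cylFC' κ x * frSig κ x a) :=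
  hasFr_of_sig (contDiff_cylF κ)

/-- Derivatives of `ζ` along the tetrad. -/
def frZ (κ : ℝ) (x : Pt) : Fin 4 → ℂ :=
  ![imk κ * sigC x * cosC x,
    -(imk κ * cosC x * cylW x ^ 2 * (1 - cylW x) * (1 + imk κ ^ 2 * cylW x)
      / (2 * sigC x * (1 - imk κ * cylW x * cosC x) * (1 + imk κ * cylW x * cosC x))),
    imk κ * cylW x * hsq * sinC x / (1 + imk κ * cylW x * cosC x),
    imk κ * cylW x * hsq * sinC x / (1 - imk κ * cylW x * cosC x)]

lemma frZ_eq (κ : ℝ) (x : Pt) (a : Fin 4) :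
    frZ κ x a = -imk κ * (frW κ x a * cosC x - cylW x * sinC x * frTh κ x a) := by
  fin_cases a <;>
    simp only [Fin.zero_eta, Fin.mk_one, Fin.reduceFinMk, frZ, frW, frTh, Matrix.cons_val] <;> ring

lemma hasFr_zeta {κ : ℝ} {x : Pt} (hS : sigC x ≠ 0) :
    HasFr κ (fun y => 1 - imk κ * cylW y * cosC y) x (frZ κ x) := by
  refine ((HasFr.const κ x 1).sub (((HasFr.const κ x (imk κ)).mul (hasFr_W hS)).mul
    hasFr_cos)).congr_val fun a => ?_
  rw [frZ_eq]
  ring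

/-- Since `ζ + ζ* = 2` is constant, the two functions have opposite derivatives, and no separate
list is needed for `ζ*`. -/
lemma hasFr_zetaBar {κ : ℝ} {x : Pt} (hS : sigC x ≠ 0) :
    HasFr κ (fun y => 1 + imk κ * cylW y * cosC y) x (fun a => -frZ κ x a) := by
  refine ((HasFr.const κ x 1).add (((HasFr.const κ x (imk κ)).mul (hasFr_W hS)).mul
    hasFr_cos)).congr_val fun a => ?_
  rw [frZ_eq]
  ring

/-! ### The connection of the background -/

section Coefficients

variable (κ : ℝ) (x : Pt)

/-- The complex conjugate of each spin coefficient is given by its own closed form rather than by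
`star`, so that it stays rational in the same symbols and can be differentiated by the same rules.
`star_bgRho` and its analogues identify the two descriptions. -/
def bgRho : ℂ := -(imk κ * sigC x * cosC x / (1 - imk κ * cylW x * cosC x))

def bgRhoBar : ℂ := imk κ * sigC x * cosC x / (1 + imk κ * cylW x * cosC x)

def bgTau : ℂ := -(imk κ * hsq * cylW x * sinC x
  / ((1 - imk κ * cylW x * cosC x) * (1 + imk κ * cylW x * cosC x)))

def bgTauBar : ℂ := imk κ * hsq * cylW x * sinC x
  / ((1 - imk κ * cylW x * cosC x) * (1 + imk κ * cylW x * cosC x))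

def bgPi : ℂ := imk κ * hsq * cylW x * sinC x / (1 - imk κ * cylW x * cosC x) ^ 2

def bgPiBar : ℂ := -(imk κ * hsq * cylW x * sinC x / (1 + imk κ * cylW x * cosC x) ^ 2)

/-- `Ξ² Δ̃`, as a complex-valued function. -/
def deltaC : ℂ := (1 - cylW x) * (1 + imk κ ^ 2 * cylW x)

def bgMu : ℂ := -(imk κ * cylW x ^ 2 * cosC x * deltaC κ x
  / (2 * sigC x * (1 - imk κ * cylW x * cosC x) ^ 2 * (1 + imk κ * cylW x * cosC x)))

def bgMuBar : ℂ := imk κ * cylW x ^ 2 * cosC x * deltaC κ x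
  / (2 * sigC x * (1 - imk κ * cylW x * cosC x) * (1 + imk κ * cylW x * cosC x) ^ 2)

/-- `γ + γ*`. -/
def bgGammaRe : ℂ :=
  (cylFC κ x * (1 - imk κ ^ 2 * cylW x ^ 2) / sigC x ^ 2
      + cylW x ^ 2 * (1 - imk κ ^ 2 + 2 * imk κ ^ 2 * cylW x) / (2 * sigC x))
    / ((1 - imk κ * cylW x * cosC x) * (1 + imk κ * cylW x * cosC x))
  - cylW x * deltaC κ x / (sigC x * (1 - imk κ * cylW x * cosC x) ^ 2
      * (1 + imk κ * cylW x * cosC x) ^ 2)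

/-- `γ - γ*`. -/
def bgGammaIm : ℂ :=
  -(imk κ * cylW x ^ 2 * cosC x * deltaC κ x / (sigC x * (1 - imk κ * cylW x * cosC x) ^ 2
      * (1 + imk κ * cylW x * cosC x) ^ 2))

/-- `α + β*`. -/
def bgAlphaSum : ℂ := bgPi κ x
  - imk κ * hsq * cylFC κ x * sinC x / (sigC x * (1 - imk κ * cylW x * cosC x))

/-- `α* + β`. -/
def bgAlphaSumBar : ℂ := bgPiBar κ x
  + imk κ * hsq * cylFC κ x * sinC x / (sigC x * (1 + imk κ * cylW x * cosC x))

/-- `α - β*`. -/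
def bgAlphaDiff : ℂ := bgPi κ x - hsq * cosC x / (sinC x * (1 - imk κ * cylW x * cosC x))

/-- `α* - β`. -/
def bgAlphaDiffBar : ℂ := bgPiBar κ x - hsq * cosC x / (sinC x * (1 + imk κ * cylW x * cosC x))

/-- The coefficients `g(∇_{e_a} e_b, e_c)` of the background connection. -/
def bgConn (κ : ℝ) : Fin 4 → Fin 4 → Fin 4 → Pt → ℂ :=
  ![![![0, 0, 0, 0], ![0, 0, bgPiBar κ, bgPi κ],
      ![0, -bgPiBar κ, 0, 0], ![0, -bgPi κ, 0, 0]],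
    ![![0, -bgGammaRe κ, -bgTau κ, -bgTauBar κ], ![bgGammaRe κ, 0, 0, 0],
      ![bgTau κ, 0, 0, bgGammaIm κ], ![bgTauBar κ, 0, -bgGammaIm κ, 0]],
    ![![0, -bgAlphaSumBar κ, 0, -bgRhoBar κ], ![bgAlphaSumBar κ, 0, 0, bgMu κ],
      ![0, 0, 0, -bgAlphaDiffBar κ], ![bgRhoBar κ, -bgMu κ, bgAlphaDiffBar κ, 0]],
    ![![0, -bgAlphaSum κ, -bgRho κ, 0], ![bgAlphaSum κ, 0, bgMuBar κ, 0],
      ![bgRho κ, -bgMuBar κ, 0, bgAlphaDiff κ], ![0, 0, -bgAlphaDiff κ, 0]]]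

end Coefficients

/-! ### Derivatives of the connection coefficients along the tetrad. -/

section Derivatives

variable {κ : ℝ} {x : Pt}

lemma hasFr_delta (hS : sigC x ≠ 0) : HasFr κ (deltaC κ) x
    (fun a => (-1 + imk κ ^ 2 - 2 * imk κ ^ 2 * cylW x) * frW κ x a) :=
  (((HasFr.const κ x 1).sub (hasFr_W hS)).mul ((HasFr.const κ x 1).add
    ((HasFr.const κ x (imk κ ^ 2)).mul (hasFr_W hS)))).congr_val fun a => by ring

lemma hasFr_rho (hS : sigC x ≠ 0) : HasFr κ (bgRho κ) x
    (fun a => -(imk κ * (frSig κ x a * cosC x - sigC x * sinC x * frTh κ x a)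
        / (1 - imk κ * cylW x * cosC x))
      + imk κ * sigC x * cosC x * frZ κ x a / (1 - imk κ * cylW x * cosC x) ^ 2) :=
  ((((HasFr.const κ x (imk κ)).mul hasFr_sig).mul hasFr_cos).div (hasFr_zeta hS)
    (zeta_ne κ x)).neg.congr_val fun a => by ring

lemma hasFr_rhoBar (hS : sigC x ≠ 0) : HasFr κ (bgRhoBar κ) x
    (fun a => imk κ * (frSig κ x a * cosC x - sigC x * sinC x * frTh κ x a)
        / (1 + imk κ * cylW x * cosC x)
      + imk κ * sigC x * cosC x * frZ κ x a / (1 + imk κ * cylW x * cosC x) ^ 2) :=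
  ((((HasFr.const κ x (imk κ)).mul hasFr_sig).mul hasFr_cos).div (hasFr_zetaBar hS)
    (zetaBar_ne κ x)).congr_val fun a => by ring

lemma hasFr_tauBar (hS : sigC x ≠ 0) : HasFr κ (bgTauBar κ) x
    (fun a => imk κ * hsq * (frW κ x a * sinC x + cylW x * cosC x * frTh κ x a)
        / ((1 - imk κ * cylW x * cosC x) * (1 + imk κ * cylW x * cosC x))
      - 2 * imk κ ^ 2 * hsq * cylW x ^ 2 * cosC x * sinC x * frZ κ x a
        / ((1 - imk κ * cylW x * cosC x) * (1 + imk κ * cylW x * cosC x)) ^ 2) :=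
  ((((HasFr.const κ x (imk κ * hsq)).mul (hasFr_W hS)).mul hasFr_sin).div
    ((hasFr_zeta hS).mul (hasFr_zetaBar hS))
    (mul_ne_zero (zeta_ne κ x) (zetaBar_ne κ x))).congr_val fun a => by ring

lemma hasFr_tau (hS : sigC x ≠ 0) : HasFr κ (bgTau κ) x
    (fun a => -(imk κ * hsq * (frW κ x a * sinC x + cylW x * cosC x * frTh κ x a)
        / ((1 - imk κ * cylW x * cosC x) * (1 + imk κ * cylW x * cosC x))
      - 2 * imk κ ^ 2 * hsq * cylW x ^ 2 * cosC x * sinC x * frZ κ x a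
        / ((1 - imk κ * cylW x * cosC x) * (1 + imk κ * cylW x * cosC x)) ^ 2)) :=
  (hasFr_tauBar hS).neg

lemma hasFr_pi (hS : sigC x ≠ 0) : HasFr κ (bgPi κ) x
    (fun a => imk κ * hsq * (frW κ x a * sinC x + cylW x * cosC x * frTh κ x a)
        / (1 - imk κ * cylW x * cosC x) ^ 2
      - 2 * imk κ * hsq * cylW x * sinC x * frZ κ x a / (1 - imk κ * cylW x * cosC x) ^ 3) :=
  ((((HasFr.const κ x (imk κ * hsq)).mul (hasFr_W hS)).mul hasFr_sin).div
    ((hasFr_zeta hS).pow 2) (pow_ne_zero 2 (zeta_ne κ x))).congr_val fun a => by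
      have := zeta_ne κ x
      push_cast
      field_simp
      ring

lemma hasFr_piBar (hS : sigC x ≠ 0) : HasFr κ (bgPiBar κ) x
    (fun a => -(imk κ * hsq * (frW κ x a * sinC x + cylW x * cosC x * frTh κ x a)
        / (1 + imk κ * cylW x * cosC x) ^ 2)
      - 2 * imk κ * hsq * cylW x * sinC x * frZ κ x a / (1 + imk κ * cylW x * cosC x) ^ 3) :=
  ((((HasFr.const κ x (imk κ * hsq)).mul (hasFr_W hS)).mul hasFr_sin).div
    ((hasFr_zetaBar hS).pow 2) (pow_ne_zero 2 (zetaBar_ne κ x))).neg.congr_val fun a => by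
      have := zetaBar_ne κ x
      push_cast
      field_simp
      ring

/-- Derivatives of the common factor `i κ ς² (1 - T)² cos θ Δ`. -/
lemma hasFr_muNum (hS : sigC x ≠ 0) :
    HasFr κ (fun y => imk κ * cylW y ^ 2 * cosC y * deltaC κ y) x
    (fun a => imk κ * (2 * cylW x * frW κ x a * cosC x * deltaC κ x
      - cylW x ^ 2 * sinC x * frTh κ x a * deltaC κ x
      + cylW x ^ 2 * cosC x * (-1 + imk κ ^ 2 - 2 * imk κ ^ 2 * cylW x) * frW κ x a)) :=
  ((((HasFr.const κ x (imk κ)).mul ((hasFr_W hS).pow 2)).mul hasFr_cos).mul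
    (hasFr_delta hS)).congr_val fun a => by push_cast; ring

lemma hasFr_mu (hS : sigC x ≠ 0) : HasFr κ (bgMu κ) x
    (fun a => -(imk κ * (2 * cylW x * frW κ x a * cosC x * deltaC κ x
      - cylW x ^ 2 * sinC x * frTh κ x a * deltaC κ x
      + cylW x ^ 2 * cosC x * (-1 + imk κ ^ 2 - 2 * imk κ ^ 2 * cylW x) * frW κ x a)
      / (2 * sigC x * (1 - imk κ * cylW x * cosC x) ^ 2 * (1 + imk κ * cylW x * cosC x)))
      - bgMu κ x * (frSig κ x a / sigC x + 2 * frZ κ x a / (1 - imk κ * cylW x * cosC x)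
        - frZ κ x a / (1 + imk κ * cylW x * cosC x))) :=
  ((hasFr_muNum hS).div ((((HasFr.const κ x 2).mul hasFr_sig).mul ((hasFr_zeta hS).pow 2)).mul
    (hasFr_zetaBar hS)) (mul_ne_zero (mul_ne_zero (mul_ne_zero two_ne_zero hS)
      (pow_ne_zero 2 (zeta_ne κ x))) (zetaBar_ne κ x))).neg.congr_val fun a => by
      have := zeta_ne κ x
      have := zetaBar_ne κ x
      simp only [bgMu]
      push_cast
      field_simp
      ring

lemma hasFr_muBar (hS : sigC x ≠ 0) : HasFr κ (bgMuBar κ) x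
    (fun a => imk κ * (2 * cylW x * frW κ x a * cosC x * deltaC κ x
      - cylW x ^ 2 * sinC x * frTh κ x a * deltaC κ x
      + cylW x ^ 2 * cosC x * (-1 + imk κ ^ 2 - 2 * imk κ ^ 2 * cylW x) * frW κ x a)
      / (2 * sigC x * (1 - imk κ * cylW x * cosC x) * (1 + imk κ * cylW x * cosC x) ^ 2)
      - bgMuBar κ x * (frSig κ x a / sigC x + frZ κ x a / (1 - imk κ * cylW x * cosC x)
        - 2 * frZ κ x a / (1 + imk κ * cylW x * cosC x))) :=
  ((hasFr_muNum hS).div ((((HasFr.const κ x 2).mul hasFr_sig).mul (hasFr_zeta hS)).mul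
    ((hasFr_zetaBar hS).pow 2)) (mul_ne_zero (mul_ne_zero (mul_ne_zero two_ne_zero hS)
      (zeta_ne κ x)) (pow_ne_zero 2 (zetaBar_ne κ x)))).congr_val fun a => by
      have := zeta_ne κ x
      have := zetaBar_ne κ x
      simp only [bgMuBar]
      push_cast
      field_simp
      ring

lemma hasFr_gammaIm (hS : sigC x ≠ 0) : HasFr κ (bgGammaIm κ) x
    (fun a => -(imk κ * (2 * cylW x * frW κ x a * cosC x * deltaC κ x
      - cylW x ^ 2 * sinC x * frTh κ x a * deltaC κ x
      + cylW x ^ 2 * cosC x * (-1 + imk κ ^ 2 - 2 * imk κ ^ 2 * cylW x) * frW κ x a)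
      / (sigC x * (1 - imk κ * cylW x * cosC x) ^ 2 * (1 + imk κ * cylW x * cosC x) ^ 2))
      - bgGammaIm κ x * (frSig κ x a / sigC x + 2 * frZ κ x a / (1 - imk κ * cylW x * cosC x)
        - 2 * frZ κ x a / (1 + imk κ * cylW x * cosC x))) :=
  ((hasFr_muNum hS).div ((hasFr_sig.mul ((hasFr_zeta hS).pow 2)).mul
    ((hasFr_zetaBar hS).pow 2)) (mul_ne_zero (mul_ne_zero hS
      (pow_ne_zero 2 (zeta_ne κ x))) (pow_ne_zero 2 (zetaBar_ne κ x)))).neg.congr_val fun a => by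
      have := zeta_ne κ x
      have := zetaBar_ne κ x
      simp only [bgGammaIm]
      push_cast
      field_simp
      ring

lemma hasFr_gammaRe (hS : sigC x ≠ 0) : HasFr κ (bgGammaRe κ) x
    (fun a => ((cylFC' κ x * frSig κ x a * (1 - imk κ ^ 2 * cylW x ^ 2)
          - 2 * cylFC κ x * imk κ ^ 2 * cylW x * frW κ x a) / sigC x ^ 2
        - 2 * cylFC κ x * (1 - imk κ ^ 2 * cylW x ^ 2) * frSig κ x a / sigC x ^ 3
        + (cylW x * (1 - imk κ ^ 2) + 3 * imk κ ^ 2 * cylW x ^ 2) * frW κ x a / sigC x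
        - cylW x ^ 2 * (1 - imk κ ^ 2 + 2 * imk κ ^ 2 * cylW x) * frSig κ x a / (2 * sigC x ^ 2))
        / ((1 - imk κ * cylW x * cosC x) * (1 + imk κ * cylW x * cosC x))
      - (cylFC κ x * (1 - imk κ ^ 2 * cylW x ^ 2) / sigC x ^ 2
          + cylW x ^ 2 * (1 - imk κ ^ 2 + 2 * imk κ ^ 2 * cylW x) / (2 * sigC x))
        * (2 * imk κ * cylW x * cosC x * frZ κ x a)
        / ((1 - imk κ * cylW x * cosC x) * (1 + imk κ * cylW x * cosC x)) ^ 2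
      - ((deltaC κ x + cylW x * (-1 + imk κ ^ 2 - 2 * imk κ ^ 2 * cylW x)) * frW κ x a / sigC x
          - cylW x * deltaC κ x * frSig κ x a / sigC x ^ 2)
        / ((1 - imk κ * cylW x * cosC x) * (1 + imk κ * cylW x * cosC x)) ^ 2
      + 4 * cylW x ^ 2 * deltaC κ x * imk κ * cosC x * frZ κ x a
        / (sigC x * ((1 - imk κ * cylW x * cosC x) * (1 + imk κ * cylW x * cosC x)) ^ 3)) := by
  have hz := zeta_ne κ x
  have hzb := zetaBar_ne κ x
  have hN := ((hasFr_F.mul ((HasFr.const κ x 1).sub ((HasFr.const κ x (imk κ ^ 2)).mul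
    ((hasFr_W hS).pow 2)))).div (hasFr_sig.pow 2) (pow_ne_zero 2 hS)).add
    ((((hasFr_W hS).pow 2).mul ((HasFr.const κ x (1 - imk κ ^ 2)).add
      ((HasFr.const κ x (2 * imk κ ^ 2)).mul (hasFr_W hS)))).div
      ((HasFr.const κ x 2).mul hasFr_sig) (mul_ne_zero two_ne_zero hS))
  refine ((hN.div ((hasFr_zeta hS).mul (hasFr_zetaBar hS)) (mul_ne_zero hz hzb)).sub
    (((hasFr_W hS).mul (hasFr_delta hS)).div ((hasFr_sig.mul ((hasFr_zeta hS).pow 2)).mul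
      ((hasFr_zetaBar hS).pow 2)) (mul_ne_zero (mul_ne_zero hS (pow_ne_zero 2 hz))
        (pow_ne_zero 2 hzb)))).congr_val fun a => ?_
  push_cast
  field_simp
  ring

lemma hasFr_alphaSum (hS : sigC x ≠ 0) : HasFr κ (bgAlphaSum κ) x
    (fun a => imk κ * hsq * (frW κ x a * sinC x + cylW x * cosC x * frTh κ x a)
        / (1 - imk κ * cylW x * cosC x) ^ 2
      - 2 * imk κ * hsq * cylW x * sinC x * frZ κ x a / (1 - imk κ * cylW x * cosC x) ^ 3
      - (imk κ * hsq * (cylFC' κ x * frSig κ x a * sinC x + cylFC κ x * cosC x * frTh κ x a)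
          / (sigC x * (1 - imk κ * cylW x * cosC x))
        - imk κ * hsq * cylFC κ x * sinC x / (sigC x * (1 - imk κ * cylW x * cosC x))
          * (frSig κ x a / sigC x + frZ κ x a / (1 - imk κ * cylW x * cosC x)))) :=
  ((hasFr_pi hS).sub ((((HasFr.const κ x (imk κ * hsq)).mul hasFr_F).mul hasFr_sin).div
    (hasFr_sig.mul (hasFr_zeta hS)) (mul_ne_zero hS (zeta_ne κ x)))).congr_val fun a => by
      have := zeta_ne κ x
      field_simp
      ring

lemma hasFr_alphaSumBar (hS : sigC x ≠ 0) : HasFr κ (bgAlphaSumBar κ) x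
    (fun a => -(imk κ * hsq * (frW κ x a * sinC x + cylW x * cosC x * frTh κ x a)
        / (1 + imk κ * cylW x * cosC x) ^ 2)
      - 2 * imk κ * hsq * cylW x * sinC x * frZ κ x a / (1 + imk κ * cylW x * cosC x) ^ 3
      + (imk κ * hsq * (cylFC' κ x * frSig κ x a * sinC x + cylFC κ x * cosC x * frTh κ x a)
          / (sigC x * (1 + imk κ * cylW x * cosC x))
        - imk κ * hsq * cylFC κ x * sinC x / (sigC x * (1 + imk κ * cylW x * cosC x))
          * (frSig κ x a / sigC x - frZ κ x a / (1 + imk κ * cylW x * cosC x)))) :=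
  ((hasFr_piBar hS).add ((((HasFr.const κ x (imk κ * hsq)).mul hasFr_F).mul hasFr_sin).div
    (hasFr_sig.mul (hasFr_zetaBar hS)) (mul_ne_zero hS (zetaBar_ne κ x)))).congr_val fun a => by
      have := zetaBar_ne κ x
      field_simp
      ring

lemma hasFr_alphaDiff (hS : sigC x ≠ 0) (hs : sinC x ≠ 0) : HasFr κ (bgAlphaDiff κ) x
    (fun a => imk κ * hsq * (frW κ x a * sinC x + cylW x * cosC x * frTh κ x a)
        / (1 - imk κ * cylW x * cosC x) ^ 2
      - 2 * imk κ * hsq * cylW x * sinC x * frZ κ x a / (1 - imk κ * cylW x * cosC x) ^ 3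
      + hsq / (1 - imk κ * cylW x * cosC x) * (frTh κ x a / sinC x ^ 2
        + cosC x * frZ κ x a / (sinC x * (1 - imk κ * cylW x * cosC x)))) :=
  ((hasFr_pi hS).sub (((HasFr.const κ x hsq).mul hasFr_cos).div
    (hasFr_sin.mul (hasFr_zeta hS)) (mul_ne_zero hs (zeta_ne κ x)))).congr_val fun a => by
      have := zeta_ne κ x
      field_simp
      linear_combination (hsq * frTh κ x a * (1 - imk κ * cylW x * cosC x) ^ 2) * sinC_sq x

lemma hasFr_alphaDiffBar (hS : sigC x ≠ 0) (hs : sinC x ≠ 0) : HasFr κ (bgAlphaDiffBar κ) x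
    (fun a => -(imk κ * hsq * (frW κ x a * sinC x + cylW x * cosC x * frTh κ x a)
        / (1 + imk κ * cylW x * cosC x) ^ 2)
      - 2 * imk κ * hsq * cylW x * sinC x * frZ κ x a / (1 + imk κ * cylW x * cosC x) ^ 3
      + hsq / (1 + imk κ * cylW x * cosC x) * (frTh κ x a / sinC x ^ 2
        - cosC x * frZ κ x a / (sinC x * (1 + imk κ * cylW x * cosC x)))) :=
  ((hasFr_piBar hS).sub (((HasFr.const κ x hsq).mul hasFr_cos).div
    (hasFr_sin.mul (hasFr_zetaBar hS)) (mul_ne_zero hs (zetaBar_ne κ x)))).congr_val fun a => by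
      have := zetaBar_ne κ x
      field_simp
      linear_combination (hsq * frTh κ x a * (1 + imk κ * cylW x * cosC x) ^ 2) * sinC_sq x

end Derivatives

lemma eta_values :
    eta 0 0 = 0 ∧ eta 0 1 = -1 ∧ eta 0 2 = 0 ∧ eta 0 3 = 0 ∧
    eta 1 0 = -1 ∧ eta 1 1 = 0 ∧ eta 1 2 = 0 ∧ eta 1 3 = 0 ∧
    eta 2 0 = 0 ∧ eta 2 1 = 0 ∧ eta 2 2 = 0 ∧ eta 2 3 = 1 ∧
    eta 3 0 = 0 ∧ eta 3 1 = 0 ∧ eta 3 2 = 1 ∧ eta 3 3 = 0 := by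
  repeat' constructor

namespace CEFEFields

variable (X : CEFEFields)

lemma connUp_zero (a b : Fin 4) (x : Pt) : X.connUp a b 0 x = -X.conn a b 1 x := by
  simp [connUp, Fin.sum_univ_four, eta_values]

lemma connUp_one (a b : Fin 4) (x : Pt) : X.connUp a b 1 x = -X.conn a b 0 x := by
  simp [connUp, Fin.sum_univ_four, eta_values]

lemma connUp_two (a b : Fin 4) (x : Pt) : X.connUp a b 2 x = X.conn a b 3 x := by
  simp [connUp, Fin.sum_univ_four, eta_values]

lemma connUp_three (a b : Fin 4) (x : Pt) : X.connUp a b 3 x = X.conn a b 2 x := by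
  simp [connUp, Fin.sum_univ_four, eta_values]

end CEFEFields

/-! ### The background fields -/

/-- Where `Ξ ≠ 0`, the equation for `Ξ` forces `L = (s g - ∇∇Ξ)/Ξ`. The components below are its
values with the factor `Ξ` cancelled, hence regular through `Ξ = 0`. -/
def bgSchouten01 (κ : ℝ) (x : Pt) : ℂ :=
  ((1 - 2 * (1 - imk κ ^ 2) * cylW x - 3 * imk κ ^ 2 * cylW x ^ 2)
      * ((1 - imk κ * cylW x * cosC x) * (1 + imk κ * cylW x * cosC x))
    + 2 * imk κ ^ 2 * cylW x ^ 2 * cosC x ^ 2 * deltaC κ x)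
  / (2 * ((1 - imk κ * cylW x * cosC x) * (1 + imk κ * cylW x * cosC x)) ^ 2)

def bgSchouten23 (κ : ℝ) (x : Pt) : ℂ :=
  deltaC κ x * (1 + imk κ ^ 2 * cylW x ^ 2 * cosC x ^ 2)
  / (2 * ((1 - imk κ * cylW x * cosC x) * (1 + imk κ * cylW x * cosC x)) ^ 2)

def bgSchouten02 (κ : ℝ) (x : Pt) : ℂ :=
  imk κ * hsq * sigC x * sinC x / (1 + imk κ * cylW x * cosC x) ^ 2

def bgSchouten03 (κ : ℝ) (x : Pt) : ℂ :=
  -(imk κ * hsq * sigC x * sinC x / (1 - imk κ * cylW x * cosC x) ^ 2)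

def bgSchouten12 (κ : ℝ) (x : Pt) : ℂ :=
  imk κ * hsq * cylW x ^ 2 * deltaC κ x * sinC x
  / (2 * sigC x * ((1 - imk κ * cylW x * cosC x) * (1 + imk κ * cylW x * cosC x)) ^ 2)

/-- The Schouten tensor of the background. -/
def bgSchouten (κ : ℝ) : Fin 4 → Fin 4 → Pt → ℂ :=
  ![![0, bgSchouten01 κ, bgSchouten02 κ, bgSchouten03 κ],
    ![bgSchouten01 κ, 0, bgSchouten12 κ, -bgSchouten12 κ],
    ![bgSchouten02 κ, bgSchouten12 κ, 0, bgSchouten23 κ],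
    ![bgSchouten03 κ, -bgSchouten12 κ, bgSchouten23 κ, 0]]

/-- The component `φ₂` of the rescaled Weyl tensor. -/
def bgPhi (rp κ : ℝ) (x : Pt) : ℂ :=
  -(rp * (1 - imk κ ^ 2) / (2 * (1 - imk κ * cylW x * cosC x) ^ 3))

def bgPhiBar (rp κ : ℝ) (x : Pt) : ℂ :=
  -(rp * (1 - imk κ ^ 2) / (2 * (1 + imk κ * cylW x * cosC x) ^ 3))

/-- Components of the bivector `e^i ∧ e^j`. -/
def biv (i j a b : Fin 4) : ℤ :=
  if a = i ∧ b = j then 1 else if a = j ∧ b = i then -1 else 0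

/-- The self-dual part of a type D Weyl tensor with `Ψ₂ = 1`. -/
def typeD (a b c f : Fin 4) : ℤ :=
  (biv 0 1 a b - biv 2 3 a b) * (biv 0 1 c f - biv 2 3 c f)
    - biv 0 2 a b * biv 1 3 c f - biv 1 3 a b * biv 0 2 c f

/-- The anti-self-dual part of a type D Weyl tensor with `Ψ₂ = 1`. -/
def typeDBar (a b c f : Fin 4) : ℤ :=
  (biv 0 1 a b + biv 2 3 a b) * (biv 0 1 c f + biv 2 3 c f)
    - biv 0 3 a b * biv 1 2 c f - biv 1 2 a b * biv 0 3 c f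

/-- The conformal Kerr background in the cylinder gauge. -/
def bgFields (rp κ : ℝ) : CEFEFields where
  e := fun a μ x => cylTetrad κ x a μ
  conn := bgConn κ
  Xi := cylXi rp
  s := fun x => x 1 * (1 - x 0) * cylDelta κ x / (2 * rp * cylSigma κ x)
  L := bgSchouten κ
  d := fun a b c f x => typeD a b c f * bgPhi rp κ x + typeDBar a b c f * bgPhiBar rp κ x

lemma bgFields_dir (rp κ : ℝ) (a : Fin 4) (f : Pt → ℂ) (x : Pt) :
    (bgFields rp κ).dir a f x = frD κ a f x := rfl

lemma bgFields_conn (rp κ : ℝ) : (bgFields rp κ).conn = bgConn κ := rfl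

lemma frD_zero (κ : ℝ) (a : Fin 4) (x : Pt) : frD κ a 0 x = 0 := by
  simp [frD]

lemma frD_neg (κ : ℝ) (a : Fin 4) (f : Pt → ℂ) (x : Pt) : frD κ a (-f) x = -frD κ a f x := by
  have : (-f) = fun y => -f y := rfl
  simp only [frD, this, pd_neg, mul_neg, Finset.sum_neg_distrib]

lemma cylXi_eq (rp : ℝ) (x : Pt) : (cylXi rp x : ℂ) = cylW x / rp := by
  simp [cylXi, cylW]

/-! ### The torsion of the background connection -/

section Tetrad

variable {κ : ℝ} {x : Pt}

/-- Derivatives of `1 - T` along the tetrad. -/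
def frU (κ : ℝ) (x : Pt) : Fin 4 → ℂ :=
  ![-1, -(cylW x / (2 * sigC x * ((1 - imk κ * cylW x * cosC x) * (1 + imk κ * cylW x * cosC x)))
      * (2 * (1 - imk κ ^ 2 * cylW x ^ 2) * cylFC κ x / sigC x ^ 2
        - cylW x / sigC x * ((1 - cylW x) * (1 + imk κ ^ 2 * cylW x)))),
    -(imk κ * hsq * cylFC κ x * cylW x * sinC x / (sigC x ^ 2 * (1 + imk κ * cylW x * cosC x))),
    imk κ * hsq * cylFC κ x * cylW x * sinC x / (sigC x ^ 2 * (1 - imk κ * cylW x * cosC x))]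

/-- Removes `T` from the rational identities, leaving `w` and `ς` as the independent symbols. -/
lemma one_sub_T (hS : sigC x ≠ 0) : 1 - (x 0 : ℂ) = cylW x / sigC x := by
  rw [cylW_eq]
  field_simp

lemma hasFr_U (hS : sigC x ≠ 0) : HasFr κ (fun y => 1 - (y 0 : ℂ)) x (frU κ x) := by
  have hz := zeta_ne κ x
  have hzb := zetaBar_ne κ x
  refine ((HasFr.const κ x 1).sub (hasFr_coord κ x 0)).congr_val fun a => ?_
  fin_cases a
  · simp [cylTetrad_zero, frU]
  · simp only [Fin.mk_one, cylTetrad_one, frU, Matrix.cons_val, one_sub_T hS]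
    field_simp
    ring
  · simp only [Fin.reduceFinMk, cylTetrad_two, frU, Matrix.cons_val, one_sub_T hS]
    field_simp
    ring
  · simp only [Fin.reduceFinMk, cylTetrad_three, frU, Matrix.cons_val, one_sub_T hS]
    field_simp
    ring

/-- In the tetrad the imaginary unit is absorbed into `imk κ` everywhere except in the `φ`
components; this rewriting makes it explicit there. -/
lemma kappa_eq (κ : ℝ) : (κ : ℂ) = -Complex.I * imk κ := by
  rw [imk, ← mul_assoc, neg_mul, Complex.I_mul_I, neg_neg, one_mul]

lemma hasFr_sigmaInv (hS : sigC x ≠ 0) :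
    HasFr κ (fun y => ((1 - imk κ * cylW y * cosC y) * (1 + imk κ * cylW y * cosC y))⁻¹) x
      (fun a => -(2 * imk κ * cylW x * cosC x * frZ κ x a)
        / ((1 - imk κ * cylW x * cosC x) * (1 + imk κ * cylW x * cosC x)) ^ 2) :=
  (((hasFr_zeta hS).mul (hasFr_zetaBar hS)).inv
    (mul_ne_zero (zeta_ne κ x) (zetaBar_ne κ x))).congr_val fun a => by ring

lemma hasFr_sigma0 (hS : sigC x ≠ 0) : HasFr κ (fun y => 1 - imk κ ^ 2 * cylW y ^ 2) x
    (fun a => -(2 * imk κ ^ 2 * cylW x * frW κ x a)) :=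
  ((HasFr.const κ x 1).sub ((HasFr.const κ x (imk κ ^ 2)).mul ((hasFr_W hS).pow 2))).congr_val
    fun a => by push_cast; ring

lemma hasFr_tetrad_zero (μ : Fin 4) : HasFr κ (fun y => cylTetrad κ y 0 μ) x (fun _ => 0) := by
  simp only [cylTetrad_zero]
  exact HasFr.const κ x _

lemma hasFr_tetrad_one_zero (hS : sigC x ≠ 0) : HasFr κ (fun y => cylTetrad κ y 1 0) x
    (fun a => ((frU κ x a / 2) / ((1 - imk κ * cylW x * cosC x) * (1 + imk κ * cylW x * cosC x))
        - cylW x / sigC x / 2 * (2 * imk κ * cylW x * cosC x * frZ κ x a)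
        / ((1 - imk κ * cylW x * cosC x) * (1 + imk κ * cylW x * cosC x)) ^ 2)
        * (2 * (1 - imk κ ^ 2 * cylW x ^ 2) * cylFC κ x / sigC x ^ 2
          - cylW x / sigC x * deltaC κ x)
      + cylW x / (2 * sigC x * ((1 - imk κ * cylW x * cosC x) * (1 + imk κ * cylW x * cosC x)))
        * ((2 * (1 - imk κ ^ 2 * cylW x ^ 2) * cylFC' κ x * frSig κ x a
            - 4 * imk κ ^ 2 * cylW x * frW κ x a * cylFC κ x) / sigC x ^ 2
          - 4 * (1 - imk κ ^ 2 * cylW x ^ 2) * cylFC κ x * frSig κ x a / sigC x ^ 3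
          - frU κ x a * deltaC κ x
          - cylW x / sigC x * (-1 + imk κ ^ 2 - 2 * imk κ ^ 2 * cylW x) * frW κ x a)) := by
  have hz := zeta_ne κ x
  have hzb := zetaBar_ne κ x
  refine ((((hasFr_U hS).mul (HasFr.const κ x (1 / 2))).mul (hasFr_sigmaInv hS)).mul
    (((((HasFr.const κ x 2).mul (hasFr_sigma0 hS)).mul hasFr_F).div (hasFr_sig.pow 2)
      (pow_ne_zero 2 hS)).sub ((hasFr_U hS).mul (hasFr_delta hS)))).congr
    (Eventually.of_forall fun y => ?_) fun a => ?_
  · simp only [cylTetrad_one, Matrix.cons_val, deltaC, div_eq_mul_inv, mul_inv]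
    ring
  · rw [one_sub_T hS]
    push_cast
    field_simp
    ring

lemma hasFr_tetrad_one_one (hS : sigC x ≠ 0) : HasFr κ (fun y => cylTetrad κ y 1 1) x
    (fun a => (cylFC' κ x * frSig κ x a * (1 - imk κ ^ 2 * cylW x ^ 2)
        - 2 * cylFC κ x * imk κ ^ 2 * cylW x * frW κ x a)
        / (sigC x * ((1 - imk κ * cylW x * cosC x) * (1 + imk κ * cylW x * cosC x)))
      - cylFC κ x * (1 - imk κ ^ 2 * cylW x ^ 2)
        / (sigC x * ((1 - imk κ * cylW x * cosC x) * (1 + imk κ * cylW x * cosC x)))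
        * (frSig κ x a / sigC x + 2 * imk κ * cylW x * cosC x * frZ κ x a
          / ((1 - imk κ * cylW x * cosC x) * (1 + imk κ * cylW x * cosC x)))) := by
  have hz := zeta_ne κ x
  have hzb := zetaBar_ne κ x
  refine ((hasFr_F.mul (hasFr_sigma0 hS)).mul ((hasFr_sig.inv hS).mul (hasFr_sigmaInv hS))).congr
    (Eventually.of_forall fun y => ?_) fun a => ?_
  · simp only [cylTetrad_one, Matrix.cons_val, div_eq_mul_inv, mul_inv]
    ring
  · field_simp
    ring

lemma hasFr_tetrad_one_three (hS : sigC x ≠ 0) : HasFr κ (fun y => cylTetrad κ y 1 3) x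
    (fun a => -Complex.I * imk κ * (frSig κ x a * cylW x ^ 2 / sigC x ^ 2
          + 2 * cylW x * frU κ x a)
        / ((1 - imk κ * cylW x * cosC x) * (1 + imk κ * cylW x * cosC x))
      + Complex.I * imk κ * cylW x ^ 2 / sigC x * (2 * imk κ * cylW x * cosC x * frZ κ x a)
          / ((1 - imk κ * cylW x * cosC x) * (1 + imk κ * cylW x * cosC x)) ^ 2) := by
  have hz := zeta_ne κ x
  have hzb := zetaBar_ne κ x
  refine ((((HasFr.const κ x (-Complex.I * imk κ)).mul hasFr_sig).mul ((hasFr_U hS).pow 2)).mul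
    (hasFr_sigmaInv hS)).congr (Eventually.of_forall fun y => ?_) fun a => ?_
  · simp only [cylTetrad_one, Matrix.cons_val, div_eq_mul_inv, kappa_eq κ]
  · rw [one_sub_T hS]
    push_cast
    field_simp
    ring

lemma hasFr_tetrad_two_zero (hS : sigC x ≠ 0) : HasFr κ (fun y => cylTetrad κ y 2 0) x
    (fun a => imk κ * hsq * (cylFC' κ x * frSig κ x a * (cylW x / sigC x) * sinC x
        + cylFC κ x * frU κ x a * sinC x + cylFC κ x * (cylW x / sigC x) * cosC x * frTh κ x a)
        / (sigC x * (1 + imk κ * cylW x * cosC x))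
      - imk κ * hsq * cylFC κ x * cylW x * sinC x
        / (sigC x ^ 2 * (1 + imk κ * cylW x * cosC x))
        * (frSig κ x a / sigC x - frZ κ x a / (1 + imk κ * cylW x * cosC x))) := by
  have hzb := zetaBar_ne κ x
  refine (((((HasFr.const κ x (imk κ * hsq)).mul hasFr_F).mul (hasFr_U hS)).mul hasFr_sin).div
    (hasFr_sig.mul (hasFr_zetaBar hS)) (mul_ne_zero hS hzb)).congr
    (Eventually.of_forall fun y => ?_) fun a => ?_
  · simp only [cylTetrad_two, Matrix.cons_val, div_eq_mul_inv, mul_inv]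
    ring
  · rw [one_sub_T hS]
    field_simp
    ring

lemma hasFr_tetrad_two_one (hS : sigC x ≠ 0) : HasFr κ (fun y => cylTetrad κ y 2 1) x
    (fun a => imk κ * hsq * (cylFC' κ x * frSig κ x a * sinC x
        + cylFC κ x * cosC x * frTh κ x a) / (1 + imk κ * cylW x * cosC x)
      + imk κ * hsq * cylFC κ x * sinC x * frZ κ x a / (1 + imk κ * cylW x * cosC x) ^ 2) := by
  have hzb := zetaBar_ne κ x
  refine ((((HasFr.const κ x (imk κ * hsq)).mul hasFr_F).mul hasFr_sin).div
    (hasFr_zetaBar hS) hzb).congr (Eventually.of_forall fun y => ?_) fun a => ?_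
  · simp only [cylTetrad_two, Matrix.cons_val, div_eq_mul_inv]
    ring
  · field_simp
    ring

lemma hasFr_tetrad_two_two (hS : sigC x ≠ 0) : HasFr κ (fun y => cylTetrad κ y 2 2) x
    (fun a => hsq * frZ κ x a / (1 + imk κ * cylW x * cosC x) ^ 2) := by
  have hzb := zetaBar_ne κ x
  refine ((HasFr.const κ x hsq).div (hasFr_zetaBar hS) hzb).congr
    (Eventually.of_forall fun y => ?_) fun a => ?_
  · simp only [cylTetrad_two, Matrix.cons_val]
  · ring

lemma hasFr_tetrad_two_three (hS : sigC x ≠ 0) (hs : sinC x ≠ 0) :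
    HasFr κ (fun y => cylTetrad κ y 2 3) x
    (fun a => Complex.I * hsq / (sinC x * (1 + imk κ * cylW x * cosC x))
      * (frZ κ x a / (1 + imk κ * cylW x * cosC x) - cosC x * frTh κ x a / sinC x)) := by
  have hzb := zetaBar_ne κ x
  refine ((HasFr.const κ x (Complex.I * hsq)).div (hasFr_sin.mul (hasFr_zetaBar hS))
    (mul_ne_zero hs hzb)).congr (Eventually.of_forall fun y => ?_) fun a => ?_
  · simp only [cylTetrad_two, Matrix.cons_val, div_eq_mul_inv, mul_inv]
    ring
  · field_simp
    ring

lemma hasFr_tetrad_three_zero (hS : sigC x ≠ 0) : HasFr κ (fun y => cylTetrad κ y 3 0) x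
    (fun a => -(imk κ * hsq * (cylFC' κ x * frSig κ x a * (cylW x / sigC x) * sinC x
        + cylFC κ x * frU κ x a * sinC x + cylFC κ x * (cylW x / sigC x) * cosC x * frTh κ x a)
        / (sigC x * (1 - imk κ * cylW x * cosC x)))
      + imk κ * hsq * cylFC κ x * cylW x * sinC x
        / (sigC x ^ 2 * (1 - imk κ * cylW x * cosC x))
        * (frSig κ x a / sigC x + frZ κ x a / (1 - imk κ * cylW x * cosC x))) := by
  have hzb := zeta_ne κ x
  refine (((((HasFr.const κ x (-imk κ * hsq)).mul hasFr_F).mul (hasFr_U hS)).mul hasFr_sin).div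
    (hasFr_sig.mul (hasFr_zeta hS)) (mul_ne_zero hS hzb)).congr
    (Eventually.of_forall fun y => ?_) fun a => ?_
  · simp only [cylTetrad_three, Matrix.cons_val, div_eq_mul_inv, mul_inv]
    ring
  · rw [one_sub_T hS]
    field_simp
    ring

lemma hasFr_tetrad_three_one (hS : sigC x ≠ 0) : HasFr κ (fun y => cylTetrad κ y 3 1) x
    (fun a => -(imk κ * hsq * (cylFC' κ x * frSig κ x a * sinC x
        + cylFC κ x * cosC x * frTh κ x a) / (1 - imk κ * cylW x * cosC x))
      + imk κ * hsq * cylFC κ x * sinC x * frZ κ x a / (1 - imk κ * cylW x * cosC x) ^ 2) := by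
  have hzb := zeta_ne κ x
  refine ((((HasFr.const κ x (-imk κ * hsq)).mul hasFr_F).mul hasFr_sin).div
    (hasFr_zeta hS) hzb).congr (Eventually.of_forall fun y => ?_) fun a => ?_
  · simp only [cylTetrad_three, Matrix.cons_val, div_eq_mul_inv]
    ring
  · field_simp
    ring

lemma hasFr_tetrad_three_two (hS : sigC x ≠ 0) : HasFr κ (fun y => cylTetrad κ y 3 2) x
    (fun a => -(hsq * frZ κ x a / (1 - imk κ * cylW x * cosC x) ^ 2)) := by
  have hzb := zeta_ne κ x
  refine ((HasFr.const κ x hsq).div (hasFr_zeta hS) hzb).congr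
    (Eventually.of_forall fun y => ?_) fun a => ?_
  · simp only [cylTetrad_three, Matrix.cons_val]
  · ring

lemma hasFr_tetrad_three_three (hS : sigC x ≠ 0) (hs : sinC x ≠ 0) :
    HasFr κ (fun y => cylTetrad κ y 3 3) x
    (fun a => Complex.I * hsq / (sinC x * (1 - imk κ * cylW x * cosC x))
      * (frZ κ x a / (1 - imk κ * cylW x * cosC x) + cosC x * frTh κ x a / sinC x)) := by
  have hzb := zeta_ne κ x
  refine ((HasFr.const κ x (-Complex.I * hsq)).div (hasFr_sin.mul (hasFr_zeta hS))
    (mul_ne_zero hs hzb)).congr (Eventually.of_forall fun y => ?_) fun a => ?_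
  · simp only [cylTetrad_three, Matrix.cons_val, div_eq_mul_inv, mul_inv]
    ring
  · field_simp
    ring

lemma contDiffAt_cylTetrad (hS : sigC x ≠ 0) (hs : sinC x ≠ 0) (a μ : Fin 4) :
    ContDiffAt ℝ ∞ (fun y => cylTetrad κ y a μ) x := by
  fin_cases a
  · exact (hasFr_tetrad_zero (κ := κ) μ).smooth
  · fin_cases μ
    · exact (hasFr_tetrad_one_zero (κ := κ) hS).smooth
    · exact (hasFr_tetrad_one_one (κ := κ) hS).smooth
    · simp only [Fin.reduceFinMk, Fin.mk_one, cylTetrad_one, Matrix.cons_val]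
      exact contDiffAt_const
    · exact (hasFr_tetrad_one_three (κ := κ) hS).smooth
  · fin_cases μ
    · exact (hasFr_tetrad_two_zero (κ := κ) hS).smooth
    · exact (hasFr_tetrad_two_one (κ := κ) hS).smooth
    · exact (hasFr_tetrad_two_two (κ := κ) hS).smooth
    · exact (hasFr_tetrad_two_three (κ := κ) hS hs).smooth
  · fin_cases μ
    · exact (hasFr_tetrad_three_zero (κ := κ) hS).smooth
    · exact (hasFr_tetrad_three_one (κ := κ) hS).smooth
    · exact (hasFr_tetrad_three_two (κ := κ) hS).smooth
    · exact (hasFr_tetrad_three_three (κ := κ) hS hs).smooth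

end Tetrad

/-- An antisymmetric array vanishes if its entries above the diagonal do. -/
lemma eq_zero_of_antisymm {G : Fin 4 → Fin 4 → ℂ} (h : ∀ a b, G a b = -G b a)
    (h01 : G 0 1 = 0) (h02 : G 0 2 = 0) (h03 : G 0 3 = 0) (h12 : G 1 2 = 0) (h13 : G 1 3 = 0)
    (h23 : G 2 3 = 0) (a b : Fin 4) : G a b = 0 := by
  have hd : ∀ a, G a a = 0 := fun a => self_eq_neg.mp (h a a)
  fin_cases a <;> fin_cases b <;>
    first
    | exact hd _
    | assumption
    | (rw [h]; exact neg_eq_zero.mpr (by assumption))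

open CEFEFields

section Structure

variable {rp κ : ℝ} {x : Pt}

lemma bgFields_e (a μ : Fin 4) : (bgFields rp κ).e a μ = fun y => cylTetrad κ y a μ := rfl

lemma bgFields_XiC : (bgFields rp κ).XiC x = cylW x / rp := cylXi_eq rp x

lemma bgFields_L : (bgFields rp κ).L = bgSchouten κ := rfl

lemma bgFields_d (a b c f : Fin 4) : (bgFields rp κ).d a b c f x
    = typeD a b c f * bgPhi rp κ x + typeDBar a b c f * bgPhiBar rp κ x := rfl

lemma frD_tetrad_one_two (a : Fin 4) : frD κ a (fun y => cylTetrad κ y 1 2) x = 0 := by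
  simp only [cylTetrad_one, Matrix.cons_val]
  exact frD_zero κ a x

lemma torsion_antisymm (X : CEFEFields) (a b μ : Fin 4) :
    X.torsion a b μ x = -X.torsion b a μ x := by
  simp only [torsion, Fin.sum_univ_four]
  ring

-- Antisymmetry leaves six pairs of frame vectors. For each of them and each coordinate component,
-- inserting the derivative rules gives a rational identity modulo `h² = 1/2` and `sin² θ = 1 - cos²
-- θ`. No relation between `F`, `F'` and `ς` is used, so the torsion vanishes for any profile `F`.
set_option maxHeartbeats 20000000 in
lemma bgFields_torsion (hS : sigC x ≠ 0) (hs : sinC x ≠ 0) (a b μ : Fin 4) :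
    (bgFields rp κ).torsion a b μ x = 0 := by
  have hz := zeta_ne κ x
  have hzb := zetaBar_ne κ x
  have hh := hsq_sq
  have hsin := sinC_sq x
  have hh3 := hsq_pow_three
  have hsin3 := sinC_pow_three x
  have hsin4 := sinC_pow_four x
  refine eq_zero_of_antisymm (fun a b => torsion_antisymm _ a b μ) ?_ ?_ ?_ ?_ ?_ ?_ a b
  all_goals fin_cases μ
  all_goals
    simp only [torsion, Fin.sum_univ_four, connUp_zero, connUp_one, connUp_two, connUp_three,
      Fin.zero_eta, Fin.mk_one, Fin.reduceFinMk,
      bgFields_dir, bgFields_conn, bgConn, bgFields_e, Matrix.cons_val, frD_neg, frD_zero,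
      Pi.neg_apply, Pi.zero_apply, (hasFr_tetrad_zero _).frD_eq, (hasFr_tetrad_one_zero hS).frD_eq,
      (hasFr_tetrad_one_one hS).frD_eq, (hasFr_tetrad_one_three hS).frD_eq,
      (hasFr_tetrad_two_zero hS).frD_eq, (hasFr_tetrad_two_one hS).frD_eq, frD_tetrad_one_two,
      (hasFr_tetrad_two_two hS).frD_eq, (hasFr_tetrad_two_three hS hs).frD_eq,
      (hasFr_tetrad_three_zero hS).frD_eq, (hasFr_tetrad_three_one hS).frD_eq,
      (hasFr_tetrad_three_two hS).frD_eq, (hasFr_tetrad_three_three hS hs).frD_eq,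
      neg_zero, mul_zero, zero_mul, add_zero, zero_add, sub_zero, zero_sub, neg_neg, mul_one,
      one_mul, mul_neg, neg_mul, sub_self, sub_neg_eq_add]
  all_goals
    try simp only [cylTetrad_zero, cylTetrad_one, cylTetrad_two, cylTetrad_three, kappa_eq κ,
      one_sub_T hS, bgPiBar, bgPi, bgTau, bgTauBar, bgRho, bgRhoBar, bgMu, bgMuBar, bgGammaRe,
      bgGammaIm, bgAlphaSum, bgAlphaSumBar, bgAlphaDiff, bgAlphaDiffBar, frSig, frW, frTh, frZ, frU,
      Matrix.cons_val, deltaC, mul_zero, zero_mul, add_zero, zero_add, sub_zero, zero_sub, zero_div,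
      neg_zero]
  all_goals
    -- The functions become independent variables. The imaginary unit too is an arbitrary symbol
    -- here: it enters only through the `φ` components, in which the torsion is linear.
    generalize sigC x = S at *
    generalize sinC x = sn at *
    generalize cosC x = c at *
    generalize cylW x = w at *
    generalize cylFC κ x = F at *
    generalize cylFC' κ x = F' at *
    generalize imk κ = K at *
    generalize hsq = h at *
    generalize Complex.I = j at *
    try field_simp
    try ring_nf
    try simp only [hh, hsin, hh3, hsin3, hsin4]
    try ring

/-! ### The curvature of the background -/

lemma biv_antisymm (i j a b : Fin 4) (h : i ≠ j) : biv i j a b = -biv i j b a := by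
  unfold biv
  grind

lemma typeD_antisymm (a b c f : Fin 4) : typeD a b c f = -typeD b a c f := by
  simp only [typeD, biv_antisymm _ _ a b (show (0 : Fin 4) ≠ 1 by decide),
    biv_antisymm _ _ a b (show (0 : Fin 4) ≠ 2 by decide),
    biv_antisymm _ _ a b (show (1 : Fin 4) ≠ 3 by decide),
    biv_antisymm _ _ a b (show (2 : Fin 4) ≠ 3 by decide)]
  ring

lemma typeDBar_antisymm (a b c f : Fin 4) : typeDBar a b c f = -typeDBar b a c f := by
  simp only [typeDBar, biv_antisymm _ _ a b (show (0 : Fin 4) ≠ 1 by decide),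
    biv_antisymm _ _ a b (show (0 : Fin 4) ≠ 3 by decide),
    biv_antisymm _ _ a b (show (1 : Fin 4) ≠ 2 by decide),
    biv_antisymm _ _ a b (show (2 : Fin 4) ≠ 3 by decide)]
  ring

lemma typeD_pair (a b c f : Fin 4) : typeD a b c f = typeD c f a b := by
  unfold typeD
  ring

lemma typeDBar_pair (a b c f : Fin 4) : typeDBar a b c f = typeDBar c f a b := by
  unfold typeDBar
  ring

lemma bgFields_d_antisymm (a b c f : Fin 4) :
    (bgFields rp κ).d a b c f x = -(bgFields rp κ).d b a c f x := by
  rw [bgFields_d, bgFields_d, typeD_antisymm a, typeDBar_antisymm a]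
  push_cast
  ring

lemma bgFields_d_pair (a b c f : Fin 4) :
    (bgFields rp κ).d a b c f x = (bgFields rp κ).d c f a b x := by
  rw [bgFields_d, bgFields_d, typeD_pair a, typeDBar_pair a]

lemma bgConn_antisymm (a b c : Fin 4) : bgConn κ a b c = -bgConn κ a c b := by
  fin_cases a <;> fin_cases b <;> fin_cases c <;>
    simp only [Fin.zero_eta, Fin.mk_one, Fin.reduceFinMk, bgConn, Matrix.cons_val, neg_zero,
      neg_neg]

lemma riem_antisymm_right (X : CEFEFields) (a b c d : Fin 4) :
    X.riem a b c d x = -X.riem a b d c x := by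
  simp only [riem, Fin.sum_univ_four]
  ring

/-- Antisymmetry is the metricity of the connection. It is assumed as an identity of functions
because the curvature differentiates the connection coefficients. -/
lemma riem_antisymm_left (X : CEFEFields) (h : ∀ a b c, X.conn a b c = -X.conn a c b)
    (a b c d : Fin 4) : X.riem a b c d x = -X.riem b a c d x := by
  have hx : ∀ a b c, X.conn a b c x = -X.conn a c b x := fun a b c => congrFun (h a b c) x
  have hd : ∀ a b c d, X.dir a (X.conn b c d) x = -X.dir a (X.conn b d c) x := by
    intro a b c d
    have : X.conn b c d = fun y => -X.conn b d c y := h b c d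
    simp only [dir, this, pd_neg, mul_neg, Finset.sum_neg_distrib]
  simp only [riem, Fin.sum_univ_four, connUp_zero, connUp_one, connUp_two, connUp_three]
  rw [hd c d b a, hd d c b a, hx 0 b a, hx 1 b a, hx 2 b a, hx 3 b a, hx c 0 a, hx c 1 a,
    hx c 2 a, hx c 3 a, hx d 0 a, hx d 1 a, hx d 2 a, hx d 3 a, hx c 0 b, hx c 1 b, hx c 2 b,
    hx c 3 b, hx d 0 b, hx d 1 b, hx d 2 b, hx d 3 b]
  ring

lemma zeroCurv_antisymm_right (a b c f : Fin 4) :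
    (bgFields rp κ).zeroCurv a b c f x = -(bgFields rp κ).zeroCurv a b f c x := by
  simp only [zeroCurv]
  rw [riem_antisymm_right, bgFields_d_pair a b c f, bgFields_d_antisymm c f,
    bgFields_d_pair f c a b]
  ring

lemma zeroCurv_antisymm_left (a b c f : Fin 4) :
    (bgFields rp κ).zeroCurv a b c f x = -(bgFields rp κ).zeroCurv b a c f x := by
  simp only [zeroCurv]
  rw [riem_antisymm_left _ bgConn_antisymm, bgFields_d_antisymm a b]
  ring

-- The antisymmetries in both index pairs reduce the 256 components to 36 rational identities,
-- checked in the same way as the torsion.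
set_option maxHeartbeats 20000000 in
lemma bgFields_zeroCurv (hrp : (rp : ℂ) ≠ 0) (hS : sigC x ≠ 0) (hs : sinC x ≠ 0)
    (a b c f : Fin 4) : (bgFields rp κ).zeroCurv a b c f x = 0 := by
  have hz := zeta_ne κ x
  have hzb := zetaBar_ne κ x
  have hh := hsq_sq
  have hsin := sinC_sq x
  have hh3 := hsq_pow_three
  have hsin3 := sinC_pow_three x
  have hsin4 := sinC_pow_four x
  refine eq_zero_of_antisymm (fun a b => zeroCurv_antisymm_left a b c f) ?_ ?_ ?_ ?_ ?_ ?_ a b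
  all_goals
    refine eq_zero_of_antisymm (fun c f => zeroCurv_antisymm_right _ _ c f) ?_ ?_ ?_ ?_ ?_ ?_ c f
  all_goals
    simp only [zeroCurv, riem, Fin.sum_univ_four, connUp_zero, connUp_one, connUp_two, connUp_three,
      bgFields_dir, bgFields_conn, bgConn, bgFields_XiC, bgFields_d, bgFields_L, bgSchouten,
        eta_values, Matrix.cons_val, frD_neg, frD_zero, Pi.neg_apply,
      Pi.zero_apply, (hasFr_gammaRe hS).frD_eq, (hasFr_gammaIm hS).frD_eq, (hasFr_rho hS).frD_eq,
      (hasFr_rhoBar hS).frD_eq, (hasFr_tau hS).frD_eq, (hasFr_tauBar hS).frD_eq,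
      (hasFr_mu hS).frD_eq, (hasFr_muBar hS).frD_eq, (hasFr_pi hS).frD_eq, (hasFr_piBar hS).frD_eq,
      (hasFr_alphaSum hS).frD_eq, (hasFr_alphaSumBar hS).frD_eq, (hasFr_alphaDiff hS hs).frD_eq,
      (hasFr_alphaDiffBar hS hs).frD_eq, typeD, typeDBar, biv, Fin.isValue, Fin.reduceEq, and_true,
      and_false, and_self, if_true, if_false, neg_zero, mul_zero, zero_mul, add_zero, zero_add,
      sub_zero, zero_sub, neg_neg, mul_one, one_mul, Int.cast_zero, Int.cast_one, Int.cast_neg,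
      mul_neg, neg_mul, sub_self, sub_neg_eq_add]
  all_goals
    try simp only [bgPiBar, bgPi, bgTau, bgTauBar, bgRho, bgRhoBar, bgMu, bgMuBar, bgGammaRe,
      bgGammaIm, bgAlphaSum, bgAlphaSumBar, bgAlphaDiff, bgAlphaDiffBar, bgSchouten01, bgSchouten02,
      bgSchouten03, bgSchouten12, bgSchouten23, bgPhi, bgPhiBar, frSig, frW, frTh, frZ,
      Matrix.cons_val, deltaC, mul_zero, zero_mul, add_zero, zero_add, sub_zero, zero_sub, zero_div,
      neg_zero]
  all_goals
    generalize sigC x = S at *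
    generalize sinC x = sn at *
    generalize cosC x = c at *
    generalize cylW x = w at *
    generalize cylFC κ x = F at *
    generalize cylFC' κ x = F' at *
    generalize imk κ = K at *
    generalize hsq = h at *
    try field_simp
    try ring_nf
    try simp only [hh, hsin, hh3, hsin3, hsin4]
    try ring

end Structure

open CEFEFields

section Equations

variable {rp κ : ℝ} {x : Pt}

/-- The formulas for first derivatives hold where `ς ≠ 0`. To differentiate such a formula again it
must be known in a neighbourhood. -/
lemma eventually_sigC_ne (hS : sigC x ≠ 0) : ∀ᶠ y in 𝓝 x, sigC y ≠ 0 :=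
  (hasFr_sig (κ := 0)).diff.continuousAt.eventually_ne hS

lemma hasFr_XiC (hS : sigC x ≠ 0) : HasFr κ (bgFields rp κ).XiC x (fun a => frW κ x a / rp) :=
  ((hasFr_W hS).mul (HasFr.const κ x (rp : ℂ)⁻¹)).congr
    (Eventually.of_forall fun y => by rw [bgFields_XiC, div_eq_mul_inv]) fun a => by ring

lemma dir_XiC (hS : sigC x ≠ 0) (a : Fin 4) :
    (bgFields rp κ).dir a (bgFields rp κ).XiC x = frW κ x a / rp :=
  (hasFr_XiC hS).frD_eq a

lemma hasFr_dir_XiC_zero (hS : sigC x ≠ 0) :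
    HasFr κ ((bgFields rp κ).dir 0 (bgFields rp κ).XiC) x (fun a => -frSig κ x a / rp) :=
  (hasFr_sig.neg.mul (HasFr.const κ x (rp : ℂ)⁻¹)).congr
    ((eventually_sigC_ne hS).mono fun y hy => by
      rw [dir_XiC hy, frW, div_eq_mul_inv]; rfl) fun a => by ring

lemma hasFr_dir_XiC_one (hrp : (rp : ℂ) ≠ 0) (hS : sigC x ≠ 0) :
    HasFr κ ((bgFields rp κ).dir 1 (bgFields rp κ).XiC) x (fun a =>
      ((2 * cylW x * deltaC κ x + cylW x ^ 2 * (-1 + imk κ ^ 2 - 2 * imk κ ^ 2 * cylW x))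
          * frW κ x a / (2 * rp * sigC x)
        - cylW x ^ 2 * deltaC κ x * frSig κ x a / (2 * rp * sigC x ^ 2))
        / ((1 - imk κ * cylW x * cosC x) * (1 + imk κ * cylW x * cosC x))
      - cylW x ^ 2 * deltaC κ x / (2 * rp * sigC x) * (2 * imk κ * cylW x * cosC x * frZ κ x a)
        / ((1 - imk κ * cylW x * cosC x) * (1 + imk κ * cylW x * cosC x)) ^ 2) := by
  refine (((((HasFr.const κ x (2 * (rp : ℂ))⁻¹).mul ((hasFr_W hS).pow 2)).mul (hasFr_delta hS)).mul
    (hasFr_sig.inv hS)).mul (hasFr_sigmaInv hS)).congr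
    ((eventually_sigC_ne hS).mono fun y hy => ?_) fun a => ?_
  · rw [dir_XiC hy, frW]
    simp only [Matrix.cons_val, deltaC, div_eq_mul_inv, mul_inv]
    ring
  · have hz := zeta_ne κ x
    have hzb := zetaBar_ne κ x
    push_cast
    field_simp
    ring

lemma frD_dir_XiC_of_frW_eq_zero (hS : sigC x ≠ 0) {b : Fin 4} (hb : ∀ y, frW κ y b = 0)
    (a : Fin 4) : frD κ a ((bgFields rp κ).dir b (bgFields rp κ).XiC) x = 0 := by
  have h : HasFr κ ((bgFields rp κ).dir b (bgFields rp κ).XiC) x (fun _ => 0) :=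
    (HasFr.const κ x 0).congr ((eventually_sigC_ne hS).mono fun y hy => by
      rw [dir_XiC hy, hb, zero_div]) fun a => rfl
  exact h.frD_eq a

lemma frW_two (y : Pt) : frW κ y 2 = 0 := rfl

lemma frW_three (y : Pt) : frW κ y 3 = 0 := rfl

lemma bgFields_sC : (bgFields rp κ).sC x = cylW x * deltaC κ x
    / (2 * rp * ((1 - imk κ * cylW x * cosC x) * (1 + imk κ * cylW x * cosC x))) := by
  rw [← sigma_eq, deltaC, ← delta_eq]
  simp [sC, bgFields, cylW]

lemma hasFr_sC (hrp : (rp : ℂ) ≠ 0) (hS : sigC x ≠ 0) : HasFr κ (bgFields rp κ).sC x (fun a =>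
    (deltaC κ x + cylW x * (-1 + imk κ ^ 2 - 2 * imk κ ^ 2 * cylW x)) * frW κ x a
        / (2 * rp * ((1 - imk κ * cylW x * cosC x) * (1 + imk κ * cylW x * cosC x)))
      - cylW x * deltaC κ x * (2 * imk κ * cylW x * cosC x * frZ κ x a)
        / (2 * rp * ((1 - imk κ * cylW x * cosC x) * (1 + imk κ * cylW x * cosC x)) ^ 2)) := by
  refine ((((HasFr.const κ x (2 * (rp : ℂ))⁻¹).mul (hasFr_W hS)).mul (hasFr_delta hS)).mul
    (hasFr_sigmaInv hS)).congr (Eventually.of_forall fun y => ?_) fun a => ?_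
  · rw [bgFields_sC, div_eq_mul_inv, mul_inv]
    ring
  · have hz := zeta_ne κ x
    have hzb := zetaBar_ne κ x
    field_simp
    ring

set_option maxHeartbeats 20000000 in
lemma bgFields_zeroXi (hrp : (rp : ℂ) ≠ 0) (hS : sigC x ≠ 0) (hs : sinC x ≠ 0)
    (a b : Fin 4) : (bgFields rp κ).zeroXi a b x = 0 := by
  have hz := zeta_ne κ x
  have hzb := zetaBar_ne κ x
  have hh := hsq_sq
  have hsin := sinC_sq x
  have hh3 := hsq_pow_three
  have hsin3 := sinC_pow_three x
  have hsin4 := sinC_pow_four x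
  fin_cases a
  all_goals fin_cases b
  all_goals
    simp only [zeroXi, hess, Fin.sum_univ_four, connUp_zero, connUp_one, connUp_two, connUp_three,
      Fin.zero_eta, Fin.mk_one, Fin.reduceFinMk, dir_XiC hS,
      bgFields_dir _ _ _ ((bgFields rp κ).dir _ (bgFields rp κ).XiC), bgFields_conn, bgConn,
      bgFields_XiC, bgFields_L, bgFields_sC, bgSchouten, eta_values, Matrix.cons_val, Pi.neg_apply,
        Pi.zero_apply,
      (hasFr_dir_XiC_zero hS).frD_eq, (hasFr_dir_XiC_one hrp hS).frD_eq,
      frD_dir_XiC_of_frW_eq_zero hS frW_two, frD_dir_XiC_of_frW_eq_zero hS frW_three,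
      neg_zero, mul_zero, zero_mul, add_zero, zero_add,
      sub_zero, zero_sub, neg_neg, mul_one, one_mul, mul_neg, neg_mul, sub_self, sub_neg_eq_add]
  all_goals
    try simp only [bgPiBar, bgPi, bgTau, bgTauBar, bgRho, bgRhoBar, bgMu, bgMuBar, bgGammaRe,
      bgGammaIm, bgAlphaSum, bgAlphaSumBar, bgAlphaDiff, bgAlphaDiffBar, bgSchouten01, bgSchouten02,
      bgSchouten03, bgSchouten12, bgSchouten23, frSig, frW, frTh, frZ,
      Matrix.cons_val, deltaC, mul_zero, zero_mul, add_zero, zero_add, sub_zero, zero_sub, zero_div,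
      neg_zero]
  all_goals
    generalize sigC x = S at *
    generalize sinC x = sn at *
    generalize cosC x = c at *
    generalize cylW x = w at *
    generalize cylFC κ x = F at *
    generalize cylFC' κ x = F' at *
    generalize imk κ = K at *
    generalize hsq = h at *
    try field_simp
    try ring_nf
    try simp only [hh, hsin, hh3, hsin3, hsin4]
    try ring

set_option maxHeartbeats 20000000 in
lemma bgFields_zeroS (hrp : (rp : ℂ) ≠ 0) (hS : sigC x ≠ 0) (a : Fin 4) :
    (bgFields rp κ).zeroS a x = 0 := by
  have hz := zeta_ne κ x
  have hzb := zetaBar_ne κ x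
  have hh := hsq_sq
  have hsin := sinC_sq x
  have hh3 := hsq_pow_three
  have hsin3 := sinC_pow_three x
  have hsin4 := sinC_pow_four x
  fin_cases a
  all_goals
    simp only [zeroS, Fin.sum_univ_four, Fin.zero_eta, Fin.mk_one, Fin.reduceFinMk, dir_XiC hS,
      bgFields_dir _ _ _ (bgFields rp κ).sC, (hasFr_sC hrp hS).frD_eq, bgFields_L, bgSchouten,
        eta_values, Matrix.cons_val, Pi.neg_apply, Pi.zero_apply,
      neg_zero, mul_zero, zero_mul, add_zero, zero_add,
      sub_zero, zero_sub, neg_neg, mul_one, one_mul, mul_neg, neg_mul, sub_self, sub_neg_eq_add]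
    simp only [bgSchouten01, bgSchouten02,
      bgSchouten03, bgSchouten12, bgSchouten23, frSig, frW, frTh, frZ,
      Matrix.cons_val, deltaC, mul_zero, zero_mul, add_zero, zero_add, sub_zero, zero_sub, zero_div,
      neg_zero]
  all_goals
    generalize sigC x = S at *
    generalize sinC x = sn at *
    generalize cosC x = c at *
    generalize cylW x = w at *
    generalize cylFC κ x = F at *
    generalize cylFC' κ x = F' at *
    generalize imk κ = K at *
    generalize hsq = h at *
    try field_simp
    try ring_nf
    try simp only [hh, hsin, hh3, hsin3, hsin4]
    try ring

/-! ### The Bianchi identities of the background -/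

lemma hasFr_phi (hS : sigC x ≠ 0) : HasFr κ (bgPhi rp κ) x
    (fun a => 3 * rp * (1 - imk κ ^ 2) * frZ κ x a / (2 * (1 - imk κ * cylW x * cosC x) ^ 4)) := by
  have hz := zeta_ne κ x
  refine (((HasFr.const κ x (rp * (1 - imk κ ^ 2))).div ((HasFr.const κ x 2).mul
    ((hasFr_zeta hS).pow 3)) (mul_ne_zero two_ne_zero (pow_ne_zero 3 hz)))).neg.congr_val
    fun a => ?_
  push_cast
  field_simp
  ring

lemma hasFr_phiBar (hS : sigC x ≠ 0) : HasFr κ (bgPhiBar rp κ) x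
    (fun a => -(3 * rp * (1 - imk κ ^ 2) * frZ κ x a
      / (2 * (1 + imk κ * cylW x * cosC x) ^ 4))) := by
  have hz := zetaBar_ne κ x
  refine (((HasFr.const κ x (rp * (1 - imk κ ^ 2))).div ((HasFr.const κ x 2).mul
    ((hasFr_zetaBar hS).pow 3)) (mul_ne_zero two_ne_zero (pow_ne_zero 3 hz)))).neg.congr_val
    fun a => ?_
  push_cast
  field_simp
  ring

lemma hasFr_d (hS : sigC x ≠ 0) (a b c f : Fin 4) : HasFr κ ((bgFields rp κ).d a b c f) x
    (fun g => typeD a b c f * (3 * rp * (1 - imk κ ^ 2) * frZ κ x g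
        / (2 * (1 - imk κ * cylW x * cosC x) ^ 4))
      - typeDBar a b c f * (3 * rp * (1 - imk κ ^ 2) * frZ κ x g
        / (2 * (1 + imk κ * cylW x * cosC x) ^ 4))) :=
  (((HasFr.const κ x (typeD a b c f : ℂ)).mul (hasFr_phi (rp := rp) hS)).add
    ((HasFr.const κ x (typeDBar a b c f : ℂ)).mul (hasFr_phiBar (rp := rp) hS))).congr_val
    fun a => by ring

lemma hasFr_schouten01 (hS : sigC x ≠ 0) : HasFr κ (bgSchouten01 κ) x (fun a =>
    (((-2 * (1 - imk κ ^ 2) - 6 * imk κ ^ 2 * cylW x) * frW κ x a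
        * ((1 - imk κ * cylW x * cosC x) * (1 + imk κ * cylW x * cosC x))
      + (1 - 2 * (1 - imk κ ^ 2) * cylW x - 3 * imk κ ^ 2 * cylW x ^ 2)
        * (2 * imk κ * cylW x * cosC x * frZ κ x a)
      + 4 * imk κ ^ 2 * cylW x * cosC x * (frW κ x a * cosC x - cylW x * sinC x * frTh κ x a)
        * deltaC κ x
      + 2 * imk κ ^ 2 * cylW x ^ 2 * cosC x ^ 2 * (-1 + imk κ ^ 2 - 2 * imk κ ^ 2 * cylW x)
        * frW κ x a)
      / (2 * ((1 - imk κ * cylW x * cosC x) * (1 + imk κ * cylW x * cosC x)) ^ 2)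
    - bgSchouten01 κ x * (4 * imk κ * cylW x * cosC x * frZ κ x a)
      / ((1 - imk κ * cylW x * cosC x) * (1 + imk κ * cylW x * cosC x)))) := by
  have hz := zeta_ne κ x
  have hzb := zetaBar_ne κ x
  refine (((((HasFr.const κ x 1).sub ((HasFr.const κ x (2 * (1 - imk κ ^ 2))).mul
    (hasFr_W hS))).sub ((HasFr.const κ x (3 * imk κ ^ 2)).mul ((hasFr_W hS).pow 2))).mul
    ((hasFr_zeta hS).mul (hasFr_zetaBar hS))).add ((((HasFr.const κ x (2 * imk κ ^ 2)).mul
      ((hasFr_W hS).pow 2)).mul (hasFr_cos.pow 2)).mul (hasFr_delta hS))).div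
    ((HasFr.const κ x 2).mul (((hasFr_zeta hS).mul (hasFr_zetaBar hS)).pow 2))
    (mul_ne_zero two_ne_zero (pow_ne_zero 2 (mul_ne_zero hz hzb))) |>.congr_val fun a => ?_
  simp only [bgSchouten01]
  push_cast
  field_simp
  ring

lemma hasFr_schouten23 (hS : sigC x ≠ 0) : HasFr κ (bgSchouten23 κ) x (fun a =>
    (((-1 + imk κ ^ 2 - 2 * imk κ ^ 2 * cylW x) * frW κ x a
        * (1 + imk κ ^ 2 * cylW x ^ 2 * cosC x ^ 2)
      + deltaC κ x * (2 * imk κ ^ 2 * cylW x * cosC x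
        * (frW κ x a * cosC x - cylW x * sinC x * frTh κ x a)))
      / (2 * ((1 - imk κ * cylW x * cosC x) * (1 + imk κ * cylW x * cosC x)) ^ 2)
    - bgSchouten23 κ x * (4 * imk κ * cylW x * cosC x * frZ κ x a)
      / ((1 - imk κ * cylW x * cosC x) * (1 + imk κ * cylW x * cosC x)))) := by
  have hz := zeta_ne κ x
  have hzb := zetaBar_ne κ x
  refine ((hasFr_delta hS).mul ((HasFr.const κ x 1).add (((HasFr.const κ x (imk κ ^ 2)).mul
    ((hasFr_W hS).pow 2)).mul (hasFr_cos.pow 2)))).div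
    ((HasFr.const κ x 2).mul (((hasFr_zeta hS).mul (hasFr_zetaBar hS)).pow 2))
    (mul_ne_zero two_ne_zero (pow_ne_zero 2 (mul_ne_zero hz hzb))) |>.congr_val fun a => ?_
  simp only [bgSchouten23]
  push_cast
  field_simp
  ring

lemma hasFr_schouten02 (hS : sigC x ≠ 0) : HasFr κ (bgSchouten02 κ) x (fun a =>
    imk κ * hsq * (frSig κ x a * sinC x + sigC x * cosC x * frTh κ x a)
      / (1 + imk κ * cylW x * cosC x) ^ 2
    + 2 * imk κ * hsq * sigC x * sinC x * frZ κ x a / (1 + imk κ * cylW x * cosC x) ^ 3) := by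
  have hzb := zetaBar_ne κ x
  refine (((HasFr.const κ x (imk κ * hsq)).mul hasFr_sig).mul hasFr_sin).div
    ((hasFr_zetaBar hS).pow 2) (pow_ne_zero 2 hzb) |>.congr_val fun a => ?_
  push_cast
  field_simp
  ring

lemma hasFr_schouten03 (hS : sigC x ≠ 0) : HasFr κ (bgSchouten03 κ) x (fun a =>
    -(imk κ * hsq * (frSig κ x a * sinC x + sigC x * cosC x * frTh κ x a)
      / (1 - imk κ * cylW x * cosC x) ^ 2)
    + 2 * imk κ * hsq * sigC x * sinC x * frZ κ x a / (1 - imk κ * cylW x * cosC x) ^ 3) := by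
  have hz := zeta_ne κ x
  refine ((((HasFr.const κ x (imk κ * hsq)).mul hasFr_sig).mul hasFr_sin).div
    ((hasFr_zeta hS).pow 2) (pow_ne_zero 2 hz)).neg |>.congr_val fun a => ?_
  push_cast
  field_simp
  ring

lemma hasFr_schouten12 (hS : sigC x ≠ 0) : HasFr κ (bgSchouten12 κ) x (fun a =>
    imk κ * hsq * ((2 * cylW x * deltaC κ x
        + cylW x ^ 2 * (-1 + imk κ ^ 2 - 2 * imk κ ^ 2 * cylW x)) * frW κ x a * sinC x
        + cylW x ^ 2 * deltaC κ x * cosC x * frTh κ x a)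
      / (2 * sigC x * ((1 - imk κ * cylW x * cosC x) * (1 + imk κ * cylW x * cosC x)) ^ 2)
    - bgSchouten12 κ x * (frSig κ x a / sigC x + 4 * imk κ * cylW x * cosC x * frZ κ x a
      / ((1 - imk κ * cylW x * cosC x) * (1 + imk κ * cylW x * cosC x)))) := by
  have hz := zeta_ne κ x
  have hzb := zetaBar_ne κ x
  refine ((((HasFr.const κ x (imk κ * hsq)).mul ((hasFr_W hS).pow 2)).mul (hasFr_delta hS)).mul
    hasFr_sin).div (((HasFr.const κ x 2).mul hasFr_sig).mul
      (((hasFr_zeta hS).mul (hasFr_zetaBar hS)).pow 2))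
    (mul_ne_zero (mul_ne_zero two_ne_zero hS) (pow_ne_zero 2 (mul_ne_zero hz hzb)))
    |>.congr_val fun a => ?_
  -- Hypotheses and goal are brought to the same order of factors, so that the non-vanishing of `ζ`
  -- and `ζ*` applies to the denominators as they stand.
  rw [mul_comm (imk κ)] at hz hzb
  simp only [bgSchouten12, mul_comm (imk κ) (cylW x)]
  push_cast
  field_simp
  ring

lemma zeroL_antisymm (a b c : Fin 4) :
    (bgFields rp κ).zeroL a b c x = -(bgFields rp κ).zeroL b a c x := by
  have h : ∀ g, (bgFields rp κ).d g c a b x = -(bgFields rp κ).d g c b a x := fun g => by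
    rw [bgFields_d_pair g c a b, bgFields_d_antisymm a b, bgFields_d_pair b a g c]
  simp only [zeroL, Fin.sum_univ_four, h]
  ring

set_option maxHeartbeats 40000000 in
lemma bgFields_zeroL (hrp : (rp : ℂ) ≠ 0) (hS : sigC x ≠ 0) (hs : sinC x ≠ 0)
    (a b c : Fin 4) : (bgFields rp κ).zeroL a b c x = 0 := by
  have hz := zeta_ne κ x
  have hzb := zetaBar_ne κ x
  have hh := hsq_sq
  have hsin := sinC_sq x
  have hh3 := hsq_pow_three
  have hsin3 := sinC_pow_three x
  have hsin4 := sinC_pow_four x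
  refine eq_zero_of_antisymm (fun a b => zeroL_antisymm a b c) ?_ ?_ ?_ ?_ ?_ ?_ a b
  all_goals fin_cases c
  all_goals
    simp only [zeroL, covL, Fin.sum_univ_four, connUp_zero, connUp_one, connUp_two, connUp_three,
      Fin.zero_eta, Fin.mk_one, Fin.reduceFinMk, dir_XiC hS, frW_two, frW_three, eta_values,
        bgFields_conn, bgConn, bgFields_L, bgSchouten,
      Matrix.cons_val, bgFields_dir _ _ _ (bgSchouten01 κ), bgFields_dir _ _ _ (bgSchouten02 κ),
      bgFields_dir _ _ _ (bgSchouten03 κ), bgFields_dir _ _ _ (bgSchouten12 κ),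
      bgFields_dir _ _ _ (bgSchouten23 κ), bgFields_dir _ _ _ (-bgSchouten12 κ),
      bgFields_dir _ _ _ 0, frD_neg, frD_zero, Pi.neg_apply, Pi.zero_apply,
      (hasFr_schouten01 hS).frD_eq, (hasFr_schouten02 hS).frD_eq, (hasFr_schouten03 hS).frD_eq,
      (hasFr_schouten12 hS).frD_eq, (hasFr_schouten23 hS).frD_eq, bgFields_d, typeD, typeDBar, biv,
      Fin.isValue, Fin.reduceEq, and_true, and_false, and_self, if_true, if_false, neg_zero,
      mul_zero, zero_mul, add_zero, zero_add, sub_zero, zero_sub, neg_neg, mul_one, one_mul,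
      Int.cast_zero, Int.cast_one, Int.cast_neg, mul_neg, neg_mul, sub_self, sub_neg_eq_add,
      zero_div]
  all_goals
    try simp only [bgPiBar, bgPi, bgTau, bgTauBar, bgRho, bgRhoBar, bgMu, bgMuBar, bgGammaRe,
      bgGammaIm, bgAlphaSum, bgAlphaSumBar, bgAlphaDiff, bgAlphaDiffBar, bgSchouten01, bgSchouten02,
      bgSchouten03, bgSchouten12, bgSchouten23, bgPhi, bgPhiBar, frSig, frW, frTh, frZ,
      Matrix.cons_val, deltaC, mul_zero, zero_mul, add_zero, zero_add, sub_zero, zero_sub, zero_div,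
      neg_zero]
  all_goals
    generalize sigC x = S at *
    generalize sinC x = sn at *
    generalize cosC x = c at *
    generalize cylW x = w at *
    generalize cylFC κ x = F at *
    generalize cylFC' κ x = F' at *
    generalize imk κ = K at *
    generalize hsq = h at *
    try field_simp
    try ring_nf
    try simp only [hh, hsin, hh3, hsin3, hsin4]
    try ring

/-- The antisymmetry of `d` in its last pair, being an identity of functions, passes to the
covariant derivative and hence to the divergence. -/
lemma zeroD_antisymm (a b c : Fin 4) :
    (bgFields rp κ).zeroD a b c x = -(bgFields rp κ).zeroD a c b x := by
  have h : ∀ g a b c, (bgFields rp κ).d g a b c = fun y => -(bgFields rp κ).d g a c b y := by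
    intro g a b c
    funext y
    rw [bgFields_d_pair g a b c, bgFields_d_antisymm b c, bgFields_d_pair c b g a]
  have hd : ∀ g a, (bgFields rp κ).dir g (fun y => -(bgFields rp κ).d g a c b y) x
    = -(bgFields rp κ).dir g ((bgFields rp κ).d g a c b) x := fun g a => frD_neg κ g _ x
  have h' : ∀ g a b c, (bgFields rp κ).d g a b c x = -(bgFields rp κ).d g a c b x :=
    fun g a b c => congrFun (h g a b c) x
  have hdd : ∀ f g, (bgFields rp κ).dir f ((bgFields rp κ).d g a b c) x
    = -(bgFields rp κ).dir f ((bgFields rp κ).d g a c b) x := fun f g => by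
      rw [h g a b c]; exact frD_neg κ f _ x
  have hc : ∀ f g, (bgFields rp κ).covD f g a b c x = -(bgFields rp κ).covD f g a c b x := by
    intro f g
    simp only [covD, Fin.sum_univ_four]
    rw [hdd f g, h' 0 a b c, h' 1 a b c, h' 2 a b c, h' 3 a b c, h' g 0 b c, h' g 1 b c,
      h' g 2 b c, h' g 3 b c, h' g a b 0, h' g a b 1, h' g a b 2, h' g a b 3, h' g a 0 c,
      h' g a 1 c, h' g a 2 c, h' g a 3 c]
    ring
  simp only [zeroD, hc, mul_neg, Finset.sum_neg_distrib]

set_option maxHeartbeats 40000000 in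
lemma bgFields_zeroD (hS : sigC x ≠ 0) (hs : sinC x ≠ 0)
    (a b c : Fin 4) : (bgFields rp κ).zeroD a b c x = 0 := by
  have hz := zeta_ne κ x
  have hzb := zetaBar_ne κ x
  have hh := hsq_sq
  have hsin := sinC_sq x
  have hh3 := hsq_pow_three
  have hsin3 := sinC_pow_three x
  have hsin4 := sinC_pow_four x
  -- The same non-vanishing facts with the factors in another order, since both orders can appear
  -- when denominators are cleared.
  have hz' : 1 - imk κ * cosC x * cylW x ≠ 0 := by rwa [mul_right_comm]
  have hzb' : 1 + imk κ * cosC x * cylW x ≠ 0 := by rwa [mul_right_comm]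
  refine eq_zero_of_antisymm (fun b c => zeroD_antisymm a b c) ?_ ?_ ?_ ?_ ?_ ?_ b c
  all_goals fin_cases a
  all_goals
    simp only [zeroD, covD, Fin.sum_univ_four, connUp_zero, connUp_one, connUp_two, connUp_three,
      Fin.zero_eta, Fin.mk_one, Fin.reduceFinMk, eta_values, bgFields_conn, bgConn, bgFields_dir,
        (hasFr_d hS _ _ _ _).frD_eq,
      Matrix.cons_val, Pi.neg_apply, Pi.zero_apply, bgFields_d, typeD, typeDBar, biv,
      Fin.isValue, Fin.reduceEq, and_true, and_false, and_self, if_true, if_false, neg_zero,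
      mul_zero, zero_mul, add_zero, zero_add, sub_zero, zero_sub, neg_neg, mul_one, one_mul,
      Int.cast_zero, Int.cast_one, Int.cast_neg, mul_neg, neg_mul, sub_self, sub_neg_eq_add,
      zero_div]
  all_goals
    try simp only [bgPiBar, bgPi, bgTau, bgTauBar, bgRho, bgRhoBar, bgMu, bgMuBar, bgGammaRe,
      bgGammaIm, bgAlphaSum, bgAlphaSumBar, bgAlphaDiff, bgAlphaDiffBar, bgPhi, bgPhiBar, frZ,
      Matrix.cons_val, deltaC, mul_zero, zero_mul, add_zero, zero_add, sub_zero, zero_sub, zero_div,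
      neg_zero]
  all_goals
    generalize sigC x = S at *
    generalize sinC x = sn at *
    generalize cosC x = c at *
    generalize cylW x = w at *
    generalize cylFC κ x = F at *
    generalize cylFC' κ x = F' at *
    generalize imk κ = K at *
    generalize hsq = h at *
    try field_simp
    try ring_nf
    try simp only [hh, hsin, hh3, hsin3, hsin4]
    try ring

end Equations

open CEFEFields

/-! ### Existence of the background solution -/

section Existence

variable {rp κ : ℝ} {x : Pt}

lemma star_zeta : star (1 - imk κ * cylW x * cosC x) = 1 + imk κ * cylW x * cosC x := by
  simp only [star_sub, star_one, star_mul', star_imk, star_cylW, star_cosC]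
  ring

lemma star_zetaBar : star (1 + imk κ * cylW x * cosC x) = 1 - imk κ * cylW x * cosC x := by
  rw [← star_zeta, star_star]

lemma star_two : star (2 : ℂ) = 2 := Complex.conj_ofNat 2

lemma star_three : star (3 : ℂ) = 3 := Complex.conj_ofNat 3

lemma star_ofReal (r : ℝ) : star (r : ℂ) = r := Complex.conj_ofReal r

lemma star_deltaC : star (deltaC κ x) = deltaC κ x := by
  simp only [deltaC, star_mul', star_sub, star_add, star_one, star_pow, star_imk, star_cylW]
  ring

lemma star_bgRho : star (bgRho κ x) = bgRhoBar κ x := by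
  simp only [bgRho, bgRhoBar, star_neg, star_div₀, star_zeta, star_mul', star_imk, star_sigC,
    star_cosC]
  ring

lemma star_bgTau : star (bgTau κ x) = bgTauBar κ x := by
  simp only [bgTau, bgTauBar, star_neg, star_div₀, star_zeta, star_zetaBar, star_mul', star_imk,
    star_hsq, star_cylW, star_sinC]
  ring

lemma star_bgPi : star (bgPi κ x) = bgPiBar κ x := by
  simp only [bgPi, bgPiBar, star_div₀, star_zeta, star_pow, star_mul', star_imk,
    star_hsq, star_cylW, star_sinC]
  ring

lemma star_bgMu : star (bgMu κ x) = bgMuBar κ x := by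
  simp only [bgMu, bgMuBar, star_neg, star_div₀, star_zeta, star_zetaBar, star_pow, star_mul',
    star_imk, star_sigC, star_cylW, star_cosC, star_two, star_deltaC]
  ring

lemma star_bgGammaRe : star (bgGammaRe κ x) = bgGammaRe κ x := by
  simp only [bgGammaRe, star_sub, star_add, star_one, star_div₀, star_pow, star_mul', star_cosC,
    star_imk, star_sigC, star_cylW, star_cylFC, star_two, star_deltaC]
  ring

lemma star_bgGammaIm : star (bgGammaIm κ x) = -bgGammaIm κ x := by
  simp only [bgGammaIm, star_neg, star_div₀, star_zeta, star_zetaBar, star_pow,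
    star_mul', star_imk, star_sigC, star_cylW, star_cosC, star_deltaC]
  ring

lemma star_bgAlphaSum : star (bgAlphaSum κ x) = bgAlphaSumBar κ x := by
  simp only [bgAlphaSum, bgAlphaSumBar, star_sub, star_bgPi, star_div₀, star_mul', star_one,
    star_imk, star_hsq, star_cylFC, star_sinC, star_sigC, star_cylW, star_cosC]
  ring

lemma star_bgAlphaDiff : star (bgAlphaDiff κ x) = bgAlphaDiffBar κ x := by
  simp only [bgAlphaDiff, bgAlphaDiffBar, star_sub, star_bgPi, star_div₀, star_mul', star_one,
    star_imk, star_hsq, star_sinC, star_cylW, star_cosC]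
  ring

lemma star_bgRhoBar : star (bgRhoBar κ x) = bgRho κ x := by rw [← star_bgRho, star_star]
lemma star_bgTauBar : star (bgTauBar κ x) = bgTau κ x := by rw [← star_bgTau, star_star]
lemma star_bgPiBar : star (bgPiBar κ x) = bgPi κ x := by rw [← star_bgPi, star_star]
lemma star_bgMuBar : star (bgMuBar κ x) = bgMu κ x := by rw [← star_bgMu, star_star]
lemma star_bgAlphaSumBar : star (bgAlphaSumBar κ x) = bgAlphaSum κ x := by
  rw [← star_bgAlphaSum, star_star]
lemma star_bgAlphaDiffBar : star (bgAlphaDiffBar κ x) = bgAlphaDiff κ x := by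
  rw [← star_bgAlphaDiff, star_star]

lemma bar_zero : bar 0 = 0 := by decide
lemma bar_one : bar 1 = 1 := by decide
lemma bar_two : bar 2 = 3 := by decide
lemma bar_three : bar 3 = 2 := by decide

lemma star_bgConn (a b c : Fin 4) :
    star (bgConn κ a b c x) = bgConn κ (bar a) (bar b) (bar c) x := by
  fin_cases a <;> fin_cases b <;> fin_cases c <;>
    simp only [Fin.zero_eta, Fin.mk_one, Fin.reduceFinMk, bar_zero, bar_one, bar_two, bar_three,
      bgConn, Matrix.cons_val, Pi.zero_apply, Pi.neg_apply, star_zero, star_neg, star_bgRho,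
      star_bgTau, star_bgPi, star_bgMu, star_bgGammaRe, star_bgGammaIm, star_bgAlphaSum,
      star_bgAlphaDiff, star_bgRhoBar, star_bgTauBar, star_bgPiBar, star_bgMuBar,
      star_bgAlphaSumBar, star_bgAlphaDiffBar, neg_neg]

lemma star_bgSchouten01 : star (bgSchouten01 κ x) = bgSchouten01 κ x := by
  simp only [bgSchouten01, star_sub, star_add, star_one, star_div₀, star_pow, star_mul', star_imk,
    star_cylW, star_cosC, star_two, star_three, star_deltaC]
  ring

lemma star_bgSchouten23 : star (bgSchouten23 κ x) = bgSchouten23 κ x := by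
  simp only [bgSchouten23, star_add, star_one, star_div₀, star_zeta, star_pow,
    star_mul', star_imk, star_cylW, star_cosC, star_two, star_deltaC]
  ring

lemma star_bgSchouten02 : star (bgSchouten02 κ x) = bgSchouten03 κ x := by
  simp only [bgSchouten02, bgSchouten03, star_div₀, star_zetaBar, star_pow, star_mul', star_imk,
    star_hsq, star_sigC, star_sinC]
  ring

lemma star_bgSchouten03 : star (bgSchouten03 κ x) = bgSchouten02 κ x := by
  rw [← star_bgSchouten02, star_star]

lemma star_bgSchouten12 : star (bgSchouten12 κ x) = -bgSchouten12 κ x := by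
  simp only [bgSchouten12, star_div₀, star_zeta, star_zetaBar, star_pow, star_mul', star_imk,
    star_hsq, star_cylW, star_sigC, star_sinC, star_two, star_deltaC]
  ring

lemma star_bgSchouten (a b : Fin 4) :
    star (bgSchouten κ a b x) = bgSchouten κ (bar a) (bar b) x := by
  fin_cases a <;> fin_cases b <;>
    simp only [Fin.zero_eta, Fin.mk_one, Fin.reduceFinMk, bar_zero, bar_one, bar_two, bar_three,
      bgSchouten, Matrix.cons_val, Pi.zero_apply, Pi.neg_apply, star_zero, star_neg,
      star_bgSchouten01, star_bgSchouten02, star_bgSchouten03, star_bgSchouten12,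
      star_bgSchouten23, neg_neg]

lemma star_bgPhi : star (bgPhi rp κ x) = bgPhiBar rp κ x := by
  simp only [bgPhi, bgPhiBar, star_neg, star_div₀, star_pow, star_mul', star_sub, star_one,
    star_imk, star_two, star_ofReal, star_cylW, star_cosC]
  ring

lemma star_bgPhiBar : star (bgPhiBar rp κ x) = bgPhi rp κ x := by
  rw [← star_bgPhi, star_star]

-- Conjugation exchanges `m` and `m*`, which interchanges self-dual and anti-self-dual bivectors.
-- With `star_bgPhi` this makes the Weyl tensor real.
set_option maxRecDepth 100000 in
lemma typeD_bar : ∀ a b c f, typeD (bar a) (bar b) (bar c) (bar f) = typeDBar a b c f := by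
  decide +kernel

lemma typeDBar_bar (a b c f : Fin 4) :
    typeDBar (bar a) (bar b) (bar c) (bar f) = typeD a b c f := by
  have hb : ∀ a, bar (bar a) = a := by decide
  rw [← typeD_bar, hb, hb, hb, hb]

lemma typeD_cyclic : ∀ a b c f, typeD a b c f + typeD a c f b + typeD a f b c = 0 := by
  decide +kernel

lemma typeDBar_cyclic : ∀ a b c f, typeDBar a b c f + typeDBar a c f b + typeDBar a f b c = 0 := by
  decide +kernel

lemma typeD_trace : ∀ b f,
    -typeD 0 b 1 f - typeD 1 b 0 f + typeD 2 b 3 f + typeD 3 b 2 f = 0 := by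
  decide +kernel

lemma typeDBar_trace : ∀ b f,
    -typeDBar 0 b 1 f - typeDBar 1 b 0 f + typeDBar 2 b 3 f + typeDBar 3 b 2 f = 0 := by
  decide +kernel

lemma det_cylTetrad (hS : sigC x ≠ 0) (hs : sinC x ≠ 0) :
    (Matrix.of fun a μ => cylTetrad κ x a μ).det
      = -(Complex.I * cylFC κ x / (sigC x * sinC x
        * ((1 - imk κ * cylW x * cosC x) * (1 + imk κ * cylW x * cosC x)))) := by
  have hz := zeta_ne κ x
  have hzb := zetaBar_ne κ x
  have hh := hsq_sq
  have hsin := sinC_sq x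
  rw [Matrix.det_succ_row_zero]
  simp only [Fin.sum_univ_four, Matrix.of_apply, cylTetrad_zero, Matrix.cons_val, mul_zero,
    zero_mul, add_zero, Fin.val_zero, pow_zero, one_mul]
  rw [Matrix.det_fin_three]
  simp only [Matrix.submatrix_apply, Matrix.of_apply, Fin.succAbove_zero, Fin.succ_zero_eq_one,
    Fin.succ_one_eq_two, show Fin.succ (2 : Fin 3) = 3 from rfl, cylTetrad_one, cylTetrad_two,
    cylTetrad_three, Matrix.cons_val, kappa_eq κ, one_sub_T hS]
  generalize sigC x = S at *
  generalize sinC x = sn at *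
  generalize cosC x = c at *
  generalize cylW x = w at *
  generalize cylFC κ x = F at *
  generalize imk κ = K at *
  generalize hsq = h at *
  generalize Complex.I = j at *
  field_simp
  ring_nf
  simp only [hh, hsin]
  ring

/-- The factors `1 - ς` and `1 - κ² ς` are positive for `0 < ς < 1` and `|κ| < 1`. By
`det_cylTetrad`, it is `F ≠ 0` that makes the tetrad a frame. -/
lemma cylFC_ne (hκ : |κ| < 1) (hx : x ∈ cylRegion) : cylFC κ x ≠ 0 := by
  have hk : κ ^ 2 < 1 := (sq_lt_one_iff_abs_lt_one κ).mpr hκ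
  obtain ⟨h0, h1, -⟩ := hx
  have h2 : 0 < 1 - κ ^ 2 * x 1 := by nlinarith [sq_nonneg κ]
  have h3 : 0 < 1 - x 1 := by linarith
  exact Complex.ofReal_ne_zero.mpr (by unfold cylF; positivity)

lemma det_cylTetrad_ne (hκ : |κ| < 1) (hx : x ∈ cylRegion) :
    (Matrix.of fun a μ => cylTetrad κ x a μ).det ≠ 0 := by
  rw [det_cylTetrad (sigC_ne hx) (sinC_ne hx)]
  exact neg_ne_zero.mpr (div_ne_zero (mul_ne_zero Complex.I_ne_zero (cylFC_ne hκ hx))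
    (mul_ne_zero (mul_ne_zero (sigC_ne hx) (sinC_ne hx))
      (mul_ne_zero (zeta_ne κ x) (zetaBar_ne κ x))))

lemma bgFields_admissible (hκ : |κ| < 1) (hx : x ∈ cylRegion) : (bgFields rp κ).Admissible x where
  frame := det_cylTetrad_ne hκ hx
  real_e := star_cylTetrad κ x
  real_conn := star_bgConn
  real_L := star_bgSchouten
  real_d a b c f := by
    have hi : ∀ n : ℤ, star (n : ℂ) = n := fun n => star_intCast n
    simp only [bgFields_d, star_add, star_mul', hi, star_bgPhi, star_bgPhiBar, typeD_bar,
      typeDBar_bar]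
    ring
  conn_metric a b c := congrFun (bgConn_antisymm a b c) x
  L_symm a b := by
    fin_cases a <;> fin_cases b <;> rfl
  d_anti := bgFields_d_antisymm
  d_pair := bgFields_d_pair
  d_cyclic a b c f := by
    have h1 : (typeD a b c f + typeD a c f b + typeD a f b c : ℂ) = 0 := by
      exact_mod_cast typeD_cyclic a b c f
    have h2 : (typeDBar a b c f + typeDBar a c f b + typeDBar a f b c : ℂ) = 0 := by
      exact_mod_cast typeDBar_cyclic a b c f
    simp only [bgFields_d]
    linear_combination bgPhi rp κ x * h1 + bgPhiBar rp κ x * h2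
  d_trace b f := by
    have h1 : (-typeD 0 b 1 f - typeD 1 b 0 f + typeD 2 b 3 f + typeD 3 b 2 f : ℂ) = 0 := by
      exact_mod_cast typeD_trace b f
    have h2 : (-typeDBar 0 b 1 f - typeDBar 1 b 0 f + typeDBar 2 b 3 f + typeDBar 3 b 2 f : ℂ)
        = 0 := by
      exact_mod_cast typeDBar_trace b f
    simp only [bgFields_d, Fin.sum_univ_four, eta_values]
    linear_combination bgPhi rp κ x * h1 + bgPhiBar rp κ x * h2

lemma contDiffAt_bgConn (hS : sigC x ≠ 0) (hs : sinC x ≠ 0) (a b c : Fin 4) :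
    ContDiffAt ℝ ∞ (bgConn κ a b c) x := by
  have h0 : ContDiffAt ℝ ∞ (0 : Pt → ℂ) x := contDiffAt_const
  have h1 := (hasFr_gammaRe (κ := κ) hS).smooth
  have h2 := (hasFr_gammaIm (κ := κ) hS).smooth
  have h3 := (hasFr_rho (κ := κ) hS).smooth
  have h4 := (hasFr_rhoBar (κ := κ) hS).smooth
  have h5 := (hasFr_tau (κ := κ) hS).smooth
  have h6 := (hasFr_tauBar (κ := κ) hS).smooth
  have h7 := (hasFr_mu (κ := κ) hS).smooth
  have h8 := (hasFr_muBar (κ := κ) hS).smooth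
  have h9 := (hasFr_pi (κ := κ) hS).smooth
  have h10 := (hasFr_piBar (κ := κ) hS).smooth
  have h11 := (hasFr_alphaSum (κ := κ) hS).smooth
  have h12 := (hasFr_alphaSumBar (κ := κ) hS).smooth
  have h13 := (hasFr_alphaDiff (κ := κ) hS hs).smooth
  have h14 := (hasFr_alphaDiffBar (κ := κ) hS hs).smooth
  fin_cases a <;> fin_cases b <;> fin_cases c <;>
    simp only [Fin.zero_eta, Fin.mk_one, Fin.reduceFinMk, bgConn, Matrix.cons_val] <;>
    first
    | assumption
    | exact ContDiffAt.neg (by assumption)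

lemma contDiffAt_bgSchouten (hS : sigC x ≠ 0) (a b : Fin 4) :
    ContDiffAt ℝ ∞ (bgSchouten κ a b) x := by
  have h0 : ContDiffAt ℝ ∞ (0 : Pt → ℂ) x := contDiffAt_const
  have h1 := (hasFr_schouten01 (κ := κ) hS).smooth
  have h2 := (hasFr_schouten02 (κ := κ) hS).smooth
  have h3 := (hasFr_schouten03 (κ := κ) hS).smooth
  have h4 := (hasFr_schouten12 (κ := κ) hS).smooth
  have h5 := (hasFr_schouten23 (κ := κ) hS).smooth
  fin_cases a <;> fin_cases b <;>
    simp only [Fin.zero_eta, Fin.mk_one, Fin.reduceFinMk, bgSchouten, Matrix.cons_val] <;>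
    first
    | assumption
    | exact ContDiffAt.neg (by assumption)

lemma contDiff_cylXi (rp : ℝ) : ContDiff ℝ ∞ (cylXi rp) := by
  unfold cylXi
  fun_prop

lemma contDiff_bgFields_s (hrp : rp ≠ 0) : ContDiff ℝ ∞ (bgFields rp κ).s := by
  have hσ : ∀ x, cylSigma κ x ≠ 0 := fun x => by
    unfold cylSigma
    positivity
  have h1 : ContDiff ℝ ∞ (fun x : Pt => x 1 * (1 - x 0) * cylDelta κ x) := by
    unfold cylDelta
    fun_prop
  have h2 : ContDiff ℝ ∞ (fun x : Pt => 2 * rp * cylSigma κ x) := by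
    unfold cylSigma
    have hc : ContDiff ℝ ∞ (fun x : Pt => Real.cos (x 2)) :=
      Real.contDiff_cos.comp (contDiff_apply ℝ ℝ 2)
    fun_prop
  exact h1.div h2 fun x => mul_ne_zero (mul_ne_zero two_ne_zero hrp) (hσ x)

theorem isCylBackground_bgFields (hrp : 0 < rp) (hκ : |κ| < 1) :
    IsCylBackground rp κ cylRegion (bgFields rp κ) where
  tetrad _ _ _ _ := rfl
  conformalFactor _ _ := rfl
  solution :=
    have hr : (rp : ℂ) ≠ 0 := Complex.ofReal_ne_zero.mpr hrp.ne'
    { smooth_e := fun a μ _ hx =>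
        (contDiffAt_cylTetrad (sigC_ne hx) (sinC_ne hx) a μ).contDiffWithinAt
      smooth_conn := fun a b c _ hx =>
        (contDiffAt_bgConn (sigC_ne hx) (sinC_ne hx) a b c).contDiffWithinAt
      smooth_Xi := (contDiff_cylXi rp).contDiffOn
      smooth_s := (contDiff_bgFields_s hrp.ne').contDiffOn
      smooth_L := fun a b _ hx => (contDiffAt_bgSchouten (sigC_ne hx) a b).contDiffWithinAt
      smooth_d := fun a b c f _ hx => (hasFr_d (sigC_ne hx) a b c f).smooth.contDiffWithinAt
      admissible := fun _ hx => bgFields_admissible hκ hx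
      eq_torsion := fun _ hx a b μ => bgFields_torsion (sigC_ne hx) (sinC_ne hx) a b μ
      eq_curv := fun _ hx a b c f => bgFields_zeroCurv hr (sigC_ne hx) (sinC_ne hx) a b c f
      eq_Xi := fun _ hx a b => bgFields_zeroXi hr (sigC_ne hx) (sinC_ne hx) a b
      eq_s := fun _ hx a => bgFields_zeroS hr (sigC_ne hx) a
      eq_L := fun _ hx a b c => bgFields_zeroL hr (sigC_ne hx) (sinC_ne hx) a b c
      eq_d := fun _ hx a b c => bgFields_zeroD (sigC_ne hx) (sinC_ne hx) a b c }

end Existence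

/-! ### Uniqueness of the connection and of the curvature fields -/

namespace CEFEFields

section Uniqueness

variable {X Y : CEFEFields} {V : Set Pt} {x : Pt}

lemma dir_congr_fun {f g : Pt → ℂ} (h : f =ᶠ[𝓝 x] g) (a : Fin 4) : X.dir a f x = X.dir a g x := by
  simp only [dir, pd_congr h]

lemma dir_congr_frame (h : ∀ a μ, X.e a μ x = Y.e a μ x) (a : Fin 4) (f : Pt → ℂ) :
    X.dir a f x = Y.dir a f x := by
  simp only [dir, h]

lemma eventuallyEq_of_eqOn {f g : Pt → ℂ} (hV : IsOpen V) (hx : x ∈ V) (h : ∀ y ∈ V, f y = g y) :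
    f =ᶠ[𝓝 x] g :=
  (hV.mem_nhds hx : V ∈ 𝓝 x) |> fun hm => Filter.mem_of_superset hm h

/-- A metric torsion-free connection is determined by the frame. -/
lemma conn_unique (hV : IsOpen V) (hX : X.IsSolution V) (hY : Y.IsSolution V)
    (he : ∀ y ∈ V, ∀ a μ, X.e a μ y = Y.e a μ y) (hx : x ∈ V) (a b c : Fin 4) :
    X.conn a b c x = Y.conn a b c x := by
  have hdir : ∀ a b μ, X.dir a (X.e b μ) x = Y.dir a (Y.e b μ) x := fun a b μ => by
    rw [dir_congr_fun (eventuallyEq_of_eqOn hV hx fun y hy => he y hy b μ),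
      dir_congr_frame (he x hx)]
  -- Both torsions vanish and the frames agree, so the commutators `[e_a, e_b]` agree. Invertibility
  -- of the frame turns this into equality of the antisymmetrised connection coefficients.
  have key : ∀ a b c, (X.connUp a b c x - X.connUp b a c x)
      - (Y.connUp a b c x - Y.connUp b a c x) = 0 := by
    intro a b
    have hdet := (hX.admissible x hx).frame
    have := Matrix.eq_zero_of_vecMul_eq_zero hdet (v := fun c => (X.connUp a b c x
      - X.connUp b a c x) - (Y.connUp a b c x - Y.connUp b a c x)) (by
        funext μ
        have h1 := hX.eq_torsion x hx a b μ
        have h2 := hY.eq_torsion x hx a b μ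
        simp only [torsion, hdir, ← he x hx, Fin.sum_univ_four] at h1 h2
        simp only [Matrix.vecMul, dotProduct, Matrix.of_apply, Pi.zero_apply, Fin.sum_univ_four]
        linear_combination h2 - h1)
    exact fun c => congrFun this c
  have hsymm : ∀ a b c, X.conn a b c x - Y.conn a b c x = X.conn b a c x - Y.conn b a c x := by
    intro a b c
    have h0 := key a b 0
    have h1 := key a b 1
    have h2 := key a b 2
    have h3 := key a b 3
    simp only [connUp_zero, connUp_one, connUp_two, connUp_three] at h0 h1 h2 h3
    fin_cases c
    · simp only [Fin.zero_eta]
      linear_combination -h1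
    · simp only [Fin.mk_one]
      linear_combination -h0
    · simp only [Fin.reduceFinMk]
      linear_combination h3
    · simp only [Fin.reduceFinMk]
      linear_combination h2
  have hanti : ∀ a b c, X.conn a b c x - Y.conn a b c x = -(X.conn a c b x - Y.conn a c b x) := by
    intro a b c
    rw [(hX.admissible x hx).conn_metric a b c, (hY.admissible x hx).conn_metric a b c]
    ring
  -- The difference of the connections is symmetric in its first two and antisymmetric in its last
  -- two indices. Permuting the indices cyclically by alternating these symmetries shows that it
  -- equals its own negative.
  linear_combination (hsymm a b c + hanti b a c - hsymm b c a - hanti c b a + hsymm c a b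
    + hanti a c b) / 2

lemma riem_congr (hV : IsOpen V) (he : ∀ y ∈ V, ∀ a μ, X.e a μ y = Y.e a μ y)
    (hc : ∀ y ∈ V, ∀ a b c, X.conn a b c y = Y.conn a b c y) (hx : x ∈ V) (a b c d : Fin 4) :
    X.riem a b c d x = Y.riem a b c d x := by
  have hd : ∀ f a b c, X.dir f (X.conn a b c) x = Y.dir f (Y.conn a b c) x := fun f a b c => by
    rw [dir_congr_fun (eventuallyEq_of_eqOn hV hx fun y hy => hc y hy a b c),
      dir_congr_frame (he x hx)]
  simp only [riem, connUp, hd, hc x hx]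

/-- The Kulkarni–Nomizu product of the metric with a symmetric tensor is injective, even modulo
trace-free tensors. -/
lemma schouten_unique (hX : X.Admissible x) (hY : Y.Admissible x)
    (hr : ∀ a b c d, X.riem a b c d x = Y.riem a b c d x)
    (h1 : ∀ a b c d, X.zeroCurv a b c d x = 0) (h2 : ∀ a b c d, Y.zeroCurv a b c d x = 0)
    (b d : Fin 4) : X.L b d x = Y.L b d x := by
  -- Contraction of the difference of the two curvature decompositions over the first and third
  -- index. The Weyl parts are trace-free, and the factor 2 is the dimension minus two.
  have key : ∀ b d, 2 * (X.L b d x - Y.L b d x)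
      + eta b d * ∑ a, ∑ c, eta a c * (X.L a c x - Y.L a c x) = 0 := by
    intro b d
    have e : ∀ a c, X.XiC x * X.d a b c d x - Y.XiC x * Y.d a b c d x
        + (eta a c * (X.L b d x - Y.L b d x) - eta b c * (X.L a d x - Y.L a d x)
          + eta b d * (X.L a c x - Y.L a c x) - eta a d * (X.L b c x - Y.L b c x)) = 0 := by
      intro a c
      have e1 := h1 a b c d
      have e2 := h2 a b c d
      simp only [zeroCurv, hr] at e1 e2
      linear_combination e2 - e1
    have t1 := hX.d_trace b d
    have t2 := hY.d_trace b d
    have e01 := e 0 1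
    have e10 := e 1 0
    have e23 := e 2 3
    have e32 := e 3 2
    simp only [Fin.sum_univ_four, eta_values] at t1 t2 e01 e10 e23 e32 ⊢
    have f1 : -(eta b 1 * (X.L 0 d x - Y.L 0 d x)) - eta b 0 * (X.L 1 d x - Y.L 1 d x)
        + eta b 3 * (X.L 2 d x - Y.L 2 d x) + eta b 2 * (X.L 3 d x - Y.L 3 d x)
        = X.L b d x - Y.L b d x := by
      fin_cases b <;> simp [eta_values]
    have f2 : -(eta 0 d * (X.L b 1 x - Y.L b 1 x)) - eta 1 d * (X.L b 0 x - Y.L b 0 x)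
        + eta 2 d * (X.L b 3 x - Y.L b 3 x) + eta 3 d * (X.L b 2 x - Y.L b 2 x)
        = X.L b d x - Y.L b d x := by
      fin_cases d <;> simp [eta_values]
    linear_combination e23 + e32 - e01 - e10 - X.XiC x * t1 + Y.XiC x * t2 + f1 + f2
  -- A second contraction yields `2 + 4 = 6` times the trace, so the trace vanishes first and then
  -- the tensor itself.
  have htr : ∑ a, ∑ c, eta a c * (X.L a c x - Y.L a c x) = 0 := by
    have k01 := key 0 1
    have k10 := key 1 0
    have k23 := key 2 3
    have k32 := key 3 2
    simp only [Fin.sum_univ_four, eta_values] at k01 k10 k23 k32 ⊢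
    linear_combination (k23 + k32 - k01 - k10) / 6
  have := key b d
  rw [htr] at this
  linear_combination this / 2

end Uniqueness

end CEFEFields

/-! ### The background is unique -/

section Background

open CEFEFields

variable {rp κ : ℝ} {V : Set Pt} {B : CEFEFields} {x : Pt}

lemma IsSolution.mono {X : CEFEFields} {U V : Set Pt} (h : X.IsSolution U) (hVU : V ⊆ U) :
    X.IsSolution V where
  smooth_e a μ := (h.smooth_e a μ).mono hVU
  smooth_conn a b c := (h.smooth_conn a b c).mono hVU
  smooth_Xi := h.smooth_Xi.mono hVU
  smooth_s := h.smooth_s.mono hVU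
  smooth_L a b := (h.smooth_L a b).mono hVU
  smooth_d a b c f := (h.smooth_d a b c f).mono hVU
  admissible x hx := h.admissible x (hVU hx)
  eq_torsion x hx := h.eq_torsion x (hVU hx)
  eq_curv x hx := h.eq_curv x (hVU hx)
  eq_Xi x hx := h.eq_Xi x (hVU hx)
  eq_s x hx := h.eq_s x (hVU hx)
  eq_L x hx := h.eq_L x (hVU hx)
  eq_d x hx := h.eq_d x (hVU hx)

lemma IsCylBackground.dir_eq (hB : IsCylBackground rp κ V B) (hx : x ∈ V) (a : Fin 4)
    (f : Pt → ℂ) : B.dir a f x = frD κ a f x := by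
  simp only [CEFEFields.dir, frD, hB.tetrad x hx]

lemma IsCylBackground.XiC_eq (hB : IsCylBackground rp κ V B) (hx : x ∈ V) :
    B.XiC x = cylW x / rp := by
  rw [CEFEFields.XiC, hB.conformalFactor x hx, cylXi_eq]

lemma IsCylBackground.conn_eq (hrp : 0 < rp) (hκ : |κ| < 1) (hV : IsOpen V) (hVU : V ⊆ cylRegion)
    (hB : IsCylBackground rp κ V B) (hx : x ∈ V) (a b c : Fin 4) :
    B.conn a b c x = bgConn κ a b c x :=
  conn_unique hV hB.solution (IsSolution.mono (isCylBackground_bgFields hrp hκ).solution hVU)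
    (fun y hy a μ => hB.tetrad y hy a μ) hx a b c

lemma IsCylBackground.riem_eq (hrp : 0 < rp) (hκ : |κ| < 1) (hV : IsOpen V) (hVU : V ⊆ cylRegion)
    (hB : IsCylBackground rp κ V B) (hx : x ∈ V) (a b c d : Fin 4) :
    B.riem a b c d x = (bgFields rp κ).riem a b c d x :=
  riem_congr hV (fun y hy a μ => hB.tetrad y hy a μ)
    (fun _ hy => hB.conn_eq hrp hκ hV hVU hy) hx a b c d

lemma IsCylBackground.L_eq (hrp : 0 < rp) (hκ : |κ| < 1) (hV : IsOpen V) (hVU : V ⊆ cylRegion)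
    (hB : IsCylBackground rp κ V B) (hx : x ∈ V) (b d : Fin 4) :
    B.L b d x = bgSchouten κ b d x :=
  schouten_unique (hB.solution.admissible x hx) (bgFields_admissible (rp := rp) hκ (hVU hx))
    (hB.riem_eq hrp hκ hV hVU hx) (hB.solution.eq_curv x hx)
    ((isCylBackground_bgFields hrp hκ).solution.eq_curv x (hVU hx)) b d

/-- The curvature and Schouten tensors being known, only the product `Ξ d` is determined directly,
and `Ξ` vanishes at `T = 1`. -/
lemma IsCylBackground.d_eq (hrp : 0 < rp) (hκ : |κ| < 1) (hV : IsOpen V) (hVU : V ⊆ cylRegion)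
    (hB : IsCylBackground rp κ V B) (hx : x ∈ V) (a b c f : Fin 4) :
    B.d a b c f x = (bgFields rp κ).d a b c f x := by
  have hr : (rp : ℂ) ≠ 0 := Complex.ofReal_ne_zero.mpr hrp.ne'
  have hS := sigC_ne (hVU hx)
  have hmul : ∀ y ∈ V, cylW y * (B.d a b c f y - (bgFields rp κ).d a b c f y) = 0 := by
    intro y hy
    have h1 := hB.solution.eq_curv y hy a b c f
    have h2 := (isCylBackground_bgFields hrp hκ).solution.eq_curv y (hVU hy) a b c f
    simp only [zeroCurv, hB.riem_eq hrp hκ hV hVU hy, hB.L_eq hrp hκ hV hVU hy,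
      hB.XiC_eq hy, bgFields_XiC, bgFields_L] at h1 h2
    have h3 : cylW y / rp * (B.d a b c f y - (bgFields rp κ).d a b c f y) = 0 := by
      linear_combination h2 - h1
    rw [div_mul_eq_mul_div, div_eq_zero_iff] at h3
    exact h3.resolve_right hr
  -- At a zero of `w` the identity `w (d - d') = 0`, valid on the whole open set, is differentiated
  -- in `T`. Since `∂_T w = -ς ≠ 0`, it gives `d = d'` there as well.
  by_cases hw : cylW x = 0
  · have hd1 : ContDiffAt ℝ ∞ (B.d a b c f) x :=
      (hB.solution.smooth_d a b c f).contDiffAt (hV.mem_nhds hx)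
    have hd2 : ContDiffAt ℝ ∞ ((bgFields rp κ).d a b c f) x := (hasFr_d hS a b c f).smooth
    have hD : DifferentiableAt ℝ (fun y => B.d a b c f y - (bgFields rp κ).d a b c f y) x :=
      (hd1.sub hd2).differentiableAt (by simp)
    have h0 : pd 0 (fun y => cylW y * (B.d a b c f y - (bgFields rp κ).d a b c f y)) x = 0 := by
      rw [pd_congr (eventuallyEq_of_eqOn hV hx hmul), pd_const]
    rw [pd_mul (hasFr_W (κ := κ) hS).diff hD, hw, zero_mul, add_zero] at h0
    have h1 : pd 0 cylW x = -sigC x := by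
      have := (hasFr_W (κ := κ) hS).frD_eq 0
      simpa [frD, Fin.sum_univ_four, cylTetrad_zero, frW] using this
    rw [h1] at h0
    exact sub_eq_zero.mp ((mul_eq_zero.mp h0).resolve_left (neg_ne_zero.mpr hS))
  · exact sub_eq_zero.mp ((mul_eq_zero.mp (hmul x hx)).resolve_left hw)

end Background

/-! ### Second-order operators in coordinates -/

section SecondOrder

variable {κ : ℝ} {x : Pt} {u f g : Pt → ℂ}

lemma frD_add (hf : DifferentiableAt ℝ f x) (hg : DifferentiableAt ℝ g x) (a : Fin 4) :
    frD κ a (fun y => f y + g y) x = frD κ a f x + frD κ a g x := by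
  simp only [frD, pd_add hf hg, mul_add, Finset.sum_add_distrib]

lemma frD_mul (hf : DifferentiableAt ℝ f x) (hg : DifferentiableAt ℝ g x) (a : Fin 4) :
    frD κ a (fun y => f y * g y) x = frD κ a f x * g x + f x * frD κ a g x := by
  simp only [frD, pd_mul hf hg, Fin.sum_univ_four]
  ring

lemma frD_congr (h : f =ᶠ[𝓝 x] g) (a : Fin 4) : frD κ a f x = frD κ a g x := by
  simp only [frD, pd_congr h]

lemma differentiableAt_pd (hu : ContDiffAt ℝ 2 u x) (μ : Fin 4) : DifferentiableAt ℝ (pd μ u) x :=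
  (contDiffAt_pd (n := 1) hu μ).differentiableAt (by norm_num)

lemma differentiableAt_of_two (hu : ContDiffAt ℝ 2 u x) : DifferentiableAt ℝ u x :=
  hu.differentiableAt (by norm_num)

lemma differentiableAt_frD (hS : sigC x ≠ 0) (hs : sinC x ≠ 0) (hu : ContDiffAt ℝ 2 u x)
    (b : Fin 4) : DifferentiableAt ℝ (frD κ b u) x := by
  have : frD κ b u = fun y => ∑ μ, cylTetrad κ y b μ * pd μ u y := rfl
  rw [this]
  exact DifferentiableAt.fun_sum fun μ _ =>
    ((contDiffAt_cylTetrad hS hs b μ).differentiableAt (by simp)).mul (differentiableAt_pd hu μ)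

lemma frD_frD (hS : sigC x ≠ 0) (hs : sinC x ≠ 0) (hu : ContDiffAt ℝ 2 u x) (a b : Fin 4) :
    frD κ a (frD κ b u) x = ∑ μ, frD κ a (fun y => cylTetrad κ y b μ) x * pd μ u x
      + ∑ μ, ∑ ν, cylTetrad κ x a ν * cylTetrad κ x b μ * pd ν (pd μ u) x := by
  have he : ∀ μ, DifferentiableAt ℝ (fun y => cylTetrad κ y b μ) x := fun μ =>
    (contDiffAt_cylTetrad hS hs b μ).differentiableAt (by simp)
  have hp : ∀ μ, DifferentiableAt ℝ (fun y => cylTetrad κ y b μ * pd μ u y) x := fun μ =>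
    (he μ).mul (differentiableAt_pd hu μ)
  have h : frD κ b u = fun y => cylTetrad κ y b 0 * pd 0 u y + cylTetrad κ y b 1 * pd 1 u y
      + cylTetrad κ y b 2 * pd 2 u y + cylTetrad κ y b 3 * pd 3 u y := by
    funext y
    simp only [frD, Fin.sum_univ_four]
  rw [h, frD_add (((hp 0).fun_add (hp 1)).fun_add (hp 2)) (hp 3),
      frD_add ((hp 0).fun_add (hp 1)) (hp 2),
    frD_add (hp 0) (hp 1), frD_mul (he 0) (differentiableAt_pd hu 0),
    frD_mul (he 1) (differentiableAt_pd hu 1), frD_mul (he 2) (differentiableAt_pd hu 2),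
    frD_mul (he 3) (differentiableAt_pd hu 3)]
  have : ∀ μ, frD κ a (pd μ u) x = ∑ ν, cylTetrad κ x a ν * pd ν (pd μ u) x := fun μ => rfl
  simp only [this, Fin.sum_univ_four]
  ring

/-- The operator `(e_a + A₀)(e_b + A)`, with `A₀` evaluated at `x`. -/
def frOp (κ : ℝ) (a b : Fin 4) (A₀ : ℂ) (A : Pt → ℂ) (u : Pt → ℂ) (x : Pt) : ℂ :=
  frD κ a (fun y => frD κ b u y + A y * u y) x + A₀ * (frD κ b u x + A x * u x)

lemma frOp_eq (hS : sigC x ≠ 0) (hs : sinC x ≠ 0) (hu : ContDiffAt ℝ 2 u x) (a b : Fin 4) (A₀ : ℂ)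
    {A : Pt → ℂ} {v : Fin 4 → ℂ} (hA : HasFr κ A x v) :
    frOp κ a b A₀ A u x
      = ∑ μ, ∑ ν, cylTetrad κ x a ν * cylTetrad κ x b μ * pd ν (pd μ u) x
        + ∑ μ, (frD κ a (fun y => cylTetrad κ y b μ) x + A x * cylTetrad κ x a μ
          + A₀ * cylTetrad κ x b μ) * pd μ u x
        + (v a + A₀ * A x) * u x := by
  have hd := differentiableAt_of_two hu
  rw [frOp, frD_add (differentiableAt_frD hS hs hu b) (hA.diff.fun_mul hd), frD_frD hS hs hu,
    frD_mul hA.diff hd, hA.frD_eq]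
  have h : ∀ c, frD κ c u x = ∑ μ, cylTetrad κ x c μ * pd μ u x := fun c => rfl
  simp only [h, Fin.sum_univ_four]
  ring

lemma pd_sinC (μ : Fin 4) : pd μ sinC x = if μ = 2 then cosC x else 0 :=
  pd_coord (Real.hasDerivAt_sin (x 2)) μ

lemma pd_cosC (μ : Fin 4) : pd μ cosC x = if μ = 2 then -sinC x else 0 := by
  refine (pd_coord (Real.hasDerivAt_cos (x 2)) μ).trans ?_
  simp [sinC]

lemma ethEthbar_eq (s : ℤ) (hs : sinC x ≠ 0) (hu : ContDiffAt ℝ 2 u x) :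
    ethEthbar s u x = pd 2 (pd 2 u) x + pd 3 (pd 3 u) x / sinC x ^ 2
      + cosC x / sinC x * pd 2 u x + 2 * s * Complex.I * cosC x / sinC x ^ 2 * pd 3 u x
      - s * (1 + (s - 1) * cosC x ^ 2) / sinC x ^ 2 * u x := by
  have hsd : DifferentiableAt ℝ sinC x := (hasFr_sin (κ := 0)).diff
  have hcd : DifferentiableAt ℝ cosC x := (hasFr_cos (κ := 0)).diff
  have hd := differentiableAt_of_two hu
  have hi : DifferentiableAt ℝ (fun y => (sinC y)⁻¹) x := hsd.inv hs
  have hK : ∀ c : ℂ, DifferentiableAt ℝ (fun _ : Pt => c) x := fun c => differentiableAt_const c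
  have hb : ethbar s u = fun y => -pd 2 u y + (Complex.I * (sinC y)⁻¹ * pd 3 u y
      + -(s : ℂ) * (cosC y * (sinC y)⁻¹ * u y)) := by
    funext y
    simp only [ethbar, sinC, cosC, Complex.ofReal_div]
    ring
  have key : ∀ μ, pd μ (ethbar s u) x = -pd μ (pd 2 u) x
      + ((Complex.I * (-pd μ sinC x / sinC x ^ 2)) * pd 3 u x
        + Complex.I * (sinC x)⁻¹ * pd μ (pd 3 u) x
      + -(s : ℂ) * ((pd μ cosC x * (sinC x)⁻¹ + cosC x * (-pd μ sinC x / sinC x ^ 2)) * u x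
        + cosC x * (sinC x)⁻¹ * pd μ u x)) := by
    intro μ
    rw [hb, pd_add (differentiableAt_pd hu 2).fun_neg ((((hK _).fun_mul hi).fun_mul
      (differentiableAt_pd hu 3)).fun_add ((hK _).fun_mul ((hcd.fun_mul hi).fun_mul hd))), pd_neg,
      pd_add (((hK _).fun_mul hi).fun_mul (differentiableAt_pd hu 3)) ((hK _).fun_mul ((hcd.fun_mul
        hi).fun_mul hd)),
      pd_mul ((hK _).fun_mul hi) (differentiableAt_pd hu 3), pd_mul (hK _) hi,
      pd_mul (hK _) ((hcd.fun_mul hi).fun_mul hd), pd_mul (hcd.fun_mul hi) hd, pd_mul hcd hi,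
      pd_inv hsd hs]
    simp only [pd_const]
    ring
  have h3 : ethEthbar s u x = -(pd 2 (ethbar s u) x + Complex.I / sinC x * pd 3 (ethbar s u) x
      - ((s : ℂ) - 1) * (cosC x / sinC x) * ethbar s u x) := by
    simp only [ethEthbar, eth, sinC, cosC, Complex.ofReal_div]
    push_cast
    ring
  have hI := Complex.I_sq
  have hsin := sinC_sq x
  have hsin3 := sinC_pow_three x
  rw [h3, key, key, hb, pd_comm hu 3 2]
  simp only [pd_sinC, pd_cosC, if_true, show (3 : Fin 4) ≠ 2 by decide, if_false]
  generalize pd 2 (pd 2 u) x = u22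
  generalize pd 2 (pd 3 u) x = u23
  generalize pd 3 (pd 3 u) x = u33
  generalize pd 2 u x = u2
  generalize pd 3 u x = u3
  generalize u x = u0
  generalize sinC x = sn at *
  generalize cosC x = c at *
  generalize Complex.I = j at *
  field_simp
  ring_nf
  simp only [hI, hsin, hsin3]
  ring

end SecondOrder

/-! ### The coefficients of the master operator -/

section MasterCoefficients

variable {κ : ℝ} {x : Pt}

/-- This and the next lemmas translate the coefficients into the symbols of the tetrad calculus. The
changed signs come from `imk κ ^ 2 = -κ²`, the quotients `w / ς` from `1 - T`. -/
lemma coefATT_eq (s : ℤ) (hS : sigC x ≠ 0) : coefATT κ s x = (2 - (s : ℂ) ^ 2 / 4) *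
    (2 * cylFC κ x * (1 - imk κ ^ 2 * cylW x ^ 2)
      + cylFC κ x ^ 2 * imk κ ^ 2 * sinC x ^ 2 * (cylW x / sigC x)
      - sigC x * cylW x * ((1 - cylW x) * (1 + imk κ ^ 2 * cylW x))) * (cylW x / sigC x) := by
  simp only [coefATT, one_sub_T hS, show (x 1 : ℂ) = sigC x from rfl,
    show ((Real.sin (x 2) : ℝ) : ℂ) = sinC x from rfl,
    show ((cylF κ (x 1) : ℝ) : ℂ) = cylFC κ x from rfl, imk_sq]
  field_simp
  ring

lemma coefATς_eq (s : ℤ) (hS : sigC x ≠ 0) : coefATς κ s x = 2 * (2 - (s : ℂ) ^ 2 / 4) * sigC x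
    * cylFC κ x * (1 - imk κ ^ 2 * (-cylFC κ x * sinC x ^ 2 + sigC x * cylW x)
      * (cylW x / sigC x)) := by
  simp only [coefATς, one_sub_T hS, show (x 1 : ℂ) = sigC x from rfl,
    show ((Real.sin (x 2) : ℝ) : ℂ) = sinC x from rfl,
    show ((cylF κ (x 1) : ℝ) : ℂ) = cylFC κ x from rfl, imk_sq]
  field_simp
  ring

lemma coefATφ_eq (s : ℤ) (hS : sigC x ≠ 0) : coefATφ κ s x = 2 * (2 - (s : ℂ) ^ 2 / 4)
    * (-Complex.I * imk κ) * (-cylFC κ x + sigC x * cylW x) * cylW x := by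
  simp only [coefATφ, one_sub_T hS, show (x 1 : ℂ) = sigC x from rfl,
    show ((cylF κ (x 1) : ℝ) : ℂ) = cylFC κ x from rfl, kappa_eq κ]
  field_simp

lemma coefAςς_eq (s : ℤ) : coefAςς κ s x = (2 - (s : ℂ) ^ 2 / 4)
    * cylFC κ x ^ 2 * imk κ ^ 2 * sinC x ^ 2 * sigC x ^ 2 := by
  simp only [coefAςς, show (x 1 : ℂ) = sigC x from rfl,
    show ((Real.sin (x 2) : ℝ) : ℂ) = sinC x from rfl,
    show ((cylF κ (x 1) : ℝ) : ℂ) = cylFC κ x from rfl, imk_sq]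
  ring

lemma coefAςφ_eq (s : ℤ) : coefAςφ κ s x = 2 * Complex.I * (2 - (s : ℂ) ^ 2 / 4)
    * cylFC κ x * imk κ * sigC x ^ 2 := by
  simp only [coefAςφ, show (x 1 : ℂ) = sigC x from rfl,
    show ((cylF κ (x 1) : ℝ) : ℂ) = cylFC κ x from rfl, kappa_eq κ]
  ring

lemma coefA_eq (s : ℤ) : coefA s x = -(2 - (s : ℂ) ^ 2 / 4) * sigC x ^ 2 := rfl

lemma coefBς_eq (s : ℤ) (hS : sigC x ≠ 0) : coefBς κ s x = cylFC κ x * imk κ * sigC x ^ 2 *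
    (2 * s * cosC x + (4 + 4 * s - (s : ℂ) ^ 2 / 2) * imk κ * cylW x
      - imk κ * sinC x ^ 2 * (2 * cylFC κ x * s / sigC x
        - (2 - (s : ℂ) ^ 2 / 4) * cylFC' κ x)) := by
  have hI := Complex.I_sq
  simp only [coefBς, one_sub_T hS, show (x 1 : ℂ) = sigC x from rfl,
    show ((Real.sin (x 2) : ℝ) : ℂ) = sinC x from rfl,
    show ((Real.cos (x 2) : ℝ) : ℂ) = cosC x from rfl,
    show ((cylF κ (x 1) : ℝ) : ℂ) = cylFC κ x from rfl,
    show ((deriv (cylF κ) (x 1) : ℝ) : ℂ) = cylFC' κ x from rfl, kappa_eq κ]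
  field_simp
  ring_nf
  simp only [hI]
  ring

lemma coefBφ_eq (s : ℤ) (hS : sigC x ≠ 0) : coefBφ κ s x = -2 * Complex.I * imk κ * sigC x *
    (cylFC κ x * s + (-2 - 2 * s + (s : ℂ) ^ 2 / 4) * sigC x * cylW x) := by
  simp only [coefBφ, one_sub_T hS, show (x 1 : ℂ) = sigC x from rfl,
    show ((cylF κ (x 1) : ℝ) : ℂ) = cylFC κ x from rfl, kappa_eq κ]
  field_simp

lemma coefBT_eq (s : ℤ) (hS : sigC x ≠ 0) : coefBT κ s x =
    -(cylFC κ x ^ 2 * (4 + 2 * s - (s : ℂ) ^ 2 / 2) * imk κ ^ 2 * sinC x ^ 2 * (cylW x / sigC x))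
    + (2 + s - (s : ℂ) ^ 2 / 4) * sigC x * cylW x
      * (2 + (-3 - imk κ ^ 2 * (-3 + 4 * cylW x)) * cylW x)
    + cylFC κ x * (-4 - 2 * s + (s : ℂ) ^ 2 / 2
      + 2 * imk κ * s * cosC x * cylW x
        - 4 * (-2 - 3 * s / 2 + (s : ℂ) ^ 2 / 4) * imk κ ^ 2 * cylW x ^ 2
      - (-2 + (s : ℂ) ^ 2 / 4) * imk κ ^ 2 * sinC x ^ 2 * cylW x * cylFC' κ x) := by
  have hI := Complex.I_sq
  simp only [coefBT, one_sub_T hS, show (x 1 : ℂ) = sigC x from rfl,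
    show ((Real.sin (x 2) : ℝ) : ℂ) = sinC x from rfl,
    show ((Real.cos (x 2) : ℝ) : ℂ) = cosC x from rfl,
    show ((cylF κ (x 1) : ℝ) : ℂ) = cylFC κ x from rfl,
    show ((deriv (cylF κ) (x 1) : ℝ) : ℂ) = cylFC' κ x from rfl, kappa_eq κ]
  field_simp
  ring_nf
  simp only [hI]
  ring

lemma coefC_eq (s : ℤ) (hS : sigC x ≠ 0) : coefC κ s x =
    cylFC κ x ^ 2 * s * (1 + s) * imk κ ^ 2 * sinC x ^ 2
    - 2 * cylFC κ x * imk κ * ((s : ℂ) ^ 2 * cosC x * sigC x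
        + s * (1 + 2 * s) * imk κ * sigC x * cylW x
        + s * imk κ * sinC x ^ 2 * cylFC' κ x * sigC x / 2)
    + sigC x ^ 2 * (-2 * s + (2 + 3 * s + 7 * (s : ℂ) ^ 2 / 4)
      * (1 - imk κ ^ 2 * (1 - 2 * cylW x)) * cylW x) := by
  have hI := Complex.I_sq
  simp only [coefC, one_sub_T hS, show (x 1 : ℂ) = sigC x from rfl,
    show ((Real.sin (x 2) : ℝ) : ℂ) = sinC x from rfl,
    show ((Real.cos (x 2) : ℝ) : ℂ) = cosC x from rfl,
    show ((cylF κ (x 1) : ℝ) : ℂ) = cylFC κ x from rfl,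
    show ((deriv (cylF κ) (x 1) : ℝ) : ℂ) = cylFC' κ x from rfl, kappa_eq κ]
  field_simp
  ring_nf
  simp only [hI]
  ring

end MasterCoefficients

/-! ### Matching of the second- and first-order coefficients. -/

section MasterMatching

variable {rp κ : ℝ} {x : Pt}

/-- The factor `2 ς² Σ` between the master operator and the Teukolsky operators. -/
def masterFactor (κ : ℝ) (x : Pt) : ℂ :=
  2 * sigC x ^ 2 * ((1 - imk κ * cylW x * cosC x) * (1 + imk κ * cylW x * cosC x))

lemma masterFactor_eq (κ : ℝ) (x : Pt) :
    masterFactor κ x = 2 * (x 1 : ℂ) ^ 2 * (cylSigma κ x : ℂ) := by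
  rw [masterFactor, sigma_eq]
  rfl

-- All three operators have, up to a factor, the principal symbol of the wave operator, `ℓ ⊗ k - m ⊗
-- m*` symmetrised. The spin weight enters only through `q = 2 - s²/4`, which is 1 for `s = ±2` and
-- 2 for `s = 0`, in accordance with the factor 2 in `-g⁻¹ = ℓ ⊗ k + k ⊗ ℓ - m ⊗ m* - m* ⊗ m`. The
-- vanishing entries say that no mixed derivative involving `θ` occurs and that the `θφ` term of `ð
-- ð̄` is absent.
set_option maxHeartbeats 4000000 in
lemma principal_part (s : ℤ) (hS : sigC x ≠ 0) (hs : sinC x ≠ 0) :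
    coefATT κ s x = (2 - (s : ℂ) ^ 2 / 4)
      * masterFactor κ x * (cylTetrad κ x 0 0 * cylTetrad κ x 1 0
        - cylTetrad κ x 2 0 * cylTetrad κ x 3 0) ∧
    coefATς κ s x = (2 - (s : ℂ) ^ 2 / 4)
      * masterFactor κ x * (cylTetrad κ x 0 0 * cylTetrad κ x 1 1
        + cylTetrad κ x 0 1 * cylTetrad κ x 1 0
      - cylTetrad κ x 2 0 * cylTetrad κ x 3 1 - cylTetrad κ x 2 1 * cylTetrad κ x 3 0) ∧
    0 = (2 - (s : ℂ) ^ 2 / 4)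
      * masterFactor κ x * (cylTetrad κ x 0 0 * cylTetrad κ x 1 2
        + cylTetrad κ x 0 2 * cylTetrad κ x 1 0
      - cylTetrad κ x 2 0 * cylTetrad κ x 3 2 - cylTetrad κ x 2 2 * cylTetrad κ x 3 0) ∧
    coefATφ κ s x = (2 - (s : ℂ) ^ 2 / 4)
      * masterFactor κ x * (cylTetrad κ x 0 0 * cylTetrad κ x 1 3
        + cylTetrad κ x 0 3 * cylTetrad κ x 1 0
      - cylTetrad κ x 2 0 * cylTetrad κ x 3 3 - cylTetrad κ x 2 3 * cylTetrad κ x 3 0) ∧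
    coefAςς κ s x = (2 - (s : ℂ) ^ 2 / 4)
      * masterFactor κ x * (cylTetrad κ x 0 1 * cylTetrad κ x 1 1
        - cylTetrad κ x 2 1 * cylTetrad κ x 3 1) ∧
    0 = (2 - (s : ℂ) ^ 2 / 4)
      * masterFactor κ x * (cylTetrad κ x 0 1 * cylTetrad κ x 1 2
        + cylTetrad κ x 0 2 * cylTetrad κ x 1 1
      - cylTetrad κ x 2 1 * cylTetrad κ x 3 2 - cylTetrad κ x 2 2 * cylTetrad κ x 3 1) ∧
    coefAςφ κ s x = (2 - (s : ℂ) ^ 2 / 4)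
      * masterFactor κ x * (cylTetrad κ x 0 1 * cylTetrad κ x 1 3
        + cylTetrad κ x 0 3 * cylTetrad κ x 1 1
      - cylTetrad κ x 2 1 * cylTetrad κ x 3 3 - cylTetrad κ x 2 3 * cylTetrad κ x 3 1) ∧
    coefA s x = (2 - (s : ℂ) ^ 2 / 4)
      * masterFactor κ x * (cylTetrad κ x 0 2 * cylTetrad κ x 1 2
        - cylTetrad κ x 2 2 * cylTetrad κ x 3 2) ∧
    0 = (2 - (s : ℂ) ^ 2 / 4)
      * masterFactor κ x * (cylTetrad κ x 0 2 * cylTetrad κ x 1 3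
        + cylTetrad κ x 0 3 * cylTetrad κ x 1 2
      - cylTetrad κ x 2 2 * cylTetrad κ x 3 3 - cylTetrad κ x 2 3 * cylTetrad κ x 3 2) ∧
    coefA s x / sinC x ^ 2 = (2 - (s : ℂ) ^ 2 / 4)
      * masterFactor κ x * (cylTetrad κ x 0 3 * cylTetrad κ x 1 3
        - cylTetrad κ x 2 3 * cylTetrad κ x 3 3) := by
  have hz := zeta_ne κ x
  have hzb := zetaBar_ne κ x
  have hh := hsq_sq
  have hsin := sinC_sq x
  have hI := Complex.I_sq
  have hI3 := Complex.I_pow_three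
  have hI4 := Complex.I_pow_four
  have hsin3 := sinC_pow_three x
  have hsin4 := sinC_pow_four x
  refine ⟨?_, ?_, ?_, ?_, ?_, ?_, ?_, ?_, ?_, ?_⟩
  all_goals
    simp only [coefATT_eq _ hS, coefATς_eq _ hS, coefATφ_eq _ hS, coefAςς_eq, coefAςφ_eq, coefA_eq,
      coefBς_eq _ hS, coefBφ_eq _ hS, coefBT_eq _ hS, coefC_eq _ hS, masterFactor]
    simp only [cylTetrad_zero, cylTetrad_one, cylTetrad_two, cylTetrad_three, kappa_eq κ,
      one_sub_T hS, bgPiBar, bgPi, bgTau, bgTauBar, bgRho, bgRhoBar, bgMu, bgMuBar, bgGammaRe,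
      bgGammaIm, bgAlphaSum, bgAlphaSumBar, bgAlphaDiff, bgAlphaDiffBar, bgSchouten01,
      bgSchouten23, bgPhi, frSig, frW, frTh, frZ, frU,
      Matrix.cons_val, deltaC, mul_zero, zero_mul, add_zero, zero_add, sub_zero, zero_sub, zero_div,
      neg_zero, mul_one, one_mul]
    generalize sigC x = S at *
    generalize sinC x = sn at *
    generalize cosC x = c at *
    generalize cylW x = w at *
    generalize cylFC κ x = F at *
    generalize cylFC' κ x = F' at *
    generalize imk κ = K at *
    generalize hsq = h at *
    generalize Complex.I = j at *
    try field_simp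
    try ring_nf
    try simp only [hh, hsin, hsin3, hsin4, hI, hI3, hI4]
    try ring

/-- First-order coefficients of `(e_a + A₀)(e_b + A) - (e_c + C₀)(e_d + C)`. -/
def firstCoef (κ : ℝ) (x : Pt) (a b c d : Fin 4) (A₀ A C₀ C : ℂ) (μ : Fin 4) : ℂ :=
  (frD κ a (fun y => cylTetrad κ y b μ) x + A * cylTetrad κ x a μ + A₀ * cylTetrad κ x b μ)
    - (frD κ c (fun y => cylTetrad κ y d μ) x + C * cylTetrad κ x c μ + C₀ * cylTetrad κ x d μ)

-- On the right, the terms with `coefA` are the first-order part of `ð ð̄`: `cot θ ∂_θ` and `2 i s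
-- cos θ / sin² θ ∂_φ`, here with `s = 2`. The arguments of `firstCoef` are the coefficients in
-- `teuk0` with `ε = 0`.
set_option maxHeartbeats 8000000 in
lemma firstCoef_zero (hS : sigC x ≠ 0) (hs : sinC x ≠ 0) :
    masterFactor κ x * firstCoef κ x 0 1 2 3
      (-4 * bgRho κ x - bgRhoBar κ x)
      (-2 * (bgGammaIm κ x + bgGammaRe κ x) + bgMu κ x)
      (bgPiBar κ x - (bgAlphaDiffBar κ x + bgAlphaSumBar κ x) / 2
      - 3 * ((bgAlphaSumBar κ x - bgAlphaDiffBar κ x) / 2) - 4 * bgTau κ x)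
      (bgPi κ x - 2 * (bgAlphaDiff κ x + bgAlphaSum κ x)) 0
      = coefBT κ 2 x ∧
    masterFactor κ x * firstCoef κ x 0 1 2 3
      (-4 * bgRho κ x - bgRhoBar κ x)
      (-2 * (bgGammaIm κ x + bgGammaRe κ x) + bgMu κ x)
      (bgPiBar κ x - (bgAlphaDiffBar κ x + bgAlphaSumBar κ x) / 2
      - 3 * ((bgAlphaSumBar κ x - bgAlphaDiffBar κ x) / 2) - 4 * bgTau κ x)
      (bgPi κ x - 2 * (bgAlphaDiff κ x + bgAlphaSum κ x)) 1
      = coefBς κ 2 x ∧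
    masterFactor κ x * firstCoef κ x 0 1 2 3
      (-4 * bgRho κ x - bgRhoBar κ x)
      (-2 * (bgGammaIm κ x + bgGammaRe κ x) + bgMu κ x)
      (bgPiBar κ x - (bgAlphaDiffBar κ x + bgAlphaSumBar κ x) / 2
      - 3 * ((bgAlphaSumBar κ x - bgAlphaDiffBar κ x) / 2) - 4 * bgTau κ x)
      (bgPi κ x - 2 * (bgAlphaDiff κ x + bgAlphaSum κ x)) 2
      = coefA 2 x * (cosC x / sinC x) ∧
    masterFactor κ x * firstCoef κ x 0 1 2 3
      (-4 * bgRho κ x - bgRhoBar κ x)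
      (-2 * (bgGammaIm κ x + bgGammaRe κ x) + bgMu κ x)
      (bgPiBar κ x - (bgAlphaDiffBar κ x + bgAlphaSumBar κ x) / 2
      - 3 * ((bgAlphaSumBar κ x - bgAlphaDiffBar κ x) / 2) - 4 * bgTau κ x)
      (bgPi κ x - 2 * (bgAlphaDiff κ x + bgAlphaSum κ x)) 3
      = coefBφ κ 2 x + coefA 2 x * (2 * (2) * Complex.I * cosC x / sinC x ^ 2) := by
  have hz := zeta_ne κ x
  have hzb := zetaBar_ne κ x
  have hh := hsq_sq
  have hsin := sinC_sq x
  have hI := Complex.I_sq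
  have hI3 := Complex.I_pow_three
  have hI4 := Complex.I_pow_four
  have hsin3 := sinC_pow_three x
  have hsin4 := sinC_pow_four x
  refine ⟨?_, ?_, ?_, ?_⟩
  all_goals
    simp only [firstCoef, masterFactor, coefATT_eq _ hS, coefATς_eq _ hS, coefATφ_eq _ hS,
      coefAςς_eq, coefAςφ_eq, coefA_eq,
      coefBς_eq _ hS, coefBφ_eq _ hS, coefBT_eq _ hS, coefC_eq _ hS,
      (hasFr_tetrad_zero _).frD_eq, (hasFr_tetrad_one_zero hS).frD_eq,
      (hasFr_tetrad_one_one hS).frD_eq, (hasFr_tetrad_one_three hS).frD_eq,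
      (hasFr_tetrad_two_zero hS).frD_eq, (hasFr_tetrad_two_one hS).frD_eq, frD_tetrad_one_two,
      (hasFr_tetrad_two_two hS).frD_eq, (hasFr_tetrad_two_three hS hs).frD_eq,
      (hasFr_tetrad_three_zero hS).frD_eq, (hasFr_tetrad_three_one hS).frD_eq,
      (hasFr_tetrad_three_two hS).frD_eq, (hasFr_tetrad_three_three hS hs).frD_eq,
      Int.cast_neg, Int.cast_ofNat]
    simp only [cylTetrad_zero, cylTetrad_one, cylTetrad_two, cylTetrad_three, kappa_eq κ,
      one_sub_T hS, bgPiBar, bgPi, bgTau, bgTauBar, bgRho, bgRhoBar, bgMu, bgMuBar, bgGammaRe,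
      bgGammaIm, bgAlphaSum, bgAlphaSumBar, bgAlphaDiff, bgAlphaDiffBar, bgSchouten01,
      bgSchouten23, bgPhi, frSig, frW, frTh, frZ, frU,
      Matrix.cons_val, deltaC, mul_zero, zero_mul, add_zero, zero_add, sub_zero, zero_sub, zero_div,
      neg_zero, mul_one, one_mul]
    generalize sigC x = S at *
    generalize sinC x = sn at *
    generalize cosC x = c at *
    generalize cylW x = w at *
    generalize cylFC κ x = F at *
    generalize cylFC' κ x = F' at *
    generalize imk κ = K at *
    generalize hsq = h at *
    generalize Complex.I = j at *
    try field_simp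
    try ring_nf
    try simp only [hh, hsin, hsin3, hsin4, hI, hI3, hI4]
    try ring

-- The coefficients here are those of `teuk4` after conjugation with `ζ⁴`: the outer ones lack `4μ`
-- and `4π`, and the inner ones contain `3ρ` and `3τ` instead of `-ρ` and `-τ`.
set_option maxHeartbeats 8000000 in
lemma firstCoef_four (hS : sigC x ≠ 0) (hs : sinC x ≠ 0) :
    masterFactor κ x * firstCoef κ x 1 0 3 2
      (3 * ((bgGammaIm κ x + bgGammaRe κ x) / 2) - (bgGammaRe κ x - bgGammaIm κ x) / 2
      + bgMuBar κ x)
      (3 * bgRho κ x)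
      (-bgTauBar κ x + (bgAlphaSum κ x - bgAlphaDiff κ x) / 2
      + 3 * ((bgAlphaDiff κ x + bgAlphaSum κ x) / 2))
      (3 * bgTau κ x + 2 * (bgAlphaSumBar κ x - bgAlphaDiffBar κ x)) 0
      = coefBT κ (-2) x ∧
    masterFactor κ x * firstCoef κ x 1 0 3 2
      (3 * ((bgGammaIm κ x + bgGammaRe κ x) / 2) - (bgGammaRe κ x - bgGammaIm κ x) / 2
      + bgMuBar κ x)
      (3 * bgRho κ x)
      (-bgTauBar κ x + (bgAlphaSum κ x - bgAlphaDiff κ x) / 2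
      + 3 * ((bgAlphaDiff κ x + bgAlphaSum κ x) / 2))
      (3 * bgTau κ x + 2 * (bgAlphaSumBar κ x - bgAlphaDiffBar κ x)) 1
      = coefBς κ (-2) x ∧
    masterFactor κ x * firstCoef κ x 1 0 3 2
      (3 * ((bgGammaIm κ x + bgGammaRe κ x) / 2) - (bgGammaRe κ x - bgGammaIm κ x) / 2
      + bgMuBar κ x)
      (3 * bgRho κ x)
      (-bgTauBar κ x + (bgAlphaSum κ x - bgAlphaDiff κ x) / 2
      + 3 * ((bgAlphaDiff κ x + bgAlphaSum κ x) / 2))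
      (3 * bgTau κ x + 2 * (bgAlphaSumBar κ x - bgAlphaDiffBar κ x)) 2
      = coefA (-2) x * (cosC x / sinC x) ∧
    masterFactor κ x * firstCoef κ x 1 0 3 2
      (3 * ((bgGammaIm κ x + bgGammaRe κ x) / 2) - (bgGammaRe κ x - bgGammaIm κ x) / 2
      + bgMuBar κ x)
      (3 * bgRho κ x)
      (-bgTauBar κ x + (bgAlphaSum κ x - bgAlphaDiff κ x) / 2
      + 3 * ((bgAlphaDiff κ x + bgAlphaSum κ x) / 2))
      (3 * bgTau κ x + 2 * (bgAlphaSumBar κ x - bgAlphaDiffBar κ x)) 3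
      = coefBφ κ (-2) x + coefA (-2) x * (2 * (-2) * Complex.I * cosC x / sinC x ^ 2) := by
  have hz := zeta_ne κ x
  have hzb := zetaBar_ne κ x
  have hh := hsq_sq
  have hsin := sinC_sq x
  have hI := Complex.I_sq
  have hI3 := Complex.I_pow_three
  have hI4 := Complex.I_pow_four
  have hsin3 := sinC_pow_three x
  have hsin4 := sinC_pow_four x
  refine ⟨?_, ?_, ?_, ?_⟩
  all_goals
    simp only [firstCoef, masterFactor, coefATT_eq _ hS, coefATς_eq _ hS, coefATφ_eq _ hS,
      coefAςς_eq, coefAςφ_eq, coefA_eq,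
      coefBς_eq _ hS, coefBφ_eq _ hS, coefBT_eq _ hS, coefC_eq _ hS,
      (hasFr_tetrad_zero _).frD_eq, (hasFr_tetrad_one_zero hS).frD_eq,
      (hasFr_tetrad_one_one hS).frD_eq, (hasFr_tetrad_one_three hS).frD_eq,
      (hasFr_tetrad_two_zero hS).frD_eq, (hasFr_tetrad_two_one hS).frD_eq, frD_tetrad_one_two,
      (hasFr_tetrad_two_two hS).frD_eq, (hasFr_tetrad_two_three hS hs).frD_eq,
      (hasFr_tetrad_three_zero hS).frD_eq, (hasFr_tetrad_three_one hS).frD_eq,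
      (hasFr_tetrad_three_two hS).frD_eq, (hasFr_tetrad_three_three hS hs).frD_eq,
      Int.cast_neg, Int.cast_ofNat]
    simp only [cylTetrad_zero, cylTetrad_one, cylTetrad_two, cylTetrad_three, kappa_eq κ,
      one_sub_T hS, bgPiBar, bgPi, bgTau, bgTauBar, bgRho, bgRhoBar, bgMu, bgMuBar, bgGammaRe,
      bgGammaIm, bgAlphaSum, bgAlphaSumBar, bgAlphaDiff, bgAlphaDiffBar, bgSchouten01,
      bgSchouten23, bgPhi, frSig, frW, frTh, frZ, frU,
      Matrix.cons_val, deltaC, mul_zero, zero_mul, add_zero, zero_add, sub_zero, zero_sub, zero_div,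
      neg_zero, mul_one, one_mul]
    generalize sigC x = S at *
    generalize sinC x = sn at *
    generalize cosC x = c at *
    generalize cylW x = w at *
    generalize cylFC κ x = F at *
    generalize cylFC' κ x = F' at *
    generalize imk κ = K at *
    generalize hsq = h at *
    generalize Complex.I = j at *
    try field_simp
    try ring_nf
    try simp only [hh, hsin, hsin3, hsin4, hI, hI3, hI4]
    try ring

end MasterMatching

/-! ### Matching of the zeroth-order coefficients. -/

section ZerothOrder

variable {rp κ : ℝ} {x : Pt}

-- The subtracted term on the right is the zeroth-order part of `ð ð̄`, which `coefC` does not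
-- contain. The factor `cylW x / rp` is `Ξ`, so `r₊` cancels against the one in `φ₂`.
set_option maxHeartbeats 8000000 in
lemma zerothCoef_zero (hr : (rp : ℂ) ≠ 0) (hS : sigC x ≠ 0) (hs : sinC x ≠ 0) :
    masterFactor κ x * ((frD κ 0 (fun y => -2 * (bgGammaIm κ y + bgGammaRe κ y) + bgMu κ y) x
      + (-4 * bgRho κ x - bgRhoBar κ x) * (-2 * (bgGammaIm κ x + bgGammaRe κ x) + bgMu κ x))
      - (frD κ 2 (fun y => bgPi κ y - 2 * (bgAlphaDiff κ y + bgAlphaSum κ y)) x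
      + (bgPiBar κ x - (bgAlphaDiffBar κ x + bgAlphaSumBar κ x) / 2
      - 3 * ((bgAlphaSumBar κ x - bgAlphaDiffBar κ x) / 2) - 4 * bgTau κ x) * (bgPi κ x
        - 2 * (bgAlphaDiff κ x + bgAlphaSum κ x)))
      - 3 * (cylW x / rp) * bgPhi rp κ x)
      = coefC κ 2 x - coefA 2 x * ((2) * (1 + ((2) - 1) * cosC x ^ 2) / sinC x ^ 2) := by
  have hz := zeta_ne κ x
  have hzb := zetaBar_ne κ x
  have hh := hsq_sq
  have hsin := sinC_sq x
  have hI := Complex.I_sq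
  have hI3 := Complex.I_pow_three
  have hI4 := Complex.I_pow_four
  have hsin3 := sinC_pow_three x
  have hsin4 := sinC_pow_four x
  have hA := ((HasFr.const κ x (-2)).mul ((hasFr_gammaIm hS).add (hasFr_gammaRe hS))).add (hasFr_mu
      hS)
  have hC := (hasFr_pi hS).sub ((HasFr.const κ x 2).mul ((hasFr_alphaDiff hS hs).add
      (hasFr_alphaSum hS)))
  rw [hA.frD_eq, hC.frD_eq]
  clear hA hC
  simp only [masterFactor, coefA_eq, coefC_eq _ hS, Int.cast_neg, Int.cast_ofNat]
  simp only [cylTetrad_zero, cylTetrad_one, cylTetrad_two, cylTetrad_three, kappa_eq κ,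
      one_sub_T hS, bgPiBar, bgPi, bgTau, bgTauBar, bgRho, bgRhoBar, bgMu, bgMuBar, bgGammaRe,
      bgGammaIm, bgAlphaSum, bgAlphaSumBar, bgAlphaDiff, bgAlphaDiffBar, bgSchouten01,
      bgSchouten23, bgPhi, frSig, frW, frTh, frZ, frU,
      Matrix.cons_val, deltaC, mul_zero, zero_mul, add_zero, zero_add, sub_zero, zero_sub, zero_div,
      neg_zero, mul_one, one_mul]
  generalize sigC x = S at *
  generalize sinC x = sn at *
  generalize cosC x = c at *
  generalize cylW x = w at *
  generalize cylFC κ x = F at *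
  generalize cylFC' κ x = F' at *
  generalize imk κ = K at *
  generalize hsq = h at *
  generalize Complex.I = j at *
  try field_simp
  try ring_nf
  try simp only [hh, hsin, hsin3, hsin4, hI, hI3, hI4]
  try ring

set_option maxHeartbeats 8000000 in
lemma zerothCoef_four (hr : (rp : ℂ) ≠ 0) (hS : sigC x ≠ 0) (hs : sinC x ≠ 0) :
    masterFactor κ x * ((frD κ 1 (fun y => 3 * bgRho κ y) x
      + (3 * ((bgGammaIm κ x + bgGammaRe κ x) / 2) - (bgGammaRe κ x - bgGammaIm κ x) / 2
      + bgMuBar κ x) * (3 * bgRho κ x))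
      - (frD κ 3 (fun y => 3 * bgTau κ y + 2 * (bgAlphaSumBar κ y - bgAlphaDiffBar κ y)) x
      + (-bgTauBar κ x + (bgAlphaSum κ x - bgAlphaDiff κ x) / 2
      + 3 * ((bgAlphaDiff κ x + bgAlphaSum κ x) / 2)) * (3 * bgTau κ x + 2 * (bgAlphaSumBar κ x
        - bgAlphaDiffBar κ x)))
      - 3 * (cylW x / rp) * bgPhi rp κ x)
      = coefC κ (-2) x - coefA (-2) x * ((-2) * (1 + ((-2) - 1) * cosC x ^ 2) / sinC x ^ 2) := by
  have hz := zeta_ne κ x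
  have hzb := zetaBar_ne κ x
  have hh := hsq_sq
  have hsin := sinC_sq x
  have hI := Complex.I_sq
  have hI3 := Complex.I_pow_three
  have hI4 := Complex.I_pow_four
  have hsin3 := sinC_pow_three x
  have hsin4 := sinC_pow_four x
  have hA := (HasFr.const κ x 3).mul (hasFr_rho hS)
  have hC := ((HasFr.const κ x 3).mul (hasFr_tau hS)).add ((HasFr.const κ x 2).mul
    ((hasFr_alphaSumBar hS).sub (hasFr_alphaDiffBar hS hs)))
  rw [hA.frD_eq, hC.frD_eq]
  clear hA hC
  simp only [masterFactor, coefA_eq, coefC_eq _ hS, Int.cast_neg, Int.cast_ofNat]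
  simp only [cylTetrad_zero, cylTetrad_one, cylTetrad_two, cylTetrad_three, kappa_eq κ,
      one_sub_T hS, bgPiBar, bgPi, bgTau, bgTauBar, bgRho, bgRhoBar, bgMu, bgMuBar, bgGammaRe,
      bgGammaIm, bgAlphaSum, bgAlphaSumBar, bgAlphaDiff, bgAlphaDiffBar, bgSchouten01,
      bgSchouten23, bgPhi, frSig, frW, frTh, frZ, frU,
      Matrix.cons_val, deltaC, mul_zero, zero_mul, add_zero, zero_add, sub_zero, zero_sub, zero_div,
      neg_zero, mul_one, one_mul]
  generalize sigC x = S at *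
  generalize sinC x = sn at *
  generalize cosC x = c at *
  generalize cylW x = w at *
  generalize cylFC κ x = F at *
  generalize cylFC' κ x = F' at *
  generalize imk κ = K at *
  generalize hsq = h at *
  generalize Complex.I = j at *
  try field_simp
  try ring_nf
  try simp only [hh, hsin, hsin3, hsin4, hI, hI3, hI4]
  try ring

end ZerothOrder

/-! ### The master operators of spin weight ±2 along the tetrad. -/

section MasterOperator

variable {rp κ : ℝ} {x : Pt} {u : Pt → ℂ}

set_option maxHeartbeats 1000000 in
/-- The master operator of spin weight `2` along the background tetrad. -/
lemma masterOp_zero (hr : (rp : ℂ) ≠ 0) (hS : sigC x ≠ 0) (hs : sinC x ≠ 0)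
    (hu : ContDiffAt ℝ 2 u x) :
    masterOp κ 2 u x = masterFactor κ x * (frOp κ 0 1 (-4 * bgRho κ x - bgRhoBar κ x)
        (fun y => -2 * (bgGammaIm κ y + bgGammaRe κ y) + bgMu κ y) u x
      - frOp κ 2 3 (bgPiBar κ x - (bgAlphaDiffBar κ x + bgAlphaSumBar κ x) / 2
      - 3 * ((bgAlphaSumBar κ x - bgAlphaDiffBar κ x) / 2) - 4 * bgTau κ x)
        (fun y => bgPi κ y - 2 * (bgAlphaDiff κ y + bgAlphaSum κ y)) u x
      - 3 * (cylW x / rp) * bgPhi rp κ x * u x) := by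
  have hA := ((HasFr.const κ x (-2)).mul ((hasFr_gammaIm hS).add (hasFr_gammaRe hS))).add (hasFr_mu
      hS)
  have hC := (hasFr_pi hS).sub ((HasFr.const κ x 2).mul ((hasFr_alphaDiff hS hs).add
      (hasFr_alphaSum hS)))
  obtain ⟨p00, p01, p02, p03, p11, p12, p13, p22, p23, p33⟩ := principal_part (κ := κ) 2 hS hs
  obtain ⟨f0, f1, f2, f3⟩ := firstCoef_zero (κ := κ) hS hs
  have h0 := zerothCoef_zero (κ := κ) hr hS hs
  rw [frOp_eq hS hs hu _ _ _ hA, frOp_eq hS hs hu _ _ _ hC, ← hA.frD_eq, ← hC.frD_eq, masterOp,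
    ethEthbar_eq _ hs hu]
  clear hA hC
  simp only [firstCoef] at f0 f1 f2 f3
  simp only [Fin.sum_univ_four, pd_comm hu 1 0, pd_comm hu 2 0, pd_comm hu 3 0, pd_comm hu 2 1,
    pd_comm hu 3 1, pd_comm hu 3 2]
  push_cast at *
  -- With second derivatives in a fixed order, both sides are linear in the same fifteen quantities:
  -- ten second derivatives, four first derivatives and `u`. Each coefficient identity is multiplied
  -- by its quantity.
  linear_combination pd 0 (pd 0 u) x * p00 + pd 0 (pd 1 u) x * p01 + pd 0 (pd 2 u) x * p02
    + pd 0 (pd 3 u) x * p03 + pd 1 (pd 1 u) x * p11 + pd 1 (pd 2 u) x * p12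
    + pd 1 (pd 3 u) x * p13 + pd 2 (pd 2 u) x * p22 + pd 2 (pd 3 u) x * p23
    + pd 3 (pd 3 u) x * p33 - pd 0 u x * f0 - pd 1 u x * f1 - pd 2 u x * f2 - pd 3 u x * f3
    - u x * h0

set_option maxHeartbeats 1000000 in
/-- The master operator of spin weight `-2` along the background tetrad. -/
lemma masterOp_four (hr : (rp : ℂ) ≠ 0) (hS : sigC x ≠ 0) (hs : sinC x ≠ 0)
    (hu : ContDiffAt ℝ 2 u x) :
    masterOp κ (-2) u x = masterFactor κ x * (frOp κ 1 0 (3 * ((bgGammaIm κ x + bgGammaRe κ x) / 2)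
      - (bgGammaRe κ x - bgGammaIm κ x) / 2
      + bgMuBar κ x)
        (fun y => 3 * bgRho κ y) u x
      - frOp κ 3 2 (-bgTauBar κ x + (bgAlphaSum κ x - bgAlphaDiff κ x) / 2
      + 3 * ((bgAlphaDiff κ x + bgAlphaSum κ x) / 2))
        (fun y => 3 * bgTau κ y + 2 * (bgAlphaSumBar κ y - bgAlphaDiffBar κ y)) u x
      - 3 * (cylW x / rp) * bgPhi rp κ x * u x) := by
  have hA := (HasFr.const κ x 3).mul (hasFr_rho hS)
  have hC := ((HasFr.const κ x 3).mul (hasFr_tau hS)).add ((HasFr.const κ x 2).mul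
    ((hasFr_alphaSumBar hS).sub (hasFr_alphaDiffBar hS hs)))
  obtain ⟨p00, p01, p02, p03, p11, p12, p13, p22, p23, p33⟩ := principal_part (κ := κ) (-2) hS hs
  obtain ⟨f0, f1, f2, f3⟩ := firstCoef_four (κ := κ) hS hs
  have h0 := zerothCoef_four (κ := κ) hr hS hs
  rw [frOp_eq hS hs hu _ _ _ hA, frOp_eq hS hs hu _ _ _ hC, ← hA.frD_eq, ← hC.frD_eq, masterOp,
    ethEthbar_eq _ hs hu]
  clear hA hC
  simp only [firstCoef] at f0 f1 f2 f3
  simp only [Fin.sum_univ_four, pd_comm hu 1 0, pd_comm hu 2 0, pd_comm hu 3 0, pd_comm hu 2 1,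
    pd_comm hu 3 1, pd_comm hu 3 2]
  push_cast at *
  linear_combination pd 0 (pd 0 u) x * p00 + pd 0 (pd 1 u) x * p01 + pd 0 (pd 2 u) x * p02
    + pd 0 (pd 3 u) x * p03 + pd 1 (pd 1 u) x * p11 + pd 1 (pd 2 u) x * p12
    + pd 1 (pd 3 u) x * p13 + pd 2 (pd 2 u) x * p22 + pd 2 (pd 3 u) x * p23
    + pd 3 (pd 3 u) x * p33 - pd 0 u x * f0 - pd 1 u x * f1 - pd 2 u x * f2 - pd 3 u x * f3
    - u x * h0

end MasterOperator

/-! ### Spin weight zero and the conformally invariant wave equation. -/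

section ScalarField

open CEFEFields

variable {rp κ : ℝ} {x : Pt} {u : Pt → ℂ}

/-- First-order coefficients of `-∇^a ∇_a` on the background. -/
def waveCoef (κ : ℝ) (x : Pt) (μ : Fin 4) : ℂ :=
  frD κ 0 (fun y => cylTetrad κ y 1 μ) x + frD κ 1 (fun y => cylTetrad κ y 0 μ) x
    - frD κ 2 (fun y => cylTetrad κ y 3 μ) x - frD κ 3 (fun y => cylTetrad κ y 2 μ) x
    - ((bgGammaRe κ x - bgMu κ x - bgMuBar κ x) * cylTetrad κ x 0 μ
      + (bgRho κ x + bgRhoBar κ x) * cylTetrad κ x 1 μ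
      + (bgPi κ x - bgTauBar κ x - bgAlphaDiff κ x) * cylTetrad κ x 2 μ
      + (bgPiBar κ x - bgTau κ x - bgAlphaDiffBar κ x) * cylTetrad κ x 3 μ)

-- For `s = 0` the operator `ð ð̄` contributes only `cot θ ∂_θ` at first order and nothing at zeroth
-- order. The last identity is the curvature term, since `2 (L₂₃ - L₀₁) = R / 6` by
-- `ricciScalar_eq`.
set_option maxHeartbeats 8000000 in
lemma waveCoef_eq (hS : sigC x ≠ 0) (hs : sinC x ≠ 0) :
    masterFactor κ x * waveCoef κ x 0 = coefBT κ 0 x ∧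
    masterFactor κ x * waveCoef κ x 1 = coefBς κ 0 x ∧
    masterFactor κ x * waveCoef κ x 2 = coefA 0 x * (cosC x / sinC x) ∧
    masterFactor κ x * waveCoef κ x 3 = coefBφ κ 0 x ∧
    masterFactor κ x * (2 * (bgSchouten23 κ x - bgSchouten01 κ x)) = coefC κ 0 x := by
  have hz := zeta_ne κ x
  have hzb := zetaBar_ne κ x
  have hh := hsq_sq
  have hsin := sinC_sq x
  have hI := Complex.I_sq
  have hI3 := Complex.I_pow_three
  have hI4 := Complex.I_pow_four
  have hsin3 := sinC_pow_three x
  have hsin4 := sinC_pow_four x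
  refine ⟨?_, ?_, ?_, ?_, ?_⟩
  all_goals
    simp only [waveCoef, masterFactor, coefATT_eq _ hS, coefATς_eq _ hS, coefATφ_eq _ hS,
      coefAςς_eq, coefAςφ_eq, coefA_eq,
      coefBς_eq _ hS, coefBφ_eq _ hS, coefBT_eq _ hS, coefC_eq _ hS,
      (hasFr_tetrad_zero _).frD_eq, (hasFr_tetrad_one_zero hS).frD_eq,
      (hasFr_tetrad_one_one hS).frD_eq, (hasFr_tetrad_one_three hS).frD_eq,
      (hasFr_tetrad_two_zero hS).frD_eq, (hasFr_tetrad_two_one hS).frD_eq, frD_tetrad_one_two,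
      (hasFr_tetrad_two_two hS).frD_eq, (hasFr_tetrad_two_three hS hs).frD_eq,
      (hasFr_tetrad_three_zero hS).frD_eq, (hasFr_tetrad_three_one hS).frD_eq,
      (hasFr_tetrad_three_two hS).frD_eq, (hasFr_tetrad_three_three hS hs).frD_eq,
      Int.cast_zero]
    simp only [cylTetrad_zero, cylTetrad_one, cylTetrad_two, cylTetrad_three, kappa_eq κ,
      one_sub_T hS, bgPiBar, bgPi, bgTau, bgTauBar, bgRho, bgRhoBar, bgMu, bgMuBar, bgGammaRe,
      bgGammaIm, bgAlphaSum, bgAlphaSumBar, bgAlphaDiff, bgAlphaDiffBar, bgSchouten01,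
      bgSchouten23, bgPhi, frSig, frW, frTh, frZ, frU,
      Matrix.cons_val, deltaC, mul_zero, zero_mul, add_zero, zero_add, sub_zero, zero_sub, zero_div,
      neg_zero, mul_one, one_mul]
    generalize sigC x = S at *
    generalize sinC x = sn at *
    generalize cosC x = c at *
    generalize cylW x = w at *
    generalize cylFC κ x = F at *
    generalize cylFC' κ x = F' at *
    generalize imk κ = K at *
    generalize hsq = h at *
    generalize Complex.I = j at *
    try field_simp
    try ring_nf
    try simp only [hh, hsin, hsin3, hsin4, hI, hI3, hI4]
    try ring

/-- The Weyl part is trace-free, so `R` is six times the trace of the Schouten tensor, and in a null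
frame that trace is `2 (L₂₃ - L₀₁)`. -/
lemma ricciScalar_eq {X : CEFEFields} (hX : X.Admissible x)
    (h : ∀ a b c d, X.zeroCurv a b c d x = 0) :
    X.ricciScalar x = 12 * (X.L 2 3 x - X.L 0 1 x) := by
  have hr : ∀ a b c d, X.riem a b c d x = X.XiC x * X.d a b c d x
      + (eta a c * X.L b d x - eta b c * X.L a d x + eta b d * X.L a c x
        - eta a d * X.L b c x) := fun a b c d => sub_eq_zero.mp (h a b c d)
  have t01 := hX.d_trace 0 1
  have t10 := hX.d_trace 1 0
  have t23 := hX.d_trace 2 3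
  have t32 := hX.d_trace 3 2
  have l10 := hX.L_symm 1 0
  have l32 := hX.L_symm 3 2
  simp only [ricciScalar, hr, Fin.sum_univ_four, eta_values] at *
  linear_combination X.XiC x * (t23 + t32 - t01 - t10) + 6 * l32 - 6 * l10

set_option maxHeartbeats 1000000 in
lemma masterOp_wave {V : Set Pt} {B : CEFEFields} (hrp : 0 < rp) (hκ : |κ| < 1) (hV : IsOpen V)
    (hVU : V ⊆ cylRegion) (hB : IsCylBackground rp κ V B) (hx : x ∈ V)
    (hu : ContDiffAt ℝ 2 u x) :
    masterOp κ 0 u x = -masterFactor κ x * (B.box u x - B.ricciScalar x / 6 * u x) := by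
  have hS := sigC_ne (hVU hx)
  have hs := sinC_ne (hVU hx)
  obtain ⟨p00, p01, p02, p03, p11, p12, p13, p22, p23, p33⟩ := principal_part (κ := κ) 0 hS hs
  obtain ⟨f0, f1, f2, f3, h0⟩ := waveCoef_eq (κ := κ) hS hs
  have hdd : ∀ a b, B.dir a (B.dir b u) x
      = ∑ μ, frD κ a (fun y => cylTetrad κ y b μ) x * pd μ u x
      + ∑ μ, ∑ ν, cylTetrad κ x a ν * cylTetrad κ x b μ * pd ν (pd μ u) x := fun a b => by
    rw [dir_congr_fun (eventuallyEq_of_eqOn hV hx fun y hy => hB.dir_eq hy b u), hB.dir_eq hx,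
      frD_frD hS hs hu]
  have hd : ∀ a, B.dir a u x = ∑ μ, cylTetrad κ x a μ * pd μ u x := fun a => hB.dir_eq hx a u
  rw [ricciScalar_eq (hB.solution.admissible x hx) (hB.solution.eq_curv x hx)]
  simp only [hB.L_eq hrp hκ hV hVU hx, bgSchouten, box, hess, hdd, hd]
  simp only [Fin.sum_univ_four, eta_values, connUp_zero, connUp_one,
    connUp_two, connUp_three, hB.conn_eq hrp hκ hV hVU hx, bgConn, Matrix.cons_val, Pi.neg_apply,
    Pi.zero_apply, zero_mul, zero_add, add_zero, mul_zero, neg_zero, sub_zero, neg_neg]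
  rw [masterOp, ethEthbar_eq _ hs hu]
  simp only [waveCoef] at f0 f1 f2 f3
  simp only [Fin.sum_univ_four, pd_comm hu 1 0, pd_comm hu 2 0, pd_comm hu 3 0, pd_comm hu 2 1,
    pd_comm hu 3 1, pd_comm hu 3 2]
  push_cast at *
  linear_combination pd 0 (pd 0 u) x * p00 + pd 0 (pd 1 u) x * p01 + pd 0 (pd 2 u) x * p02
    + pd 0 (pd 3 u) x * p03 + pd 1 (pd 1 u) x * p11 + pd 1 (pd 2 u) x * p12
    + pd 1 (pd 3 u) x * p13 + pd 2 (pd 2 u) x * p22 + pd 2 (pd 3 u) x * p23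
    + pd 3 (pd 3 u) x * p33 - pd 0 u x * f0 - pd 1 u x * f1 - pd 2 u x * f2 - pd 3 u x * f3
    - u x * h0

end ScalarField

/-! ### Newman–Penrose scalars of the background -/

namespace IsCylBackground

open CEFEFields

variable {rp κ : ℝ} {V : Set Pt} {B : CEFEFields} {x : Pt} {u : Pt → ℂ}

/-- The spin coefficients of the background. -/
lemma spinCoefficients_eq (hrp : 0 < rp) (hκ : |κ| < 1) (hV : IsOpen V) (hVU : V ⊆ cylRegion)
    (hB : IsCylBackground rp κ V B) (hx : x ∈ V) :
    B.npKappa x = 0 ∧ B.npSigma x = 0 ∧ B.npNu x = 0 ∧ B.npLambda x = 0 ∧ B.npEps x = 0 ∧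
    B.npRho x = bgRho κ x ∧ B.npTau x = bgTau κ x ∧ B.npPi x = bgPi κ x ∧ B.npMu x = bgMu κ x ∧
    B.npGamma x = (bgGammaIm κ x + bgGammaRe κ x) / 2 ∧
    B.npAlpha x = (bgAlphaDiff κ x + bgAlphaSum κ x) / 2 ∧
    B.npBeta x = (bgAlphaSumBar κ x - bgAlphaDiffBar κ x) / 2 := by
  have h := hB.conn_eq hrp hκ hV hVU hx
  refine ⟨?_, ?_, ?_, ?_, ?_, ?_, ?_, ?_, ?_, ?_, ?_, ?_⟩
  all_goals
    simp [npKappa, npSigma, npNu, npLambda, npEps, npRho, npTau, npPi, npMu, npGamma, npAlpha,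
      npBeta, h, bgConn]
  all_goals ring

/-- The Weyl scalars of the background. -/
lemma weylScalars_eq (hrp : 0 < rp) (hκ : |κ| < 1) (hV : IsOpen V) (hVU : V ⊆ cylRegion)
    (hB : IsCylBackground rp κ V B) (hx : x ∈ V) :
    B.phi0 x = 0 ∧ B.phi1 x = 0 ∧ B.phi3 x = 0 ∧ B.phi4 x = 0 ∧ B.phi2 x = bgPhi rp κ x := by
  have h : ∀ a b c f, B.d a b c f x
      = typeD a b c f * bgPhi rp κ x + typeDBar a b c f * bgPhiBar rp κ x :=
    hB.d_eq hrp hκ hV hVU hx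
  refine ⟨?_, ?_, ?_, ?_, ?_⟩
  · rw [phi0, h, show typeD 0 2 0 2 = 0 by decide, show typeDBar 0 2 0 2 = 0 by decide]
    simp
  · rw [phi1, h, show typeD 0 1 0 2 = 0 by decide, show typeDBar 0 1 0 2 = 0 by decide]
    simp
  · rw [phi3, h, show typeD 0 1 3 1 = 0 by decide, show typeDBar 0 1 3 1 = 0 by decide]
    simp
  · rw [phi4, h, show typeD 1 3 1 3 = 0 by decide, show typeDBar 1 3 1 3 = 0 by decide]
    simp
  · rw [phi2, h, show typeD 0 2 3 1 = 1 by decide, show typeDBar 0 2 3 1 = 0 by decide]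
    simp

lemma _root_.CylTeukolsky.bgPhi_eq (rp κ : ℝ) (x : Pt) :
    bgPhi rp κ x = -(kerrMass rp κ : ℂ) / cylZeta κ x ^ 3 := by
  have hz := zeta_ne κ x
  rw [bgPhi, zeta_eq, kerrMass, imk_sq]
  push_cast
  field_simp
  ring

/-- By uniqueness of the background every coefficient may be replaced by its closed form; `ε`
vanishes in this gauge, so its terms disappear. -/
lemma teuk0_eq (hrp : 0 < rp) (hκ : |κ| < 1) (hV : IsOpen V) (hVU : V ⊆ cylRegion)
    (hB : IsCylBackground rp κ V B) (hx : x ∈ V) (u : Pt → ℂ) :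
    B.teuk0 u x = frOp κ 0 1 (-4 * bgRho κ x - bgRhoBar κ x)
        (fun y => -2 * (bgGammaIm κ y + bgGammaRe κ y) + bgMu κ y) u x
      - frOp κ 2 3 (bgPiBar κ x - (bgAlphaDiffBar κ x + bgAlphaSumBar κ x) / 2
          - 3 * ((bgAlphaSumBar κ x - bgAlphaDiffBar κ x) / 2) - 4 * bgTau κ x)
        (fun y => bgPi κ y - 2 * (bgAlphaDiff κ y + bgAlphaSum κ y)) u x
      - 3 * (cylW x / rp) * bgPhi rp κ x * u x := by
  -- The inner operators are rewritten on all of `V`, not only at `x`, because the outer derivative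
  -- acts on them.
  have hp : ∀ y ∈ V, B.dir 1 u y + (-4 * B.npGamma y + B.npMu y) * u y
      = frD κ 1 u y + (-2 * (bgGammaIm κ y + bgGammaRe κ y) + bgMu κ y) * u y := fun y hy => by
    simp only [hB.dir_eq hy, hB.spinCoefficients_eq hrp hκ hV hVU hy]
    ring
  have hq : ∀ y ∈ V, B.dir 3 u y + (B.npPi y - 4 * B.npAlpha y) * u y
      = frD κ 3 u y + (bgPi κ y - 2 * (bgAlphaDiff κ y + bgAlphaSum κ y)) * u y := fun y hy => by
    simp only [hB.dir_eq hy, hB.spinCoefficients_eq hrp hκ hV hVU hy]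
    ring
  simp only [teuk0]
  rw [dir_congr_fun (eventuallyEq_of_eqOn hV hx hp), dir_congr_fun (eventuallyEq_of_eqOn hV hx hq),
    hp x hx, hq x hx, hB.dir_eq hx, hB.dir_eq hx, hB.XiC_eq hx, frOp, frOp]
  simp only [hB.spinCoefficients_eq hrp hκ hV hVU hx, hB.weylScalars_eq hrp hκ hV hVU hx,
    star_div₀, star_add, star_bgRho, star_bgPi, star_bgAlphaDiff, star_bgAlphaSum,
    star_zero, star_ofNat]
  ring

lemma masterOp_teuk0 (hrp : 0 < rp) (hκ : |κ| < 1) (hV : IsOpen V) (hVU : V ⊆ cylRegion)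
    (hB : IsCylBackground rp κ V B) (hx : x ∈ V) (hu : ContDiffAt ℝ 2 u x) :
    masterOp κ 2 u x = masterFactor κ x * B.teuk0 u x := by
  rw [hB.teuk0_eq hrp hκ hV hVU hx, masterOp_zero (Complex.ofReal_ne_zero.mpr hrp.ne')
    (sigC_ne (hVU hx)) (sinC_ne (hVU hx)) hu]

/-- Conjugation by `ζ⁴`. -/
lemma frD_zeta_pow_mul {f : Pt → ℂ} (hS : sigC x ≠ 0) (hf : DifferentiableAt ℝ f x) (a : Fin 4) :
    frD κ a (fun y => (1 - imk κ * cylW y * cosC y) ^ 4 * f y) x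
      = (1 - imk κ * cylW x * cosC x) ^ 4
        * (frD κ a f x + 4 * (frZ κ x a / (1 - imk κ * cylW x * cosC x)) * f x) := by
  have hz := zeta_ne κ x
  have h := (hasFr_zeta (κ := κ) hS).pow 4
  rw [frD_mul h.diff hf, h.frD_eq]
  push_cast
  field_simp
  ring

/-- The logarithmic derivatives of the Killing–Yano coefficient `ζ` along `ℓ, k, m, m*` are `-ρ, μ,
-τ, π`. They explain both the weight `ζ⁴` of the master function and the behaviour of `φ₂`, a
constant multiple of `ζ⁻³`. -/
lemma frZ_div_zero (κ : ℝ) (x : Pt) :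
    frZ κ x 0 / (1 - imk κ * cylW x * cosC x) = -bgRho κ x := by
  simp only [frZ, bgRho, Matrix.cons_val]
  ring

lemma frZ_div_one (κ : ℝ) (x : Pt) :
    frZ κ x 1 / (1 - imk κ * cylW x * cosC x) = bgMu κ x := by
  simp only [frZ, bgMu, deltaC, Matrix.cons_val]
  rw [neg_div, div_div]
  congr 2 <;> ring

lemma frZ_div_two (κ : ℝ) (x : Pt) :
    frZ κ x 2 / (1 - imk κ * cylW x * cosC x) = -bgTau κ x := by
  simp only [frZ, bgTau, Matrix.cons_val]
  rw [neg_neg, div_div]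
  congr 1 <;> ring

lemma frZ_div_three (κ : ℝ) (x : Pt) :
    frZ κ x 3 / (1 - imk κ * cylW x * cosC x) = bgPi κ x := by
  simp only [frZ, bgPi, Matrix.cons_val]
  rw [div_div]
  congr 1 <;> ring

lemma eventually_contDiffAt_two (hu : ContDiffAt ℝ 2 u x) :
    ∀ᶠ y in 𝓝 x, ContDiffAt ℝ 2 u y :=
  hu.eventually (by decide)

/-- Conjugation of `(e_a + A₀)(e_b + A)` by `ζ⁴`. -/
lemma frOp_zeta_pow_mul (hS : sigC x ≠ 0) (hs : sinC x ≠ 0) (hu : ContDiffAt ℝ 2 u x)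
    (a b : Fin 4) (A₀ : ℂ) {A A' : Pt → ℂ} {v : Fin 4 → ℂ} (hA : HasFr κ A' x v)
    (hAA : ∀ y, A' y = A y + 4 * (frZ κ y b / (1 - imk κ * cylW y * cosC y))) :
    frOp κ a b A₀ A (fun y => (1 - imk κ * cylW y * cosC y) ^ 4 * u y) x
      = (1 - imk κ * cylW x * cosC x) ^ 4
        * frOp κ a b (A₀ + 4 * (frZ κ x a / (1 - imk κ * cylW x * cosC x))) A' u x := by
  have h : ∀ y, sigC y ≠ 0 → DifferentiableAt ℝ u y →
      frD κ b (fun y => (1 - imk κ * cylW y * cosC y) ^ 4 * u y) y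
        + A y * ((1 - imk κ * cylW y * cosC y) ^ 4 * u y)
      = (1 - imk κ * cylW y * cosC y) ^ 4 * (frD κ b u y + A' y * u y) := fun y hy hd => by
    rw [frD_zeta_pow_mul hy hd, hAA]
    ring
  have hev : (fun y => frD κ b (fun y => (1 - imk κ * cylW y * cosC y) ^ 4 * u y) y
        + A y * ((1 - imk κ * cylW y * cosC y) ^ 4 * u y))
      =ᶠ[𝓝 x] fun y => (1 - imk κ * cylW y * cosC y) ^ 4 * (frD κ b u y + A' y * u y) := by
    filter_upwards [eventually_sigC_ne hS, eventually_contDiffAt_two hu] with y hy hd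
    exact h y hy (differentiableAt_of_two hd)
  rw [frOp, frOp, h x hS (differentiableAt_of_two hu), frD_congr hev, frD_zeta_pow_mul hS
    ((differentiableAt_frD hS hs hu b).fun_add (hA.diff.fun_mul (differentiableAt_of_two hu)))]
  ring

lemma teuk4_eq (hrp : 0 < rp) (hκ : |κ| < 1) (hV : IsOpen V) (hVU : V ⊆ cylRegion)
    (hB : IsCylBackground rp κ V B) (hx : x ∈ V) (u : Pt → ℂ) :
    B.teuk4 u x = frOp κ 1 0 (3 * ((bgGammaIm κ x + bgGammaRe κ x) / 2)
          - (bgGammaRe κ x - bgGammaIm κ x) / 2 + bgMuBar κ x + 4 * bgMu κ x)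
        (fun y => -bgRho κ y) u x
      - frOp κ 3 2 (-bgTauBar κ x + (bgAlphaSum κ x - bgAlphaDiff κ x) / 2
          + 3 * ((bgAlphaDiff κ x + bgAlphaSum κ x) / 2) + 4 * bgPi κ x)
        (fun y => -bgTau κ y + 2 * (bgAlphaSumBar κ y - bgAlphaDiffBar κ y)) u x
      - 3 * (cylW x / rp) * bgPhi rp κ x * u x := by
  have hp : ∀ y ∈ V, B.dir 0 u y + (4 * B.npEps y - B.npRho y) * u y
      = frD κ 0 u y + -bgRho κ y * u y := fun y hy => by
    simp only [hB.dir_eq hy, hB.spinCoefficients_eq hrp hκ hV hVU hy]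
    ring
  have hq : ∀ y ∈ V, B.dir 2 u y + (-B.npTau y + 4 * B.npBeta y) * u y
      = frD κ 2 u y + (-bgTau κ y + 2 * (bgAlphaSumBar κ y - bgAlphaDiffBar κ y)) * u y :=
    fun y hy => by
    simp only [hB.dir_eq hy, hB.spinCoefficients_eq hrp hκ hV hVU hy]
    ring
  simp only [teuk4]
  rw [dir_congr_fun (eventuallyEq_of_eqOn hV hx hp), dir_congr_fun (eventuallyEq_of_eqOn hV hx hq),
    hp x hx, hq x hx, hB.dir_eq hx, hB.dir_eq hx, hB.XiC_eq hx, frOp, frOp]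
  simp only [hB.spinCoefficients_eq hrp hκ hV hVU hx, hB.weylScalars_eq hrp hκ hV hVU hx,
    star_div₀, star_add, star_sub, star_bgMu, star_bgTau, star_bgAlphaDiffBar,
    star_bgAlphaSumBar, star_bgGammaRe, star_bgGammaIm, star_ofNat]
  ring

/-- Moving `ζ⁴` through both factors adds four times its logarithmic derivative: the inner
coefficients pass from `3ρ`, `3τ` to `-ρ`, `-τ`, and the outer ones gain `4μ` and `4π`. This
recovers exactly `teuk4`. -/
lemma masterOp_teuk4 (hrp : 0 < rp) (hκ : |κ| < 1) (hV : IsOpen V) (hVU : V ⊆ cylRegion)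
    (hB : IsCylBackground rp κ V B) (hx : x ∈ V) (hu : ContDiffAt ℝ 2 u x) :
    masterOp κ (-2) (fun y => cylZeta κ y ^ 4 * u y) x
      = masterFactor κ x * cylZeta κ x ^ 4 * B.teuk4 u x := by
  have hS := sigC_ne (hVU hx)
  have hs := sinC_ne (hVU hx)
  have hz : (fun y => cylZeta κ y ^ 4 * u y)
      = fun y => (1 - imk κ * cylW y * cosC y) ^ 4 * u y := by
    funext y
    rw [zeta_eq]
  have hc : ContDiffAt ℝ 2 (fun y => (1 - imk κ * cylW y * cosC y) ^ 4 * u y) x :=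
    (((hasFr_zeta (κ := κ) hS).pow 4).smooth.of_le (WithTop.coe_le_coe.mpr le_top)).mul hu
  rw [hz, zeta_eq, hB.teuk4_eq hrp hκ hV hVU hx, masterOp_four
    (Complex.ofReal_ne_zero.mpr hrp.ne') hS hs hc,
    frOp_zeta_pow_mul hS hs hu 1 0 _ (hasFr_rho hS).neg
      (fun y => by rw [frZ_div_zero]; ring),
    frOp_zeta_pow_mul hS hs hu 3 2 _ ((hasFr_tau hS).neg.add ((HasFr.const κ x 2).mul
      ((hasFr_alphaSumBar hS).sub (hasFr_alphaDiffBar hS hs))))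
      (fun y => by rw [frZ_div_two]; ring), frZ_div_one, frZ_div_three]
  ring

end IsCylBackground

/-! ### First-order variations of smooth families -/

/-- The first-order variation of a one-parameter family of functions. -/
def vari (g : ℝ → Pt → ℂ) (x : Pt) : ℂ := deriv (fun ε => g ε x) 0

/-- Joint smoothness of a one-parameter family along `ε = 0`. -/
def SmoothFam (V : Set Pt) (g : ℝ → Pt → ℂ) : Prop :=
  ∀ x ∈ V, ContDiffAt ℝ ∞ (fun p : ℝ × Pt => g p.1 p.2) (0, x)

namespace SmoothFam

variable {V : Set Pt} {g : ℝ → Pt → ℂ} {x : Pt}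

lemma of_contDiffOn {δ : ℝ} (hδ : 0 < δ) (hV : IsOpen V)
    (h : ContDiffOn ℝ ∞ (fun p : ℝ × Pt => g p.1 p.2) (Ioo (-δ) δ ×ˢ V)) : SmoothFam V g :=
  fun _ hx => h.contDiffAt (prod_mem_nhds (Ioo_mem_nhds (by linarith) hδ) (hV.mem_nhds hx))

lemma differentiableAt (hg : SmoothFam V g) (hx : x ∈ V) :
    DifferentiableAt ℝ (fun p : ℝ × Pt => g p.1 p.2) (0, x) :=
  (hg x hx).differentiableAt (by simp)

lemma hasDerivAt_fderiv {ε : ℝ} (h : DifferentiableAt ℝ (fun p : ℝ × Pt => g p.1 p.2) (ε, x)) :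
    HasDerivAt (fun ε => g ε x) (fderiv ℝ (fun p : ℝ × Pt => g p.1 p.2) (ε, x) (1, 0)) ε :=
  HasFDerivAt.comp_hasDerivAt (f := fun ε : ℝ => (ε, x)) ε h.hasFDerivAt
    ((hasDerivAt_id' ε).prodMk (hasDerivAt_const ε x))

lemma vari_eq (hg : SmoothFam V g) (hx : x ∈ V) :
    vari g x = fderiv ℝ (fun p : ℝ × Pt => g p.1 p.2) (0, x) (1, 0) :=
  (hasDerivAt_fderiv (hg.differentiableAt hx)).deriv

lemma hasDerivAt (hg : SmoothFam V g) (hx : x ∈ V) :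
    HasDerivAt (fun ε => g ε x) (vari g x) 0 :=
  (hasDerivAt_fderiv (hg.differentiableAt hx)).differentiableAt.hasDerivAt

lemma pd_eq {ε : ℝ} (h : DifferentiableAt ℝ (fun p : ℝ × Pt => g p.1 p.2) (ε, x)) (μ : Fin 4) :
    pd μ (g ε) x = fderiv ℝ (fun p : ℝ × Pt => g p.1 p.2) (ε, x) (0, Pi.single μ 1) := by
  have h1 : HasFDerivAt (g ε) ((fderiv ℝ (fun p : ℝ × Pt => g p.1 p.2) (ε, x)).comp
      (ContinuousLinearMap.inr ℝ ℝ Pt)) x :=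
    HasFDerivAt.comp (f := fun y : Pt => (ε, y)) x h.hasFDerivAt (hasFDerivAt_prodMk_right ε x)
  rw [pd, h1.fderiv]
  rfl

lemma contDiffAt_vari (hV : IsOpen V) (hg : SmoothFam V g) (hx : x ∈ V) :
    ContDiffAt ℝ ∞ (vari g) x := by
  have h1 : ContDiffAt ℝ ∞ (fun y : Pt =>
      fderiv ℝ (fun p : ℝ × Pt => g p.1 p.2) (0, y) ((1 : ℝ), (0 : Pt))) x :=
    (((hg x hx).fderiv_right (m := ∞) (by simp)).comp x
      (contDiffAt_const.prodMk contDiffAt_id)).clm_apply contDiffAt_const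
  refine h1.congr_of_eventuallyEq ?_
  filter_upwards [hV.mem_nhds hx] with y hy using hg.vari_eq hy

/-- The variation commutes with coordinate derivatives. -/
lemma hasDerivAt_pd (hV : IsOpen V) (hg : SmoothFam V g) (hx : x ∈ V) (μ : Fin 4) :
    HasDerivAt (fun ε => pd μ (g ε) x) (pd μ (vari g) x) 0 := by
  set G : ℝ × Pt → ℂ := fun p => g p.1 p.2 with hG
  have hd : DifferentiableAt ℝ (fderiv ℝ G) (0, x) :=
    ((hg x hx).fderiv_right (m := ∞) (by simp)).differentiableAt (by simp)
  -- The lemma is the symmetry of the second derivative of the joint function of `ε` and `x`; the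
  -- rest expresses both iterated derivatives through it.
  have hsymm : IsSymmSndFDerivAt ℝ G (0, x) :=
    (hg x hx).isSymmSndFDerivAt (by
      simpa using WithTop.coe_le_coe.mpr (le_top (a := (2 : ℕ∞))))
  have hev : ∀ᶠ ε in 𝓝 (0 : ℝ), DifferentiableAt ℝ G (ε, x) := by
    have h2 : ∀ᶠ p in 𝓝 ((0 : ℝ), x), DifferentiableAt ℝ G p := by
      have := ((hg x hx).of_le (m := 1) (by exact_mod_cast le_top)).eventually (by simp)
      exact this.mono fun p hp => hp.differentiableAt (by simp)
    exact (Continuous.prodMk continuous_id continuous_const).continuousAt.eventually h2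
  have h1 : HasDerivAt (fun ε : ℝ => fderiv ℝ G (ε, x)) (fderiv ℝ (fderiv ℝ G) (0, x) (1, 0)) 0 :=
    HasFDerivAt.comp_hasDerivAt (f := fun ε : ℝ => (ε, x)) (0 : ℝ) hd.hasFDerivAt
      ((hasDerivAt_id' (0 : ℝ)).prodMk (hasDerivAt_const (0 : ℝ) x))
  have h1' : HasDerivAt (fun ε : ℝ => fderiv ℝ G (ε, x) ((0 : ℝ), (Pi.single μ 1 : Pt)))
      (fderiv ℝ (fderiv ℝ G) (0, x) (1, 0) (0, Pi.single μ 1)) 0 := by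
    simpa using h1.clm_apply (hasDerivAt_const (0 : ℝ) ((0 : ℝ), (Pi.single μ 1 : Pt)))
  have h2 : pd μ (vari g) x = fderiv ℝ (fderiv ℝ G) (0, x) (1, 0) (0, Pi.single μ 1) := by
    have hv : vari g =ᶠ[𝓝 x] fun y => fderiv ℝ G (0, y) ((1 : ℝ), (0 : Pt)) := by
      filter_upwards [hV.mem_nhds hx] with y hy using hg.vari_eq hy
    rw [pd_congr hv, hsymm.eq]
    have h3 : HasFDerivAt (fun y : Pt => fderiv ℝ G ((0 : ℝ), y))
        ((fderiv ℝ (fderiv ℝ G) (0, x)).comp (ContinuousLinearMap.inr ℝ ℝ Pt)) x :=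
      HasFDerivAt.comp (f := fun y : Pt => ((0 : ℝ), y)) x hd.hasFDerivAt
        (hasFDerivAt_prodMk_right (0 : ℝ) x)
    have h4 := h3.clm_apply (hasFDerivAt_const ((1 : ℝ), (0 : Pt)) x)
    rw [pd, h4.fderiv]
    simp
  rw [h2]
  exact h1'.congr_of_eventuallyEq (hev.mono fun ε hε => pd_eq hε μ)

end SmoothFam

/-- This makes the linearisation short: when a factor vanishes on the background, the perturbation
of its cofactor, be it a tetrad component, a spin coefficient, `φ₂` or `Ξ`, does not contribute. -/
lemma hasDerivAt_mul_of_zero {f g : ℝ → ℂ} {g' : ℂ} (hf : DifferentiableAt ℝ f 0)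
    (hg : HasDerivAt g g' 0) (h0 : g 0 = 0) :
    HasDerivAt (fun ε => f ε * g ε) (f 0 * g') 0 := by
  refine (hf.hasDerivAt.mul hg).congr_deriv ?_
  rw [h0, mul_zero, zero_add]

/-- Variation of a directional derivative of a family that vanishes for `ε = 0`. -/
lemma hasDerivAt_dir {V : Set Pt} {𝓕 : ℝ → CEFEFields} {g : ℝ → Pt → ℂ} {x : Pt} (hV : IsOpen V)
    (he : ∀ a μ, SmoothFam V fun ε => (𝓕 ε).e a μ) (hg : SmoothFam V g)
    (h0 : ∀ y ∈ V, g 0 y = 0) (hx : x ∈ V) (a : Fin 4) :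
    HasDerivAt (fun ε => (𝓕 ε).dir a (g ε) x) ((𝓕 0).dir a (vari g) x) 0 := by
  have hp : ∀ μ, pd μ (g 0) x = 0 := fun μ => by
    rw [pd_congr (CEFEFields.eventuallyEq_of_eqOn hV hx h0), pd_const]
  exact HasDerivAt.fun_sum fun μ _ => hasDerivAt_mul_of_zero
    ((he a μ).hasDerivAt hx).differentiableAt (hg.hasDerivAt_pd hV hx μ) (hp μ)

/-! ### Structure and Bianchi equations in Newman–Penrose form -/

namespace CEFEFields

section Symmetries

variable {X : CEFEFields} {x : Pt}

lemma Admissible.d_anti_right (h : X.Admissible x) (c f a b : Fin 4) :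
    X.d a b c f x = -X.d a b f c x := by
  rw [h.d_pair, h.d_anti, h.d_pair f]

lemma Admissible.d_self_left (h : X.Admissible x) (a c f : Fin 4) : X.d a a c f x = 0 :=
  self_eq_neg.mp (h.d_anti a a c f)

lemma Admissible.d_self_right (h : X.Admissible x) (a b c : Fin 4) : X.d a b c c x = 0 :=
  self_eq_neg.mp (h.d_anti_right c c a b)

lemma Admissible.conn_self (h : X.Admissible x) (a b : Fin 4) : X.conn a b b x = 0 :=
  self_eq_neg.mp (h.conn_metric a b b)

/-- Rewriting rules that order the index pairs of `d`. -/
lemma Admissible.d_sorted (h : X.Admissible x) :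
    (∀ a c f, X.d a a c f x = 0) ∧ (∀ a b c, X.d a b c c x = 0) ∧
    (∀ c f, X.d 1 0 c f x = -X.d 0 1 c f x) ∧ (∀ c f, X.d c f 1 0 x = -X.d c f 0 1 x) ∧
    (∀ c f, X.d 2 0 c f x = -X.d 0 2 c f x) ∧ (∀ c f, X.d c f 2 0 x = -X.d c f 0 2 x) ∧
    (∀ c f, X.d 3 0 c f x = -X.d 0 3 c f x) ∧ (∀ c f, X.d c f 3 0 x = -X.d c f 0 3 x) ∧
    (∀ c f, X.d 2 1 c f x = -X.d 1 2 c f x) ∧ (∀ c f, X.d c f 2 1 x = -X.d c f 1 2 x) ∧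
    (∀ c f, X.d 3 1 c f x = -X.d 1 3 c f x) ∧ (∀ c f, X.d c f 3 1 x = -X.d c f 1 3 x) ∧
    (∀ c f, X.d 3 2 c f x = -X.d 2 3 c f x) ∧ (∀ c f, X.d c f 3 2 x = -X.d c f 2 3 x) ∧
    X.d 0 2 0 1 x = X.d 0 1 0 2 x ∧ X.d 0 3 0 1 x = X.d 0 1 0 3 x ∧ X.d 0 3 0 2 x = X.d 0 2 0 3 x ∧
    X.d 1 2 0 1 x = X.d 0 1 1 2 x ∧ X.d 1 2 0 2 x = X.d 0 2 1 2 x ∧ X.d 1 2 0 3 x = X.d 0 3 1 2 x ∧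
    X.d 1 3 0 1 x = X.d 0 1 1 3 x ∧ X.d 1 3 0 2 x = X.d 0 2 1 3 x ∧ X.d 1 3 0 3 x = X.d 0 3 1 3 x ∧
    X.d 1 3 1 2 x = X.d 1 2 1 3 x ∧ X.d 2 3 0 1 x = X.d 0 1 2 3 x ∧ X.d 2 3 0 2 x = X.d 0 2 2 3 x ∧
    X.d 2 3 0 3 x = X.d 0 3 2 3 x ∧ X.d 2 3 1 2 x = X.d 1 2 2 3 x ∧ X.d 2 3 1 3 x = X.d 1 3 2 3 x :=
  ⟨h.d_self_left, h.d_self_right, h.d_anti 1 0, h.d_anti_right 1 0, h.d_anti 2 0,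
    h.d_anti_right 2 0,
    h.d_anti 3 0, h.d_anti_right 3 0, h.d_anti 2 1, h.d_anti_right 2 1, h.d_anti 3 1,
    h.d_anti_right 3 1, h.d_anti 3 2, h.d_anti_right 3 2,
    by repeat' first | exact h.d_pair _ _ _ _ | constructor⟩

/-- Rewriting rules that order the last index pair of the connection coefficients. -/
lemma Admissible.conn_sorted (h : X.Admissible x) :
    (∀ a b, X.conn a b b x = 0) ∧
    (∀ a, X.conn a 1 0 x = -X.conn a 0 1 x) ∧
    (∀ a, X.conn a 2 0 x = -X.conn a 0 2 x) ∧
    (∀ a, X.conn a 3 0 x = -X.conn a 0 3 x) ∧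
    (∀ a, X.conn a 2 1 x = -X.conn a 1 2 x) ∧
    (∀ a, X.conn a 3 1 x = -X.conn a 1 3 x) ∧
    (∀ a, X.conn a 3 2 x = -X.conn a 2 3 x) :=
  ⟨h.conn_self, (h.conn_metric · 1 0), (h.conn_metric · 2 0), (h.conn_metric · 3 0),
    (h.conn_metric · 2 1), (h.conn_metric · 3 1), (h.conn_metric · 3 2)⟩

/-- The components of a Weyl tensor that the trace condition and the cyclic identity eliminate. -/
lemma Admissible.d_relations (h : X.Admissible x) :
    X.d 0 2 0 3 x = 0 ∧
    X.d 1 2 1 3 x = 0 ∧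
    X.d 0 2 1 2 x = 0 ∧
    X.d 0 3 1 3 x = 0 ∧
    X.d 0 1 0 1 x = -X.d 0 2 1 3 x - X.d 0 3 1 2 x ∧
    X.d 2 3 2 3 x = -X.d 0 2 1 3 x - X.d 0 3 1 2 x ∧
    X.d 0 2 2 3 x = -X.d 0 1 0 2 x ∧
    X.d 0 3 2 3 x = X.d 0 1 0 3 x ∧
    X.d 1 2 2 3 x = X.d 0 1 1 2 x ∧
    X.d 1 3 2 3 x = -X.d 0 1 1 3 x ∧
    X.d 0 1 2 3 x = X.d 0 2 1 3 x - X.d 0 3 1 2 x := by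
  have t := h.d_trace
  simp only [Fin.sum_univ_four, eta_values, zero_mul, zero_add, add_zero, one_mul, neg_mul] at t
  have t0203 := t 0 0
  have t1213 := t 1 1
  have t0212 := t 2 2
  have t0313 := t 3 3
  have t0101 := t 0 1
  have t2323 := t 2 3
  have t0223 := t 0 2
  have t0323 := t 0 3
  have t1223 := t 1 2
  have t1323 := t 1 3
  have c0123 := h.d_cyclic 0 1 2 3
  simp only [h.d_sorted]
    at t0203 t1213 t0212 t0313 t0101 t2323 t0223 t0323 t1223 t1323 c0123
  refine ⟨?_, ?_, ?_, ?_, ?_, ?_, ?_, ?_, ?_, ?_, ?_⟩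
  · linear_combination t0203 / 2
  · linear_combination t1213 / 2
  · linear_combination -t0212 / 2
  · linear_combination -t0313 / 2
  · linear_combination t0101
  · linear_combination -t2323
  · linear_combination t0223
  · linear_combination -t0323
  · linear_combination t1223
  · linear_combination -t1323
  · linear_combination c0123

lemma dir_neg_of_eqOn {V : Set Pt} {f g : Pt → ℂ} (hV : IsOpen V) (hx : x ∈ V)
    (h : ∀ y ∈ V, f y = -g y) (a : Fin 4) : X.dir a f x = -X.dir a g x := by
  rw [dir_congr_fun (eventuallyEq_of_eqOn hV hx h)]
  simp [dir, pd_neg, Finset.sum_neg_distrib]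

lemma dir_eq_zero_of_eqOn {V : Set Pt} {f : Pt → ℂ} (hV : IsOpen V) (hx : x ∈ V)
    (h : ∀ y ∈ V, f y = 0) (a : Fin 4) : X.dir a f x = 0 := by
  rw [dir_congr_fun (eventuallyEq_of_eqOn hV hx h)]
  simp [dir]

end Symmetries

section NewmanPenrose

variable {X : CEFEFields} {V : Set Pt} {x : Pt}

/-- A Newman–Penrose Bianchi identity, obtained from the algebraic symmetries alone; no field
equation is assumed, so it applies to every member of a perturbed family. -/
lemma zeroD_002 (hV : IsOpen V) (hA : ∀ y ∈ V, X.Admissible y) (hx : x ∈ V) :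
    X.zeroD 0 0 2 x = X.dir 0 X.phi1 x - X.dir 3 X.phi0 x
      - ((X.npPi x - 4 * X.npAlpha x) * X.phi0 x + (4 * X.npRho x + 2 * X.npEps x) * X.phi1 x
        - 3 * X.phi2 x * X.npKappa x) := by
  have h := hA x hx
  -- Components under a derivative are reduced to Weyl scalars on the whole open set; the
  -- undifferentiated ones are reduced at `x` at the end.
  have q1002 : X.dir 0 (X.d 1 0 0 2) x = -X.dir 0 X.phi1 x := dir_neg_of_eqOn hV hx (fun y hy => by
    have h := hA y hy
    simp only [phi1, h.d_sorted, h.d_relations, neg_neg]) 0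
  have q0002 : X.dir 1 (X.d 0 0 0 2) x = 0 := dir_eq_zero_of_eqOn hV hx (fun y hy => by
    have h := hA y hy
    simp only [h.d_sorted, h.d_relations, neg_zero]) 1
  have q3002 : X.dir 2 (X.d 3 0 0 2) x = 0 := dir_eq_zero_of_eqOn hV hx (fun y hy => by
    have h := hA y hy
    simp only [h.d_sorted, h.d_relations, neg_zero]) 2
  have q2002 : X.dir 3 (X.d 2 0 0 2) x = -X.dir 3 X.phi0 x := dir_neg_of_eqOn hV hx (fun y hy => by
    have h := hA y hy
    simp only [phi0, h.d_sorted, h.d_relations, neg_neg]) 3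
  simp only [zeroD, covD, Fin.sum_univ_four, eta_values, zero_mul, zero_add, add_zero, one_mul,
    neg_mul,
    connUp_zero, connUp_one, connUp_two, connUp_three]
  rw [q1002, q0002, q3002, q2002]
  simp only [phi0, phi1, phi2, phi3, phi4, npKappa, npSigma, npRho, npTau, npEps, npBeta, npGamma,
    npAlpha,
    npPi, npMu, npNu, npLambda, h.d_sorted, h.conn_sorted, h.d_relations]
  ring

lemma zeroD_202 (hV : IsOpen V) (hA : ∀ y ∈ V, X.Admissible y) (hx : x ∈ V) :
    X.zeroD 2 0 2 x = X.dir 2 X.phi1 x - X.dir 1 X.phi0 x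
      + ((4 * X.npGamma x - X.npMu x) * X.phi0 x - (4 * X.npTau x + 2 * X.npBeta x) * X.phi1 x
        + 3 * X.phi2 x * X.npSigma x) := by
  have h := hA x hx
  have q1202 : X.dir 0 (X.d 1 2 0 2) x = 0 := dir_eq_zero_of_eqOn hV hx (fun y hy => by
    have h := hA y hy
    simp only [h.d_sorted, h.d_relations, neg_zero]) 0
  have q0202 : X.dir 1 (X.d 0 2 0 2) x = X.dir 1 X.phi0 x :=
      dir_congr_fun (eventuallyEq_of_eqOn hV hx fun y hy => by
    have h := hA y hy
    simp only [phi0, h.d_sorted, h.d_relations, neg_neg]) 1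
  have q3202 : X.dir 2 (X.d 3 2 0 2) x = X.dir 2 X.phi1 x :=
      dir_congr_fun (eventuallyEq_of_eqOn hV hx fun y hy => by
    have h := hA y hy
    simp only [phi1, h.d_sorted, h.d_relations, neg_neg]) 2
  have q2202 : X.dir 3 (X.d 2 2 0 2) x = 0 := dir_eq_zero_of_eqOn hV hx (fun y hy => by
    have h := hA y hy
    simp only [h.d_sorted, h.d_relations, neg_zero]) 3
  simp only [zeroD, covD, Fin.sum_univ_four, eta_values, zero_mul, zero_add, add_zero, one_mul,
    neg_mul,
    connUp_zero, connUp_one, connUp_two, connUp_three]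
  rw [q1202, q0202, q3202, q2202]
  simp only [phi0, phi1, phi2, phi3, phi4, npKappa, npSigma, npRho, npTau, npEps, npBeta, npGamma,
    npAlpha,
    npPi, npMu, npNu, npLambda, h.d_sorted, h.conn_sorted, h.d_relations]
  ring

/-- The counterpart under `ℓ ↔ k`, `m ↔ m*`: `φ₄`, `φ₃`, `ν`, `λ` take the roles of `φ₀`, `φ₁`, `κ`,
`σ`. -/
lemma zeroD_113 (hV : IsOpen V) (hA : ∀ y ∈ V, X.Admissible y) (hx : x ∈ V) :
    X.zeroD 1 1 3 x = X.dir 1 X.phi3 x - X.dir 2 X.phi4 x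
      - ((-X.npTau x + 4 * X.npBeta x) * X.phi4 x - (4 * X.npMu x + 2 * X.npGamma x) * X.phi3 x
        + 3 * X.phi2 x * X.npNu x) := by
  have h := hA x hx
  have q1113 : X.dir 0 (X.d 1 1 1 3) x = 0 := dir_eq_zero_of_eqOn hV hx (fun y hy => by
    have h := hA y hy
    simp only [h.d_sorted, h.d_relations, neg_zero]) 0
  have q0113 : X.dir 1 (X.d 0 1 1 3) x = -X.dir 1 X.phi3 x := dir_neg_of_eqOn hV hx (fun y hy => by
    have h := hA y hy
    simp only [phi3, h.d_sorted, h.d_relations, neg_neg]) 1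
  have q3113 : X.dir 2 (X.d 3 1 1 3) x = -X.dir 2 X.phi4 x := dir_neg_of_eqOn hV hx (fun y hy => by
    have h := hA y hy
    simp only [phi4, h.d_sorted, h.d_relations, neg_neg]) 2
  have q2113 : X.dir 3 (X.d 2 1 1 3) x = 0 := dir_eq_zero_of_eqOn hV hx (fun y hy => by
    have h := hA y hy
    simp only [h.d_sorted, h.d_relations, neg_zero]) 3
  simp only [zeroD, covD, Fin.sum_univ_four, eta_values, zero_mul, zero_add, add_zero, one_mul,
    neg_mul,
    connUp_zero, connUp_one, connUp_two, connUp_three]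
  rw [q1113, q0113, q3113, q2113]
  simp only [phi0, phi1, phi2, phi3, phi4, npKappa, npSigma, npRho, npTau, npEps, npBeta, npGamma,
    npAlpha,
    npPi, npMu, npNu, npLambda, h.d_sorted, h.conn_sorted, h.d_relations]
  ring

lemma zeroD_313 (hV : IsOpen V) (hA : ∀ y ∈ V, X.Admissible y) (hx : x ∈ V) :
    X.zeroD 3 1 3 x = X.dir 3 X.phi3 x - X.dir 0 X.phi4 x
      + ((-4 * X.npEps x + X.npRho x) * X.phi4 x + (4 * X.npPi x + 2 * X.npAlpha x) * X.phi3 x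
        - 3 * X.phi2 x * X.npLambda x) := by
  have h := hA x hx
  have q1313 : X.dir 0 (X.d 1 3 1 3) x = X.dir 0 X.phi4 x :=
      dir_congr_fun (eventuallyEq_of_eqOn hV hx fun y hy => by
    have h := hA y hy
    simp only [phi4, h.d_sorted, h.d_relations, neg_neg]) 0
  have q0313 : X.dir 1 (X.d 0 3 1 3) x = 0 := dir_eq_zero_of_eqOn hV hx (fun y hy => by
    have h := hA y hy
    simp only [h.d_sorted, h.d_relations, neg_zero]) 1
  have q3313 : X.dir 2 (X.d 3 3 1 3) x = 0 := dir_eq_zero_of_eqOn hV hx (fun y hy => by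
    have h := hA y hy
    simp only [h.d_sorted, h.d_relations, neg_zero]) 2
  have q2313 : X.dir 3 (X.d 2 3 1 3) x = X.dir 3 X.phi3 x :=
      dir_congr_fun (eventuallyEq_of_eqOn hV hx fun y hy => by
    have h := hA y hy
    simp only [phi3, h.d_sorted, h.d_relations, neg_neg]) 3
  simp only [zeroD, covD, Fin.sum_univ_four, eta_values, zero_mul, zero_add, add_zero, one_mul,
    neg_mul,
    connUp_zero, connUp_one, connUp_two, connUp_three]
  rw [q1313, q0313, q3313, q2313]
  simp only [phi0, phi1, phi2, phi3, phi4, npKappa, npSigma, npRho, npTau, npEps, npBeta, npGamma,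
    npAlpha,
    npPi, npMu, npNu, npLambda, h.d_sorted, h.conn_sorted, h.d_relations]
  ring

/-- For these indices every metric component multiplying the Schouten tensor is zero, so of the
curvature only the Weyl scalar remains. Since `conn 2 0 2 = -σ` and `conn 0 0 2 = -κ`, this is the
equation for `Dσ - δκ`. -/
lemma zeroCurv_2002 (h : X.Admissible x) :
    X.zeroCurv 2 0 0 2 x = X.dir 0 (X.conn 2 0 2) x - X.dir 2 (X.conn 0 0 2) x
      + (X.conn 2 0 3 x + X.conn 3 0 2 x - 2 * X.conn 0 2 3 x + X.conn 0 0 1 x) * X.conn 2 0 2 x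
      + (-X.conn 0 1 2 x - X.conn 1 0 2 x + X.conn 2 2 3 x - 2 * X.conn 2 0 1 x) * X.conn 0 0 2 x
      + X.XiC x * X.phi0 x := by
  simp only [zeroCurv, riem, Fin.sum_univ_four, eta_values, connUp_zero, connUp_one, connUp_two,
    connUp_three, phi0, phi4, h.d_sorted, h.conn_sorted, h.d_relations]
  ring

lemma zeroCurv_3113 (h : X.Admissible x) :
    X.zeroCurv 3 1 1 3 x = X.dir 1 (X.conn 3 1 3) x - X.dir 3 (X.conn 1 1 3) x
      + (X.conn 3 1 2 x + X.conn 2 1 3 x + 2 * X.conn 1 2 3 x - X.conn 1 0 1 x) * X.conn 3 1 3 x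
      + (-X.conn 1 0 3 x - X.conn 0 1 3 x - X.conn 3 2 3 x + 2 * X.conn 3 0 1 x) * X.conn 1 1 3 x
      + X.XiC x * X.phi4 x := by
  simp only [zeroCurv, riem, Fin.sum_univ_four, eta_values, connUp_zero, connUp_one, connUp_two,
    connUp_three, phi0, phi4, h.d_sorted, h.conn_sorted, h.d_relations]
  ring

end NewmanPenrose

end CEFEFields

/-! ### The linearised equations -/

section Linearised

open CEFEFields

variable {rp κ : ℝ} {V : Set Pt} {𝓕 : ℝ → CEFEFields} {x : Pt}

lemma IsLinearisedSolution.smooth_e (hV : IsOpen V) (h : IsLinearisedSolution V 𝓕)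
    (a μ : Fin 4) : SmoothFam V (fun ε => (𝓕 ε).e a μ) := by
  obtain ⟨δ, hδ, he, -⟩ := h.family
  exact SmoothFam.of_contDiffOn hδ hV (he a μ)

lemma IsLinearisedSolution.smooth_conn (hV : IsOpen V) (h : IsLinearisedSolution V 𝓕)
    (a b c : Fin 4) : SmoothFam V (fun ε => (𝓕 ε).conn a b c) := by
  obtain ⟨δ, hδ, -, hc, -⟩ := h.family
  exact SmoothFam.of_contDiffOn hδ hV (hc a b c)

lemma IsLinearisedSolution.smooth_d (hV : IsOpen V) (h : IsLinearisedSolution V 𝓕)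
    (a b c f : Fin 4) : SmoothFam V (fun ε => (𝓕 ε).d a b c f) := by
  obtain ⟨δ, hδ, -, -, -, -, -, hd, -⟩ := h.family
  exact SmoothFam.of_contDiffOn hδ hV (hd a b c f)

lemma IsLinearisedSolution.smooth_XiC (hV : IsOpen V) (h : IsLinearisedSolution V 𝓕) :
    SmoothFam V (fun ε => (𝓕 ε).XiC) := by
  obtain ⟨δ, hδ, -, -, hX, -⟩ := h.family
  exact SmoothFam.of_contDiffOn hδ hV (Complex.ofRealCLM.contDiff.comp_contDiffOn hX)

lemma IsLinearisedSolution.eventually_admissible (h : IsLinearisedSolution V 𝓕) :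
    ∀ᶠ ε in 𝓝 (0 : ℝ), ∀ y ∈ V, (𝓕 ε).Admissible y := by
  obtain ⟨δ, hδ, -, -, -, -, -, -, hA⟩ := h.family
  filter_upwards [Ioo_mem_nhds (neg_lt_zero.mpr hδ) hδ] with ε hε using hA ε hε

section PhiZero

/-- Each term of the Bianchi equation contains `φ₀`, `φ₁` or `κ`, which vanish on the background;
hence the linearised equation has background coefficients throughout. -/
lemma linearised_bianchi_kappa (hV : IsOpen V) (h : IsLinearisedSolution V 𝓕) (hx : x ∈ V)
    (h0 : ∀ y ∈ V, (𝓕 0).phi0 y = 0) (h1 : ∀ y ∈ V, (𝓕 0).phi1 y = 0)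
    (hk : ∀ y ∈ V, (𝓕 0).conn 0 0 2 y = 0) :
    (𝓕 0).dir 3 (phi0Pert 𝓕) x + ((𝓕 0).npPi x - 4 * (𝓕 0).npAlpha x) * phi0Pert 𝓕 x
      = (𝓕 0).dir 0 (vari fun ε => (𝓕 ε).phi1) x
        + (-4 * (𝓕 0).npRho x - 2 * (𝓕 0).npEps x) * vari (fun ε => (𝓕 ε).phi1) x
        - 3 * (𝓕 0).phi2 x * vari (fun ε => (𝓕 ε).conn 0 0 2) x := by
  have he := h.smooth_e hV
  have hc : ∀ a b c, DifferentiableAt ℝ (fun ε => (𝓕 ε).conn a b c x) 0 := fun a b c =>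
    ((h.smooth_conn hV a b c).hasDerivAt hx).differentiableAt
  have hd : ∀ a b c f, DifferentiableAt ℝ (fun ε => (𝓕 ε).d a b c f x) 0 := fun a b c f =>
    ((h.smooth_d hV a b c f).hasDerivAt hx).differentiableAt
  have s0 : SmoothFam V (fun ε => (𝓕 ε).phi0) := h.smooth_d hV 0 2 0 2
  have s1 : SmoothFam V (fun ε => (𝓕 ε).phi1) := h.smooth_d hV 0 1 0 2
  have key := ((hasDerivAt_dir hV he s0 h0 hx 3).fun_sub (hasDerivAt_dir hV he s1 h1 hx 0)).fun_add
    (((hasDerivAt_mul_of_zero (f := fun ε => ((𝓕 ε).npPi x - 4 * (𝓕 ε).npAlpha x))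
      (by simp only [npPi, npAlpha]; fun_prop) (s0.hasDerivAt hx) (h0 x hx)).fun_sub
      (hasDerivAt_mul_of_zero (f := fun ε => (-4 * (𝓕 ε).npRho x - 2 * (𝓕 ε).npEps x))
        (by simp only [npRho, npEps]; fun_prop) (s1.hasDerivAt hx) (h1 x hx))).fun_add
      (hasDerivAt_mul_of_zero (f := fun ε => 3 * (𝓕 ε).phi2 x)
        (by simp only [phi2]; fun_prop) ((h.smooth_conn hV 0 0 2).hasDerivAt hx) (hk x hx)))
  have hlin := h.lin_d x hx 0 0 2
  -- The Newman–Penrose form requires the algebraic symmetries, which are available for small `ε`;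
  -- this suffices for the derivative at 0.
  rw [(key.neg.congr_of_eventuallyEq (h.eventually_admissible.mono fun ε hε => by
    simp only [zeroD_002 hV hε hx, Pi.neg_apply, npKappa]; ring)).deriv] at hlin
  have : phi0Pert 𝓕 = vari fun ε => (𝓕 ε).phi0 := rfl
  rw [this]
  linear_combination -hlin

lemma linearised_bianchi_sigma (hV : IsOpen V) (h : IsLinearisedSolution V 𝓕) (hx : x ∈ V)
    (h0 : ∀ y ∈ V, (𝓕 0).phi0 y = 0) (h1 : ∀ y ∈ V, (𝓕 0).phi1 y = 0)
    (hs : ∀ y ∈ V, (𝓕 0).conn 2 0 2 y = 0) :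
    (𝓕 0).dir 1 (phi0Pert 𝓕) x + (-4 * (𝓕 0).npGamma x + (𝓕 0).npMu x) * phi0Pert 𝓕 x
      = (𝓕 0).dir 2 (vari fun ε => (𝓕 ε).phi1) x
        + (-4 * (𝓕 0).npTau x - 2 * (𝓕 0).npBeta x) * vari (fun ε => (𝓕 ε).phi1) x
        - 3 * (𝓕 0).phi2 x * vari (fun ε => (𝓕 ε).conn 2 0 2) x := by
  have he := h.smooth_e hV
  have hc : ∀ a b c, DifferentiableAt ℝ (fun ε => (𝓕 ε).conn a b c x) 0 := fun a b c =>
    ((h.smooth_conn hV a b c).hasDerivAt hx).differentiableAt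
  have hd : ∀ a b c f, DifferentiableAt ℝ (fun ε => (𝓕 ε).d a b c f x) 0 := fun a b c f =>
    ((h.smooth_d hV a b c f).hasDerivAt hx).differentiableAt
  have s0 : SmoothFam V (fun ε => (𝓕 ε).phi0) := h.smooth_d hV 0 2 0 2
  have s1 : SmoothFam V (fun ε => (𝓕 ε).phi1) := h.smooth_d hV 0 1 0 2
  have key := ((hasDerivAt_dir hV he s0 h0 hx 1).fun_sub (hasDerivAt_dir hV he s1 h1 hx 2)).fun_add
    (((hasDerivAt_mul_of_zero (f := fun ε => (-4 * (𝓕 ε).npGamma x + (𝓕 ε).npMu x))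
      (by simp only [npGamma, npMu]; fun_prop) (s0.hasDerivAt hx) (h0 x hx)).fun_sub
      (hasDerivAt_mul_of_zero (f := fun ε => (-4 * (𝓕 ε).npTau x - 2 * (𝓕 ε).npBeta x))
        (by simp only [npTau, npBeta]; fun_prop) (s1.hasDerivAt hx) (h1 x hx))).fun_add
      (hasDerivAt_mul_of_zero (f := fun ε => 3 * (𝓕 ε).phi2 x)
        (by simp only [phi2]; fun_prop) ((h.smooth_conn hV 2 0 2).hasDerivAt hx) (hs x hx)))
  have hlin := h.lin_d x hx 2 0 2
  rw [(key.neg.congr_of_eventuallyEq (h.eventually_admissible.mono fun ε hε => by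
    simp only [zeroD_202 hV hε hx, Pi.neg_apply, npSigma]; ring)).deriv] at hlin
  have : phi0Pert 𝓕 = vari fun ε => (𝓕 ε).phi0 := rfl
  rw [this]
  linear_combination -hlin

lemma linearised_ricci_sigma (hV : IsOpen V) (h : IsLinearisedSolution V 𝓕) (hx : x ∈ V)
    (h0 : ∀ y ∈ V, (𝓕 0).phi0 y = 0) (hk : ∀ y ∈ V, (𝓕 0).conn 0 0 2 y = 0)
    (hs : ∀ y ∈ V, (𝓕 0).conn 2 0 2 y = 0) :
    (𝓕 0).dir 0 (vari fun ε => (𝓕 ε).conn 2 0 2) x - (𝓕 0).dir 2 (vari fun ε => (𝓕 ε).conn 0 0 2) x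
      + ((𝓕 0).conn 2 0 3 x + (𝓕 0).conn 3 0 2 x - 2 * (𝓕 0).conn 0 2 3 x + (𝓕 0).conn 0 0 1 x)
        * vari (fun ε => (𝓕 ε).conn 2 0 2) x
      + (-(𝓕 0).conn 0 1 2 x - (𝓕 0).conn 1 0 2 x + (𝓕 0).conn 2 2 3 x - 2 * (𝓕 0).conn 2 0 1 x)
        * vari (fun ε => (𝓕 ε).conn 0 0 2) x
      + (𝓕 0).XiC x * phi0Pert 𝓕 x = 0 := by
  have he := h.smooth_e hV
  have hc : ∀ a b c, DifferentiableAt ℝ (fun ε => (𝓕 ε).conn a b c x) 0 := fun a b c =>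
    ((h.smooth_conn hV a b c).hasDerivAt hx).differentiableAt
  have hd : ∀ a b c f, DifferentiableAt ℝ (fun ε => (𝓕 ε).d a b c f x) 0 := fun a b c f =>
    ((h.smooth_d hV a b c f).hasDerivAt hx).differentiableAt
  have s0 : SmoothFam V (fun ε => (𝓕 ε).phi0) := h.smooth_d hV 0 2 0 2
  have key := ((((hasDerivAt_dir hV he (h.smooth_conn hV 2 0 2) hs hx 0).fun_sub
    (hasDerivAt_dir hV he (h.smooth_conn hV 0 0 2) hk hx 2)).fun_add
    (hasDerivAt_mul_of_zero (f := fun ε => ((𝓕 ε).conn 2 0 3 x + (𝓕 ε).conn 3 0 2 x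
      - 2 * (𝓕 ε).conn 0 2 3 x + (𝓕 ε).conn 0 0 1 x))
      (by fun_prop) ((h.smooth_conn hV 2 0 2).hasDerivAt hx) (hs x hx))).fun_add
    (hasDerivAt_mul_of_zero (f := fun ε => (-(𝓕 ε).conn 0 1 2 x - (𝓕 ε).conn 1 0 2 x
      + (𝓕 ε).conn 2 2 3 x - 2 * (𝓕 ε).conn 2 0 1 x))
      (by fun_prop) ((h.smooth_conn hV 0 0 2).hasDerivAt hx) (hk x hx))).fun_add
    (hasDerivAt_mul_of_zero (f := fun ε => (𝓕 ε).XiC x)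
      ((h.smooth_XiC hV).hasDerivAt hx).differentiableAt (s0.hasDerivAt hx) (h0 x hx))
  have hlin := h.lin_curv x hx 2 0 0 2
  rwa [(key.congr_of_eventuallyEq (h.eventually_admissible.mono fun ε hε =>
    zeroCurv_2002 (hε x hx))).deriv] at hlin

end PhiZero

section PhiFour

lemma linearised_bianchi_nu (hV : IsOpen V) (h : IsLinearisedSolution V 𝓕) (hx : x ∈ V)
    (h0 : ∀ y ∈ V, (𝓕 0).phi4 y = 0) (h1 : ∀ y ∈ V, (𝓕 0).phi3 y = 0)
    (hk : ∀ y ∈ V, (𝓕 0).conn 1 1 3 y = 0) :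
    (𝓕 0).dir 2 (phi4Pert 𝓕) x + (-(𝓕 0).npTau x + 4 * (𝓕 0).npBeta x) * phi4Pert 𝓕 x
      = (𝓕 0).dir 1 (vari fun ε => (𝓕 ε).phi3) x
        + (4 * (𝓕 0).npMu x + 2 * (𝓕 0).npGamma x) * vari (fun ε => (𝓕 ε).phi3) x
        - 3 * (𝓕 0).phi2 x * vari (fun ε => (𝓕 ε).conn 1 1 3) x := by
  have he := h.smooth_e hV
  have hc : ∀ a b c, DifferentiableAt ℝ (fun ε => (𝓕 ε).conn a b c x) 0 := fun a b c =>
    ((h.smooth_conn hV a b c).hasDerivAt hx).differentiableAt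
  have hd : ∀ a b c f, DifferentiableAt ℝ (fun ε => (𝓕 ε).d a b c f x) 0 := fun a b c f =>
    ((h.smooth_d hV a b c f).hasDerivAt hx).differentiableAt
  have s0 : SmoothFam V (fun ε => (𝓕 ε).phi4) := h.smooth_d hV 1 3 1 3
  have s1 : SmoothFam V (fun ε => (𝓕 ε).phi3) := h.smooth_d hV 0 1 3 1
  have key := ((hasDerivAt_dir hV he s0 h0 hx 2).fun_sub (hasDerivAt_dir hV he s1 h1 hx 1)).fun_add
    (((hasDerivAt_mul_of_zero (f := fun ε => (-(𝓕 ε).npTau x + 4 * (𝓕 ε).npBeta x))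
      (by simp only [npTau, npBeta]; fun_prop) (s0.hasDerivAt hx) (h0 x hx)).fun_sub
      (hasDerivAt_mul_of_zero (f := fun ε => (4 * (𝓕 ε).npMu x + 2 * (𝓕 ε).npGamma x))
        (by simp only [npMu, npGamma]; fun_prop) (s1.hasDerivAt hx) (h1 x hx))).fun_add
      (hasDerivAt_mul_of_zero (f := fun ε => 3 * (𝓕 ε).phi2 x)
        (by simp only [phi2]; fun_prop) ((h.smooth_conn hV 1 1 3).hasDerivAt hx) (hk x hx)))
  have hlin := h.lin_d x hx 1 1 3
  rw [(key.neg.congr_of_eventuallyEq (h.eventually_admissible.mono fun ε hε => by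
    simp only [zeroD_113 hV hε hx, Pi.neg_apply, npNu]; ring)).deriv] at hlin
  have : phi4Pert 𝓕 = vari fun ε => (𝓕 ε).phi4 := rfl
  rw [this]
  linear_combination -hlin

lemma linearised_bianchi_lambda (hV : IsOpen V) (h : IsLinearisedSolution V 𝓕) (hx : x ∈ V)
    (h0 : ∀ y ∈ V, (𝓕 0).phi4 y = 0) (h1 : ∀ y ∈ V, (𝓕 0).phi3 y = 0)
    (hs : ∀ y ∈ V, (𝓕 0).conn 3 1 3 y = 0) :
    (𝓕 0).dir 0 (phi4Pert 𝓕) x + (4 * (𝓕 0).npEps x - (𝓕 0).npRho x) * phi4Pert 𝓕 x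
      = (𝓕 0).dir 3 (vari fun ε => (𝓕 ε).phi3) x
        + (4 * (𝓕 0).npPi x + 2 * (𝓕 0).npAlpha x) * vari (fun ε => (𝓕 ε).phi3) x
        - 3 * (𝓕 0).phi2 x * vari (fun ε => (𝓕 ε).conn 3 1 3) x := by
  have he := h.smooth_e hV
  have hc : ∀ a b c, DifferentiableAt ℝ (fun ε => (𝓕 ε).conn a b c x) 0 := fun a b c =>
    ((h.smooth_conn hV a b c).hasDerivAt hx).differentiableAt
  have hd : ∀ a b c f, DifferentiableAt ℝ (fun ε => (𝓕 ε).d a b c f x) 0 := fun a b c f =>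
    ((h.smooth_d hV a b c f).hasDerivAt hx).differentiableAt
  have s0 : SmoothFam V (fun ε => (𝓕 ε).phi4) := h.smooth_d hV 1 3 1 3
  have s1 : SmoothFam V (fun ε => (𝓕 ε).phi3) := h.smooth_d hV 0 1 3 1
  have key := ((hasDerivAt_dir hV he s0 h0 hx 0).fun_sub (hasDerivAt_dir hV he s1 h1 hx 3)).fun_add
    (((hasDerivAt_mul_of_zero (f := fun ε => (4 * (𝓕 ε).npEps x - (𝓕 ε).npRho x))
      (by simp only [npEps, npRho]; fun_prop) (s0.hasDerivAt hx) (h0 x hx)).fun_sub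
      (hasDerivAt_mul_of_zero (f := fun ε => (4 * (𝓕 ε).npPi x + 2 * (𝓕 ε).npAlpha x))
        (by simp only [npPi, npAlpha]; fun_prop) (s1.hasDerivAt hx) (h1 x hx))).fun_add
      (hasDerivAt_mul_of_zero (f := fun ε => 3 * (𝓕 ε).phi2 x)
        (by simp only [phi2]; fun_prop) ((h.smooth_conn hV 3 1 3).hasDerivAt hx) (hs x hx)))
  have hlin := h.lin_d x hx 3 1 3
  rw [(key.neg.congr_of_eventuallyEq (h.eventually_admissible.mono fun ε hε => by
    simp only [zeroD_313 hV hε hx, Pi.neg_apply, npLambda]; ring)).deriv] at hlin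
  have : phi4Pert 𝓕 = vari fun ε => (𝓕 ε).phi4 := rfl
  rw [this]
  linear_combination -hlin

lemma linearised_ricci_lambda (hV : IsOpen V) (h : IsLinearisedSolution V 𝓕) (hx : x ∈ V)
    (h0 : ∀ y ∈ V, (𝓕 0).phi4 y = 0) (hk : ∀ y ∈ V, (𝓕 0).conn 1 1 3 y = 0)
    (hs : ∀ y ∈ V, (𝓕 0).conn 3 1 3 y = 0) :
    (𝓕 0).dir 1 (vari fun ε => (𝓕 ε).conn 3 1 3) x - (𝓕 0).dir 3 (vari fun ε => (𝓕 ε).conn 1 1 3) x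
      + ((𝓕 0).conn 3 1 2 x + (𝓕 0).conn 2 1 3 x + 2 * (𝓕 0).conn 1 2 3 x - (𝓕 0).conn 1 0 1 x)
        * vari (fun ε => (𝓕 ε).conn 3 1 3) x
      + (-(𝓕 0).conn 1 0 3 x - (𝓕 0).conn 0 1 3 x - (𝓕 0).conn 3 2 3 x + 2 * (𝓕 0).conn 3 0 1 x)
        * vari (fun ε => (𝓕 ε).conn 1 1 3) x
      + (𝓕 0).XiC x * phi4Pert 𝓕 x = 0 := by
  have he := h.smooth_e hV
  have hc : ∀ a b c, DifferentiableAt ℝ (fun ε => (𝓕 ε).conn a b c x) 0 := fun a b c =>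
    ((h.smooth_conn hV a b c).hasDerivAt hx).differentiableAt
  have hd : ∀ a b c f, DifferentiableAt ℝ (fun ε => (𝓕 ε).d a b c f x) 0 := fun a b c f =>
    ((h.smooth_d hV a b c f).hasDerivAt hx).differentiableAt
  have s0 : SmoothFam V (fun ε => (𝓕 ε).phi4) := h.smooth_d hV 1 3 1 3
  have key := ((((hasDerivAt_dir hV he (h.smooth_conn hV 3 1 3) hs hx 1).fun_sub
    (hasDerivAt_dir hV he (h.smooth_conn hV 1 1 3) hk hx 3)).fun_add
    (hasDerivAt_mul_of_zero (f := fun ε => ((𝓕 ε).conn 3 1 2 x + (𝓕 ε).conn 2 1 3 x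
      + 2 * (𝓕 ε).conn 1 2 3 x - (𝓕 ε).conn 1 0 1 x))
      (by fun_prop) ((h.smooth_conn hV 3 1 3).hasDerivAt hx) (hs x hx))).fun_add
    (hasDerivAt_mul_of_zero (f := fun ε => (-(𝓕 ε).conn 1 0 3 x - (𝓕 ε).conn 0 1 3 x
      - (𝓕 ε).conn 3 2 3 x + 2 * (𝓕 ε).conn 3 0 1 x))
      (by fun_prop) ((h.smooth_conn hV 1 1 3).hasDerivAt hx) (hk x hx))).fun_add
    (hasDerivAt_mul_of_zero (f := fun ε => (𝓕 ε).XiC x)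
      ((h.smooth_XiC hV).hasDerivAt hx).differentiableAt (s0.hasDerivAt hx) (h0 x hx))
  have hlin := h.lin_curv x hx 3 1 1 3
  rwa [(key.congr_of_eventuallyEq (h.eventually_admissible.mono fun ε hε =>
    zeroCurv_3113 (hε x hx))).deriv] at hlin

end PhiFour

end Linearised

/-! ### Decoupling -/

section Decoupling

open CEFEFields

variable {rp κ : ℝ} {V : Set Pt} {x : Pt}

/-- The commutator of two derivatives along the background tetrad. -/
lemma frD_commutator {u : Pt → ℂ} (hS : sigC x ≠ 0) (hs : sinC x ≠ 0) (hu : ContDiffAt ℝ 2 u x)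
    (a c : Fin 4) : frD κ a (frD κ c u) x - frD κ c (frD κ a u) x
      = ∑ f, ((bgFields rp κ).connUp a c f x - (bgFields rp κ).connUp c a f x) * frD κ f u x := by
  have ht : ∀ μ, frD κ a (fun y => cylTetrad κ y c μ) x - frD κ c (fun y => cylTetrad κ y a μ) x
      = ∑ f, ((bgFields rp κ).connUp a c f x - (bgFields rp κ).connUp c a f x)
        * cylTetrad κ x f μ := fun μ =>
    sub_eq_zero.mp (bgFields_torsion (rp := rp) (κ := κ) hS hs a c μ)
  have hf : ∀ f, frD κ f u x = ∑ μ, cylTetrad κ x f μ * pd μ u x := fun f => rfl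
  have t0 := ht 0
  have t1 := ht 1
  have t2 := ht 2
  have t3 := ht 3
  rw [frD_frD hS hs hu, frD_frD hS hs hu]
  simp only [Fin.sum_univ_four, hf, pd_comm hu 1 0, pd_comm hu 2 0, pd_comm hu 3 0,
    pd_comm hu 2 1, pd_comm hu 3 1, pd_comm hu 3 2] at *
  linear_combination pd 0 u x * t0 + pd 1 u x * t1 + pd 2 u x * t2 + pd 3 u x * t3

/-- Teukolsky's decoupling: two Bianchi equations and one structure equation combine to a
second-order equation for `ψ₀`. -/
lemma frOp_decoupled (hV : IsOpen V) (hx : x ∈ V) {a b c d : Fin 4} {A₀ C₀ Ξ ra rc : ℂ}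
    {A C P Q φ ψ₀ ψ₁ k s : Pt → ℂ} {vP vQ : Fin 4 → ℂ} (hP : HasFr κ P x vP) (hQ : HasFr κ Q x vQ)
    (hS : sigC x ≠ 0) (hsn : sinC x ≠ 0) (hφ : DifferentiableAt ℝ φ x)
    (hφa : frD κ a φ x = 3 * ra * φ x) (hφc : frD κ c φ x = 3 * rc * φ x)
    (hψ₁ : ContDiffAt ℝ 2 ψ₁ x) (hk : DifferentiableAt ℝ k x) (hs : DifferentiableAt ℝ s x)
    (hbk : ∀ y ∈ V, frD κ d ψ₀ y + C y * ψ₀ y = frD κ a ψ₁ y + Q y * ψ₁ y - 3 * φ y * k y)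
    (hbs : ∀ y ∈ V, frD κ b ψ₀ y + A y * ψ₀ y = frD κ c ψ₁ y + P y * ψ₁ y - 3 * φ y * s y)
    (hric : frD κ a s x - frD κ c k x + (A₀ + 3 * ra) * s x - (C₀ + 3 * rc) * k x
      + Ξ * ψ₀ x = 0)
    (hcomm : frD κ a (frD κ c ψ₁) x - frD κ c (frD κ a ψ₁) x
      = (C₀ - P x) * frD κ a ψ₁ x + (Q x - A₀) * frD κ c ψ₁ x)
    (hPQ : vP a - vQ c + A₀ * P x - C₀ * Q x = 0) :
    frOp κ a b A₀ A ψ₀ x - frOp κ c d C₀ C ψ₀ x - 3 * Ξ * φ x * ψ₀ x = 0 := by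
  have hd₁ := differentiableAt_of_two hψ₁
  have h3 : DifferentiableAt ℝ (fun y => -3 * φ y) x := hφ.const_mul _
  have exp : ∀ {e f : Fin 4} {W w : Pt → ℂ} {v : Fin 4 → ℂ}, HasFr κ W x v →
      DifferentiableAt ℝ w x → frD κ e (fun y => frD κ f ψ₁ y + W y * ψ₁ y - 3 * φ y * w y) x
        = frD κ e (frD κ f ψ₁) x + (v e * ψ₁ x + W x * frD κ e ψ₁ x)
          - 3 * (frD κ e φ x * w x + φ x * frD κ e w x) := by
    intro e f W w v hW hw
    have hfun : (fun y => frD κ f ψ₁ y + W y * ψ₁ y - 3 * φ y * w y)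
        = fun y => (frD κ f ψ₁ y + W y * ψ₁ y) + (-3) * (φ y * w y) := by
      funext y
      ring
    have hm : DifferentiableAt ℝ (fun y => φ y * w y) x := hφ.fun_mul hw
    rw [hfun, frD_add ((differentiableAt_frD hS hsn hψ₁ f).fun_add (hW.diff.fun_mul hd₁))
      (hm.const_mul _), frD_add (differentiableAt_frD hS hsn hψ₁ f) (hW.diff.fun_mul hd₁),
      frD_mul hW.diff hd₁, frD_mul (differentiableAt_const (-3 : ℂ)) hm, frD_mul hφ hw, hW.frD_eq,
      (HasFr.const κ x (-3)).frD_eq]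
    ring
  rw [frOp, frOp, frD_congr (eventuallyEq_of_eqOn hV hx hbs),
    frD_congr (eventuallyEq_of_eqOn hV hx hbk), hbs x hx, hbk x hx, exp hP hs, exp hQ hk, hφa, hφc]
  -- The commutator cancels the second- and first-order terms in `ψ₁`, and `hPQ` the zeroth-order
  -- one. The derivatives of `φ` add `3 ra` and `3 rc` to the coefficients of `s` and `k`, so that
  -- the structure equation, multiplied by `-3φ`, replaces these terms by `3Ξφψ₀`.
  linear_combination hcomm + ψ₁ x * hPQ - 3 * φ x * hric

-- The zeroth-order coefficient of the perturbed `φ₁` left by the decoupling, with `P = -4τ - 2β`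
-- and `Q = -4ρ`. Its vanishing is a relation between background spin coefficients.
set_option maxHeartbeats 8000000 in
lemma potential_zero (hS : sigC x ≠ 0) (hs : sinC x ≠ 0) :
    frD κ 0 (fun y => -4 * bgTau κ y + (-1) * (bgAlphaSumBar κ y - bgAlphaDiffBar κ y)) x
      - frD κ 2 (fun y => -4 * bgRho κ y) x
      + (-4 * bgRho κ x - bgRhoBar κ x) * (-4 * bgTau κ x + (-1) * (bgAlphaSumBar κ x
        - bgAlphaDiffBar κ x))
      - (bgPiBar κ x - (bgAlphaDiffBar κ x + bgAlphaSumBar κ x) / 2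
      - 3 * ((bgAlphaSumBar κ x - bgAlphaDiffBar κ x) / 2) - 4 * bgTau κ x) * (-4 * bgRho κ x)
        = 0 := by
  have hz := zeta_ne κ x
  have hzb := zetaBar_ne κ x
  have hh := hsq_sq
  have hsin := sinC_sq x
  have hI := Complex.I_sq
  have hI3 := Complex.I_pow_three
  have hI4 := Complex.I_pow_four
  have hsin3 := sinC_pow_three x
  have hsin4 := sinC_pow_four x
  have hP := ((HasFr.const κ x (-4)).mul (hasFr_tau hS)).add ((HasFr.const κ x (-1)).mul
    ((hasFr_alphaSumBar hS).sub (hasFr_alphaDiffBar hS hs)))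
  have hQ := (HasFr.const κ x (-4)).mul (hasFr_rho hS)
  rw [hP.frD_eq, hQ.frD_eq]
  clear hP hQ
  simp only [cylTetrad_zero, cylTetrad_one, cylTetrad_two, cylTetrad_three, kappa_eq κ,
      one_sub_T hS, bgPiBar, bgPi, bgTau, bgTauBar, bgRho, bgRhoBar, bgMu, bgMuBar, bgGammaRe,
      bgGammaIm, bgAlphaSum, bgAlphaSumBar, bgAlphaDiff, bgAlphaDiffBar, bgSchouten01,
      bgSchouten23, bgPhi, frSig, frW, frTh, frZ, frU,
      Matrix.cons_val, deltaC, mul_zero, zero_mul, add_zero, zero_add, sub_zero, zero_sub, zero_div,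
      neg_zero, mul_one, one_mul]
  generalize sigC x = S at *
  generalize sinC x = sn at *
  generalize cosC x = c at *
  generalize cylW x = w at *
  generalize cylFC κ x = F at *
  generalize cylFC' κ x = F' at *
  generalize imk κ = K at *
  generalize hsq = h at *
  generalize Complex.I = j at *
  try field_simp
  try ring_nf
  try simp only [hh, hsin, hsin3, hsin4, hI, hI3, hI4]
  try ring

-- The analogous obstruction for the perturbed `φ₃`, with `P = 4π + 2α` and `Q = 4μ + 2γ`.
set_option maxHeartbeats 8000000 in
lemma potential_four (hS : sigC x ≠ 0) (hs : sinC x ≠ 0) :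
    frD κ 1 (fun y => 4 * bgPi κ y + (bgAlphaDiff κ y + bgAlphaSum κ y)) x
      - frD κ 3 (fun y => 4 * bgMu κ y + (bgGammaIm κ y + bgGammaRe κ y)) x
      + (3 * ((bgGammaIm κ x + bgGammaRe κ x) / 2) - (bgGammaRe κ x - bgGammaIm κ x) / 2
      + bgMuBar κ x + 4 * bgMu κ x) * (4 * bgPi κ x + (bgAlphaDiff κ x + bgAlphaSum κ x))
      - (-bgTauBar κ x + (bgAlphaSum κ x - bgAlphaDiff κ x) / 2
      + 3 * ((bgAlphaDiff κ x + bgAlphaSum κ x) / 2) + 4 * bgPi κ x) * (4 * bgMu κ x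
        + (bgGammaIm κ x + bgGammaRe κ x)) = 0 := by
  have hz := zeta_ne κ x
  have hzb := zetaBar_ne κ x
  have hh := hsq_sq
  have hsin := sinC_sq x
  have hI := Complex.I_sq
  have hI3 := Complex.I_pow_three
  have hI4 := Complex.I_pow_four
  have hsin3 := sinC_pow_three x
  have hsin4 := sinC_pow_four x
  have hP := ((HasFr.const κ x 4).mul (hasFr_pi hS)).add
    ((hasFr_alphaDiff hS hs).add (hasFr_alphaSum hS))
  have hQ := ((HasFr.const κ x 4).mul (hasFr_mu hS)).add
    ((hasFr_gammaIm hS).add (hasFr_gammaRe hS))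
  rw [hP.frD_eq, hQ.frD_eq]
  clear hP hQ
  simp only [cylTetrad_zero, cylTetrad_one, cylTetrad_two, cylTetrad_three, kappa_eq κ,
      one_sub_T hS, bgPiBar, bgPi, bgTau, bgTauBar, bgRho, bgRhoBar, bgMu, bgMuBar, bgGammaRe,
      bgGammaIm, bgAlphaSum, bgAlphaSumBar, bgAlphaDiff, bgAlphaDiffBar, bgSchouten01,
      bgSchouten23, bgPhi, frSig, frW, frTh, frZ, frU,
      Matrix.cons_val, deltaC, mul_zero, zero_mul, add_zero, zero_add, sub_zero, zero_sub, zero_div,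
      neg_zero, mul_one, one_mul]
  generalize sigC x = S at *
  generalize sinC x = sn at *
  generalize cosC x = c at *
  generalize cylW x = w at *
  generalize cylFC κ x = F at *
  generalize cylFC' κ x = F' at *
  generalize imk κ = K at *
  generalize hsq = h at *
  generalize Complex.I = j at *
  try field_simp
  try ring_nf
  try simp only [hh, hsin, hsin3, hsin4, hI, hI3, hI4]
  try ring

/-- `φ₂` is a constant times `ζ⁻³`, so its logarithmic derivatives are `-3` times those of `ζ`, that
is `3ρ, -3μ, 3τ, -3π`. -/
lemma frD_phi (hS : sigC x ≠ 0) (a : Fin 4) :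
    frD κ a (bgPhi rp κ) x
      = -3 * (frZ κ x a / (1 - imk κ * cylW x * cosC x)) * bgPhi rp κ x := by
  have hz := zeta_ne κ x
  rw [(hasFr_phi hS).frD_eq, bgPhi]
  field_simp

end Decoupling

/-! ### The Teukolsky equations for the perturbations. -/

section TeukolskyEquations

open CEFEFields IsCylBackground

variable {rp κ : ℝ} {V : Set Pt} {𝓕 : ℝ → CEFEFields} {x : Pt}

lemma contDiffAt_phi0Pert (hV : IsOpen V) (h : IsLinearisedSolution V 𝓕) (hx : x ∈ V) :
    ContDiffAt ℝ ∞ (phi0Pert 𝓕) x :=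
  (h.smooth_d hV 0 2 0 2).contDiffAt_vari hV hx

lemma contDiffAt_phi4Pert (hV : IsOpen V) (h : IsLinearisedSolution V 𝓕) (hx : x ∈ V) :
    ContDiffAt ℝ ∞ (phi4Pert 𝓕) x :=
  (h.smooth_d hV 1 3 1 3).contDiffAt_vari hV hx

set_option maxHeartbeats 1000000 in
/-- The Teukolsky equation for the perturbation of `φ₀`. -/
theorem teuk0_linearised (hrp : 0 < rp) (hκ : |κ| < 1) (hV : IsOpen V) (hVU : V ⊆ cylRegion)
    (h : IsLinearisedSolution V 𝓕) (hB : IsCylBackground rp κ V (𝓕 0)) (hx : x ∈ V) :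
    (𝓕 0).teuk0 (phi0Pert 𝓕) x = 0 := by
  have hS := sigC_ne (hVU hx)
  have hs := sinC_ne (hVU hx)
  have hc : ∀ y ∈ V, ∀ a b c, (𝓕 0).conn a b c y = bgConn κ a b c y := fun y hy =>
    hB.conn_eq hrp hκ hV hVU hy
  have h0 : ∀ y ∈ V, (𝓕 0).phi0 y = 0 := fun y hy => (hB.weylScalars_eq hrp hκ hV hVU hy).1
  have h1 : ∀ y ∈ V, (𝓕 0).phi1 y = 0 := fun y hy => (hB.weylScalars_eq hrp hκ hV hVU hy).2.1
  have hk0 : ∀ y ∈ V, (𝓕 0).conn 0 0 2 y = 0 := fun y hy => hc y hy 0 0 2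
  have hs0 : ∀ y ∈ V, (𝓕 0).conn 2 0 2 y = 0 := fun y hy => hc y hy 2 0 2
  have hψ₁ : ContDiffAt ℝ ∞ (vari fun ε => (𝓕 ε).phi1) x :=
    SmoothFam.contDiffAt_vari hV (h.smooth_d hV 0 1 0 2) hx
  have hdk := ((h.smooth_conn hV 0 0 2).contDiffAt_vari hV hx).differentiableAt (by simp)
  have hds := ((h.smooth_conn hV 2 0 2).contDiffAt_vari hV hx).differentiableAt (by simp)
  have hψ₂ := hψ₁.of_le (m := 2) (WithTop.coe_le_coe.mpr le_top)
  have hcm := frD_commutator (rp := rp) (κ := κ) hS hs hψ₂ 0 2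
  have hric := linearised_ricci_sigma hV h hx h0 hk0 hs0
  have hpot := potential_zero (κ := κ) hS hs
  have hP := ((HasFr.const κ x (-4)).mul (hasFr_tau hS)).add ((HasFr.const κ x (-1)).mul
      ((hasFr_alphaSumBar hS).sub (hasFr_alphaDiffBar hS hs)))
  have hQ := (HasFr.const κ x (-4)).mul (hasFr_rho hS)
  rw [hB.teuk0_eq hrp hκ hV hVU hx]
  refine frOp_decoupled hV hx hP hQ hS hs (hasFr_phi (rp := rp) hS).diff
    (ra := bgRho κ x) (rc := bgTau κ x) ?_ ?_ hψ₂ hdk hds (fun y hy => ?_) (fun y hy => ?_) ?_ ?_ ?_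
  · rw [frD_phi hS, frZ_div_zero]
    ring
  · rw [frD_phi hS, frZ_div_two]
    ring
  · have e := linearised_bianchi_kappa hV h hy h0 h1 hk0
    simp only [hB.dir_eq hy, hB.spinCoefficients_eq hrp hκ hV hVU hy,
      hB.weylScalars_eq hrp hκ hV hVU hy] at e
    linear_combination e
  · have e := linearised_bianchi_sigma hV h hy h0 h1 hs0
    simp only [hB.dir_eq hy, hB.spinCoefficients_eq hrp hκ hV hVU hy,
      hB.weylScalars_eq hrp hκ hV hVU hy] at e
    linear_combination e
  · simp only [hB.dir_eq hx, hc x hx, hB.XiC_eq hx, bgConn, Matrix.cons_val, Pi.neg_apply,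
      Pi.zero_apply] at hric
    linear_combination hric
  · rw [hcm]
    simp only [Fin.sum_univ_four, connUp_zero, connUp_one, connUp_two, connUp_three, bgFields_conn,
      bgConn, Matrix.cons_val, Pi.neg_apply, Pi.zero_apply]
    ring
  · rw [hP.frD_eq, hQ.frD_eq] at hpot
    exact hpot

set_option maxHeartbeats 1000000 in
/-- The Teukolsky equation for the perturbation of `φ₄`. -/
theorem teuk4_linearised (hrp : 0 < rp) (hκ : |κ| < 1) (hV : IsOpen V) (hVU : V ⊆ cylRegion)
    (h : IsLinearisedSolution V 𝓕) (hB : IsCylBackground rp κ V (𝓕 0)) (hx : x ∈ V) :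
    (𝓕 0).teuk4 (phi4Pert 𝓕) x = 0 := by
  have hS := sigC_ne (hVU hx)
  have hs := sinC_ne (hVU hx)
  have hc : ∀ y ∈ V, ∀ a b c, (𝓕 0).conn a b c y = bgConn κ a b c y := fun y hy =>
    hB.conn_eq hrp hκ hV hVU hy
  have h0 : ∀ y ∈ V, (𝓕 0).phi4 y = 0 := fun y hy => (hB.weylScalars_eq hrp hκ hV hVU hy).2.2.2.1
  have h1 : ∀ y ∈ V, (𝓕 0).phi3 y = 0 := fun y hy => (hB.weylScalars_eq hrp hκ hV hVU hy).2.2.1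
  have hk0 : ∀ y ∈ V, (𝓕 0).conn 1 1 3 y = 0 := fun y hy => hc y hy 1 1 3
  have hs0 : ∀ y ∈ V, (𝓕 0).conn 3 1 3 y = 0 := fun y hy => hc y hy 3 1 3
  have hψ₁ : ContDiffAt ℝ ∞ (vari fun ε => (𝓕 ε).phi3) x :=
    SmoothFam.contDiffAt_vari hV (h.smooth_d hV 0 1 3 1) hx
  have hdk := ((h.smooth_conn hV 1 1 3).contDiffAt_vari hV hx).differentiableAt (by simp)
  have hds := ((h.smooth_conn hV 3 1 3).contDiffAt_vari hV hx).differentiableAt (by simp)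
  have hψ₂ := hψ₁.of_le (m := 2) (WithTop.coe_le_coe.mpr le_top)
  have hcm := frD_commutator (rp := rp) (κ := κ) hS hs hψ₂ 1 3
  have hric := linearised_ricci_lambda hV h hx h0 hk0 hs0
  have hpot := potential_four (κ := κ) hS hs
  have hP := ((HasFr.const κ x 4).mul (hasFr_pi hS)).add
      ((hasFr_alphaDiff hS hs).add (hasFr_alphaSum hS))
  have hQ := ((HasFr.const κ x 4).mul (hasFr_mu hS)).add
      ((hasFr_gammaIm hS).add (hasFr_gammaRe hS))
  rw [hB.teuk4_eq hrp hκ hV hVU hx]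
  refine frOp_decoupled hV hx hP hQ hS hs (hasFr_phi (rp := rp) hS).diff
    (ra := -bgMu κ x) (rc := -bgPi κ x) ?_ ?_ hψ₂ hdk hds (fun y hy => ?_) (fun y hy => ?_) ?_ ?_ ?_
  · rw [frD_phi hS, frZ_div_one]
    ring
  · rw [frD_phi hS, frZ_div_three]
    ring
  · have e := linearised_bianchi_nu hV h hy h0 h1 hk0
    simp only [hB.dir_eq hy, hB.spinCoefficients_eq hrp hκ hV hVU hy,
      hB.weylScalars_eq hrp hκ hV hVU hy] at e
    linear_combination e
  · have e := linearised_bianchi_lambda hV h hy h0 h1 hs0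
    simp only [hB.dir_eq hy, hB.spinCoefficients_eq hrp hκ hV hVU hy,
      hB.weylScalars_eq hrp hκ hV hVU hy] at e
    linear_combination e
  · simp only [hB.dir_eq hx, hc x hx, hB.XiC_eq hx, bgConn, Matrix.cons_val, Pi.neg_apply,
      Pi.zero_apply] at hric
    linear_combination hric
  · rw [hcm]
    simp only [Fin.sum_univ_four, connUp_zero, connUp_one, connUp_two, connUp_three, bgFields_conn,
      bgConn, Matrix.cons_val, Pi.neg_apply, Pi.zero_apply]
    ring
  · rw [hP.frD_eq, hQ.frD_eq] at hpot
    exact hpot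

end TeukolskyEquations

/-! ### The transformation to Boyer–Lindquist coordinates -/

section Transformation

variable {rp κ : ℝ} {x : Pt}

/-- `∂t/∂T`. -/
def blTimeT (rp κ : ℝ) (x : Pt) : ℝ :=
  rp * (1 / (x 1 * (1 - x 0) ^ 2) + (1 + κ ^ 2) / (1 - x 0)
    + (1 + κ ^ 2) / (1 - κ ^ 2) * (x 1 / (1 - x 1 * (1 - x 0))
      - κ ^ 4 * x 1 / (1 - κ ^ 2 * x 1 * (1 - x 0))))

/-- `∂t/∂ς`. -/
def blTimeS (rp κ : ℝ) (x : Pt) : ℝ :=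
  rp * (-(x 0 / (x 1 ^ 2 * (1 - x 0)))
    + (1 + κ ^ 2) / (1 - κ ^ 2) * (κ ^ 4 * (1 - x 0) / (1 - κ ^ 2 * x 1 * (1 - x 0))
      - κ ^ 4 / (1 - κ ^ 2 * x 1) + 1 / (1 - x 1) - (1 - x 0) / (1 - x 1 * (1 - x 0))))

/-- `∂r/∂T`. -/
def blRadiusT (rp : ℝ) (x : Pt) : ℝ := rp / (x 1 * (1 - x 0) ^ 2)

/-- `∂r/∂ς`. -/
def blRadiusS (rp : ℝ) (x : Pt) : ℝ := -(rp / (x 1 ^ 2 * (1 - x 0)))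

lemma hasFDerivAt_coord (i : Fin 4) (x : Pt) :
    HasFDerivAt (fun y : Pt => y i) (ContinuousLinearMap.proj (R := ℝ) (φ := fun _ => ℝ) i) x :=
  hasFDerivAt_apply i x

lemma hasFDerivAt_div {f g : Pt → ℝ} {f' g' : Pt →L[ℝ] ℝ} (hf : HasFDerivAt f f' x)
    (hg : HasFDerivAt g g' x) (h : g x ≠ 0) :
    HasFDerivAt (fun y => f y / g y) ((g x)⁻¹ • f' - (f x / g x ^ 2) • g') x := by
  have h2 : HasFDerivAt (fun y => (g y)⁻¹) ((-(g x ^ 2)⁻¹) • g') x :=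
    (hasDerivAt_inv h).comp_hasFDerivAt x hg
  simp only [div_eq_mul_inv]
  refine (hf.mul h2).congr_fderiv ?_
  ext v
  simp
  ring

lemma kappa_sq_lt (hκ : |κ| < 1) : κ ^ 2 < 1 := by
  rw [← sq_abs]
  nlinarith [abs_nonneg κ]

/-- The inequalities satisfied by the coordinates in the exterior region. -/
structure Exterior (κ : ℝ) (x : Pt) : Prop where
  sig : 0 < x 1
  u : 0 < 1 - x 0
  one_sub_sig : 0 < 1 - x 1
  one_sub_w : 0 < 1 - x 1 * (1 - x 0)
  one_sub_k_sig : 0 < 1 - κ ^ 2 * x 1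
  one_sub_k_w : 0 < 1 - κ ^ 2 * x 1 * (1 - x 0)
  one_sub_k : 0 < 1 - κ ^ 2

lemma Exterior.of_mem (hκ : |κ| < 1) (hx : x ∈ cylRegion) (hT : x 0 < 1) : Exterior κ x := by
  obtain ⟨h1, h2, h3, -, -⟩ := hx
  have hk := kappa_sq_lt hκ
  have hk0 := sq_nonneg κ
  have hu : 0 < 1 - x 0 := by linarith
  have hw : 0 < x 1 * (1 - x 0) := mul_pos h1 hu
  exact ⟨h1, hu, by linarith, by linarith, by nlinarith, by nlinarith, by linarith⟩

lemma hasFDerivAt_radius (h : Exterior κ x) :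
    HasFDerivAt (fun y : Pt => rp / (y 1 * (1 - y 0)))
      (blRadiusT rp x • ContinuousLinearMap.proj (R := ℝ) (φ := fun _ => ℝ) (0 : Fin 4)
        + blRadiusS rp x • ContinuousLinearMap.proj (R := ℝ) (φ := fun _ => ℝ) (1 : Fin 4)) x := by
  have h1 := h.sig.ne'
  have hu := h.u.ne'
  have hw := ((hasFDerivAt_coord 1 x).mul ((hasFDerivAt_coord 0 x).const_sub 1))
  refine (hasFDerivAt_div (hasFDerivAt_const rp x) hw (mul_ne_zero h1 hu)).congr_fderiv ?_
  ext v
  simp [blRadiusT, blRadiusS]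
  field_simp
  ring

lemma hasFDerivAt_time (h : Exterior κ x) (φs : ℝ → ℝ) :
    HasFDerivAt (fun y : Pt => cylToBL rp κ φs y 0)
      (blTimeT rp κ x • ContinuousLinearMap.proj (R := ℝ) (φ := fun _ => ℝ) (0 : Fin 4)
        + blTimeS rp κ x • ContinuousLinearMap.proj (R := ℝ) (φ := fun _ => ℝ) (1 : Fin 4)) x := by
  have h1 := h.sig.ne'
  have hu := h.u.ne'
  have h3 := h.one_sub_sig.ne'
  have h4 := h.one_sub_w.ne'
  have h5 := h.one_sub_k_sig.ne'
  have h6 := h.one_sub_k_w.ne'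
  have h7 := h.one_sub_k.ne'
  have c1 := hasFDerivAt_coord 1 x
  have c0 := hasFDerivAt_coord 0 x
  have du := c0.const_sub 1
  have dw := c1.mul du
  have dk := (c1.const_mul (κ ^ 2))
  have main := ((((hasFDerivAt_div c0 dw (mul_ne_zero h1 hu)).sub ((du.log hu).const_mul (1
      + κ ^ 2))).add
    (((((hasFDerivAt_div (dk.const_sub 1) ((dk.mul du).const_sub 1) h6).log (div_ne_zero h5
      h6)).const_mul
      (κ ^ 2)).sub ((hasFDerivAt_div (c1.const_sub 1) (dw.const_sub 1) h4).log
        (div_ne_zero h3 h4))).const_mul ((1 + κ ^ 2) / (1 - κ ^ 2)))).const_mul rp)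
  refine (main.congr_fderiv ?_)
  ext v
  simp only [blTimeT, blTimeS, smul_apply, sub_apply,
    add_apply, neg_apply, ContinuousLinearMap.proj_apply,
    smul_eq_mul, Pi.mul_apply]
  clear main du dw dk c0 c1 h
  -- The remaining identity holds formally in these denominators. Naming them and forgetting their
  -- definitions keeps them from being expanded.
  generalize hAeq : 1 - x 1 * (1 - x 0) = A at *
  generalize hEeq : 1 - κ ^ 2 * x 1 * (1 - x 0) = E at *
  generalize hBeq : 1 - x 1 = B at *
  generalize hCeq : 1 - κ ^ 2 * x 1 = C at *
  generalize hGeq : 1 - κ ^ 2 = G at *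
  clear hAeq hEeq hBeq hCeq hGeq
  obtain ⟨u, hxu⟩ : ∃ u, x 0 = 1 - u := ⟨1 - x 0, by ring⟩
  rw [hxu] at hu ⊢
  rw [sub_sub_cancel] at hu ⊢
  field_simp
  ring

end Transformation

/-! ### The Jacobian and the Kerr functions at the image point. -/

section Kinnersley

variable {rp κ : ℝ} {x : Pt} {φs : ℝ → ℝ}

/-- The rows of the Jacobian matrix of the coordinate transformation. -/
def blJacobian (rp κ f : ℝ) (x : Pt) : Fin 4 → Fin 4 → ℝ :=
  ![![blTimeT rp κ x, blTimeS rp κ x, 0, 0], ![blRadiusT rp x, blRadiusS rp x, 0, 0],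
    ![0, 0, 1, 0], ![f * blRadiusT rp x, f * blRadiusS rp x, 0, 1]]

lemma hasFDerivAt_cylToBL {f : ℝ} (h : Exterior κ x)
    (hφ : HasDerivAt φs f (rp / (x 1 * (1 - x 0)))) :
    HasFDerivAt (cylToBL rp κ φs) (ContinuousLinearMap.pi fun μ =>
      ∑ ν, blJacobian rp κ f x μ ν • ContinuousLinearMap.proj (R := ℝ) (φ := fun _ => ℝ) ν) x := by
  refine hasFDerivAt_pi.mpr fun μ => ?_
  fin_cases μ
  · refine (hasFDerivAt_time h φs).congr_fderiv ?_
    simp [blJacobian, Fin.sum_univ_four]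
  · refine (hasFDerivAt_radius h).congr_fderiv ?_
    simp [blJacobian, Fin.sum_univ_four]
  · refine (hasFDerivAt_coord 2 x).congr_fderiv ?_
    simp [blJacobian, Fin.sum_univ_four]
  · have h1 := (hasFDerivAt_coord 3 x).fun_add
      (hφ.comp_hasFDerivAt x (hasFDerivAt_radius (rp := rp) h))
    refine h1.congr_fderiv ?_
    ext v
    simp [blJacobian, Fin.sum_univ_four]
    ring

lemma jac_cylToBL {f : ℝ} (h : Exterior κ x)
    (hφ : HasDerivAt φs f (rp / (x 1 * (1 - x 0)))) (μ ν : Fin 4) :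
    jac (cylToBL rp κ φs) x μ ν = blJacobian rp κ f x μ ν := by
  rw [jac, (hasFDerivAt_cylToBL h hφ).fderiv]
  simp [Pi.single_apply]

/-- The vector `(1 - T)/ς ∂_T + ∂_ς` annihilates `r`, hence also `φ_*(r)`, so its image is a
multiple of `∂_t`. -/
lemma blRadius_relation (h : Exterior κ x) :
    blRadiusT rp x * ((1 - x 0) / x 1) + blRadiusS rp x = 0 := by
  have h1 := h.sig.ne'
  have hu := h.u.ne'
  rw [blRadiusT, blRadiusS]
  field_simp
  ring

/-- With `blRadius_relation`: `F ((1 - T)/ς ∂_T + ∂_ς)` is `r₊` times the stationary Killing vector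
`∂_t`. This is where the explicit form of `F` is needed. -/
lemma blTime_relation (h : Exterior κ x) :
    cylF κ (x 1) * (blTimeT rp κ x * ((1 - x 0) / x 1) + blTimeS rp κ x) = rp := by
  have h1 := h.sig.ne'
  have hu := h.u.ne'
  have h3 := h.one_sub_sig.ne'
  have h4 := h.one_sub_w.ne'
  have h5 := h.one_sub_k_sig.ne'
  have h6 := h.one_sub_k_w.ne'
  have h7 := h.one_sub_k.ne'
  have h8 : 1 + κ ^ 2 * x 1 ^ 2 ≠ 0 := by positivity
  have h9 : 1 - x 1 * κ ^ 2 ≠ 0 := by rwa [mul_comm]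
  have e : blTimeT rp κ x * ((1 - x 0) / x 1) + blTimeS rp κ x
      = rp * (1 + κ ^ 2 * x 1 ^ 2) / (x 1 ^ 2 * (1 - x 1) * (1 - κ ^ 2 * x 1)) := by
    -- The `T`-dependent terms cancel first, leaving a partial-fraction expansion in `ς` alone.
    have e1 : blTimeT rp κ x * ((1 - x 0) / x 1) + blTimeS rp κ x
        = rp * (1 / x 1 ^ 2 + (1 + κ ^ 2) / x 1
          + (1 + κ ^ 2) / (1 - κ ^ 2) * (1 / (1 - x 1) - κ ^ 4 / (1 - κ ^ 2 * x 1))) := by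
      rw [blTimeT, blTimeS]
      generalize 1 - x 1 * (1 - x 0) = A at *
      generalize 1 - κ ^ 2 * x 1 * (1 - x 0) = E at *
      generalize 1 - x 1 = B at *
      generalize 1 - κ ^ 2 * x 1 = C at *
      generalize 1 - κ ^ 2 = G at *
      obtain ⟨u, hxu⟩ : ∃ u, x 0 = 1 - u := ⟨1 - x 0, by ring⟩
      rw [hxu] at hu ⊢
      rw [sub_sub_cancel] at hu ⊢
      field_simp
      ring
    rw [e1]
    field_simp
    ring
  rw [e, cylF]
  field_simp

/-- Boyer–Lindquist functions in terms of the conformal ones. -/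
lemma kerrDelta_eq (h : Exterior κ x) :
    kerrDelta (kerrMass rp κ) (kerrSpin rp κ) (rp / (x 1 * (1 - x 0)))
      = (rp / (x 1 * (1 - x 0))) ^ 2 * cylDelta κ x := by
  have h1 := h.sig.ne'
  have hu := h.u.ne'
  simp only [kerrDelta, kerrMass, kerrSpin, cylDelta]
  field_simp
  ring

lemma kerrSigma_eq (h : Exterior κ x) :
    kerrSigma (kerrSpin rp κ) (rp / (x 1 * (1 - x 0))) (x 2)
      = (rp / (x 1 * (1 - x 0))) ^ 2 * cylSigma κ x := by
  have h1 := h.sig.ne'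
  have hu := h.u.ne'
  simp only [kerrSigma, kerrSpin, cylSigma]
  field_simp

lemma radius_sq_add_spin_sq (h : Exterior κ x) :
    (rp / (x 1 * (1 - x 0))) ^ 2 + kerrSpin rp κ ^ 2
      = (rp / (x 1 * (1 - x 0))) ^ 2 * cylSigma0 κ x := by
  have h1 := h.sig.ne'
  have hu := h.u.ne'
  simp only [kerrSpin, cylSigma0]
  field_simp

lemma cylDelta_pos (h : Exterior κ x) : 0 < cylDelta κ x := by
  rw [cylDelta, ← mul_assoc]
  exact mul_pos h.one_sub_w h.one_sub_k_w

lemma cylSigma_pos (κ : ℝ) (x : Pt) : 0 < cylSigma κ x := by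
  rw [cylSigma]
  positivity

/-- Along `∂_T` one has `dt/dr = (r² + a²)/Δ̃`, the slope of the principal null direction. Thus
`∂_T` is `∂r/∂T` times the Kinnersley vector `ℓ̃`. -/
lemma blTimeT_eq (h : Exterior κ x) :
    blTimeT rp κ x = blRadiusT rp x * (cylSigma0 κ x / cylDelta κ x) := by
  have h1 := h.sig.ne'
  have hu := h.u.ne'
  have h4 := h.one_sub_w.ne'
  have h6 := h.one_sub_k_w.ne'
  have h7 := h.one_sub_k.ne'
  rw [blTimeT, blRadiusT, cylSigma0, cylDelta, ← mul_assoc (κ ^ 2)]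
  obtain ⟨u, hxu⟩ : ∃ u, x 0 = 1 - u := ⟨1 - x 0, by ring⟩
  rw [hxu] at hu h4 h6 ⊢
  rw [sub_sub_cancel] at hu h4 h6 ⊢
  have h9 : 1 - x 1 * u * κ ^ 2 ≠ 0 := by rwa [mul_comm, ← mul_assoc]
  field_simp
  ring

end Kinnersley

/-! ### The image of the cylinder tetrad in Boyer–Lindquist coordinates. -/

section TetradTransformation

variable {rp κ : ℝ} {x : Pt} {φs : ℝ → ℝ}

/-- The value of `φs'` at the image point. -/
def blAngleSlope (rp κ : ℝ) (x : Pt) : ℝ :=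
  kerrSpin rp κ / kerrDelta (kerrMass rp κ) (kerrSpin rp κ) (rp / (x 1 * (1 - x 0)))

lemma blTetrad_zero (hrp : 0 < rp) (h : Exterior κ x) (φs : ℝ → ℝ) (μ : Fin 4) :
    ∑ ν, (blJacobian rp κ (blAngleSlope rp κ x) x μ ν : ℂ) * cylTetrad κ x 0 ν
      = (tetradScale rp x 0 : ℂ)
        * kinnersley (kerrMass rp κ) (kerrSpin rp κ) (cylToBL rp κ φs x) 0 μ := by
  have h1 := h.sig.ne'
  have hu := h.u.ne'
  have hr := hrp.ne'
  have hsc : tetradScale rp x 0 = blRadiusT rp x := by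
    simp only [tetradScale, Matrix.cons_val, cylXi, blRadiusT]
    field_simp
  have hD := (cylDelta_pos h).ne'
  have hk : kinnersley (kerrMass rp κ) (kerrSpin rp κ) (cylToBL rp κ φs x) 0
      = ![((cylSigma0 κ x / cylDelta κ x : ℝ) : ℂ), 1, 0, (blAngleSlope rp κ x : ℝ)] := by
    have : ((rp / (x 1 * (1 - x 0))) ^ 2 + kerrSpin rp κ ^ 2)
        / kerrDelta (kerrMass rp κ) (kerrSpin rp κ) (rp / (x 1 * (1 - x 0)))
        = cylSigma0 κ x / cylDelta κ x := by
      rw [radius_sq_add_spin_sq h, kerrDelta_eq h]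
      field_simp
    rw [← this]
    rfl
  have ht : cylTetrad κ x 0 = ![1, 0, 0, 0] := rfl
  rw [hsc, hk, ht]
  fin_cases μ
  · simp [Fin.sum_univ_four, blJacobian, blTimeT_eq h]
  · simp [Fin.sum_univ_four, blJacobian]
  · simp [Fin.sum_univ_four, blJacobian]
  · simp [Fin.sum_univ_four, blJacobian, mul_comm]

lemma blTetrad_one (hrp : 0 < rp) (h : Exterior κ x) (φs : ℝ → ℝ) (μ : Fin 4) :
    ∑ ν, (blJacobian rp κ (blAngleSlope rp κ x) x μ ν : ℂ) * cylTetrad κ x 1 ν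
      = (tetradScale rp x 1 : ℂ)
        * kinnersley (kerrMass rp κ) (kerrSpin rp κ) (cylToBL rp κ φs x) 1 μ := by
  have h1 := h.sig.ne'
  have hu := h.u.ne'
  have hr := hrp.ne'
  have hD := (cylDelta_pos h).ne'
  have hS := (cylSigma_pos κ x).ne'
  have hsc : tetradScale rp x 1 = rp / x 1 := rfl
  have hk : kinnersley (kerrMass rp κ) (kerrSpin rp κ) (cylToBL rp κ φs x) 1
      = ![((cylSigma0 κ x / (2 * cylSigma κ x) : ℝ) : ℂ),
          ((-cylDelta κ x / (2 * cylSigma κ x) : ℝ) : ℂ), 0,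
          ((κ * x 1 ^ 2 * (1 - x 0) ^ 2 / (2 * rp * cylSigma κ x) : ℝ) : ℂ)] := by
    have e0 : ((rp / (x 1 * (1 - x 0))) ^ 2 + kerrSpin rp κ ^ 2)
        / (2 * kerrSigma (kerrSpin rp κ) (rp / (x 1 * (1 - x 0))) (x 2))
        = cylSigma0 κ x / (2 * cylSigma κ x) := by
      rw [radius_sq_add_spin_sq h, kerrSigma_eq h]
      field_simp
    have e1 : -kerrDelta (kerrMass rp κ) (kerrSpin rp κ) (rp / (x 1 * (1 - x 0)))
        / (2 * kerrSigma (kerrSpin rp κ) (rp / (x 1 * (1 - x 0))) (x 2))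
        = -cylDelta κ x / (2 * cylSigma κ x) := by
      rw [kerrDelta_eq h, kerrSigma_eq h]
      field_simp
    have e3 : kerrSpin rp κ / (2 * kerrSigma (kerrSpin rp κ) (rp / (x 1 * (1 - x 0))) (x 2))
        = κ * x 1 ^ 2 * (1 - x 0) ^ 2 / (2 * rp * cylSigma κ x) := by
      rw [kerrSigma_eq h, kerrSpin]
      field_simp
    rw [← e0, ← e1, ← e3]
    rfl
  have hT := blTime_relation (rp := rp) h
  have hR := blRadius_relation (rp := rp) h
  have hTT := blTimeT_eq (rp := rp) h
  have hrT : blRadiusT rp x = rp / (x 1 * (1 - x 0) ^ 2) := rfl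
  -- The `T` component is split so that the `T` and `ς` parts of `k` become a multiple of the
  -- Killing direction minus a multiple of `∂_T`; the relations for `t` and `r` then apply to each
  -- part.
  have hk0 : (1 - x 0) / (2 * cylSigma κ x) * (2 * cylSigma0 κ x * cylF κ (x 1) / x 1 ^ 2
      - (1 - x 0) * cylDelta κ x)
      = (1 - x 0) / x 1 * (cylF κ (x 1) / x 1 * (cylSigma0 κ x / cylSigma κ x))
        - (1 - x 0) ^ 2 * cylDelta κ x / (2 * cylSigma κ x) := by
    field_simp
  have ht : cylTetrad κ x 1 = ![(((1 - x 0) / x 1 * (cylF κ (x 1) / x 1 * (cylSigma0 κ x / cylSigma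
      κ x))
        - (1 - x 0) ^ 2 * cylDelta κ x / (2 * cylSigma κ x) : ℝ) : ℂ),
      ((cylF κ (x 1) / x 1 * (cylSigma0 κ x / cylSigma κ x) : ℝ) : ℂ), 0,
      ((κ * x 1 * (1 - x 0) ^ 2 / cylSigma κ x : ℝ) : ℂ)] := by
    rw [← hk0]
    rfl
  have r0 : blTimeT rp κ x * ((1 - x 0) / x 1 * (cylF κ (x 1) / x 1 * (cylSigma0 κ x / cylSigma κ
      x))
        - (1 - x 0) ^ 2 * cylDelta κ x / (2 * cylSigma κ x))
      + blTimeS rp κ x * (cylF κ (x 1) / x 1 * (cylSigma0 κ x / cylSigma κ x))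
      = rp / x 1 * (cylSigma0 κ x / (2 * cylSigma κ x)) := by
    have : blTimeT rp κ x * ((1 - x 0) ^ 2 * cylDelta κ x / (2 * cylSigma κ x))
        = rp / x 1 * (cylSigma0 κ x / (2 * cylSigma κ x)) := by
      rw [hTT, hrT]
      field_simp
    have h2 : cylSigma0 κ x / cylSigma κ x = 2 * (cylSigma0 κ x / (2 * cylSigma κ x)) := by
      field_simp
    linear_combination (cylSigma0 κ x / cylSigma κ x / x 1) * hT - this + rp / x 1 * h2
  have r1 : blRadiusT rp x * ((1 - x 0) / x 1 * (cylF κ (x 1) / x 1 * (cylSigma0 κ x / cylSigma κ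
      x))
        - (1 - x 0) ^ 2 * cylDelta κ x / (2 * cylSigma κ x))
      + blRadiusS rp x * (cylF κ (x 1) / x 1 * (cylSigma0 κ x / cylSigma κ x))
      = rp / x 1 * (-cylDelta κ x / (2 * cylSigma κ x)) := by
    have : blRadiusT rp x * ((1 - x 0) ^ 2 * cylDelta κ x / (2 * cylSigma κ x))
        = rp / x 1 * (cylDelta κ x / (2 * cylSigma κ x)) := by
      rw [hrT]
      field_simp
    linear_combination (cylF κ (x 1) / x 1 * (cylSigma0 κ x / cylSigma κ x)) * hR - this
  have r3 : blAngleSlope rp κ x * (rp / x 1 * (-cylDelta κ x / (2 * cylSigma κ x)))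
      + κ * x 1 * (1 - x 0) ^ 2 / cylSigma κ x
      = rp / x 1 * (κ * x 1 ^ 2 * (1 - x 0) ^ 2 / (2 * rp * cylSigma κ x)) := by
    rw [blAngleSlope, kerrDelta_eq h, kerrSpin]
    field_simp
    ring
  rw [hsc, hk, ht]
  fin_cases μ
  · simp only [Fin.sum_univ_four, blJacobian, Fin.zero_eta, Matrix.cons_val]
    have e := congrArg (fun t : ℝ => (t : ℂ)) r0
    push_cast at e ⊢
    linear_combination e
  · simp only [Fin.sum_univ_four, blJacobian, Fin.mk_one, Matrix.cons_val]
    have e := congrArg (fun t : ℝ => (t : ℂ)) r1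
    push_cast at e ⊢
    linear_combination e
  · simp [Fin.sum_univ_four, blJacobian]
  · simp only [Fin.sum_univ_four, blJacobian, Fin.reduceFinMk, Matrix.cons_val]
    have e := congrArg (fun t : ℝ => (t : ℂ)) r3
    have e1 := congrArg (fun t : ℝ => (t : ℂ)) r1
    push_cast at e e1 ⊢
    linear_combination e + (blAngleSlope rp κ x : ℂ) * e1

lemma blTetrad_two (hrp : 0 < rp) (h : Exterior κ x) (φs : ℝ → ℝ) (μ : Fin 4) :
    ∑ ν, (blJacobian rp κ (blAngleSlope rp κ x) x μ ν : ℂ) * cylTetrad κ x 2 ν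
      = (tetradScale rp x 2 : ℂ)
        * kinnersley (kerrMass rp κ) (kerrSpin rp κ) (cylToBL rp κ φs x) 2 μ := by
  have h1 := h.sig.ne'
  have hu := h.u.ne'
  have hr := hrp.ne'
  have hc : ((tetradScale rp x 2 : ℝ) : ℂ) * (1 / ((Real.sqrt 2 : ℝ)
      * (((rp / (x 1 * (1 - x 0)) : ℝ) : ℂ)
        + Complex.I * (kerrSpin rp κ : ℝ) * (Real.cos (x 2) : ℝ))))
      = 1 / ((Real.sqrt 2 : ℝ)
        * (1 + Complex.I * κ * (x 1 * (1 - x 0) : ℝ) * (Real.cos (x 2) : ℝ))) := by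
    have h1c : (x 1 : ℂ) ≠ 0 := Complex.ofReal_ne_zero.mpr h1
    have huc : (1 - (x 0 : ℂ)) ≠ 0 := by
      have := Complex.ofReal_ne_zero.mpr hu
      push_cast at this
      exact this
    have hrc : (rp : ℂ) ≠ 0 := Complex.ofReal_ne_zero.mpr hr
    have e1 : ((rp / (x 1 * (1 - x 0)) : ℝ) : ℂ)
        + Complex.I * (kerrSpin rp κ : ℝ) * (Real.cos (x 2) : ℝ)
        = ((rp / (x 1 * (1 - x 0)) : ℝ) : ℂ)
          * (1 + Complex.I * κ * (x 1 * (1 - x 0) : ℝ) * (Real.cos (x 2) : ℝ)) := by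
      rw [kerrSpin]
      push_cast
      field_simp
    have e2 : tetradScale rp x 2 = rp / (x 1 * (1 - x 0)) := by
      simp only [tetradScale, Matrix.cons_val, cylXi, inv_div]
    rw [e1, e2]
    have hn : ((rp / (x 1 * (1 - x 0)) : ℝ) : ℂ) ≠ 0 :=
      Complex.ofReal_ne_zero.mpr (div_ne_zero hr (mul_ne_zero h1 hu))
    rw [mul_left_comm, one_div, mul_inv, ← mul_assoc, mul_inv_cancel₀ hn, one_mul, one_div]
  set c : ℂ := 1 / ((Real.sqrt 2 : ℝ)
    * (1 + Complex.I * κ * (x 1 * (1 - x 0) : ℝ) * (Real.cos (x 2) : ℝ))) with hcdef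
  set c' : ℂ := 1 / ((Real.sqrt 2 : ℝ) * (((rp / (x 1 * (1 - x 0)) : ℝ) : ℂ)
        + Complex.I * (kerrSpin rp κ : ℝ) * (Real.cos (x 2) : ℝ))) with hcdef'
  have ht : cylTetrad κ x 2 = ![c * ((cylF κ (x 1) * (1 - x 0) / x 1 : ℝ)
        * (Complex.I * κ * (Real.sin (x 2) : ℝ))),
      c * ((cylF κ (x 1) : ℝ) * (Complex.I * κ * (Real.sin (x 2) : ℝ))), c,
      c * (Complex.I / (Real.sin (x 2) : ℝ))] := rfl
  have hk : kinnersley (kerrMass rp κ) (kerrSpin rp κ) (cylToBL rp κ φs x) 2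
      = ![c' * (Complex.I * (kerrSpin rp κ : ℝ) * (Real.sin (x 2) : ℝ)), 0, c',
        c' * (Complex.I / (Real.sin (x 2) : ℝ))] := rfl
  have hT := congrArg (fun t : ℝ => (t : ℂ)) (blTime_relation (rp := rp) h)
  have hR := congrArg (fun t : ℝ => (t : ℂ)) (blRadius_relation (rp := rp) h)
  clear_value c c'
  rw [ht, hk]
  simp only [kerrSpin] at *
  push_cast at hT hR hc ⊢
  fin_cases μ
  · simp only [Fin.sum_univ_four, blJacobian, Fin.zero_eta, Matrix.cons_val]
    push_cast
    linear_combination c * Complex.I * κ * Complex.sin (x 2) * hT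
      - Complex.I * κ * rp * Complex.sin (x 2) * hc
  · simp only [Fin.sum_univ_four, blJacobian, Fin.mk_one, Matrix.cons_val]
    push_cast
    linear_combination c * Complex.I * κ * Complex.sin (x 2) * (cylF κ (x 1) : ℂ) * hR
  · simp only [Fin.sum_univ_four, blJacobian, Fin.reduceFinMk, Matrix.cons_val]
    push_cast
    rw [hc]
    ring
  · simp only [Fin.sum_univ_four, blJacobian, Fin.reduceFinMk, Matrix.cons_val]
    push_cast
    linear_combination (blAngleSlope rp κ x : ℂ) * c * Complex.I * κ * Complex.sin (x 2)
      * (cylF κ (x 1) : ℂ) * hR - Complex.I / Complex.sin (x 2) * hc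

lemma blTetrad (hrp : 0 < rp) (h : Exterior κ x) (φs : ℝ → ℝ) (a μ : Fin 4) :
    ∑ ν, (blJacobian rp κ (blAngleSlope rp κ x) x μ ν : ℂ) * cylTetrad κ x a ν
      = (tetradScale rp x a : ℂ)
        * kinnersley (kerrMass rp κ) (kerrSpin rp κ) (cylToBL rp κ φs x) a μ := by
  fin_cases a
  · exact blTetrad_zero hrp h φs μ
  · exact blTetrad_one hrp h φs μ
  · exact blTetrad_two hrp h φs μ
  · have := congrArg star (blTetrad_two hrp h φs μ)
    simp only [star_sum, star_mul', Complex.star_def, Complex.conj_ofReal] at this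
    exact this

end TetradTransformation

/-! ### Normalisation of the Kinnersley tetrad and of the conformal tetrad. -/

section Normalisation

variable {rp κ : ℝ} {x : Pt} {φs : ℝ → ℝ}

set_option maxHeartbeats 1000000 in
/-- The Kinnersley tetrad is a normalised null tetrad of the Kerr metric. -/
lemma kinnersley_normalised {M a : ℝ} {y : Pt} (hr : y 1 ≠ 0) (hD : kerrDelta M a (y 1) ≠ 0)
    (hs : Real.sin (y 2) ≠ 0) (b c : Fin 4) :
    ∑ α, ∑ β, (kerrMetric M a y α β : ℂ) * kinnersley M a y b α * kinnersley M a y c β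
      = eta b c := by
  have hh : hsq ^ 2 = 1 / 2 := hsq_sq
  have hI : Complex.I ^ 2 = -1 := Complex.I_sq
  have hp : (y 1 : ℂ) + Complex.I * a * (Real.cos (y 2) : ℝ) ≠ 0 := by
    intro h
    have := congrArg Complex.re h
    simp at this
    exact hr this
  have hq : (y 1 : ℂ) - Complex.I * a * (Real.cos (y 2) : ℝ) ≠ 0 := by
    intro h
    have := congrArg Complex.re h
    simp at this
    exact hr this
  have hS : (kerrSigma a (y 1) (y 2) : ℂ) = ((y 1 : ℂ) + Complex.I * a * (Real.cos (y 2) : ℝ))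
      * ((y 1 : ℂ) - Complex.I * a * (Real.cos (y 2) : ℝ)) := by
    simp only [kerrSigma]
    push_cast
    linear_combination ((a : ℂ) ^ 2 * Complex.cos (y 2) ^ 2) * hI
  -- The mass enters the metric only through `2 M r`, so it can be eliminated in favour of `Δ̃`.
  have hM : 2 * (M : ℂ) * (y 1 : ℂ) = (y 1 : ℂ) ^ 2 + (a : ℂ) ^ 2 - (kerrDelta M a (y 1) : ℂ) := by
    simp only [kerrDelta]
    push_cast
    ring
  have hDc : (kerrDelta M a (y 1) : ℂ) ≠ 0 := Complex.ofReal_ne_zero.mpr hD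
  have hsc : (Real.sin (y 2) : ℂ) ≠ 0 := Complex.ofReal_ne_zero.mpr hs
  have hm : kinnersleyM a y = ![hsq / ((y 1 : ℂ) + Complex.I * a * (Real.cos (y 2) : ℝ))
        * (Complex.I * a * (Real.sin (y 2) : ℝ)), 0,
      hsq / ((y 1 : ℂ) + Complex.I * a * (Real.cos (y 2) : ℝ)),
      hsq / ((y 1 : ℂ) + Complex.I * a * (Real.cos (y 2) : ℝ))
        * (Complex.I / (Real.sin (y 2) : ℝ))] := by
    have : (1 : ℂ) / ((Real.sqrt 2 : ℝ) * ((y 1 : ℂ) + Complex.I * a * (Real.cos (y 2) : ℝ)))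
        = hsq / ((y 1 : ℂ) + Complex.I * a * (Real.cos (y 2) : ℝ)) := by
      simp [hsq, div_eq_mul_inv, mul_comm]
    simp only [kinnersleyM, this]
  have hmb : (fun μ => star (kinnersleyM a y μ))
      = ![-(hsq / ((y 1 : ℂ) - Complex.I * a * (Real.cos (y 2) : ℝ))
        * (Complex.I * a * (Real.sin (y 2) : ℝ))), 0,
      hsq / ((y 1 : ℂ) - Complex.I * a * (Real.cos (y 2) : ℝ)),
      -(hsq / ((y 1 : ℂ) - Complex.I * a * (Real.cos (y 2) : ℝ))
        * (Complex.I / (Real.sin (y 2) : ℝ)))] := by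
    have hstar : star (hsq / ((y 1 : ℂ) + Complex.I * a * (Real.cos (y 2) : ℝ)))
        = hsq / ((y 1 : ℂ) - Complex.I * a * (Real.cos (y 2) : ℝ)) := by
      rw [star_div₀, star_hsq]
      simp [-Complex.ofReal_cos, sub_eq_add_neg]
    have hreal : ∀ t : ℝ, star (t : ℂ) = t := Complex.conj_ofReal
    have hsI : star Complex.I = -Complex.I := Complex.conj_I
    rw [hm]
    funext μ
    fin_cases μ
    · simp only [Fin.zero_eta, Matrix.cons_val, star_mul', hstar, hreal, hsI]
      ring
    · simp
    · simp only [Fin.reduceFinMk, Matrix.cons_val, hstar]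
    · simp only [Fin.reduceFinMk, Matrix.cons_val, star_mul', star_div₀ Complex.I, hstar, hreal,
        hsI]
      ring
  have hk : kinnersley M a y = ![![((y 1 : ℂ) ^ 2 + (a : ℂ) ^ 2) / (kerrDelta M a (y 1) : ℂ), 1, 0,
        (a : ℂ) / (kerrDelta M a (y 1) : ℂ)],
      ![((y 1 : ℂ) ^ 2 + (a : ℂ) ^ 2) / (2 * (kerrSigma a (y 1) (y 2) : ℂ)),
        -(kerrDelta M a (y 1) : ℂ) / (2 * (kerrSigma a (y 1) (y 2) : ℂ)), 0,
        (a : ℂ) / (2 * (kerrSigma a (y 1) (y 2) : ℂ))],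
      kinnersleyM a y, fun μ => star (kinnersleyM a y μ)] := by
    simp only [kinnersley]
    push_cast
    rfl
  have hg : ∀ α β, (kerrMetric M a y α β : ℂ)
      = (!![-(1 - (2 * (M : ℂ) * (y 1 : ℂ)) / (kerrSigma a (y 1) (y 2) : ℂ)), 0, 0,
          -((2 * (M : ℂ) * (y 1 : ℂ)) * a / (kerrSigma a (y 1) (y 2) : ℂ)
            * (Real.sin (y 2) : ℂ) ^ 2);
        0, (kerrSigma a (y 1) (y 2) : ℂ) / (kerrDelta M a (y 1) : ℂ), 0, 0;
        0, 0, (kerrSigma a (y 1) (y 2) : ℂ), 0;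
        -((2 * (M : ℂ) * (y 1 : ℂ)) * a / (kerrSigma a (y 1) (y 2) : ℂ)
            * (Real.sin (y 2) : ℂ) ^ 2), 0, 0,
          (Real.sin (y 2) : ℂ) ^ 2 * ((y 1 : ℂ) ^ 2 + (a : ℂ) ^ 2 + (2 * (M : ℂ) * (y 1 : ℂ))
            * (a : ℂ) ^ 2 / (kerrSigma a (y 1) (y 2) : ℂ)
            * (Real.sin (y 2) : ℂ) ^ 2)] : Matrix (Fin 4) (Fin 4) ℂ) α β := by
    intro α β
    simp only [kerrMetric]
    generalize Real.sin (y 2) = s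
    fin_cases α <;> fin_cases β <;>
      simp only [Fin.zero_eta, Fin.mk_one, Fin.reduceFinMk, Matrix.of_apply, Matrix.cons_val] <;>
      push_cast <;> ring
  have hS' : (kerrSigma a (y 1) (y 2) : ℂ)
      = (y 1 : ℂ) ^ 2 + (a : ℂ) ^ 2 - (a : ℂ) ^ 2 * (Real.sin (y 2) : ℂ) ^ 2 := by
    have : kerrSigma a (y 1) (y 2) = y 1 ^ 2 + a ^ 2 - a ^ 2 * Real.sin (y 2) ^ 2 := by
      rw [kerrSigma, Real.sin_sq]
      ring
    rw [this]
    push_cast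
    rfl
  have hSc : (kerrSigma a (y 1) (y 2) : ℂ) ≠ 0 := hS ▸ mul_ne_zero hp hq
  -- The Kerr metric as a sum of squares of the four one-forms `dt - a sin² θ dφ`, `dr`, `dθ` and
  -- `(r² + a²) dφ - a dt`. On the Kinnersley vectors these one-forms take simple values, many of
  -- them zero.
  have hform : ∀ v w : Fin 4 → ℂ, ∑ α, ∑ β, (kerrMetric M a y α β : ℂ) * v α * w β
      = -((kerrDelta M a (y 1) : ℂ) / (kerrSigma a (y 1) (y 2) : ℂ))
          * (v 0 - a * (Real.sin (y 2) : ℂ) ^ 2 * v 3) * (w 0 - a * (Real.sin (y 2) : ℂ) ^ 2 * w 3)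
        + (kerrSigma a (y 1) (y 2) : ℂ) / (kerrDelta M a (y 1) : ℂ) * v 1 * w 1
        + (kerrSigma a (y 1) (y 2) : ℂ) * v 2 * w 2
        + (Real.sin (y 2) : ℂ) ^ 2 / (kerrSigma a (y 1) (y 2) : ℂ)
          * (((y 1 : ℂ) ^ 2 + (a : ℂ) ^ 2) * v 3 - a * v 0)
          * (((y 1 : ℂ) ^ 2 + (a : ℂ) ^ 2) * w 3 - a * w 0) := by
    intro v w
    simp only [hg, hM, Fin.sum_univ_four, Matrix.of_apply, Matrix.cons_val]
    clear hm hmb hk hg hS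
    generalize (kerrSigma a (y 1) (y 2) : ℂ) = S at *
    generalize (Real.sin (y 2) : ℂ) = sn at *
    field_simp
    rw [hS']
    ring
  have hl0 : kinnersley M a y 0 0 - a * (Real.sin (y 2) : ℂ) ^ 2 * kinnersley M a y 0 3
      = (kerrSigma a (y 1) (y 2) : ℂ) / (kerrDelta M a (y 1) : ℂ) := by
    rw [hk, hS']
    simp only [Matrix.cons_val]
    ring
  have hk0 : kinnersley M a y 1 0 - a * (Real.sin (y 2) : ℂ) ^ 2 * kinnersley M a y 1 3
      = 1 / 2 := by
    rw [hk]
    simp only [Matrix.cons_val]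
    field_simp
    rw [hS']
  have hm0 : kinnersley M a y 2 0 - a * (Real.sin (y 2) : ℂ) ^ 2 * kinnersley M a y 2 3
      = 0 := by
    rw [hk, hm]
    simp only [Matrix.cons_val]
    field_simp
    ring
  have hb0 : kinnersley M a y 3 0 - a * (Real.sin (y 2) : ℂ) ^ 2 * kinnersley M a y 3 3
      = 0 := by
    rw [hk, hmb]
    simp only [Matrix.cons_val]
    field_simp
    ring
  have hl3 : ((y 1 : ℂ) ^ 2 + (a : ℂ) ^ 2) * kinnersley M a y 0 3 - a * kinnersley M a y 0 0
      = 0 := by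
    rw [hk]
    simp only [Matrix.cons_val]
    ring
  have hk3 : ((y 1 : ℂ) ^ 2 + (a : ℂ) ^ 2) * kinnersley M a y 1 3 - a * kinnersley M a y 1 0
      = 0 := by
    rw [hk]
    simp only [Matrix.cons_val]
    ring
  have hm3 : ((y 1 : ℂ) ^ 2 + (a : ℂ) ^ 2) * kinnersley M a y 2 3 - a * kinnersley M a y 2 0
      = hsq / ((y 1 : ℂ) + Complex.I * a * (Real.cos (y 2) : ℝ))
        * (Complex.I * (kerrSigma a (y 1) (y 2) : ℂ) / (Real.sin (y 2) : ℂ)) := by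
    rw [hk, hm, hS']
    simp only [Matrix.cons_val]
    field_simp
  have hb3 : ((y 1 : ℂ) ^ 2 + (a : ℂ) ^ 2) * kinnersley M a y 3 3 - a * kinnersley M a y 3 0
      = -(hsq / ((y 1 : ℂ) - Complex.I * a * (Real.cos (y 2) : ℝ))
        * (Complex.I * (kerrSigma a (y 1) (y 2) : ℂ) / (Real.sin (y 2) : ℂ))) := by
    rw [hk, hmb, hS']
    simp only [Matrix.cons_val]
    field_simp
    ring
  have hl1 : kinnersley M a y 0 1 = 1 := rfl
  have hk1 : kinnersley M a y 1 1
      = -(kerrDelta M a (y 1) : ℂ) / (2 * (kerrSigma a (y 1) (y 2) : ℂ)) := by rw [hk]; rfl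
  have hm1 : kinnersley M a y 2 1 = 0 := rfl
  have hb1 : kinnersley M a y 3 1 = 0 := by rw [hk, hmb]; rfl
  have hl2 : kinnersley M a y 0 2 = 0 := rfl
  have hk2 : kinnersley M a y 1 2 = 0 := rfl
  have hm2 : kinnersley M a y 2 2
      = hsq / ((y 1 : ℂ) + Complex.I * a * (Real.cos (y 2) : ℝ)) := by rw [hk, hm]; rfl
  have hb2 : kinnersley M a y 3 2
      = hsq / ((y 1 : ℂ) - Complex.I * a * (Real.cos (y 2) : ℝ)) := by rw [hk, hmb]; rfl
  rw [hform]
  clear hform hg hk hm hmb hM hS'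
  generalize (Real.sin (y 2) : ℂ) = sn at *
  generalize (y 1 : ℂ) + Complex.I * a * (Real.cos (y 2) : ℝ) = p at *
  generalize (y 1 : ℂ) - Complex.I * a * (Real.cos (y 2) : ℝ) = q at *
  generalize (kerrDelta M a (y 1) : ℂ) = D at *
  generalize (kerrSigma a (y 1) (y 2) : ℂ) = S at *
  generalize hsq = h at *
  generalize Complex.I = j at *
  fin_cases b <;> fin_cases c <;>
    simp only [Fin.zero_eta, Fin.mk_one, Fin.reduceFinMk, eta_values,
      hl0, hl1, hl2, hl3, hk0, hk1, hk2, hk3, hm0, hm1, hm2, hm3, hb0, hb1, hb2, hb3,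
      mul_zero, zero_mul, add_zero, zero_add, mul_one]
  all_goals
    field_simp
    try simp only [hI, hh, hS]
    try ring

end Normalisation

section Normalisation

variable {rp κ : ℝ} {x : Pt} {φs : ℝ → ℝ}

/-- The boost factors of `ℓ` and `k` are inverse to each other up to `Ξ⁻²`, so for each nonzero
entry of `eta` the product of the two scales compensates the conformal factor `Ξ²`. -/
lemma cylXi_sq_mul_tetradScale (hrp : 0 < rp) (h : Exterior κ x) (a b : Fin 4) :
    ((cylXi rp x ^ 2 * tetradScale rp x a * tetradScale rp x b : ℝ) : ℂ) * eta a b = eta a b := by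
  have h1 := h.sig.ne'
  have hu := h.u.ne'
  have hr := hrp.ne'
  have hX : cylXi rp x ≠ 0 := div_ne_zero (mul_ne_zero h1 hu) hr
  have h01 : cylXi rp x ^ 2 * ((cylXi rp x ^ 2)⁻¹ * (x 1 / rp)) * (rp / x 1) = 1 := by
    field_simp
  have h10 : cylXi rp x ^ 2 * (rp / x 1) * ((cylXi rp x ^ 2)⁻¹ * (x 1 / rp)) = 1 := by
    field_simp
  have h23 : cylXi rp x ^ 2 * (cylXi rp x)⁻¹ * (cylXi rp x)⁻¹ = 1 := by
    field_simp
  fin_cases a <;> fin_cases b <;>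
    simp only [Fin.zero_eta, Fin.mk_one, Fin.reduceFinMk, eta_values,
      mul_zero, tetradScale, Matrix.cons_val, h01, h10, h23, Complex.ofReal_one, one_mul]

/-- Pulling back the bilinear form `s • g` along `J`. -/
lemma sum_pullback (s : ℝ) (g J : Fin 4 → Fin 4 → ℝ) (v w : Fin 4 → ℂ) :
    ∑ μ, ∑ ν, ∑ α, ∑ β, ((s * g α β * J α μ * J β ν : ℝ) : ℂ) * v μ * w ν
      = s * ∑ α, ∑ β, (g α β : ℂ) * (∑ μ, (J α μ : ℂ) * v μ) * ∑ ν, (J β ν : ℂ) * w ν := by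
  have hL : ∀ μ ν, ∑ α, ∑ β, ((s * g α β * J α μ * J β ν : ℝ) : ℂ) * v μ * w ν
      = ∑ α, ∑ β, (s : ℂ) * ((g α β : ℂ) * ((J α μ : ℂ) * v μ) * ((J β ν : ℂ) * w ν)) := by
    intro μ ν
    refine Finset.sum_congr rfl fun α _ => Finset.sum_congr rfl fun β _ => ?_
    push_cast
    ring
  simp only [hL, Finset.mul_sum, Finset.sum_mul]
  rw [Finset.sum_congr rfl fun μ _ => Finset.sum_comm, Finset.sum_comm]
  refine Finset.sum_congr rfl fun α _ => ?_
  rw [Finset.sum_congr rfl fun μ _ => Finset.sum_comm, Finset.sum_comm]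
  rw [Finset.sum_congr rfl fun β _ => Finset.sum_comm]

/-- The conformal tetrad is normalised for the conformal metric `Ξ² g̃`. -/
lemma cylTetrad_normalised (hrp : 0 < rp) (h : Exterior κ x) (hs : Real.sin (x 2) ≠ 0)
    (hφ : HasDerivAt φs (blAngleSlope rp κ x) (rp / (x 1 * (1 - x 0)))) (a b : Fin 4) :
    ∑ μ, ∑ ν, ∑ α, ∑ β,
        (((cylXi rp x) ^ 2
          * kerrMetric (kerrMass rp κ) (kerrSpin rp κ) (cylToBL rp κ φs x) α β
          * jac (cylToBL rp κ φs) x α μ * jac (cylToBL rp κ φs) x β ν : ℝ) : ℂ)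
          * cylTetrad κ x a μ * cylTetrad κ x b ν = eta a b := by
  have hr : rp / (x 1 * (1 - x 0)) ≠ 0 :=
    div_ne_zero hrp.ne' (mul_ne_zero h.sig.ne' h.u.ne')
  have hD : kerrDelta (kerrMass rp κ) (kerrSpin rp κ) (rp / (x 1 * (1 - x 0))) ≠ 0 := by
    rw [kerrDelta_eq h]
    exact mul_ne_zero (pow_ne_zero _ hr) (cylDelta_pos h).ne'
  have hn := kinnersley_normalised (M := kerrMass rp κ) (a := kerrSpin rp κ)
    (y := cylToBL rp κ φs x) hr hD hs a b
  refine (sum_pullback _ (kerrMetric (kerrMass rp κ) (kerrSpin rp κ) (cylToBL rp κ φs x))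
    (jac (cylToBL rp κ φs) x) _ _).trans ?_
  simp only [jac_cylToBL h hφ, blTetrad hrp h φs]
  rw [← cylXi_sq_mul_tetradScale hrp h a b, ← hn]
  simp only [Finset.mul_sum]
  refine Finset.sum_congr rfl fun α _ => Finset.sum_congr rfl fun β _ => ?_
  push_cast
  ring

end Normalisation

/-! ### The limit `ς → 0` and the transport equation. -/

section Transport

variable {κ : ℝ} {p : Pt} {u : Pt → ℂ}

/-- The quotient `F / ς²`, which is regular at `ς = 0`. -/
def cylFQuot (κ ς : ℝ) : ℝ := (1 - ς) * (1 - κ ^ 2 * ς) / (1 + κ ^ 2 * ς ^ 2)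

lemma cylF_eq_mul_cylFQuot (κ ς : ℝ) : cylF κ ς = ς ^ 2 * cylFQuot κ ς := by
  rw [cylF, cylFQuot]
  ring

lemma continuous_cylFQuot (κ : ℝ) : Continuous (cylFQuot κ) :=
  Continuous.div (by fun_prop) (by fun_prop) fun ς => by positivity

lemma continuousAt_pd (hu : ContDiffAt ℝ 2 u p) (μ : Fin 4) : ContinuousAt (pd μ u) p :=
  (contDiffAt_pd (n := 1) hu μ).continuousAt

lemma continuousAt_pd_pd (hu : ContDiffAt ℝ 2 u p) (μ ν : Fin 4) :
    ContinuousAt (pd μ (pd ν u)) p :=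
  (contDiffAt_pd (n := 0) (f := pd ν u) (by
    have := contDiffAt_pd (n := 1) hu ν
    simpa using this) μ).continuousAt

lemma continuousAt_ethEthbar (s : ℤ) (hs : sinC p ≠ 0) (hu : ContDiffAt ℝ 2 u p) :
    ContinuousAt (ethEthbar s u) p := by
  have hsC : ContinuousAt sinC p := (hasFr_sin (κ := 0)).diff.continuousAt
  have hcC : ContinuousAt cosC p := (hasFr_cos (κ := 0)).diff.continuousAt
  have h22 := continuousAt_pd_pd hu 2 2
  have h33 := continuousAt_pd_pd hu 3 3
  have h2 := continuousAt_pd hu 2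
  have h3 := continuousAt_pd hu 3
  have h0 := hu.continuousAt
  have he : ethEthbar s u =ᶠ[𝓝 p] fun x => pd 2 (pd 2 u) x + pd 3 (pd 3 u) x / sinC x ^ 2
      + cosC x / sinC x * pd 2 u x + 2 * s * Complex.I * cosC x / sinC x ^ 2 * pd 3 u x
      - s * (1 + (s - 1) * cosC x ^ 2) / sinC x ^ 2 * u x := by
    filter_upwards [hsC.eventually_ne hs, hu.eventually (by decide)] with x h1 h2
    exact ethEthbar_eq s h1 h2
  refine ContinuousAt.congr ?_ he.symm
  have hs2 : sinC p ^ 2 ≠ 0 := pow_ne_zero 2 hs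
  have hi : ContinuousAt (fun x => (sinC x)⁻¹) p := hsC.inv₀ hs
  have key : ∀ S C I a b c d f : Pt → ℂ, ContinuousAt S p → ContinuousAt C p →
      ContinuousAt I p → ContinuousAt a p →
      ContinuousAt b p → ContinuousAt c p → ContinuousAt d p → ContinuousAt f p →
      ContinuousAt (fun x => a x + b x * I x ^ 2 + C x * I x * c x
        + 2 * s * Complex.I * C x * I x ^ 2 * d x
        - s * (1 + (s - 1) * C x ^ 2) * I x ^ 2 * f x) p := by
    intro S C I a b c d f h1 h2 h3 h4 h5 h6 h7 h8
    fun_prop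
  simpa only [div_eq_mul_inv, inv_pow] using
    key sinC cosC (fun x => (sinC x)⁻¹) _ _ _ _ _ hsC hcC hi h22 h33 h2 h3 h0

/-- The master operator divided by `ς²`, in terms of `G = F / ς²` and `F'`. -/
lemma masterOp_div (κ : ℝ) (s : ℤ) (u : Pt → ℂ) {x : Pt} {T ς G E sn cs : ℂ} (hς : x 1 ≠ 0)
    (hT : T = x 0) (hx : ς = x 1) (hG : G = cylFQuot κ (x 1)) (hE : E = deriv (cylF κ) (x 1))
    (hsn : sn = (Real.sin (x 2) : ℝ)) (hcs : cs = (Real.cos (x 2) : ℝ)) :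
    masterOp κ s u x / (x 1 : ℂ) ^ 2
      = (2 - (s : ℂ) ^ 2 / 4) * (2 * G * (1 + κ ^ 2 * ς ^ 2 * (1 - T) ^ 2)
          - ς ^ 2 * G ^ 2 * κ ^ 2 * sn ^ 2 * (1 - T)
          - (-1 + ς * (1 - T)) * (-1 + κ ^ 2 * ς * (1 - T)) * (1 - T)) * (1 - T)
          * pd 0 (pd 0 u) x
        + ς * (2 * (2 - (s : ℂ) ^ 2 / 4) * G
          * (1 + κ ^ 2 * (-(ς ^ 2 * G) * sn ^ 2 + ς ^ 2 * (1 - T)) * (1 - T))) * pd 0 (pd 1 u) x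
        + ς * (2 * (2 - (s : ℂ) ^ 2 / 4) * κ * (-G + (1 - T)) * (1 - T)) * pd 0 (pd 3 u) x
        + ς * (-ς ^ 3 * G ^ 2 * (2 - (s : ℂ) ^ 2 / 4) * κ ^ 2 * sn ^ 2) * pd 1 (pd 1 u) x
        + ς * ((-2) * ς * G * (2 - (s : ℂ) ^ 2 / 4) * κ) * pd 1 (pd 3 u) x
        - (2 - (s : ℂ) ^ 2 / 4) * ethEthbar s u x
        + ς * (G * κ * (2 * Complex.I * s * cs * ς + (-4 - 4 * s + s ^ 2 / 2) * κ * ς ^ 2 * (1 - T)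
          + κ * sn ^ 2 * (2 * (ς ^ 2 * G) * s - (2 - s ^ 2 / 4) * ς * E))) * pd 1 u x
        + ς * (2 * κ * (G * s + (-2 - 2 * s + s ^ 2 / 4) * (1 - T))) * pd 3 u x
        + ((2 + s - s ^ 2 / 4) * 2 * (1 - T) + G * (-4 - 2 * s + s ^ 2 / 2)
          + ς * (ς * G ^ 2 * (4 + 2 * s - s ^ 2 / 2) * κ ^ 2 * sn ^ 2 * (1 - T)
            + (2 + s - s ^ 2 / 4) * ((-3 + κ ^ 2 * (-3 + 4 * ς * (1 - T))) * (1 - T)) * (1 - T)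
            + G * (4 * κ * (Complex.I * s * cs / 2
                + (-2 - 3 * s / 2 + s ^ 2 / 4) * κ * ς * (1 - T)) * (1 - T)
              + (-2 + s ^ 2 / 4) * κ ^ 2 * sn ^ 2 * (1 - T) * E))) * pd 0 u x
        + (-2 * s + ς * ((-ς * G ^ 2) * s * (1 + s) * κ ^ 2 * sn ^ 2
          + 2 * G * κ * (-Complex.I * s ^ 2 * cs + s * (1 + 2 * s) * κ * ς * (1 - T)
            + s * κ * sn ^ 2 * E / 2)
          + (2 + 3 * s + 7 * s ^ 2 / 4) * (1 + κ ^ 2 * (1 - 2 * ς * (1 - T))) * (1 - T))) * u x :=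
            by
  have h1 : (x 1 : ℂ) ≠ 0 := Complex.ofReal_ne_zero.mpr hς
  rw [div_eq_iff (pow_ne_zero 2 h1)]
  simp only [masterOp, coefATT, coefATς, coefATφ, coefAςς, coefAςφ, coefA, coefBς, coefBφ, coefBT,
    coefC, cylF_eq_mul_cylFQuot κ (x 1), Complex.ofReal_mul, Complex.ofReal_pow, ← hT, ← hx, ← hG,
    ← hE, ← hsn, ← hcs]
  ring

end Transport

section Transport

variable {p : Pt} {u : Pt → ℂ}

-- The quotient from `masterOp_div` with every factor replaced by an arbitrary function continuous
-- at `p`. The right-hand side there is polynomial in these factors and therefore extends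
-- continuously to `ς = 0`.
set_option maxHeartbeats 1000000 in
lemma continuousAt_masterOp_quotient (κ : ℝ) (s : ℤ)
    {T ς G E sn cs d00 d01 d03 d11 d13 dE d1 d3 d0 f : Pt → ℂ}
    (hT : ContinuousAt T p)
    (hς : ContinuousAt ς p)
    (hG : ContinuousAt G p)
    (hE : ContinuousAt E p)
    (hsn : ContinuousAt sn p)
    (hcs : ContinuousAt cs p)
    (hd00 : ContinuousAt d00 p)
    (hd01 : ContinuousAt d01 p)
    (hd03 : ContinuousAt d03 p)
    (hd11 : ContinuousAt d11 p)
    (hd13 : ContinuousAt d13 p)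
    (hdE : ContinuousAt dE p)
    (hd1 : ContinuousAt d1 p)
    (hd3 : ContinuousAt d3 p)
    (hd0 : ContinuousAt d0 p)
    (hf : ContinuousAt f p) :
    ContinuousAt (fun x =>
      (2 - (s : ℂ) ^ 2 / 4) * (2 * G x * (1 + κ ^ 2 * ς x ^ 2 * (1 - T x) ^ 2)
              - ς x ^ 2 * G x ^ 2 * κ ^ 2 * sn x ^ 2 * (1 - T x)
              - (-1 + ς x * (1 - T x)) * (-1 + κ ^ 2 * ς x * (1 - T x)) * (1 - T x)) * (1 - T x)
              * d00 x
            + ς x * (2 * (2 - (s : ℂ) ^ 2 / 4) * G x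
              * (1 + κ ^ 2 * (-(ς x ^ 2 * G x) * sn x ^ 2 + ς x ^ 2 * (1 - T x)) * (1
                - T x))) * d01 x
            + ς x * (2 * (2 - (s : ℂ) ^ 2 / 4) * κ * (-G x + (1 - T x)) * (1 - T x)) * d03 x
            + ς x * (-ς x ^ 3 * G x ^ 2 * (2 - (s : ℂ) ^ 2 / 4) * κ ^ 2 * sn x ^ 2) * d11 x
            + ς x * ((-2) * ς x * G x * (2 - (s : ℂ) ^ 2 / 4) * κ) * d13 x
            - (2 - (s : ℂ) ^ 2 / 4) * dE x
            + ς x * (G x * κ * (2 * Complex.I * s * cs x * ς x + (-4 - 4 * s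
              + s ^ 2 / 2) * κ * ς x ^ 2 * (1 - T x)
              + κ * sn x ^ 2 * (2 * (ς x ^ 2 * G x) * s - (2 - s ^ 2 / 4) * ς x * E x))) * d1 x
            + ς x * (2 * κ * (G x * s + (-2 - 2 * s + s ^ 2 / 4) * (1 - T x))) * d3 x
            + ((2 + s - s ^ 2 / 4) * 2 * (1 - T x) + G x * (-4 - 2 * s + s ^ 2 / 2)
              + ς x * (ς x * G x ^ 2 * (4 + 2 * s - s ^ 2 / 2) * κ ^ 2 * sn x ^ 2 * (1 - T x)
                + (2 + s - s ^ 2 / 4) * ((-3 + κ ^ 2 * (-3 + 4 * ς x * (1 - T x))) * (1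
                  - T x)) * (1 - T x)
                + G x * (4 * κ * (Complex.I * s * cs x / 2
                    + (-2 - 3 * s / 2 + s ^ 2 / 4) * κ * ς x * (1 - T x)) * (1 - T x)
                  + (-2 + s ^ 2 / 4) * κ ^ 2 * sn x ^ 2 * (1 - T x) * E x))) * d0 x
            + (-2 * s + ς x * ((-ς x * G x ^ 2) * s * (1 + s) * κ ^ 2 * sn x ^ 2
              + 2 * G x * κ * (-Complex.I * s ^ 2 * cs x + s * (1 + 2 * s) * κ * ς x * (1 - T x)
                + s * κ * sn x ^ 2 * E x / 2)
              + (2 + 3 * s + 7 * s ^ 2 / 4) * (1 + κ ^ 2 * (1 - 2 * ς x * (1 - T x))) * (1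
                - T x))) * f x) p := by
  fun_prop

/-- The limit of `ς⁻² P_s u` at `ς = 0`. -/
theorem tendsto_masterOp_div (κ : ℝ) {s : ℤ} (hs : s = 2 ∨ s = 0 ∨ s = -2) (hp : p 1 = 0)
    (hp0 : 0 < p 2) (hp1 : p 2 < Real.pi) (hu : ContDiffAt ℝ 2 u p) :
    Tendsto (fun x => masterOp κ s u x / (x 1 : ℂ) ^ 2) (𝓝[{x : Pt | 0 < x 1}] p)
      (𝓝 ((2 - (s : ℂ) ^ 2 / 4) * transportOp s u p)) := by
  have hsn : sinC p ≠ 0 := Complex.ofReal_ne_zero.mpr (Real.sin_pos_of_pos_of_lt_pi hp0 hp1).ne'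
  have hder : Continuous (deriv (cylF κ)) := (contDiff_cylF κ).continuous_deriv (by simp)
  have hc : Continuous (cylFQuot κ) := continuous_cylFQuot κ
  have hof : ∀ {g : ℝ → ℝ}, Continuous g → ∀ i : Fin 4,
      ContinuousAt (fun x : Pt => (g (x i) : ℂ)) p := fun hg i =>
    (Complex.continuous_ofReal.comp (hg.comp (continuous_apply i))).continuousAt
  have h := continuousAt_masterOp_quotient (p := p) κ s (T := fun x => (x 0 : ℂ))
    (ς := fun x => (x 1 : ℂ)) (G := fun x => (cylFQuot κ (x 1) : ℂ))
    (E := fun x => ((deriv (cylF κ) (x 1) : ℝ) : ℂ)) (sn := fun x => ((Real.sin (x 2) : ℝ) : ℂ))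
    (cs := fun x => ((Real.cos (x 2) : ℝ) : ℂ)) (hof continuous_id 0) (hof continuous_id 1)
    (hof hc 1) (hof hder 1) (hof Real.continuous_sin 2) (hof Real.continuous_cos 2)
    (continuousAt_pd_pd hu 0 0) (continuousAt_pd_pd hu 0 1) (continuousAt_pd_pd hu 0 3)
    (continuousAt_pd_pd hu 1 1) (continuousAt_pd_pd hu 1 3) (continuousAt_ethEthbar s hsn hu)
    (continuousAt_pd hu 1) (continuousAt_pd hu 3) (continuousAt_pd hu 0) hu.continuousAt
  have hq : (cylFQuot κ (p 1) : ℂ) = 1 := by simp [hp, cylFQuot]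
  have hς : (p 1 : ℂ) = 0 := by simp [hp]
  have hlim := h.tendsto.mono_left (nhdsWithin_le_nhds (s := {x : Pt | 0 < x 1}))
  refine (hlim.congr' ?_).trans (le_of_eq (congrArg 𝓝 ?_))
  · filter_upwards [self_mem_nhdsWithin] with x hx
    exact (masterOp_div κ s u (ne_of_gt hx) rfl rfl rfl rfl rfl rfl).symm
  · simp only [hq, hς, transportOp]
    -- With `ς = 0` and `G = 1` the coefficients agree only if `s³ = 4s`: for instance the
    -- zeroth-order terms require `(2 - s²/4) s = s`. This is why the three spin weights are treated
    -- separately.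
    rcases hs with rfl | rfl | rfl <;> push_cast <;> ring

/-- The point `p` is approached from `ς > 0` by varying the coordinate `ς` alone; without this,
limits along the filter would not be unique. -/
lemma nhdsWithin_sig_pos_neBot (hp : p 1 = 0) : (𝓝[{x : Pt | 0 < x 1}] p).NeBot := by
  refine mem_closure_iff_nhdsWithin_neBot.mp ?_
  have hc : ContinuousWithinAt (fun t : ℝ => Function.update p 1 t) (Ioi 0) 0 :=
    (continuous_const.update 1 continuous_id).continuousWithinAt
  have := hc.mem_closure (t := {x : Pt | 0 < x 1}) (by simp) (fun t ht => by simpa using ht)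
  have hup : Function.update p 1 0 = p := by rw [← hp, Function.update_eq_self]
  rwa [hup] at this

/-- Solutions of the master equation satisfy the transport equation at `ς = 0`. -/
theorem transportOp_eq_zero (κ : ℝ) {s : ℤ} (hs : s = 2 ∨ s = 0 ∨ s = -2) (hp : p 1 = 0)
    (hp0 : 0 < p 2) (hp1 : p 2 < Real.pi) (hu : ContDiffAt ℝ 2 u p)
    (h : ∀ᶠ x in 𝓝[{x : Pt | 0 < x 1}] p, masterOp κ s u x = 0) : transportOp s u p = 0 := by
  have := nhdsWithin_sig_pos_neBot hp
  have h0 : Tendsto (fun x => masterOp κ s u x / (x 1 : ℂ) ^ 2) (𝓝[{x : Pt | 0 < x 1}] p)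
      (𝓝 0) := by
    refine tendsto_const_nhds.congr' ?_
    filter_upwards [h] with x hx
    rw [hx, zero_div]
  have hz := tendsto_nhds_unique (tendsto_masterOp_div κ hs hp hp0 hp1 hu) h0
  refine (mul_eq_zero.mp hz).resolve_left ?_
  rcases hs with rfl | rfl | rfl <;> norm_num

end Transport

end CylTeukolsky

end

/-! ### Assembly of the theorem. -/

theorem mainTheorem3 (rp κ : ℝ) (hrp : 0 < rp) (hκ : |κ| < 1) :
    -- the tetrad and the conformal factor come from the Kerr spacetime: `Ξ = 1/r`, the tetrad is
    -- the rescaled and boosted Kinnersley tetrad, and it is normalised for `g = Ξ² g̃`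
    (∀ φs : ℝ → ℝ,
      (∀ r, rp < r →
        HasDerivAt φs (kerrSpin rp κ / kerrDelta (kerrMass rp κ) (kerrSpin rp κ) r) r) →
      ∀ x ∈ cylRegion, x 0 < 1 →
        rp < cylToBL rp κ φs x 1 ∧
        DifferentiableAt ℝ (cylToBL rp κ φs) x ∧
        cylXi rp x = 1 / cylToBL rp κ φs x 1 ∧
        (∀ a μ, ∑ ν, (jac (cylToBL rp κ φs) x μ ν : ℂ) * cylTetrad κ x a ν
          = (tetradScale rp x a : ℂ)
            * kinnersley (kerrMass rp κ) (kerrSpin rp κ) (cylToBL rp κ φs x) a μ) ∧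
        (∀ a b, ∑ μ, ∑ ν, ∑ α, ∑ β,
            (((cylXi rp x) ^ 2
              * kerrMetric (kerrMass rp κ) (kerrSpin rp κ) (cylToBL rp κ φs x) α β
              * jac (cylToBL rp κ φs) x α μ * jac (cylToBL rp κ φs) x β ν : ℝ) : ℂ)
              * cylTetrad κ x a μ * cylTetrad κ x b ν = eta a b)) ∧
    -- the background exists as a solution of the conformal Einstein field equations
    (∃ B, IsCylBackground rp κ cylRegion B) ∧
    -- properties of the background, and the CEFE-Teukolsky operators in coordinates
    (∀ V : Set Pt, IsOpen V → V ⊆ cylRegion → ∀ B, IsCylBackground rp κ V B → ∀ x ∈ V,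
      (B.phi0 x = 0 ∧ B.phi1 x = 0 ∧ B.phi3 x = 0 ∧ B.phi4 x = 0 ∧
        B.phi2 x = -(kerrMass rp κ : ℂ) / cylZeta κ x ^ 3) ∧
      (B.npKappa x = 0 ∧ B.npSigma x = 0 ∧ B.npNu x = 0 ∧ B.npLambda x = 0) ∧
      (∀ u : Pt → ℂ, ContDiffAt ℝ 2 u x →
        masterOp κ 2 u x = 2 * (x 1 : ℂ) ^ 2 * (cylSigma κ x : ℂ) * B.teuk0 u x ∧
        masterOp κ (-2) (fun y => cylZeta κ y ^ 4 * u y) x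
          = 2 * (x 1 : ℂ) ^ 2 * (cylSigma κ x : ℂ) * cylZeta κ x ^ 4 * B.teuk4 u x ∧
        -- spin weight zero: the conformally invariant scalar wave equation
        masterOp κ 0 u x = -2 * (x 1 : ℂ) ^ 2 * (cylSigma κ x : ℂ)
          * (B.box u x - B.ricciScalar x / 6 * u x))) ∧
    -- the linearised conformal Einstein field equations imply the master equation
    (∀ V : Set Pt, IsOpen V → V ⊆ cylRegion → ∀ 𝓕 : ℝ → CEFEFields,
      IsLinearisedSolution V 𝓕 → IsCylBackground rp κ V (𝓕 0) → ∀ x ∈ V,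
        (𝓕 0).teuk0 (phi0Pert 𝓕) x = 0 ∧
        (𝓕 0).teuk4 (phi4Pert 𝓕) x = 0 ∧
        masterOp κ 2 (phi0Pert 𝓕) x = 0 ∧
        masterOp κ (-2) (fun y => cylZeta κ y ^ 4 * phi4Pert 𝓕 y) x = 0) ∧
    -- at `ς = 0` the equation becomes a transport equation
    (∀ s : ℤ, s = 2 ∨ s = 0 ∨ s = -2 → ∀ p : Pt, p 1 = 0 → 0 < p 2 → p 2 < Real.pi →
      ∀ u : Pt → ℂ, ContDiffAt ℝ 2 u p →
        Tendsto (fun x => masterOp κ s u x / (x 1 : ℂ) ^ 2) (𝓝[{x : Pt | 0 < x 1}] p)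
          (𝓝 ((2 - (s : ℂ) ^ 2 / 4) * transportOp s u p)) ∧
        ((∀ᶠ x in 𝓝[{x : Pt | 0 < x 1}] p, masterOp κ s u x = 0) → transportOp s u p = 0)) := by
  refine ⟨fun φs hφs x hx hT => ?_, ⟨bgFields rp κ, isCylBackground_bgFields hrp hκ⟩,
    fun V hV hVU B hB x hx => ?_, fun V hV hVU 𝓕 h hB x hx => ?_, fun s hs p hp hp0 hp1 u hu => ?_⟩
  · have h := Exterior.of_mem hκ hx hT
    have hw : 0 < x 1 * (1 - x 0) := mul_pos h.sig h.u
    -- The condition `ς(1 - T) < 1` in the region says that the image point lies outside the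
    -- horizon, where the derivative of `φ_*` is prescribed.
    have hr : rp < rp / (x 1 * (1 - x 0)) := by
      rw [lt_div_iff₀ hw]
      nlinarith [h.one_sub_w]
    have hφ := hφs _ hr
    refine ⟨hr, (hasFDerivAt_cylToBL h hφ).differentiableAt, ?_, fun a μ => ?_,
      cylTetrad_normalised hrp h (Real.sin_pos_of_pos_of_lt_pi hx.2.2.2.1 hx.2.2.2.2).ne' hφ⟩
    · exact (one_div_div _ _).symm
    · simp only [jac_cylToBL h hφ]
      exact blTetrad hrp h φs a μ
  · obtain ⟨w0, w1, w3, w4, w2⟩ := hB.weylScalars_eq hrp hκ hV hVU hx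
    obtain ⟨c1, c2, c3, c4, -⟩ := hB.spinCoefficients_eq hrp hκ hV hVU hx
    refine ⟨⟨w0, w1, w3, w4, w2.trans (bgPhi_eq rp κ x)⟩, ⟨c1, c2, c3, c4⟩, fun u hu => ?_⟩
    have hf := masterFactor_eq κ x
    refine ⟨?_, ?_, ?_⟩
    · rw [← hf]
      exact hB.masterOp_teuk0 hrp hκ hV hVU hx hu
    · rw [← hf]
      exact hB.masterOp_teuk4 hrp hκ hV hVU hx hu
    · rw [masterOp_wave hrp hκ hV hVU hB hx hu, hf]
      ring
  · have h0 := teuk0_linearised hrp hκ hV hVU h hB hx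
    have h4 := teuk4_linearised hrp hκ hV hVU h hB hx
    have hle : (2 : WithTop ℕ∞) ≤ ∞ := WithTop.coe_le_coe.mpr le_top
    refine ⟨h0, h4, ?_, ?_⟩
    · rw [hB.masterOp_teuk0 hrp hκ hV hVU hx ((contDiffAt_phi0Pert hV h hx).of_le hle), h0,
        mul_zero]
    · rw [hB.masterOp_teuk4 hrp hκ hV hVU hx ((contDiffAt_phi4Pert hV h hx).of_le hle), h4,
        mul_zero]
  · exact ⟨tendsto_masterOp_div κ hs hp hp0 hp1 hu, transportOp_eq_zero κ hs hp hp0 hp1 hu⟩
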